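/- Let $X$ be a complex manifold of dimension $n$ (Hausdorff, second countable), $\omega$ a smooth positive $(1,1)$-form on $X$ (not assumed closed), and $(E,h_E)$ a holomorphic vector bundle of rank $r$ over $X$ with a smooth Hermitian metric. Fix $0\le m\le n$ and smooth positive $(1,1)$-forms $\alpha_{m+1},\dots,\alpha_n$ on $X$, and put $T:=\alpha_{m+1}\wedge\cdots\wedge\alpha_n$ ($T:=1$ if $m=n$). Let $V=\bigoplus_k V^k$ be the space of smooth $E$-valued forms with compact support on $X$, $f_T(u):=T\wedge u$, $V_T^k:=f_T(V^k)$ and $V_T:=f_T(V)$. Let $L u:=\omega\wedge u$, let $J$ be the Weil operator ($Ju=i^{p-q}u$ on $(p,q)$-forms), and let $\bar\partial+\partial^E$ be the Chern connection of $(E,h_E)$, with $(1,0)$-part $\partial^E$. Call $u\in V_T^k$ primitive if $k\le m$ and $L^{m-k+1}u=0$, and let the Lefschetz star operator be the $\mathbb C$-linear map $*_s:V_T\to V_T$ with $$*_s\Big(\frac{L^j}{j!}u\Big)=(-1)^{k(k+1)/2}\,\frac{L^{m-k-j}}{(m-k-j)!}\,u\qquad (u\in V_T^k \text{ primitive},\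 0\le j\le m-k).$$ Put $\Lambda:=*_s^{-1}L*_s$ and $*:=*_s\circ J$. For $E$-valued forms $u=\sum u^a\otimes e_a$, $v=\sum v^b\otimes e_b$ put $\{u,v\}_{h_E}=\sum h_E(e_a,e_b)\,u^a\wedge\overline{v^b}$. Equip $V_T$ with the inner product $(u,v):=\int_X\{a,*v\}_{h_E}$, where $a\in V$ is any form with $T\wedge a=u$ (equivalently $(u,v)=\int_X\{u,b\}_{h_E}$ for any $b\in V$ with $T\wedge b=*v$), the integral being that of the component of degree $2n$. Let $\bar\partial^*$ be the adjoint of $\bar\partial:V_T\to V_T$ for this inner product. Theorem. Assume that $T$ is $d$-closed. Then $L$, $J$, $\bar\partial$ and $\partial^E$ map $V_T$ to itself; the operator $*_s$ exists, is unique and is invertible; the adjoint $\bar\partial^*:V_T\to V_T$ exists and is unique; and, with $[A,B]=AB-BA$, $$[\bar\partial^*,L]=i\big(\partial^E+[\Lambda,[\partial^E,L]]\big)\qquad\text{on } V_T .$$ -/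

import Mathlib

open scoped TensorProduct Manifold ContDiff Topology
open Complex MeasureTheory

noncomputable section

namespace THodge

/-! ### Linear algebra on the model space `ℂⁿ` -/

/-- The model space `ℂⁿ` of an `n`-dimensional complex manifold. -/
abbrev CV (n : ℕ) : Type := Fin n → ℂ

/-- The real exterior algebra `⨁ₖ ⋀ᵏ V*` of the real dual of `V = ℂⁿ`. As with Mathlib's
`TangentSpace`, the real tangent space at a point `p` of a manifold modelled on `ℂⁿ` is identified
with `ℂⁿ` through the differential at `p` of the preferred chart `chartAt p`. So `Lam n` is the
algebra of real (mixed degree) forms at `p`, with the wedge product as multiplication, and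
`E p ⊗[ℝ] Lam n` is the space of `E`-valued (mixed degree, complexified) forms at `p`. -/
abbrev Lam (n : ℕ) : Type := ExteriorAlgebra ℝ (Module.Dual ℝ (CV n))

instance lam_finite (n : ℕ) : Module.Finite ℝ (Lam n) :=
  Module.Finite.of_basis (Module.finBasis ℝ (Module.Dual ℝ (CV n))).ExteriorAlgebra

/-- The real vector `∂/∂x_j`. -/
def ex {n : ℕ} (j : Fin n) : CV n := Pi.single j 1

/-- The real vector `∂/∂y_j`, which is `i` times `∂/∂x_j`. -/
def ey {n : ℕ} (j : Fin n) : CV n := Pi.single j I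

/-- The covector `dx_j = Re z_j`. -/
def dx {n : ℕ} (j : Fin n) : Module.Dual ℝ (CV n) := reLm ∘ₗ LinearMap.proj j

/-- The covector `dy_j = Im z_j`. -/
def dy {n : ℕ} (j : Fin n) : Module.Dual ℝ (CV n) := imLm ∘ₗ LinearMap.proj j

/-- The value of the degree `k` component of a form on vectors `v₁, …, v_k`, normalized by
`(λ₁ ∧ ⋯ ∧ λ_k)(v₁, …, v_k) = det (λ_a (v_b))`. -/
def evalForm {n k : ℕ} (v : Fin k → CV n) : Lam n →ₗ[ℝ] ℝ :=
  ExteriorAlgebra.liftAlternating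
    (Pi.single k ((Matrix.detRowAlternating (n := Fin k) (R := ℝ)).compLinearMap
      (LinearMap.pi fun b => Module.Dual.eval ℝ (CV n) (v b))))

/-- The positively oriented real frame `∂/∂x₁, ∂/∂y₁, …, ∂/∂xₙ, ∂/∂yₙ` of `ℂⁿ`. -/
def realFrame (n : ℕ) (a : Fin (n * 2)) : CV n :=
  if (finProdFinEquiv.symm a).2 = 0 then ex (finProdFinEquiv.symm a).1
  else ey (finProdFinEquiv.symm a).1

/-- The coefficient of `dx₁ ∧ dy₁ ∧ ⋯ ∧ dxₙ ∧ dyₙ` in a complex valued form. -/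
def topCoeff (n : ℕ) (η : ℂ ⊗[ℝ] Lam n) : ℂ :=
  TensorProduct.rid ℝ ℂ (LinearMap.lTensor ℂ (evalForm (realFrame n)) η)

/-- The Weil operator `J` on real forms: on covectors `(J λ)(v) = λ (i v)`, extended as an algebra
homomorphism. -/
def weilLam (n : ℕ) : Lam n →ₐ[ℝ] Lam n :=
  ExteriorAlgebra.map
    (LinearMap.dualMap ((LinearMap.lsmul ℂ (CV n) I).restrictScalars ℝ))

/-- `a` is (the value at a point of) a positive real `(1,1)`-form: a real `2`-form which is
`J`-invariant and satisfies `a (v, i v) > 0` for `v ≠ 0`. -/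
def IsPositive11 {n : ℕ} (a : Lam n) : Prop :=
  a ∈ ⋀[ℝ]^2 (Module.Dual ℝ (CV n)) ∧ weilLam n a = a ∧
    ∀ v : CV n, v ≠ 0 → 0 < evalForm ![v, I • v] a

section Fibre

variable {n : ℕ} {W : Type*} [AddCommGroup W] [Module ℂ W]

/-- `u ↦ a ∧ u` on `W`-valued forms, for a real form `a`. -/
def wedge (a : Lam n) : W ⊗[ℝ] Lam n →ₗ[ℂ] W ⊗[ℝ] Lam n :=
  TensorProduct.AlgebraTensorModule.map LinearMap.id (LinearMap.mulLeft ℝ a)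

/-- `u ↦ dz_j ∧ u`, where `dz_j = dx_j + i dy_j`. -/
def wedgeDz (j : Fin n) (u : W ⊗[ℝ] Lam n) : W ⊗[ℝ] Lam n :=
  wedge (ExteriorAlgebra.ι ℝ (dx j)) u + I • wedge (ExteriorAlgebra.ι ℝ (dy j)) u

/-- `u ↦ dz̄_j ∧ u`, where `dz̄_j = dx_j - i dy_j`. -/
def wedgeDzbar (j : Fin n) (u : W ⊗[ℝ] Lam n) : W ⊗[ℝ] Lam n :=
  wedge (ExteriorAlgebra.ι ℝ (dx j)) u - I • wedge (ExteriorAlgebra.ι ℝ (dy j)) u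

end Fibre

/-! ### Calculus on open subsets of `ℂⁿ` with values in a finite dimensional real space -/

section Flat

variable {n : ℕ} {W : Type*} [AddCommGroup W] [Module ℝ W]

/-- Smoothness (in the real sense) of a function with values in a finite dimensional real vector
space, tested by linear functionals. -/
def SmoothAt (g : CV n → W) (y : CV n) : Prop :=
  ∀ l : Module.Dual ℝ W, ContDiffAt ℝ ∞ (fun z => l (g z)) y

/-- The derivative at `y` in the real direction `v`, computed in a basis of the (finite
dimensional) target. -/
def dirDeriv [Module.Finite ℝ W] (g : CV n → W) (y v : CV n) : W :=
  ∑ a, fderiv ℝ (fun z => (Module.finBasis ℝ W).repr (g z) a) y v • Module.finBasis ℝ W a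

/-- The exterior derivative `∑_j dx_j ∧ ∂g/∂x_j + dy_j ∧ ∂g/∂y_j` of a real form on `ℂⁿ`. -/
def flatD (g : CV n → Lam n) (y : CV n) : Lam n :=
  ∑ j, (ExteriorAlgebra.ι ℝ (dx j) * dirDeriv g y (ex j) +
    ExteriorAlgebra.ι ℝ (dy j) * dirDeriv g y (ey j))

end Flat

section FlatComplex

variable {n r : ℕ}

/-- `∂g/∂z_j = (∂g/∂x_j - i ∂g/∂y_j) / 2`. -/
def partialZ (g : CV n → (Fin r → ℂ) ⊗[ℝ] Lam n) (y : CV n) (j : Fin n) :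
    (Fin r → ℂ) ⊗[ℝ] Lam n :=
  (1 / 2 : ℂ) • (dirDeriv g y (ex j) - I • dirDeriv g y (ey j))

/-- `∂g/∂z̄_j = (∂g/∂x_j + i ∂g/∂y_j) / 2`. -/
def partialZbar (g : CV n → (Fin r → ℂ) ⊗[ℝ] Lam n) (y : CV n) (j : Fin n) :
    (Fin r → ℂ) ⊗[ℝ] Lam n :=
  (1 / 2 : ℂ) • (dirDeriv g y (ex j) + I • dirDeriv g y (ey j))

/-- `∂̄g = ∑_j dz̄_j ∧ ∂g/∂z̄_j` for a `ℂʳ`-valued form on `ℂⁿ`. -/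
def flatDbar (g : CV n → (Fin r → ℂ) ⊗[ℝ] Lam n) (y : CV n) : (Fin r → ℂ) ⊗[ℝ] Lam n :=
  ∑ j, wedgeDzbar j (partialZbar g y j)

/-- The matrix `θ_j = (∂H/∂z_j) H⁻¹` of the Chern connection of a Hermitian metric with Gram
matrix `H_{ab} = h (e_a, e_b)` in a holomorphic frame; it means `D_{∂/∂z_j} e_a = ∑_b θ_{ab} e_b`.
-/
def chernMatrix (H : CV n → Matrix (Fin r) (Fin r) ℂ) (y : CV n) (j : Fin n) :
    Matrix (Fin r) (Fin r) ℂ :=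
  (Matrix.of fun a b => (1 / 2 : ℂ) *
    (fderiv ℝ (fun z => H z a b) y (ex j) - I * fderiv ℝ (fun z => H z a b) y (ey j))) * (H y)⁻¹

/-- The `(1,0)`-part of the Chern connection, `∑_j dz_j ∧ (∂g/∂z_j + θ_j g)`, on `ℂʳ`-valued forms
(written in a holomorphic frame with Gram matrix `H`). -/
def flatDel (H : CV n → Matrix (Fin r) (Fin r) ℂ) (g : CV n → (Fin r → ℂ) ⊗[ℝ] Lam n)
    (y : CV n) : (Fin r → ℂ) ⊗[ℝ] Lam n :=
  ∑ j, wedgeDz j (partialZ g y j +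
    TensorProduct.AlgebraTensorModule.map (Matrix.vecMulLinear (chernMatrix H y j))
      (LinearMap.id : Lam n →ₗ[ℝ] Lam n) (g y))

end FlatComplex

/-! ### Real and complex valued forms on a manifold -/

section Manifold

variable {n : ℕ} {X : Type*} [TopologicalSpace X] [ChartedSpace (CV n) X]

/-- Let `p` be the point with coordinate `y` in the chart at `x₀`. This is the pull back of forms
at `p` (which are written in the coordinates of the chart at `p`) to forms at `y ∈ ℂⁿ` along the
inverse of the chart at `x₀`. -/
def pullLam (x₀ : X) (y : CV n) : Lam n →ₐ[ℝ] Lam n :=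
  ExteriorAlgebra.map
    (LinearMap.dualMap
      (fderiv ℝ (chartAt (CV n) ((chartAt (CV n) x₀).symm y) ∘ (chartAt (CV n) x₀).symm) y :
        CV n →ₗ[ℝ] CV n))

/-- The expression of a real form in the chart at `x₀`. -/
def localReal (a : X → Lam n) (x₀ : X) (y : CV n) : Lam n :=
  pullLam x₀ y (a ((chartAt (CV n) x₀).symm y))

/-- A smooth real form. -/
def IsSmoothReal (a : X → Lam n) : Prop :=
  ∀ x₀ : X, SmoothAt (localReal a x₀) (chartAt (CV n) x₀ x₀)

/-- A smooth positive `(1,1)`-form, that is, a Hermitian form on the manifold. -/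
def IsHermitianForm (a : X → Lam n) : Prop :=
  IsSmoothReal a ∧ ∀ x, IsPositive11 (a x)

/-- A `d`-closed real form. -/
def IsDClosed (a : X → Lam n) : Prop :=
  ∀ x : X, flatD (localReal a x) (chartAt (CV n) x x) = 0

/-- The wedge product `α₁ ∧ ⋯ ∧ α_s`, equal to `1` for `s = 0`. -/
def wedgeProd {s : ℕ} (α : Fin s → X → Lam n) (x : X) : Lam n :=
  (List.ofFn fun j => α j x).prod

variable [T2Space X] [SecondCountableTopology X]

variable (n X) in
theorem exists_chartPartition :
    ∃ ρ : PartitionOfUnity X X Set.univ, ρ.IsSubordinate fun x => (chartAt (CV n) x).source := by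
  have : LocallyCompactSpace X := ChartedSpace.locallyCompactSpace (CV n) X
  exact PartitionOfUnity.exists_isSubordinate isClosed_univ _
    (fun x => (chartAt (CV n) x).open_source)
    (fun x _ => Set.mem_iUnion.2 ⟨x, mem_chart_source (CV n) x⟩)

variable (n X) in
/-- A partition of unity subordinate to the domains of the preferred charts. -/
def chartPartition : PartitionOfUnity X X Set.univ := (exists_chartPartition n X).choose

/-- The integral `∫_X η` (of the top degree component) of a complex valued form, for the
orientation `dx₁ ∧ dy₁ ∧ ⋯ ∧ dxₙ ∧ dyₙ > 0`: the sum over the partition of unity of the integrals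
of `ρ_x η` in the chart at `x`. -/
def integral (η : X → ℂ ⊗[ℝ] Lam n) : ℂ :=
  ∑ᶠ x : X, ∫ y in (chartAt (CV n) x).target,
    (chartPartition n X x ((chartAt (CV n) x).symm y) : ℂ) *
      topCoeff n (LinearMap.lTensor ℂ (pullLam x y).toLinearMap (η ((chartAt (CV n) x).symm y)))

end Manifold

/-! ### Forms with values in a holomorphic Hermitian vector bundle -/

section Bundle

variable {n r : ℕ} {X : Type*} [TopologicalSpace X] [ChartedSpace (CV n) X]
  {E : X → Type*} [∀ x, AddCommGroup (E x)] [∀ x, Module ℂ (E x)]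

variable (n E) in
/-- Arbitrary (not necessarily continuous) `E`-valued forms of mixed degree. -/
abbrev Forms : Type _ := ∀ x : X, E x ⊗[ℝ] Lam n

/-- `u ↦ a ∧ u` for a real form `a` on `X`. -/
def wedgeForm (a : X → Lam n) : Forms n E →ₗ[ℂ] Forms n E :=
  LinearMap.pi fun x => wedge (a x) ∘ₗ LinearMap.proj x

/-- The Weil operator on `E`-valued forms; it is multiplication by `i^{p-q}` on `(p,q)`-forms. -/
def weil : Forms n E →ₗ[ℂ] Forms n E :=
  LinearMap.pi fun x =>
    TensorProduct.AlgebraTensorModule.map LinearMap.id (weilLam n).toLinearMap ∘ₗ LinearMap.proj x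

variable (n E) in
/-- The forms which are homogeneous of degree `k`. -/
def homogeneous (k : ℕ) : Submodule ℂ (Forms n E) where
  carrier := {u | ∀ x, u x ∈ LinearMap.range
    (TensorProduct.AlgebraTensorModule.map (LinearMap.id : E x →ₗ[ℂ] E x)
      (⋀[ℝ]^k (Module.Dual ℝ (CV n))).subtype)}
  add_mem' hu hv _ := Submodule.add_mem _ (hu _) (hv _)
  zero_mem' _ := Submodule.zero_mem _
  smul_mem' c _ hu x := Submodule.smul_mem _ c (hu x)

/-- A family of sesquilinear forms on the fibres, linear in the first variable. -/
abbrev SesqForm (E : X → Type*) [∀ x, AddCommGroup (E x)] [∀ x, Module ℂ (E x)] : Type _ :=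
  ∀ x : X, E x →ₗ[ℂ] E x →ₗ⋆[ℂ] ℂ

/-- The pairing `{u, v}_h = ∑ h(e_a, e_b) u^a ∧ conj (v^b)`, in the fibre over `x`. -/
def hermPair (h : SesqForm E) (x : X) :
    E x ⊗[ℝ] Lam n →ₗ[ℝ] E x ⊗[ℝ] Lam n →ₗ[ℝ] ℂ ⊗[ℝ] Lam n :=
  TensorProduct.map₂
    (LinearMap.mk₂ ℝ (fun s t => h x s t) (by intros; simp)
      (by intro c s t; rw [← Complex.coe_smul c s]; simp) (by intros; simp)
      (by intro c s t; rw [← Complex.coe_smul c t, map_smulₛₗ]; simp))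
    (LinearMap.mul ℝ (Lam n))

variable [TopologicalSpace (Bundle.TotalSpace (Fin r → ℂ) E)] [∀ x, TopologicalSpace (E x)]
  [FiberBundle (Fin r → ℂ) E] [VectorBundle ℂ (Fin r → ℂ) E]

variable (r) in
/-- The expression of an `E`-valued form in the chart at `x₀` and in the holomorphic frame of `E`
given by the preferred trivialization at `x₀`. -/
def localRep (u : Forms n E) (x₀ : X) (y : CV n) : (Fin r → ℂ) ⊗[ℝ] Lam n :=
  TensorProduct.AlgebraTensorModule.map
    ((trivializationAt (Fin r → ℂ) E x₀).linearMapAt ℂ ((chartAt (CV n) x₀).symm y))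
    (pullLam x₀ y).toLinearMap (u ((chartAt (CV n) x₀).symm y))

variable (n r E) in
/-- The space `V` of smooth `E`-valued forms with compact support. -/
def smoothForms : Submodule ℂ (Forms n E) where
  carrier := {u | (∀ x₀ : X, SmoothAt (localRep r u x₀) (chartAt (CV n) x₀ x₀)) ∧
    ∃ K : Set X, IsCompact K ∧ ∀ x ∉ K, u x = 0}
  add_mem' := by
    rintro u v ⟨hu, K, hK, hu'⟩ ⟨hv, K', hK', hv'⟩
    refine ⟨fun x₀ l => ?_, K ∪ K', hK.union hK', fun x hx => ?_⟩
    · simpa [localRep] using (hu x₀ l).add (hv x₀ l)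
    · simp only [Set.mem_union, not_or] at hx
      simp [hu' x hx.1, hv' x hx.2]
  zero_mem' := by
    refine ⟨fun x₀ l => ?_, ∅, isCompact_empty, fun x _ => rfl⟩
    simpa [localRep] using contDiffAt_const
  smul_mem' := by
    rintro c u ⟨hu, K, hK, hu'⟩
    refine ⟨fun x₀ l => ?_, K, hK, fun x hx => by simp [hu' x hx]⟩
    simpa [localRep] using
      hu x₀ (l ∘ₗ ((LinearMap.lsmul ℂ ((Fin r → ℂ) ⊗[ℝ] Lam n) c).restrictScalars ℝ))

variable (n r) in
/-- The Gram matrix of `h` in the holomorphic frame given by the preferred trivialization at `x₀`,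
as a function of the coordinates of the chart at `x₀`. -/
def gram (h : SesqForm E) (x₀ : X) (y : CV n) : Matrix (Fin r) (Fin r) ℂ :=
  Matrix.of fun a b => h ((chartAt (CV n) x₀).symm y)
    ((trivializationAt (Fin r → ℂ) E x₀).symmₗ ℂ ((chartAt (CV n) x₀).symm y) (Pi.single a 1))
    ((trivializationAt (Fin r → ℂ) E x₀).symmₗ ℂ ((chartAt (CV n) x₀).symm y) (Pi.single b 1))

variable (n r) in
/-- A smooth Hermitian metric on `E`. -/
structure IsHermitianMetric (h : SesqForm E) : Prop where
  symm : ∀ x s t, h x s t = (starRingEnd ℂ) (h x t s)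
  pos : ∀ x s, s ≠ 0 → 0 < (h x s s).re
  smooth : ∀ (x₀ : X) (a b : Fin r),
    ContDiffAt ℝ ∞ (fun y => gram n r h x₀ y a b) (chartAt (CV n) x₀ x₀)

variable (r) in
/-- Back from the expression at `x` in the chart and frame at `x` to the fibre over `x`. -/
def fromLocal (x : X) : (Fin r → ℂ) ⊗[ℝ] Lam n →ₗ[ℂ] E x ⊗[ℝ] Lam n :=
  TensorProduct.AlgebraTensorModule.map ((trivializationAt (Fin r → ℂ) E x).symmₗ ℂ x)
    (LinearMap.id : Lam n →ₗ[ℝ] Lam n)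

variable (r) in
/-- The operator `∂̄` on `E`-valued forms, computed at `x` in the chart at `x` and in the
holomorphic frame of `E` at `x`. -/
def dbar (u : Forms n E) : Forms n E := fun x =>
  fromLocal r x (flatDbar (localRep r u x) (chartAt (CV n) x x))

variable (r) in
/-- The `(1,0)`-part `∂^E` of the Chern connection of `(E, h)` on `E`-valued forms. -/
def del (h : SesqForm E) (u : Forms n E) : Forms n E := fun x =>
  fromLocal r x (flatDel (gram n r h x) (localRep r u x) (chartAt (CV n) x x))

/-! ### The space `V_T` and its operators -/

variable (r E) in
/-- The space `V_T = {T ∧ u : u ∈ V}`. -/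
def VT (T : X → Lam n) : Submodule ℂ (Forms n E) :=
  (smoothForms n r E).map (wedgeForm T)

variable (r E) in
/-- The space `V_T^k = {T ∧ u : u ∈ V^k}`. -/
def VTdeg (T : X → Lam n) (k : ℕ) : Submodule ℂ (Forms n E) :=
  (smoothForms n r E ⊓ homogeneous n E k).map (wedgeForm T)

variable (r) in
/-- The endomorphism of `V_T` which is the restriction of `P`. (It is meaningful only if `P` maps
`V_T` linearly to itself.) -/
def restrictVT (T : X → Lam n) (P : Forms n E → Forms n E) : Module.End ℂ (VT r E T) :=
  Classical.epsilon fun A => ∀ u : VT r E T, (A u : Forms n E) = P u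

variable (r E) in
/-- `L : u ↦ ω ∧ u` on `V_T`. -/
def opL (om T : X → Lam n) : Module.End ℂ (VT r E T) := restrictVT r T (wedgeForm om)

variable (r E) in
/-- The Weil operator `J` on `V_T`. -/
def opJ (T : X → Lam n) : Module.End ℂ (VT r E T) := restrictVT r T weil

variable (r E) in
/-- `∂̄ : V_T → V_T`. -/
def opDbar (T : X → Lam n) : Module.End ℂ (VT r E T) := restrictVT r T (dbar r)

variable (r) in
/-- `∂^E : V_T → V_T`. -/
def opDel (h : SesqForm E) (T : X → Lam n) : Module.End ℂ (VT r E T) := restrictVT r T (del r h)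

variable (r E) in
/-- The defining property of the Lefschetz star operator on `V_T`, with `L_j = L^j / j!`:
`S (L_j u) = (-1)^{k + ⋯ + 1} L_{m-k-j} u` for all primitive `u ∈ V_T^k`. -/
def IsLefschetzStar (m : ℕ) (om T : X → Lam n) (S : Module.End ℂ (VT r E T)) : Prop :=
  ∀ k ≤ m, ∀ u : VT r E T, (u : Forms n E) ∈ VTdeg r E T k →
    (opL r E om T ^ (m - k + 1)) u = 0 → ∀ j ≤ m - k,
      S (((j.factorial : ℂ)⁻¹) • (opL r E om T ^ j) u) =
        ((-1 : ℂ) ^ (k * (k + 1) / 2) * ((m - k - j).factorial : ℂ)⁻¹) •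
          (opL r E om T ^ (m - k - j)) u

variable (r E) in
/-- The Lefschetz star operator `*ₛ` on `V_T`. -/
def opStar (m : ℕ) (om T : X → Lam n) : Module.End ℂ (VT r E T) :=
  Classical.epsilon (IsLefschetzStar r E m om T)

variable (r E) in
/-- `Λ = *ₛ⁻¹ L *ₛ`. -/
def opLambda (m : ℕ) (om T : X → Lam n) : Module.End ℂ (VT r E T) :=
  Ring.inverse (opStar r E m om T) * opL r E om T * opStar r E m om T

variable [T2Space X] [SecondCountableTopology X]

variable (r) in
/-- The inner product `(u, v) = ∫_X {f_T⁻¹ u, * v}_h` on `V_T`, where `f_T a = T ∧ a` and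
`* = *ₛ ∘ J` is the Hodge star operator. Any preimage `a` of `u` under `f_T` may be used: if
`* v = T ∧ b` then `{a, * v} = T ∧ {a, b} = {u, b}`, which depends neither on the choice of `a`
nor on that of `b`. -/
def innerVT (m : ℕ) (h : SesqForm E) (om T : X → Lam n) (u v : VT r E T) : ℂ :=
  integral fun x => hermPair h x ((Submodule.mem_map.1 u.2).choose x)
    (((opStar r E m om T * opJ r E T) v : Forms n E) x)

variable (r) in
/-- `B` is the adjoint of `A` for the inner product of `V_T`. -/
def IsAdjointVT (m : ℕ) (h : SesqForm E) (om T : X → Lam n) (A B : Module.End ℂ (VT r E T)) :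
    Prop :=
  ∀ u v : VT r E T, innerVT r m h om T (A u) v = innerVT r m h om T u (B v)

variable (r) in
/-- The adjoint `∂̄*` of `∂̄ : V_T → V_T`. -/
def opDbarStar (m : ℕ) (h : SesqForm E) (om T : X → Lam n) : Module.End ℂ (VT r E T) :=
  Classical.epsilon (IsAdjointVT r m h om T (opDbar r E T))

end Bundle

end THodge

end

/-! The form `T` is real, closed and invariant under the Weil operator, so `∂T` and `∂̄T` vanish
separately. Wedging with `T` therefore commutes with `∂̄` and `∂^E`, and both operators act on
`V_T`. Stokes' theorem for the Chern connection gives the explicit adjoint `∂̄* = -i *ₛ ∂^E *ₛ P`,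
where `P` is the parity of the degree (`isAdjointVT_dbarAdjoint`). It is the only adjoint because
the integral pairing is nondegenerate (`eq_zero_of_integral_pairForm`).

With this formula the identity is pure algebra in a module graded by weights `k - m`, on which `L`
has degree two and the hard Lefschetz property (`IsLefschetz`). The operator `D = ∂^E` has degree
one, and `C = [D, L]` is wedging with `∂ω`. This `C` need not vanish, but it commutes with `L`, and
that is all that is used. For primitive `u`, the primitive decomposition of `C u` has at most four
terms and that of `D u` at most three, the last one of `D u` being determined by the last one of `C
u` (`IsLefschetz.exists_components`). Both sides of the identity, evaluated on `L^j u / j!`, are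
then explicit combinations of powers of `L` on six primitive elements, and the coefficients agree
(`IsLefschetz.commutator_star`).

That `V_T` is such a module is the mixed hard Lefschetz theorem: on a vector space of complex
dimension `n`, wedging with a product of `n - k` positive `(1,1)`-forms is injective on `k`-forms
(`mixedHL`). It is proved by induction on `n` together with the mixed Hodge–Riemann relations.
Hodge–Riemann in dimension `n` gives hard Lefschetz in dimension `n + 1` by restriction to
coordinate hyperplanes (`mixedHL_succ`). Hard Lefschetz in dimension `n` gives Hodge–Riemann in
dimension `n` by deforming all forms to the standard one (`mixedHR_of_mixedHL`, `pos_of_deform`),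
for which the relations follow by splitting off one complex coordinate (`hodgeRiemann_std`). The
fibrewise inverse depends smoothly on the base point (`smoothAt_solve`), so the statement passes to
smooth forms with compact support (`isLefschetz_VT`).

The operators `∂̄` and `∂^E` are defined at each point through the preferred chart and frame at that
point. `localRep_dbar` and `localRep_del` show that the same formulas hold in every chart and frame.
For `∂^E` this rests on writing it as `H⁻¹ ∂ H` with `H` the Gram matrix (`flatDel_eq`): the
coefficient vector multiplied by `H` changes by antiholomorphic matrices, which `∂` does not see. -/

noncomputable section

namespace THodge

/-! ### Calculus with values in finite dimensional real spaces -/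

section Calculus

variable {n : ℕ} {W W₁ W₂ W₃ : Type*} [AddCommGroup W] [Module ℝ W]
  [AddCommGroup W₁] [Module ℝ W₁] [AddCommGroup W₂] [Module ℝ W₂] [AddCommGroup W₃] [Module ℝ W₃]

theorem ext_dual [Module.Finite ℝ W] {x y : W} (h : ∀ l : Module.Dual ℝ W, l x = l y) : x = y := by
  rw [← sub_eq_zero, ← Module.forall_dual_apply_eq_zero_iff ℝ]
  intro l
  rw [map_sub, h, sub_self]

theorem SmoothAt.congr {g g' : CV n → W} {y : CV n} (hg : SmoothAt g y) (h : g' =ᶠ[𝓝 y] g) :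
    SmoothAt g' y := fun l =>
  (hg l).congr_of_eventuallyEq (h.fun_comp (fun w => l w))

theorem smoothAt_const (w : W) (y : CV n) : SmoothAt (fun _ => w) y := fun _ => contDiffAt_const

theorem SmoothAt.linear {g : CV n → W} {y : CV n} (hg : SmoothAt g y) (A : W →ₗ[ℝ] W₁) :
    SmoothAt (fun z => A (g z)) y := fun l => hg (l ∘ₗ A)

theorem SmoothAt.add {g g' : CV n → W} {y : CV n} (hg : SmoothAt g y) (hg' : SmoothAt g' y) :
    SmoothAt (fun z => g z + g' z) y := fun l => by
  simpa using (hg l).add (hg' l)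

theorem SmoothAt.sub {g g' : CV n → W} {y : CV n} (hg : SmoothAt g y) (hg' : SmoothAt g' y) :
    SmoothAt (fun z => g z - g' z) y := fun l => by
  simpa using (hg l).sub (hg' l)

theorem SmoothAt.sum {ι : Type*} {s : Finset ι} {g : ι → CV n → W} {y : CV n}
    (hg : ∀ i ∈ s, SmoothAt (g i) y) : SmoothAt (fun z => ∑ i ∈ s, g i z) y := fun l => by
  simpa using ContDiffAt.sum fun i hi => hg i hi l

theorem SmoothAt.smul {f : CV n → ℝ} {g : CV n → W} {y : CV n} (hf : ContDiffAt ℝ ∞ f y)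
    (hg : SmoothAt g y) : SmoothAt (fun z => f z • g z) y := fun l => by
  simpa using hf.mul (hg l)

theorem SmoothAt.comp {k : ℕ} {g : CV n → W} {φ : CV k → CV n} {y : CV k}
    (hg : SmoothAt g (φ y)) (hφ : ContDiffAt ℝ ∞ φ y) : SmoothAt (fun z => g (φ z)) y := fun l =>
  ContDiffAt.comp (g := fun z => l (g z)) y (hg l) hφ

/-- Expansion of a family of linear maps applied to a function. -/
theorem family_expand [Module.Finite ℝ W] (Φ : CV n → W →ₗ[ℝ] W₁) (g : CV n → W) (z : CV n) :
    Φ z (g z) = ∑ a, (Module.finBasis ℝ W).repr (g z) a • Φ z (Module.finBasis ℝ W a) := by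
  conv_lhs => rw [← (Module.finBasis ℝ W).sum_repr (g z)]
  simp only [map_sum, map_smul]

theorem SmoothAt.repr [Module.Finite ℝ W] {g : CV n → W} {y : CV n} (hg : SmoothAt g y) (a) :
    ContDiffAt ℝ ∞ (fun z => (Module.finBasis ℝ W).repr (g z) a) y :=
  hg ((Module.finBasis ℝ W).coord a)

theorem SmoothAt.family [Module.Finite ℝ W] {Φ : CV n → W →ₗ[ℝ] W₁} {g : CV n → W} {y : CV n}
    (hΦ : ∀ w, SmoothAt (fun z => Φ z w) y) (hg : SmoothAt g y) :
    SmoothAt (fun z => Φ z (g z)) y := by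
  simp_rw [family_expand Φ g]
  exact SmoothAt.sum fun a _ => SmoothAt.smul (hg.repr a) (hΦ _)

theorem SmoothAt.bilin [Module.Finite ℝ W₂] (B : W₁ →ₗ[ℝ] W₂ →ₗ[ℝ] W₃) {f : CV n → W₁}
    {g : CV n → W₂} {y : CV n} (hf : SmoothAt f y) (hg : SmoothAt g y) :
    SmoothAt (fun z => B (f z) (g z)) y :=
  SmoothAt.family (Φ := fun z => B (f z)) (fun w => hf.linear (B.flip w)) hg

/-- Testing by functionals needs no norm on the target. Where a norm is available the two notions
agree by expanding in a basis, which gives access to the usual calculus. -/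
theorem smoothAt_iff_contDiffAt {F : Type*} [NormedAddCommGroup F] [NormedSpace ℝ F]
    [FiniteDimensional ℝ F] {g : CV n → F} {y : CV n} : SmoothAt g y ↔ ContDiffAt ℝ ∞ g y := by
  constructor
  · intro hg
    have : g = fun z => ∑ a, (Module.finBasis ℝ F).repr (g z) a • Module.finBasis ℝ F a := by
      funext z
      exact ((Module.finBasis ℝ F).sum_repr (g z)).symm
    rw [this]
    exact ContDiffAt.sum fun a _ => (hg.repr a).smul contDiffAt_const
  · intro hg l
    exact (LinearMap.toContinuousLinearMap l).contDiff.contDiffAt.comp y hg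

theorem SmoothAt.differentiableAt {g : CV n → W} {y : CV n} (hg : SmoothAt g y)
    (l : Module.Dual ℝ W) : DifferentiableAt ℝ (fun z => l (g z)) y :=
  (hg l).differentiableAt (by simp)

variable [Module.Finite ℝ W] [Module.Finite ℝ W₁] [Module.Finite ℝ W₂] [Module.Finite ℝ W₃]

/-- A functional passes through the basis expansion that defines `dirDeriv`. Combined with
`ext_dual`, this reduces each rule of differentiation below to the corresponding rule for scalar
functions. -/
theorem apply_dirDeriv {g : CV n → W} {y : CV n} (hg : SmoothAt g y) (v : CV n)
    (l : Module.Dual ℝ W) : l (dirDeriv g y v) = fderiv ℝ (fun z => l (g z)) y v := by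
  have h : (fun z => l (g z)) = fun z => ∑ a, (Module.finBasis ℝ W).repr (g z) a •
      l (Module.finBasis ℝ W a) := by
    funext z
    conv_lhs => rw [← (Module.finBasis ℝ W).sum_repr (g z)]
    simp only [map_sum, map_smul]
  rw [h, fderiv_fun_sum fun a _ => ((hg.repr a).differentiableAt (by simp)).smul_const _]
  simp only [dirDeriv, map_sum, map_smul, _root_.sum_apply]
  refine Finset.sum_congr rfl fun a _ => ?_
  have hd := (hg.repr a).differentiableAt (n := ∞) (by simp)
  rw [fderiv_smul_const hd]
  simp

theorem dirDeriv_congr {g g' : CV n → W} {y : CV n} (h : g =ᶠ[𝓝 y] g') (v : CV n) :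
    dirDeriv g y v = dirDeriv g' y v := by
  unfold dirDeriv
  refine Finset.sum_congr rfl fun a _ => ?_
  have := (h.fun_comp fun w => (Module.finBasis ℝ W).repr w a).fderiv_eq (𝕜 := ℝ)
  exact congrArg (fun T : CV n →L[ℝ] ℝ => T v • Module.finBasis ℝ W a) this

theorem dirDeriv_const (w : W) (y v : CV n) : dirDeriv (fun _ => w) y v = 0 := by
  simp [dirDeriv]

theorem dirDeriv_add_right (g : CV n → W) (y v w : CV n) :
    dirDeriv g y (v + w) = dirDeriv g y v + dirDeriv g y w := by
  simp [dirDeriv, add_smul, Finset.sum_add_distrib]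

theorem dirDeriv_smul_right (g : CV n → W) (y v : CV n) (c : ℝ) :
    dirDeriv g y (c • v) = c • dirDeriv g y v := by
  simp [dirDeriv, Finset.smul_sum, mul_smul]

/-- `dirDeriv g y` as a linear map in the direction. -/
def dirDerivL (g : CV n → W) (y : CV n) : CV n →ₗ[ℝ] W where
  toFun := dirDeriv g y
  map_add' := dirDeriv_add_right g y
  map_smul' c v := dirDeriv_smul_right g y v c

theorem dirDeriv_linear {g : CV n → W} {y : CV n} (hg : SmoothAt g y) (A : W →ₗ[ℝ] W₁)
    (v : CV n) : dirDeriv (fun z => A (g z)) y v = A (dirDeriv g y v) :=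
  ext_dual fun l => by
    rw [apply_dirDeriv (hg.linear A)]
    exact (apply_dirDeriv hg v (l ∘ₗ A)).symm

theorem dirDeriv_add {g g' : CV n → W} {y : CV n} (hg : SmoothAt g y) (hg' : SmoothAt g' y)
    (v : CV n) : dirDeriv (fun z => g z + g' z) y v = dirDeriv g y v + dirDeriv g' y v :=
  ext_dual fun l => by
    rw [apply_dirDeriv (hg.add hg'), map_add, apply_dirDeriv hg, apply_dirDeriv hg']
    simp only [map_add]
    rw [fderiv_fun_add (hg.differentiableAt l) (hg'.differentiableAt l)]
    rfl

theorem dirDeriv_sum {ι : Type*} {s : Finset ι} {g : ι → CV n → W} {y : CV n}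
    (hg : ∀ i ∈ s, SmoothAt (g i) y) (v : CV n) :
    dirDeriv (fun z => ∑ i ∈ s, g i z) y v = ∑ i ∈ s, dirDeriv (g i) y v :=
  ext_dual fun l => by
    rw [apply_dirDeriv (SmoothAt.sum hg), map_sum]
    simp only [map_sum]
    rw [fderiv_fun_sum fun i hi => (hg i hi).differentiableAt l, _root_.sum_apply]
    exact Finset.sum_congr rfl fun i hi => (apply_dirDeriv (hg i hi) v l).symm

theorem dirDeriv_smul {f : CV n → ℝ} {g : CV n → W} {y : CV n} (hf : ContDiffAt ℝ ∞ f y)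
    (hg : SmoothAt g y) (v : CV n) :
    dirDeriv (fun z => f z • g z) y v = fderiv ℝ f y v • g y + f y • dirDeriv g y v :=
  ext_dual fun l => by
    rw [apply_dirDeriv (SmoothAt.smul hf hg), map_add, map_smul, map_smul, apply_dirDeriv hg]
    simp only [map_smul, smul_eq_mul]
    rw [fderiv_fun_mul (hf.differentiableAt (by simp)) (hg.differentiableAt l)]
    simp
    ring

/-- Product rule for evaluation of a moving linear map, obtained by expanding `g` in a basis. In the
first term the argument is frozen at `g y`. Gauge transformations and pull backs are both families
of this kind, so their Leibniz rules reduce to differentiating them on constant forms. -/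
theorem dirDeriv_family {Φ : CV n → W →ₗ[ℝ] W₁} {g : CV n → W} {y : CV n}
    (hΦ : ∀ w, SmoothAt (fun z => Φ z w) y) (hg : SmoothAt g y) (v : CV n) :
    dirDeriv (fun z => Φ z (g z)) y v =
      dirDeriv (fun z => Φ z (g y)) y v + Φ y (dirDeriv g y v) := by
  simp_rw [family_expand Φ g]
  rw [dirDeriv_sum fun a _ => SmoothAt.smul (hg.repr a) (hΦ _)]
  simp_rw [dirDeriv_smul (hg.repr _) (hΦ _)]
  rw [Finset.sum_add_distrib, add_comm]
  congr 1
  · have h := fun z => family_expand Φ (fun _ => g y) z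
    simp_rw [h]
    rw [dirDeriv_sum fun a _ => SmoothAt.smul contDiffAt_const (hΦ _)]
    simp_rw [dirDeriv_smul contDiffAt_const (hΦ _)]
    simp
  · simp [dirDeriv]

theorem dirDeriv_bilin (B : W₁ →ₗ[ℝ] W₂ →ₗ[ℝ] W₃) {f : CV n → W₁}
    {g : CV n → W₂} {y : CV n} (hf : SmoothAt f y) (hg : SmoothAt g y) (v : CV n) :
    dirDeriv (fun z => B (f z) (g z)) y v =
      B (dirDeriv f y v) (g y) + B (f y) (dirDeriv g y v) := by
  rw [dirDeriv_family (Φ := fun z => B (f z)) (fun w => hf.linear (B.flip w)) hg]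
  congr 1
  exact dirDeriv_linear hf (B.flip (g y)) v

theorem dirDeriv_comp {k : ℕ} {g : CV n → W} {φ : CV k → CV n} {y : CV k}
    (hg : SmoothAt g (φ y)) (hφ : ContDiffAt ℝ ∞ φ y) (v : CV k) :
    dirDeriv (fun z => g (φ z)) y v = dirDeriv g (φ y) (fderiv ℝ φ y v) :=
  ext_dual fun l => by
    rw [apply_dirDeriv (hg.comp hφ), apply_dirDeriv hg]
    have := fderiv_comp (g := fun z => l (g z)) y (hg.differentiableAt l)
      (hφ.differentiableAt (by simp))
    exact congrArg (fun T => T v) this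

theorem SmoothAt.dirDeriv {g : CV n → W} {y : CV n} (hg : SmoothAt g y) (v : CV n) :
    SmoothAt (fun z => THodge.dirDeriv g z v) y := by
  unfold THodge.dirDeriv
  refine SmoothAt.sum fun a _ => SmoothAt.smul ?_ (smoothAt_const _ _)
  exact ((hg.repr a).fderiv_right (m := ∞) (by simp)).clm_apply contDiffAt_const

theorem dirDeriv_eq_fderiv {F : Type*} [NormedAddCommGroup F] [NormedSpace ℝ F]
    [FiniteDimensional ℝ F] {g : CV n → F} {y : CV n} (hg : SmoothAt g y) (v : CV n) :
    THodge.dirDeriv g y v = fderiv ℝ g y v :=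
  ext_dual fun l => by
    rw [apply_dirDeriv hg]
    have := fderiv_comp (g := LinearMap.toContinuousLinearMap l) (f := g) y
      (ContinuousLinearMap.differentiableAt _)
      ((smoothAt_iff_contDiffAt.1 hg).differentiableAt (by simp))
    rw [ContinuousLinearMap.fderiv] at this
    exact congrArg (fun T => T v) this

end Calculus

/-! ### The real frame and coframe of `ℂⁿ` -/

section Frame

variable {n : ℕ}

/-- The real frame `∂/∂x_j, ∂/∂y_j`. -/
def fr (a : Fin n × Fin 2) : CV n := if a.2 = 0 then ex a.1 else ey a.1

/-- The dual coframe `dx_j, dy_j`. -/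
def cofr (a : Fin n × Fin 2) : Module.Dual ℝ (CV n) := if a.2 = 0 then dx a.1 else dy a.1

theorem realFrame_eq (n : ℕ) (a : Fin (n * 2)) : realFrame n a = fr (finProdFinEquiv.symm a) := rfl

theorem sum_fr {M : Type*} [AddCommMonoid M] (f : Fin n × Fin 2 → M) :
    ∑ a, f a = ∑ j, (f (j, 0) + f (j, 1)) := by
  simp [Fintype.sum_prod_type]

theorem cofr_fr (a b : Fin n × Fin 2) : cofr a (fr b) = if a = b then 1 else 0 := by
  obtain ⟨i, s⟩ := a
  obtain ⟨j, t⟩ := b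
  by_cases hij : i = j
  · subst hij
    fin_cases s <;> fin_cases t <;> simp [cofr, fr, dx, dy, ex, ey]
  · fin_cases s <;> fin_cases t <;> simp [cofr, fr, dx, dy, ex, ey, hij]

theorem sum_cofr_smul_fr (v : CV n) : ∑ a, cofr a v • fr a = v := by
  rw [sum_fr]
  funext j
  simp only [cofr, fr, Finset.sum_apply, Pi.add_apply, Pi.smul_apply]
  rw [Finset.sum_eq_single j]
  · simp [dx, dy, ex, ey]
  · intro b _ hb
    simp [ex, ey, hb.symm]
  · simp

theorem sum_apply_fr_smul_cofr (l : Module.Dual ℝ (CV n)) : ∑ a, l (fr a) • cofr a = l := by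
  refine LinearMap.ext fun v => ?_
  conv_rhs => rw [← sum_cofr_smul_fr v]
  simp only [map_sum, map_smul, LinearMap.sum_apply, LinearMap.smul_apply, smul_eq_mul, mul_comm]

/-- Multiplication by `i` as a real endomorphism of `ℂⁿ`. -/
def mulI (n : ℕ) : CV n →ₗ[ℝ] CV n := (LinearMap.lsmul ℂ (CV n) I).restrictScalars ℝ

@[simp] theorem mulI_apply (v : CV n) : mulI n v = I • v := rfl

theorem mulI_mulI (v : CV n) : mulI n (mulI n v) = -v := by
  simp [smul_smul]

/-- The trace identity `∑ (e^a ∘ A) ⊗ e_a = ∑ e^a ⊗ A e_a`. -/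
theorem sum_cofr_comp {k : ℕ} {M : Type*} [AddCommGroup M] [Module ℝ M]
    (B : Module.Dual ℝ (CV n) →ₗ[ℝ] CV k →ₗ[ℝ] M) (A : CV n →ₗ[ℝ] CV k) :
    ∑ a, B (cofr a) (A (fr a)) = ∑ b : Fin k × Fin 2, B (cofr b ∘ₗ A) (fr b) := by
  have h1 : ∀ a : Fin n × Fin 2, A (fr a) = ∑ b, cofr b (A (fr a)) • fr b := fun a =>
    (sum_cofr_smul_fr _).symm
  have h2 : ∀ b : Fin k × Fin 2, cofr b ∘ₗ A = ∑ a, cofr b (A (fr a)) • cofr a := fun b =>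
    (sum_apply_fr_smul_cofr (cofr b ∘ₗ A)).symm
  simp_rw [h2]
  conv_lhs => enter [2, a]; rw [h1 a]
  simp only [map_sum, map_smul, LinearMap.sum_apply, LinearMap.smul_apply]
  exact Finset.sum_comm

end Frame

end THodge
end

noncomputable section

namespace THodge

/-! ### Pull back of forms along linear maps -/

section PullBack

variable {n k l : ℕ} {W W' W'' : Type*} [AddCommGroup W] [Module ℂ W]
  [AddCommGroup W'] [Module ℂ W'] [AddCommGroup W''] [Module ℂ W'']

/-- Pull back of forms along a linear map. -/
def pb (A : CV k →ₗ[ℝ] CV n) : Lam n →ₐ[ℝ] Lam k := ExteriorAlgebra.map A.dualMap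

theorem pb_ι (A : CV k →ₗ[ℝ] CV n) (l : Module.Dual ℝ (CV n)) :
    pb A (ExteriorAlgebra.ι ℝ l) = ExteriorAlgebra.ι ℝ (l ∘ₗ A) :=
  ExteriorAlgebra.map_apply_ι _ _

theorem pb_comp (A : CV k →ₗ[ℝ] CV n) (B : CV l →ₗ[ℝ] CV k) (x : Lam n) :
    pb B (pb A x) = pb (A ∘ₗ B) x := by
  have : (pb B).comp (pb A) = pb (A ∘ₗ B) := by
    unfold pb
    rw [ExteriorAlgebra.map_comp_map]
    rfl
  exact congrArg (fun f => f x) this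

theorem pb_id (x : Lam n) : pb LinearMap.id x = x := by
  unfold pb
  rw [LinearMap.dualMap_id, ExteriorAlgebra.map_id]
  rfl

theorem weilLam_eq (n : ℕ) : weilLam n = pb (mulI n) := rfl

/-- The parity automorphism, `(-1)^k` on forms of degree `k`. -/
def par (n : ℕ) : Lam n →ₐ[ℝ] Lam n := pb (-LinearMap.id)

theorem par_ι (l : Module.Dual ℝ (CV n)) :
    par n (ExteriorAlgebra.ι ℝ l) = -ExteriorAlgebra.ι ℝ l := by
  rw [par, pb_ι, ← map_neg]
  congr 1
  ext
  simp

/-- Parity is itself the pull back along `-1`, which commutes with every linear map. -/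
theorem pb_par (A : CV k →ₗ[ℝ] CV n) (x : Lam n) : pb A (par n x) = par k (pb A x) := by
  rw [par, par, pb_comp, pb_comp]
  congr 2
  ext
  simp

theorem par_par (x : Lam n) : par n (par n x) = x := by
  rw [par, pb_comp]
  convert pb_id x using 2
  ext
  simp

theorem weilLam_weilLam (x : Lam n) : weilLam n (weilLam n x) = par n x := by
  rw [weilLam_eq, par, pb_comp]
  congr 2
  exact LinearMap.ext mulI_mulI

/-- Parity absorbs the sign produced when a covector passes a form of mixed degree, so most sign
rules below need no degrees. -/
theorem ι_mul_eq (l : Module.Dual ℝ (CV n)) (x : Lam n) :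
    ExteriorAlgebra.ι ℝ l * x = par n x * ExteriorAlgebra.ι ℝ l := by
  induction x using ExteriorAlgebra.induction with
  | algebraMap r => rw [AlgHom.commutes, Algebra.commutes]
  | ι x => rw [par_ι, neg_mul, eq_neg_iff_add_eq_zero, ExteriorAlgebra.ι_add_mul_swap]
  | mul a b ha hb => rw [← mul_assoc, ha, mul_assoc, hb, map_mul, mul_assoc]
  | add a b ha hb => rw [mul_add, ha, hb, map_add, add_mul]

/-- A linear map on values tensored with a linear map on forms. -/
abbrev tm (f : W →ₗ[ℂ] W') (g : Lam n →ₗ[ℝ] Lam k) : W ⊗[ℝ] Lam n →ₗ[ℂ] W' ⊗[ℝ] Lam k :=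
  TensorProduct.AlgebraTensorModule.map f g

theorem tm_tmul (f : W →ₗ[ℂ] W') (g : Lam n →ₗ[ℝ] Lam k) (s : W) (a : Lam n) :
    tm f g (s ⊗ₜ a) = f s ⊗ₜ g a := rfl

theorem tm_tm (f : W →ₗ[ℂ] W') (g : Lam n →ₗ[ℝ] Lam k) (f' : W' →ₗ[ℂ] W'')
    (g' : Lam k →ₗ[ℝ] Lam l) (u : W ⊗[ℝ] Lam n) :
    tm f' g' (tm f g u) = tm (f' ∘ₗ f) (g' ∘ₗ g) u := by
  induction u using TensorProduct.induction_on with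
  | zero => simp only [map_zero]
  | tmul s a => rfl
  | add u v hu hv => simp only [map_add, hu, hv]

theorem tm_id (u : W ⊗[ℝ] Lam n) : tm LinearMap.id LinearMap.id u = u := by
  induction u using TensorProduct.induction_on with
  | zero => simp only [map_zero]
  | tmul s a => rfl
  | add u v hu hv => simp only [map_add, hu, hv]

theorem wedge_tmul (a : Lam n) (s : W) (b : Lam n) :
    wedge a (s ⊗ₜ[ℝ] b) = s ⊗ₜ[ℝ] (a * b) := rfl

theorem wedge_wedge (a b : Lam n) (u : W ⊗[ℝ] Lam n) : wedge a (wedge b u) = wedge (a * b) u := by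
  induction u using TensorProduct.induction_on with
  | zero => simp only [map_zero]
  | tmul s x => simp only [wedge_tmul, mul_assoc]
  | add u v hu hv => simp only [map_add, hu, hv]

theorem wedge_one (u : W ⊗[ℝ] Lam n) : wedge (1 : Lam n) u = u := by
  induction u using TensorProduct.induction_on with
  | zero => simp only [map_zero]
  | tmul s x => simp only [wedge_tmul, one_mul]
  | add u v hu hv => simp only [map_add, hu, hv]

/-- The wedge product as a bilinear map. -/
def wedgeL : Lam n →ₗ[ℝ] W ⊗[ℝ] Lam n →ₗ[ℝ] W ⊗[ℝ] Lam n :=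
  LinearMap.mk₂ ℝ (fun a u => wedge a u)
    (fun a b u => by
      induction u using TensorProduct.induction_on with
      | zero => simp only [map_zero, add_zero]
      | tmul s x => simp only [wedge_tmul, add_mul, TensorProduct.tmul_add]
      | add u v hu hv => simp only [map_add, hu, hv]; abel)
    (fun c a u => by
      induction u using TensorProduct.induction_on with
      | zero => simp only [map_zero, smul_zero]
      | tmul s x => simp only [wedge_tmul, smul_mul_assoc, TensorProduct.tmul_smul]
      | add u v hu hv => simp only [map_add, hu, hv, smul_add])
    (fun a u v => map_add _ _ _)
    (fun c a u => ((wedge a).restrictScalars ℝ).map_smul c u)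

@[simp] theorem wedgeL_apply (a : Lam n) (u : W ⊗[ℝ] Lam n) : wedgeL a u = wedge a u := rfl

theorem wedge_zero (u : W ⊗[ℝ] Lam n) : wedge (0 : Lam n) u = 0 :=
  congrArg (fun f => f u) (map_zero (wedgeL (W := W)))

theorem wedge_sum {ι : Type*} (s : Finset ι) (a : ι → Lam n) (u : W ⊗[ℝ] Lam n) :
    wedge (∑ i ∈ s, a i) u = ∑ i ∈ s, wedge (a i) u := by
  simpa only [wedgeL_apply, LinearMap.sum_apply] using
    congrArg (fun f => f u) (map_sum (wedgeL (W := W)) a s)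

theorem tm_wedge (f : W →ₗ[ℂ] W') (g : Lam n →ₐ[ℝ] Lam k) (a : Lam n) (u : W ⊗[ℝ] Lam n) :
    tm f g.toLinearMap (wedge a u) = wedge (g a) (tm f g.toLinearMap u) := by
  induction u using TensorProduct.induction_on with
  | zero => simp only [map_zero]
  | tmul s x => simp only [wedge_tmul, tm_tmul, AlgHom.toLinearMap_apply, map_mul]
  | add u v hu hv => simp only [map_add, hu, hv]

theorem tm_id_wedge (f : W →ₗ[ℂ] W') (a : Lam n) (u : W ⊗[ℝ] Lam n) :
    tm f LinearMap.id (wedge a u) = wedge a (tm f LinearMap.id u) :=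
  tm_wedge f (AlgHom.id ℝ _) a u

/-- Parity on vector valued forms. -/
def parW (n : ℕ) (W : Type*) [AddCommGroup W] [Module ℂ W] : W ⊗[ℝ] Lam n →ₗ[ℂ] W ⊗[ℝ] Lam n :=
  tm LinearMap.id (par n).toLinearMap

/-- The Weil operator on vector valued forms. -/
def weilW (n : ℕ) (W : Type*) [AddCommGroup W] [Module ℂ W] : W ⊗[ℝ] Lam n →ₗ[ℂ] W ⊗[ℝ] Lam n :=
  tm LinearMap.id (weilLam n).toLinearMap

end PullBack

/-! ### First order operators with constant coefficients -/

section Flat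

variable {n : ℕ} {W W' : Type*} [AddCommGroup W] [Module ℂ W] [Module.Finite ℝ W]
  [AddCommGroup W'] [Module ℂ W'] [Module.Finite ℝ W']

/-- `∑ e^a ∧ ∂_{K e_a}`. For `K = 1` it is `d` and for `K = i` it is `i (∂̄ - ∂)`, up to sign. -/
def Dop (K : CV n →ₗ[ℝ] CV n) (g : CV n → W ⊗[ℝ] Lam n) (y : CV n) : W ⊗[ℝ] Lam n :=
  ∑ a, wedge (ExteriorAlgebra.ι ℝ (cofr a)) (dirDeriv g y (K (fr a)))

/-- `∑ e^a ∧ ∂_{K e_a}` on real forms. -/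
def DopR (K : CV n →ₗ[ℝ] CV n) (g : CV n → Lam n) (y : CV n) : Lam n :=
  ∑ a, ExteriorAlgebra.ι ℝ (cofr a) * dirDeriv g y (K (fr a))

/-- `∂̄` on vector valued forms on `ℂⁿ`. -/
def dbar0 (g : CV n → W ⊗[ℝ] Lam n) (y : CV n) : W ⊗[ℝ] Lam n :=
  (1 / 2 : ℂ) • (Dop LinearMap.id g y + I • Dop (mulI n) g y)

/-- `∂` on vector valued forms on `ℂⁿ`. -/
def del0 (g : CV n → W ⊗[ℝ] Lam n) (y : CV n) : W ⊗[ℝ] Lam n :=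
  (1 / 2 : ℂ) • (Dop LinearMap.id g y - I • Dop (mulI n) g y)

theorem I_mul_half_mul_I : I * (1 / 2 * I) = -(1 / 2 : ℂ) := by
  rw [mul_left_comm, I_mul_I]
  ring

theorem flatD_eq (g : CV n → Lam n) (y : CV n) : flatD g y = DopR LinearMap.id g y := by
  simp only [DopR, sum_fr, flatD, cofr, fr]
  simp

theorem mulI_fr_zero (j : Fin n) : mulI n (fr (j, 0)) = fr (j, 1) := by
  ext i
  simp only [fr, ex, ey, mulI_apply, Pi.smul_apply]
  by_cases h : i = j
  · subst h; simp
  · simp [h]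

theorem mulI_fr_one (j : Fin n) : mulI n (fr (j, 1)) = -fr (j, 0) := by
  rw [← mulI_fr_zero, mulI_mulI]

theorem dirDeriv_neg_right (g : CV n → W ⊗[ℝ] Lam n) (y v : CV n) :
    dirDeriv g y (-v) = -dirDeriv g y v := map_neg (dirDerivL g y) v

theorem Dop_id_eq (g : CV n → W ⊗[ℝ] Lam n) (y : CV n) :
    Dop LinearMap.id g y = ∑ j, (wedge (ExteriorAlgebra.ι ℝ (dx j)) (dirDeriv g y (ex j)) +
      wedge (ExteriorAlgebra.ι ℝ (dy j)) (dirDeriv g y (ey j))) := by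
  simp only [Dop, sum_fr, cofr, fr]
  simp

theorem Dop_mulI_eq (g : CV n → W ⊗[ℝ] Lam n) (y : CV n) :
    Dop (mulI n) g y = ∑ j, (wedge (ExteriorAlgebra.ι ℝ (dx j)) (dirDeriv g y (ey j)) -
      wedge (ExteriorAlgebra.ι ℝ (dy j)) (dirDeriv g y (ex j))) := by
  rw [Dop, sum_fr]
  refine Finset.sum_congr rfl fun j _ => ?_
  rw [mulI_fr_zero, mulI_fr_one, dirDeriv_neg_right, map_neg, ← sub_eq_add_neg]
  simp [cofr, fr]

omit [Module.Finite ℝ W] in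
theorem sum_dzbar (X Y : Fin n → W ⊗[ℝ] Lam n) :
    ∑ j, wedgeDzbar j ((1 / 2 : ℂ) • (X j + I • Y j)) =
      (1 / 2 : ℂ) • (∑ j, (wedge (ExteriorAlgebra.ι ℝ (dx j)) (X j) +
        wedge (ExteriorAlgebra.ι ℝ (dy j)) (Y j)) + I • ∑ j,
        (wedge (ExteriorAlgebra.ι ℝ (dx j)) (Y j) - wedge (ExteriorAlgebra.ι ℝ (dy j)) (X j))) := by
  rw [Finset.smul_sum, ← Finset.sum_add_distrib, Finset.smul_sum]
  refine Finset.sum_congr rfl fun j _ => ?_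
  simp only [wedgeDzbar, map_smul, map_add, smul_add, smul_sub, smul_smul]
  rw [I_mul_half_mul_I]
  module

omit [Module.Finite ℝ W] in
theorem sum_dz (X Y : Fin n → W ⊗[ℝ] Lam n) :
    ∑ j, wedgeDz j ((1 / 2 : ℂ) • (X j - I • Y j)) =
      (1 / 2 : ℂ) • (∑ j, (wedge (ExteriorAlgebra.ι ℝ (dx j)) (X j) +
        wedge (ExteriorAlgebra.ι ℝ (dy j)) (Y j)) - I • ∑ j,
        (wedge (ExteriorAlgebra.ι ℝ (dx j)) (Y j) - wedge (ExteriorAlgebra.ι ℝ (dy j)) (X j))) := by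
  rw [Finset.smul_sum, ← Finset.sum_sub_distrib, Finset.smul_sum]
  refine Finset.sum_congr rfl fun j _ => ?_
  simp only [wedgeDz, map_smul, map_sub, smul_add, smul_sub, smul_smul]
  rw [I_mul_half_mul_I]
  module

theorem dbar0_eq_sum (g : CV n → W ⊗[ℝ] Lam n) (y : CV n) :
    dbar0 g y = ∑ j, wedgeDzbar j ((1 / 2 : ℂ) • (dirDeriv g y (ex j) + I • dirDeriv g y (ey j))) := by
  rw [sum_dzbar, dbar0, Dop_id_eq, Dop_mulI_eq]

theorem del0_eq_sum (g : CV n → W ⊗[ℝ] Lam n) (y : CV n) :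
    del0 g y = ∑ j, wedgeDz j ((1 / 2 : ℂ) • (dirDeriv g y (ex j) - I • dirDeriv g y (ey j))) := by
  rw [sum_dz, del0, Dop_id_eq, Dop_mulI_eq]

theorem flatDbar_eq {r : ℕ} (g : CV n → (Fin r → ℂ) ⊗[ℝ] Lam n) (y : CV n) :
    flatDbar g y = dbar0 g y := by
  rw [dbar0_eq_sum]
  rfl

theorem Dop_congr {K : CV n →ₗ[ℝ] CV n} {g g' : CV n → W ⊗[ℝ] Lam n} {y : CV n}
    (h : g =ᶠ[𝓝 y] g') : Dop K g y = Dop K g' y := by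
  simp only [Dop, dirDeriv_congr h]

theorem dbar0_congr {g g' : CV n → W ⊗[ℝ] Lam n} {y : CV n} (h : g =ᶠ[𝓝 y] g') :
    dbar0 g y = dbar0 g' y := by
  simp only [dbar0, Dop_congr h]

theorem del0_congr {g g' : CV n → W ⊗[ℝ] Lam n} {y : CV n} (h : g =ᶠ[𝓝 y] g') :
    del0 g y = del0 g' y := by
  simp only [del0, Dop_congr h]

theorem SmoothAt.Dop {K : CV n →ₗ[ℝ] CV n} {g : CV n → W ⊗[ℝ] Lam n} {y : CV n}
    (hg : SmoothAt g y) : SmoothAt (THodge.Dop K g) y :=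
  SmoothAt.sum fun _ _ => (hg.dirDeriv _).linear ((wedge _).restrictScalars ℝ)

omit [Module.Finite ℝ W] in
theorem SmoothAt.csmul {g : CV n → W ⊗[ℝ] Lam n} {y : CV n}
    (hg : SmoothAt g y) (c : ℂ) : SmoothAt (fun z => c • g z) y :=
  hg.linear ((LinearMap.lsmul ℂ (W ⊗[ℝ] Lam n) c).restrictScalars ℝ)

theorem SmoothAt.dbar0 {g : CV n → W ⊗[ℝ] Lam n} {y : CV n}
    (hg : SmoothAt g y) : SmoothAt (THodge.dbar0 g) y :=
  (hg.Dop.add (hg.Dop.csmul I)).csmul _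

theorem SmoothAt.del0 {g : CV n → W ⊗[ℝ] Lam n} {y : CV n}
    (hg : SmoothAt g y) : SmoothAt (THodge.del0 g) y :=
  (hg.Dop.sub (hg.Dop.csmul I)).csmul _

theorem dirDeriv_csmul {g : CV n → W ⊗[ℝ] Lam n} {y : CV n} (hg : SmoothAt g y) (c : ℂ)
    (v : CV n) : dirDeriv (fun z => c • g z) y v = c • dirDeriv g y v :=
  dirDeriv_linear hg ((LinearMap.lsmul ℂ (W ⊗[ℝ] Lam n) c).restrictScalars ℝ) v

theorem Dop_add {K : CV n →ₗ[ℝ] CV n} {g g' : CV n → W ⊗[ℝ] Lam n} {y : CV n}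
    (hg : SmoothAt g y) (hg' : SmoothAt g' y) :
    Dop K (fun z => g z + g' z) y = Dop K g y + Dop K g' y := by
  simp only [Dop, dirDeriv_add hg hg', map_add, Finset.sum_add_distrib]

theorem Dop_csmul {K : CV n →ₗ[ℝ] CV n} {g : CV n → W ⊗[ℝ] Lam n} {y : CV n}
    (hg : SmoothAt g y) (c : ℂ) : Dop K (fun z => c • g z) y = c • Dop K g y := by
  simp only [Dop, dirDeriv_csmul hg, map_smul, Finset.smul_sum]

theorem dbar0_add {g g' : CV n → W ⊗[ℝ] Lam n} {y : CV n} (hg : SmoothAt g y)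
    (hg' : SmoothAt g' y) : dbar0 (fun z => g z + g' z) y = dbar0 g y + dbar0 g' y := by
  simp only [dbar0, Dop_add hg hg']
  module

theorem del0_add {g g' : CV n → W ⊗[ℝ] Lam n} {y : CV n} (hg : SmoothAt g y)
    (hg' : SmoothAt g' y) : del0 (fun z => g z + g' z) y = del0 g y + del0 g' y := by
  simp only [del0, Dop_add hg hg']
  module

theorem dbar0_csmul {g : CV n → W ⊗[ℝ] Lam n} {y : CV n} (hg : SmoothAt g y) (c : ℂ) :
    dbar0 (fun z => c • g z) y = c • dbar0 g y := by
  simp only [dbar0, Dop_csmul hg]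
  module

theorem del0_csmul {g : CV n → W ⊗[ℝ] Lam n} {y : CV n} (hg : SmoothAt g y) (c : ℂ) :
    del0 (fun z => c • g z) y = c • del0 g y := by
  simp only [del0, Dop_csmul hg]
  module

/-- Leibniz rule for a gauge transformation. -/
theorem Dop_gauge {K : CV n →ₗ[ℝ] CV n} {G : CV n → W →ₗ[ℂ] W'} {g : CV n → W ⊗[ℝ] Lam n}
    {y : CV n} (hG : ∀ s, SmoothAt (fun z => G z s) y) (hg : SmoothAt g y) :
    Dop K (fun z => tm (G z) LinearMap.id (g z)) y =
      Dop K (fun z => tm (G z) LinearMap.id (g y)) y + tm (G y) LinearMap.id (Dop K g y) := by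
  have hG' : ∀ w : W ⊗[ℝ] Lam n, SmoothAt (fun z => tm (G z) LinearMap.id w) y := by
    intro w
    induction w using TensorProduct.induction_on with
    | zero => simpa only [map_zero] using smoothAt_const _ _
    | tmul s a => exact (hG s).linear ((TensorProduct.mk ℝ W' (Lam n)).flip a)
    | add u v hu hv => simpa only [map_add] using hu.add hv
  simp only [Dop, map_sum, ← Finset.sum_add_distrib]
  refine Finset.sum_congr rfl fun a _ => ?_
  have := dirDeriv_family (Φ := fun z => (tm (G z) LinearMap.id).restrictScalars ℝ) hG' hg
    (K (fr a))
  simp only [LinearMap.coe_restrictScalars] at this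
  rw [this, map_add, tm_id_wedge]

omit [Module.Finite ℝ W'] in
theorem smoothAt_gauge {G : CV n → W →ₗ[ℂ] W'} {g : CV n → W ⊗[ℝ] Lam n}
    {y : CV n} (hG : ∀ s, SmoothAt (fun z => G z s) y) (hg : SmoothAt g y) :
    SmoothAt (fun z => tm (G z) LinearMap.id (g z)) y := by
  have hG' : ∀ w : W ⊗[ℝ] Lam n, SmoothAt (fun z => tm (G z) LinearMap.id w) y := by
    intro w
    induction w using TensorProduct.induction_on with
    | zero => simpa only [map_zero] using smoothAt_const _ _
    | tmul s a => exact (hG s).linear ((TensorProduct.mk ℝ W' (Lam n)).flip a)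
    | add u v hu hv => simpa only [map_add] using hu.add hv
  exact SmoothAt.family (Φ := fun z => (tm (G z) LinearMap.id).restrictScalars ℝ) hG' hg

theorem Dop_mulI_gauge_const {G : CV n → W →ₗ[ℂ] W'} {y : CV n} {c : ℂ}
    (hG : ∀ s, SmoothAt (fun z => G z s) y)
    (hc : ∀ s v, dirDeriv (fun z => G z s) y (I • v) = c • dirDeriv (fun z => G z s) y v)
    (w : W ⊗[ℝ] Lam n) :
    Dop (mulI n) (fun z => tm (G z) LinearMap.id w) y =
      c • Dop LinearMap.id (fun z => tm (G z) LinearMap.id w) y := by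
  induction w using TensorProduct.induction_on with
  | zero => simp only [map_zero, Dop, dirDeriv_const, Finset.sum_const_zero, smul_zero]
  | tmul s a =>
    simp only [Dop, Finset.smul_sum, ← map_smul]
    refine Finset.sum_congr rfl fun b _ => ?_
    congr 1
    have h := fun v => dirDeriv_linear (hG s) ((TensorProduct.mk ℝ W' (Lam n)).flip a) v
    simp only [LinearMap.flip_apply, TensorProduct.mk_apply] at h
    simp only [tm_tmul, LinearMap.id_apply]
    rw [h, h, mulI_apply, hc]
    rfl
  | add u v hu hv =>
    have h1 := fun u => smoothAt_gauge (g := fun _ => u) hG (smoothAt_const (n := n) u y)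
    simp only [map_add]
    rw [Dop_add (h1 u) (h1 v), Dop_add (h1 u) (h1 v), hu, hv, smul_add]

/-- For a holomorphic family `G` the operator with `K = i` equals `i` times the one with `K = 1`.
Since `1 + i · i = 0`, the terms in which `G` is differentiated cancel in `∂̄`. -/
theorem dbar0_gauge {G : CV n → W →ₗ[ℂ] W'} {g : CV n → W ⊗[ℝ] Lam n}
    {y : CV n} (hG : ∀ s, SmoothAt (fun z => G z s) y)
    (hol : ∀ s v, dirDeriv (fun z => G z s) y (I • v) = I • dirDeriv (fun z => G z s) y v)
    (hg : SmoothAt g y) :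
    dbar0 (fun z => tm (G z) LinearMap.id (g z)) y = tm (G y) LinearMap.id (dbar0 g y) := by
  simp only [dbar0, Dop_gauge hG hg, Dop_mulI_gauge_const hG hol, map_smul, map_add, smul_add,
    smul_smul, I_mul_I]
  module

/-- The conjugate cancellation: antiholomorphic families have factor `-i`, and `1 - i · (-i) = 0`.
-/
theorem del0_gauge {G : CV n → W →ₗ[ℂ] W'} {g : CV n → W ⊗[ℝ] Lam n}
    {y : CV n} (hG : ∀ s, SmoothAt (fun z => G z s) y)
    (hol : ∀ s v, dirDeriv (fun z => G z s) y (I • v) = (-I) • dirDeriv (fun z => G z s) y v)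
    (hg : SmoothAt g y) :
    del0 (fun z => tm (G z) LinearMap.id (g z)) y = tm (G y) LinearMap.id (del0 g y) := by
  simp only [del0, Dop_gauge hG hg, Dop_mulI_gauge_const hG hol, map_smul, map_sub, smul_add,
    smul_smul, mul_neg, I_mul_I, smul_sub]
  module

/-- Leibniz rule for multiplication by an even real form. -/
theorem Dop_wedge {K : CV n →ₗ[ℝ] CV n} {a : CV n → Lam n} {g : CV n → W ⊗[ℝ] Lam n}
    {y : CV n} (ha : SmoothAt a y) (hg : SmoothAt g y) (hc : ∀ x, a y * x = x * a y) :
    Dop K (fun z => wedge (a z) (g z)) y = wedge (DopR K a y) (g y) + wedge (a y) (Dop K g y) := by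
  simp only [Dop, DopR, map_sum, wedge_sum, ← Finset.sum_add_distrib]
  refine Finset.sum_congr rfl fun b _ => ?_
  have := dirDeriv_bilin (wedgeL (W := W)) ha hg (K (fr b))
  simp only [wedgeL_apply] at this
  rw [this, map_add, wedge_wedge, wedge_wedge, wedge_wedge, hc]

theorem smoothAt_wedge {a : CV n → Lam n} {g : CV n → W ⊗[ℝ] Lam n}
    {y : CV n} (ha : SmoothAt a y) (hg : SmoothAt g y) :
    SmoothAt (fun z => wedge (a z) (g z)) y :=
  SmoothAt.bilin (wedgeL (W := W)) ha hg

/-- The Weil operator turns the covector `e^a` into `e^a ∘ i`. By the trace identity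
`sum_cofr_comp`, this `i` can be moved from the covector to the vector along which one
differentiates. -/
theorem weilW_Dop {K : CV n →ₗ[ℝ] CV n} {g : CV n → W ⊗[ℝ] Lam n}
    {y : CV n} (hg : SmoothAt g y) :
    weilW n W (Dop K g y) = Dop (K ∘ₗ mulI n) (fun z => weilW n W (g z)) y := by
  simp only [Dop, map_sum]
  have h1 : ∀ v, dirDeriv (fun z => weilW n W (g z)) y v = weilW n W (dirDeriv g y v) :=
    fun v => dirDeriv_linear hg ((weilW n W).restrictScalars ℝ) v
  have h2 : ∀ a u, weilW n W (wedge (ExteriorAlgebra.ι ℝ a) u) =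
      wedge (ExteriorAlgebra.ι ℝ (a ∘ₗ mulI n)) (weilW n W u) := fun a u => by
    rw [weilW, tm_wedge, weilLam_eq, pb_ι]
  simp only [h1, h2]
  let B : Module.Dual ℝ (CV n) →ₗ[ℝ] CV n →ₗ[ℝ] W ⊗[ℝ] Lam n :=
    (wedgeL ∘ₗ ExteriorAlgebra.ι ℝ).compl₂
      ((weilW n W).restrictScalars ℝ ∘ₗ dirDerivL g y ∘ₗ K)
  exact (sum_cofr_comp B (mulI n)).symm

theorem weilLam_DopR {K : CV n →ₗ[ℝ] CV n} {g : CV n → Lam n}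
    {y : CV n} (hg : SmoothAt g y) :
    weilLam n (DopR K g y) = DopR (K ∘ₗ mulI n) (fun z => weilLam n (g z)) y := by
  simp only [DopR, map_sum]
  have h1 : ∀ v, dirDeriv (fun z => weilLam n (g z)) y v = weilLam n (dirDeriv g y v) :=
    fun v => dirDeriv_linear hg (weilLam n).toLinearMap v
  have h2 : ∀ a u, weilLam n (ExteriorAlgebra.ι ℝ a * u) =
      ExteriorAlgebra.ι ℝ (a ∘ₗ mulI n) * (weilLam n u) := fun a u => by
    rw [map_mul, weilLam_eq, pb_ι]
  simp only [h1, h2]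
  let B : Module.Dual ℝ (CV n) →ₗ[ℝ] CV n →ₗ[ℝ] Lam n :=
    (LinearMap.mul ℝ (Lam n) ∘ₗ ExteriorAlgebra.ι ℝ).compl₂
      ((weilLam n).toLinearMap ∘ₗ dirDerivL g y ∘ₗ K)
  exact (sum_cofr_comp B (mulI n)).symm

/-- The previous rule exchanges the two summands of `∂` up to sign, because `K = i` becomes `K =
-1`. The factor `i` reflects that `J` multiplies `(1,0)`-covectors by `i`. -/
theorem weilW_del0 {g : CV n → W ⊗[ℝ] Lam n} {y : CV n} (hg : SmoothAt g y) :
    weilW n W (del0 g y) = I • del0 (fun z => weilW n W (g z)) y := by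
  have h : Dop (mulI n ∘ₗ mulI n) (fun z => weilW n W (g z)) y =
      -Dop LinearMap.id (fun z => weilW n W (g z)) y := by
    simp only [Dop, LinearMap.comp_apply, mulI_mulI, dirDeriv_neg_right, map_neg,
      Finset.sum_neg_distrib, LinearMap.id_apply]
  simp only [del0, map_smul, map_sub, weilW_Dop hg, h, LinearMap.id_comp, smul_sub, smul_smul]
  rw [I_mul_half_mul_I]
  module

end Flat

end THodge
end

noncomputable section

namespace THodge

/-! ### Pull back along holomorphic maps -/

section HolomorphicPullBack

variable {n : ℕ} {W W' : Type*} [AddCommGroup W] [Module ℂ W] [Module.Finite ℝ W]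

theorem smoothAt_mul {a b : CV n → Lam n} {y : CV n} (ha : SmoothAt a y) (hb : SmoothAt b y) :
    SmoothAt (fun z => a z * b z) y :=
  SmoothAt.bilin (LinearMap.mul ℝ (Lam n)) ha hb

theorem dirDeriv_mul {a b : CV n → Lam n} {y : CV n} (ha : SmoothAt a y) (hb : SmoothAt b y)
    (v : CV n) : dirDeriv (fun z => a z * b z) y v = dirDeriv a y v * b y + a y * dirDeriv b y v :=
  dirDeriv_bilin (LinearMap.mul ℝ (Lam n)) ha hb v

theorem covector_expand (A : CV n →ₗ[ℝ] CV n) (l : Module.Dual ℝ (CV n)) :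
    l ∘ₗ A = ∑ b, l (A (fr b)) • cofr b := (sum_apply_fr_smul_cofr (l ∘ₗ A)).symm

theorem contDiffAt_apply_fderiv {φ : CV n → CV n} {y : CV n} (hφ : ContDiffAt ℝ ∞ φ y)
    (l : Module.Dual ℝ (CV n)) (w : CV n) : ContDiffAt ℝ ∞ (fun z => l (fderiv ℝ φ z w)) y :=
  (LinearMap.toContinuousLinearMap l).contDiff.contDiffAt.comp y
    ((hφ.fderiv_right (m := ∞) (by simp)).clm_apply contDiffAt_const)

theorem fderiv_apply_fderiv {φ : CV n → CV n} {y : CV n} (hφ : ContDiffAt ℝ ∞ φ y)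
    (l : Module.Dual ℝ (CV n)) (v w : CV n) :
    fderiv ℝ (fun z => l (fderiv ℝ φ z w)) y v = l (fderiv ℝ (fderiv ℝ φ) y v w) := by
  have hd : DifferentiableAt ℝ (fderiv ℝ φ) y :=
    (hφ.fderiv_right (m := ∞) (by simp)).differentiableAt (by simp)
  have h := (ContinuousLinearMap.apply ℝ (CV n) w).hasFDerivAt.comp y hd.hasFDerivAt
  have h2 := (LinearMap.toContinuousLinearMap l).hasFDerivAt.comp y h
  exact congrArg (fun T => T v) h2.fderiv

theorem smoothAt_pb_ι {φ : CV n → CV n} {y : CV n} (hφ : ContDiffAt ℝ ∞ φ y)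
    (l : Module.Dual ℝ (CV n)) :
    SmoothAt (fun z => pb (fderiv ℝ φ z : CV n →ₗ[ℝ] CV n) (ExteriorAlgebra.ι ℝ l)) y := by
  simp only [pb_ι, covector_expand, map_sum, map_smul]
  exact SmoothAt.sum fun b _ => SmoothAt.smul (contDiffAt_apply_fderiv hφ l _) (smoothAt_const _ _)

theorem smoothAt_pb {φ : CV n → CV n} {y : CV n} (hφ : ContDiffAt ℝ ∞ φ y) (x : Lam n) :
    SmoothAt (fun z => pb (fderiv ℝ φ z : CV n →ₗ[ℝ] CV n) x) y := by
  induction x using ExteriorAlgebra.induction with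
  | algebraMap r => simpa only [AlgHom.commutes] using smoothAt_const _ _
  | ι l => exact smoothAt_pb_ι hφ l
  | mul a b ha hb => simpa only [map_mul] using smoothAt_mul ha hb
  | add a b ha hb => simpa only [map_add] using ha.add hb

/-- Exchanging the summation indices changes the sign of the wedge product but not the coefficient,
so the sum equals its own negative. It is applied to second derivatives. -/
theorem sum_symm_wedge (S : Fin n × Fin 2 → Fin n × Fin 2 → ℝ) (hS : ∀ a b, S a b = S b a) :
    ∑ a, ∑ b, S a b • (ExteriorAlgebra.ι ℝ (cofr (n := n) a) * ExteriorAlgebra.ι ℝ (cofr b)) =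
      0 := by
  set X := ∑ a, ∑ b,
    S a b • (ExteriorAlgebra.ι ℝ (cofr (n := n) a) * ExteriorAlgebra.ι ℝ (cofr b))
  have h : X = -X := by
    conv_lhs => rw [show X = _ from Finset.sum_comm]
    rw [← Finset.sum_neg_distrib]
    refine Finset.sum_congr rfl fun a _ => ?_
    rw [← Finset.sum_neg_distrib]
    refine Finset.sum_congr rfl fun b _ => ?_
    rw [hS, ← smul_neg]
    congr 1
    rw [eq_neg_iff_add_eq_zero, ExteriorAlgebra.ι_add_mul_swap]
  have h2 : (2 : ℝ) • X = 0 := by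
    rw [two_smul]
    nth_rewrite 1 [h]
    exact neg_add_cancel X
  exact (smul_eq_zero.1 h2).resolve_left two_ne_zero

/-- The pull back along `φ` of a form with constant coefficients is closed. -/
theorem DopR_pb_const {K : CV n →ₗ[ℝ] CV n} {φ : CV n → CV n} {y : CV n}
    (hφ : ContDiffAt ℝ ∞ φ y)
    (hK : ∀ᶠ z in 𝓝 y, ∀ v, fderiv ℝ φ z (K v) = K (fderiv ℝ φ z v)) (x : Lam n) :
    DopR K (fun z => pb (fderiv ℝ φ z : CV n →ₗ[ℝ] CV n) x) y = 0 := by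
  induction x using ExteriorAlgebra.induction with
  | algebraMap r => simp only [AlgHom.commutes, DopR, dirDeriv_const, mul_zero,
      Finset.sum_const_zero]
  | ι l =>
    have hsym : ∀ v w, fderiv ℝ (fderiv ℝ φ) y v w = fderiv ℝ (fderiv ℝ φ) y w v := fun v w =>
      hφ.isSymmSndFDerivAt (by simpa using WithTop.coe_le_coe.2 (le_top : (2 : ℕ∞) ≤ ⊤)) v w
    have hd : DifferentiableAt ℝ (fderiv ℝ φ) y :=
      (hφ.fderiv_right (m := ∞) (by simp)).differentiableAt (by simp)
    -- Differentiating the `K`-linearity of `dφ`, valid in a neighbourhood of `y`, shows that the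
    -- second derivative is `K`-linear in its second argument.
    have hKK : ∀ v w, fderiv ℝ (fderiv ℝ φ) y v (K w) = K (fderiv ℝ (fderiv ℝ φ) y v w) := by
      intro v w
      have h1 := (ContinuousLinearMap.apply ℝ (CV n) (K w)).hasFDerivAt.comp y hd.hasFDerivAt
      have h2 : HasFDerivAt (fun z => K (fderiv ℝ φ z w)) _ y :=
        (LinearMap.toContinuousLinearMap K).hasFDerivAt.comp y
          ((ContinuousLinearMap.apply ℝ (CV n) w).hasFDerivAt.comp y hd.hasFDerivAt)
      have h3 := h1.congr_of_eventuallyEq (f₁ := fun z => K (fderiv ℝ φ z w))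
        (hK.mono fun z hz => (hz w).symm)
      exact congrArg (fun T => T v) (h3.unique h2)
    have hdir : ∀ v, dirDeriv (fun z => pb (fderiv ℝ φ z : CV n →ₗ[ℝ] CV n)
        (ExteriorAlgebra.ι ℝ l)) y v =
        ∑ b, l (fderiv ℝ (fderiv ℝ φ) y v (fr b)) • ExteriorAlgebra.ι ℝ (cofr b) := by
      intro v
      simp only [pb_ι, covector_expand, map_sum, map_smul]
      simp only [ContinuousLinearMap.coe_coe]
      rw [dirDeriv_sum fun b _ => SmoothAt.smul (contDiffAt_apply_fderiv hφ l (fr b))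
        (smoothAt_const (ExteriorAlgebra.ι ℝ (cofr b)) _)]
      refine Finset.sum_congr rfl fun b _ => ?_
      rw [dirDeriv_smul (contDiffAt_apply_fderiv hφ l _) (smoothAt_const _ _), dirDeriv_const,
        smul_zero, add_zero]
      congr 1
      exact fderiv_apply_fderiv hφ l v (fr b)
    simp only [DopR, hdir, Finset.mul_sum, mul_smul_comm]
    refine sum_symm_wedge (fun a b => l (fderiv ℝ (fderiv ℝ φ) y (K (fr a)) (fr b))) ?_
    intro a b
    -- Symmetry and `K`-linearity in one argument give `K`-linearity in both, so `K` can be moved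
    -- from the first slot to the second; the coefficients are therefore symmetric.
    rw [hsym, hKK, hsym, ← hKK, hsym]
  | mul a b ha hb =>
    simp only [map_mul, DopR] at ha hb ⊢
    -- The operator is an antiderivation: the covector passes the first factor at the cost of its
    -- parity.
    have h : ∀ (l : Module.Dual ℝ (CV n)) (A A' B B' : Lam n),
        ExteriorAlgebra.ι ℝ l * (A' * B + A * B') =
          (ExteriorAlgebra.ι ℝ l * A') * B + par n A * (ExteriorAlgebra.ι ℝ l * B') := by
      intro l A A' B B'
      rw [mul_add, ← mul_assoc, ← mul_assoc, ι_mul_eq l A, mul_assoc (par n A)]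
    simp_rw [dirDeriv_mul (smoothAt_pb hφ a) (smoothAt_pb hφ b), h]
    rw [Finset.sum_add_distrib, ← Finset.sum_mul, ha, ← Finset.mul_sum, hb, zero_mul, mul_zero,
      add_zero]
  | add a b ha hb =>
    simp only [map_add, DopR] at ha hb ⊢
    simp_rw [dirDeriv_add (smoothAt_pb hφ a) (smoothAt_pb hφ b), mul_add]
    rw [Finset.sum_add_distrib, ha, hb, add_zero]

theorem smoothAt_tm_pb {φ : CV n → CV n} {g : CV n → W ⊗[ℝ] Lam n} {y : CV n}
    (hφ : ContDiffAt ℝ ∞ φ y) (hg : SmoothAt g y) :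
    SmoothAt (fun z => tm (LinearMap.id : W →ₗ[ℂ] W)
      (pb (fderiv ℝ φ z : CV n →ₗ[ℝ] CV n)).toLinearMap (g z)) y := by
  refine SmoothAt.family (Φ := fun z => (tm (LinearMap.id : W →ₗ[ℂ] W)
      (pb (fderiv ℝ φ z : CV n →ₗ[ℝ] CV n)).toLinearMap).restrictScalars ℝ) (fun w => ?_) hg
  simp only [LinearMap.coe_restrictScalars]
  induction w using TensorProduct.induction_on with
  | zero => simpa only [map_zero] using smoothAt_const _ _
  | tmul s a => exact (smoothAt_pb hφ a).linear (TensorProduct.mk ℝ W (Lam n) s)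
  | add u v hu hv => simpa only [map_add] using hu.add hv

theorem Dop_tm_pb_const {K : CV n →ₗ[ℝ] CV n} {φ : CV n → CV n} {y : CV n}
    (hφ : ContDiffAt ℝ ∞ φ y)
    (hK : ∀ᶠ z in 𝓝 y, ∀ v, fderiv ℝ φ z (K v) = K (fderiv ℝ φ z v)) (w : W ⊗[ℝ] Lam n) :
    Dop K (fun z => tm (LinearMap.id : W →ₗ[ℂ] W)
      (pb (fderiv ℝ φ z : CV n →ₗ[ℝ] CV n)).toLinearMap w) y = 0 := by
  induction w using TensorProduct.induction_on with
  | zero => simp only [map_zero, Dop, dirDeriv_const, Finset.sum_const_zero]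
  | tmul s a =>
    have h := fun v => dirDeriv_linear (smoothAt_pb hφ a) (TensorProduct.mk ℝ W (Lam n) s) v
    simp only [TensorProduct.mk_apply] at h
    simp only [Dop, tm_tmul, LinearMap.id_apply, AlgHom.toLinearMap_apply, h, wedge_tmul,
      ← TensorProduct.tmul_sum]
    have h2 := DopR_pb_const hφ hK a
    rw [DopR] at h2
    rw [h2, TensorProduct.tmul_zero]
  | add u v hu hv =>
    have h1 := fun u : W ⊗[ℝ] Lam n =>
      smoothAt_tm_pb (g := fun _ => u) hφ (smoothAt_const (n := n) u y)
    simp only [map_add]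
    rw [Dop_add (h1 u) (h1 v), hu, hv, add_zero]

/-- `∑ e^a ∧ ∂_{K e_a}` commutes with the pull back along maps with `K`-linear differential. -/
theorem Dop_pullback {K : CV n →ₗ[ℝ] CV n} {φ : CV n → CV n} {g : CV n → W ⊗[ℝ] Lam n} {y : CV n}
    (hφ : ContDiffAt ℝ ∞ φ y)
    (hK : ∀ᶠ z in 𝓝 y, ∀ v, fderiv ℝ φ z (K v) = K (fderiv ℝ φ z v)) (hg : SmoothAt g (φ y)) :
    Dop K (fun z => tm (LinearMap.id : W →ₗ[ℂ] W)
      (pb (fderiv ℝ φ z : CV n →ₗ[ℝ] CV n)).toLinearMap (g (φ z))) y =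
    tm (LinearMap.id : W →ₗ[ℂ] W)
      (pb (fderiv ℝ φ y : CV n →ₗ[ℝ] CV n)).toLinearMap (Dop K g (φ y)) := by
  have hs := fun w : W ⊗[ℝ] Lam n =>
    smoothAt_tm_pb (g := fun _ => w) hφ (smoothAt_const (n := n) w y)
  have h1 := fun v => dirDeriv_family (Φ := fun z => (tm (LinearMap.id : W →ₗ[ℂ] W)
    (pb (fderiv ℝ φ z : CV n →ₗ[ℝ] CV n)).toLinearMap).restrictScalars ℝ) hs (hg.comp hφ) v
  simp only [LinearMap.coe_restrictScalars] at h1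
  -- The term with frozen argument is the operator applied to the pull back of a constant form,
  -- which vanishes. Only the derivative of `g` remains, and the trace identity rewrites it as a
  -- pull back.
  have h2 := Dop_tm_pb_const hφ hK (g (φ y))
  simp only [Dop] at h2 ⊢
  simp only [h1, map_add, Finset.sum_add_distrib]
  rw [h2, zero_add, map_sum]
  simp only [tm_wedge, dirDeriv_comp hg hφ, hK.self_of_nhds, pb_ι]
  let B : Module.Dual ℝ (CV n) →ₗ[ℝ] CV n →ₗ[ℝ] W ⊗[ℝ] Lam n :=
    (wedgeL ∘ₗ ExteriorAlgebra.ι ℝ).compl₂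
      ((tm (LinearMap.id : W →ₗ[ℂ] W)
        (pb (fderiv ℝ φ y : CV n →ₗ[ℝ] CV n)).toLinearMap).restrictScalars ℝ ∘ₗ
          dirDerivL g (φ y) ∘ₗ K)
  exact sum_cofr_comp B (fderiv ℝ φ y : CV n →ₗ[ℝ] CV n)

/-- `φ` is smooth near `y` with complex linear differential. -/
structure HolAt (φ : CV n → CV n) (y : CV n) : Prop where
  smooth : ContDiffAt ℝ ∞ φ y
  linear : ∀ᶠ z in 𝓝 y, ∀ v, fderiv ℝ φ z (I • v) = I • fderiv ℝ φ z v

theorem dbar0_pullback {φ : CV n → CV n} {g : CV n → W ⊗[ℝ] Lam n} {y : CV n}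
    (hφ : HolAt φ y) (hg : SmoothAt g (φ y)) :
    dbar0 (fun z => tm (LinearMap.id : W →ₗ[ℂ] W)
      (pb (fderiv ℝ φ z : CV n →ₗ[ℝ] CV n)).toLinearMap (g (φ z))) y =
    tm (LinearMap.id : W →ₗ[ℂ] W)
      (pb (fderiv ℝ φ y : CV n →ₗ[ℝ] CV n)).toLinearMap (dbar0 g (φ y)) := by
  rw [dbar0, dbar0, Dop_pullback hφ.smooth (by simp) hg, Dop_pullback hφ.smooth hφ.linear hg]
  simp only [map_smul, map_add]

theorem del0_pullback {φ : CV n → CV n} {g : CV n → W ⊗[ℝ] Lam n} {y : CV n}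
    (hφ : HolAt φ y) (hg : SmoothAt g (φ y)) :
    del0 (fun z => tm (LinearMap.id : W →ₗ[ℂ] W)
      (pb (fderiv ℝ φ z : CV n →ₗ[ℝ] CV n)).toLinearMap (g (φ z))) y =
    tm (LinearMap.id : W →ₗ[ℂ] W)
      (pb (fderiv ℝ φ y : CV n →ₗ[ℝ] CV n)).toLinearMap (del0 g (φ y)) := by
  rw [del0, del0, Dop_pullback hφ.smooth (by simp) hg, Dop_pullback hφ.smooth hφ.linear hg]
  simp only [map_smul, map_sub]

end HolomorphicPullBack

end THodge
end

noncomputable section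

namespace THodge

/-! ### The Chern connection in a frame -/

section Chern

variable {n r : ℕ}

theorem smoothAt_vecMul {H : CV n → Matrix (Fin r) (Fin r) ℂ} {y : CV n}
    (hH : ∀ a b, ContDiffAt ℝ ∞ (fun z => H z a b) y) (s : Fin r → ℂ) :
    SmoothAt (fun z => Matrix.vecMulLinear (H z) s) y := by
  rw [smoothAt_iff_contDiffAt, contDiffAt_pi]
  intro b
  simp only [Matrix.vecMulLinear_apply, Matrix.vecMul, dotProduct]
  exact ContDiffAt.sum fun a _ => contDiffAt_const.mul (hH a b)

theorem dirDeriv_vecMul {H : CV n → Matrix (Fin r) (Fin r) ℂ} {y : CV n}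
    (hH : ∀ a b, ContDiffAt ℝ ∞ (fun z => H z a b) y) (s : Fin r → ℂ) (v : CV n) :
    dirDeriv (fun z => Matrix.vecMulLinear (H z) s) y v =
      Matrix.vecMulLinear (Matrix.of fun a b => fderiv ℝ (fun z => H z a b) y v) s := by
  have hs := smoothAt_vecMul hH s
  rw [dirDeriv_eq_fderiv hs]
  funext b
  have hd : ∀ c, DifferentiableAt ℝ (fun z => Matrix.vecMulLinear (H z) s c) y := fun c =>
    (contDiffAt_pi.1 (smoothAt_iff_contDiffAt.1 hs) c).differentiableAt (by simp)
  rw [fderiv_pi hd]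
  simp only [ContinuousLinearMap.coe_pi', Matrix.vecMulLinear_apply, Matrix.vecMul, dotProduct,
    Matrix.of_apply]
  have hd' : ∀ a ∈ Finset.univ, DifferentiableAt ℝ (fun z => s a * H z a b) y := fun a _ =>
    ((hH a b).differentiableAt (by simp)).const_mul _
  rw [fderiv_fun_sum hd', _root_.sum_apply]
  refine Finset.sum_congr rfl fun a _ => ?_
  rw [fderiv_const_mul ((hH a b).differentiableAt (by simp))]
  rfl

theorem vecMulLinear_comp (A B : Matrix (Fin r) (Fin r) ℂ) :
    Matrix.vecMulLinear B ∘ₗ Matrix.vecMulLinear A = Matrix.vecMulLinear (A * B) := by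
  refine LinearMap.ext fun x => ?_
  exact Matrix.vecMul_vecMul x A B

/-- The right action of a matrix on vector valued forms. -/
abbrev rmul (A : Matrix (Fin r) (Fin r) ℂ) :
    (Fin r → ℂ) ⊗[ℝ] Lam n →ₗ[ℂ] (Fin r → ℂ) ⊗[ℝ] Lam n :=
  tm (Matrix.vecMulLinear A) LinearMap.id

theorem rmul_rmul (A B : Matrix (Fin r) (Fin r) ℂ) (u : (Fin r → ℂ) ⊗[ℝ] Lam n) :
    rmul B (rmul A u) = rmul (A * B) u := by
  rw [rmul, rmul, tm_tm, vecMulLinear_comp]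
  rfl

theorem rmul_one (u : (Fin r → ℂ) ⊗[ℝ] Lam n) : rmul 1 u = u := by
  have : Matrix.vecMulLinear (1 : Matrix (Fin r) (Fin r) ℂ) = LinearMap.id := by
    refine LinearMap.ext fun x => ?_
    simp
  rw [rmul, this, tm_id]

/-- Coefficient vectors are rows, and matrices act on them from the right. Differentiating `w H`
with `w` constant and multiplying by `H⁻¹` gives `w (∂_j H) H⁻¹`, in the order used by
`chernMatrix`. -/
theorem rmul_chern {H : CV n → Matrix (Fin r) (Fin r) ℂ} {y : CV n}
    (hH : ∀ a b, ContDiffAt ℝ ∞ (fun z => H z a b) y) (w : (Fin r → ℂ) ⊗[ℝ] Lam n) (j : Fin n) :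
    rmul (H y)⁻¹ ((1 / 2 : ℂ) • (dirDeriv (fun z => rmul (H z) w) y (ex j) -
      I • dirDeriv (fun z => rmul (H z) w) y (ey j))) = rmul (chernMatrix H y j) w := by
  induction w using TensorProduct.induction_on with
  | zero => simp only [map_zero, dirDeriv_const, smul_zero, sub_zero]
  | tmul s a =>
    have h : ∀ v, dirDeriv (fun z => Matrix.vecMulLinear (H z) s ⊗ₜ[ℝ] a) y v =
        dirDeriv (fun z => Matrix.vecMulLinear (H z) s) y v ⊗ₜ[ℝ] a := fun v =>
      dirDeriv_linear (smoothAt_vecMul hH s)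
        ((TensorProduct.mk ℝ (Fin r → ℂ) (Lam n)).flip a) v
    have h2 : ∀ z, rmul (H z) (s ⊗ₜ a) = Matrix.vecMulLinear (H z) s ⊗ₜ a := fun z => rfl
    simp only [h2, h, dirDeriv_vecMul hH, chernMatrix]
    rw [TensorProduct.smul_tmul', ← TensorProduct.sub_tmul, TensorProduct.smul_tmul',
      ← rmul_rmul]
    congr 1
    simp only [rmul, tm_tmul, LinearMap.id_apply]
    congr 1
    ext b
    simp only [Matrix.vecMulLinear_apply, Matrix.vecMul, dotProduct, Matrix.of_apply,
      Pi.smul_apply, Pi.sub_apply, smul_eq_mul, Finset.mul_sum, ← Finset.sum_sub_distrib]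
    refine Finset.sum_congr rfl fun a _ => ?_
    ring
  | add u v hu hv =>
    have h1 := fun u : (Fin r → ℂ) ⊗[ℝ] Lam n =>
      smoothAt_gauge (g := fun _ => u) (smoothAt_vecMul hH) (smoothAt_const (n := n) u y)
    have h2 := fun d => dirDeriv_add (h1 u) (h1 v) d
    simp only [map_add, rmul] at hu hv h2 ⊢
    rw [h2, h2, ← hu, ← hv, ← map_add]
    congr 1
    module

/-- The `(1,0)`-part of the Chern connection is gauge equivalent to `∂`. -/
theorem flatDel_eq {H : CV n → Matrix (Fin r) (Fin r) ℂ} {g : CV n → (Fin r → ℂ) ⊗[ℝ] Lam n}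
    {y : CV n} (hH : ∀ a b, ContDiffAt ℝ ∞ (fun z => H z a b) y) (hdet : IsUnit (H y).det)
    (hg : SmoothAt g y) :
    flatDel H g y = rmul (H y)⁻¹ (del0 (fun z => rmul (H z) (g z)) y) := by
  have h1 : ∀ j (u : (Fin r → ℂ) ⊗[ℝ] Lam n), rmul (H y)⁻¹ (wedgeDz j u) =
      wedgeDz j (rmul (H y)⁻¹ u) := by
    intro j u
    simp only [wedgeDz, map_add, map_smul, rmul, tm_id_wedge]
  have h2 : del0 (fun z => rmul (H z) (g z)) y = del0 (fun z => rmul (H z) (g y)) y +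
      rmul (H y) (del0 g y) := by
    simp only [del0, Dop_gauge (smoothAt_vecMul hH) hg, map_smul, map_sub, smul_add, rmul]
    module
  rw [h2, map_add, rmul_rmul, Matrix.mul_nonsing_inv _ hdet, rmul_one, del0_eq_sum, map_sum,
    del0_eq_sum, ← Finset.sum_add_distrib, flatDel]
  refine Finset.sum_congr rfl fun j _ => ?_
  rw [h1, rmul_chern hH, add_comm]
  simp only [wedgeDz, map_add, smul_add, partialZ]
  abel

end Chern

/-! ### The standard sesquilinear pairing -/

section Pairing

variable {n r : ℕ}

/-- The pairing `∑ u_a ∧ conj v_a`. -/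
def stdPair (n r : ℕ) :
    (Fin r → ℂ) ⊗[ℝ] Lam n →ₗ[ℝ] (Fin r → ℂ) ⊗[ℝ] Lam n →ₗ[ℝ] ℂ ⊗[ℝ] Lam n :=
  TensorProduct.map₂
    (LinearMap.mk₂ ℝ (fun s t : Fin r → ℂ => ∑ a, s a * (starRingEnd ℂ) (t a))
      (by intros; simp [add_mul, Finset.sum_add_distrib])
      (by intros; simp [Finset.mul_sum, mul_assoc])
      (by intros; simp [mul_add, Finset.sum_add_distrib])
      (by intros; simp [Finset.mul_sum, mul_left_comm]))
    (LinearMap.mul ℝ (Lam n))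

theorem stdPair_tmul (s t : Fin r → ℂ) (a b : Lam n) :
    stdPair n r (s ⊗ₜ a) (t ⊗ₜ b) = (∑ i, s i * (starRingEnd ℂ) (t i)) ⊗ₜ[ℝ] (a * b) := rfl

theorem tensor_induction₂ {W₁ W₂ : Type*} [AddCommGroup W₁] [Module ℂ W₁]
    [AddCommGroup W₂] [Module ℂ W₂] {p : W₁ ⊗[ℝ] Lam n → W₂ ⊗[ℝ] Lam n → Prop}
    (h : ∀ s a t b, p (s ⊗ₜ a) (t ⊗ₜ b)) (h0 : ∀ v, p 0 v) (h0' : ∀ u, p u 0)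
    (hl : ∀ u u' v, p u v → p u' v → p (u + u') v)
    (hr : ∀ u v v', p u v → p u v' → p u (v + v')) (u : W₁ ⊗[ℝ] Lam n) (v : W₂ ⊗[ℝ] Lam n) :
    p u v := by
  induction u using TensorProduct.induction_on with
  | zero => exact h0 v
  | tmul s a =>
    induction v using TensorProduct.induction_on with
    | zero => exact h0' _
    | tmul t b => exact h s a t b
    | add v v' hv hv' => exact hr _ _ _ hv hv'
  | add u u' hu hu' => exact hl _ _ _ hu hu'

theorem stdPair_csmul_left (c : ℂ) (u v : (Fin r → ℂ) ⊗[ℝ] Lam n) :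
    stdPair n r (c • u) v = c • stdPair n r u v := by
  refine tensor_induction₂ (p := fun u v => stdPair n r (c • u) v = c • stdPair n r u v)
    ?_ ?_ ?_ ?_ ?_ u v
  · intro s a t b
    rw [TensorProduct.smul_tmul', stdPair_tmul, stdPair_tmul, TensorProduct.smul_tmul']
    simp [Finset.mul_sum, mul_assoc]
  · intro v; simp
  · intro u; simp
  · intro u u' v h h'; simp only [smul_add, map_add, LinearMap.add_apply, h, h']
  · intro u v v' h h'; simp only [smul_add, map_add, h, h']

theorem stdPair_csmul_right (c : ℂ) (u v : (Fin r → ℂ) ⊗[ℝ] Lam n) :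
    stdPair n r u (c • v) = (starRingEnd ℂ) c • stdPair n r u v := by
  refine tensor_induction₂ (p := fun u v => stdPair n r u (c • v) =
    (starRingEnd ℂ) c • stdPair n r u v) ?_ ?_ ?_ ?_ ?_ u v
  · intro s a t b
    rw [TensorProduct.smul_tmul', stdPair_tmul, stdPair_tmul, TensorProduct.smul_tmul']
    simp [Finset.mul_sum, mul_left_comm]
  · intro v; simp
  · intro u; simp
  · intro u u' v h h'; simp only [smul_add, map_add, LinearMap.add_apply, h, h']
  · intro u v v' h h'; simp only [smul_add, map_add, h, h']

theorem stdPair_wedge_left (x : Lam n) (u v : (Fin r → ℂ) ⊗[ℝ] Lam n) :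
    stdPair n r (wedge x u) v = wedge x (stdPair n r u v) := by
  refine tensor_induction₂ (p := fun u v => stdPair n r (wedge x u) v =
    wedge x (stdPair n r u v)) ?_ ?_ ?_ ?_ ?_ u v
  · intro s a t b
    rw [wedge_tmul, stdPair_tmul, stdPair_tmul, wedge_tmul, mul_assoc]
  · intro v; simp
  · intro u; simp
  · intro u u' v h h'; simp only [map_add, LinearMap.add_apply, h, h']
  · intro u v v' h h'; simp only [map_add, h, h']

theorem stdPair_par_wedge (l : Module.Dual ℝ (CV n)) (u v : (Fin r → ℂ) ⊗[ℝ] Lam n) :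
    stdPair n r (parW n _ u) (wedge (ExteriorAlgebra.ι ℝ l) v) =
      wedge (ExteriorAlgebra.ι ℝ l) (stdPair n r u v) := by
  refine tensor_induction₂ (p := fun u v => stdPair n r (parW n _ u)
    (wedge (ExteriorAlgebra.ι ℝ l) v) = wedge (ExteriorAlgebra.ι ℝ l) (stdPair n r u v))
    ?_ ?_ ?_ ?_ ?_ u v
  · intro s a t b
    rw [wedge_tmul, parW, tm_tmul, stdPair_tmul, stdPair_tmul, wedge_tmul,
      AlgHom.toLinearMap_apply, ← mul_assoc, ← ι_mul_eq, mul_assoc]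
    rfl
  · intro v; simp
  · intro u; simp
  · intro u u' v h h'; simp only [map_add, LinearMap.add_apply, h, h']
  · intro u v v' h h'; simp only [map_add, h, h']

theorem smoothAt_stdPair {g g' : CV n → (Fin r → ℂ) ⊗[ℝ] Lam n} {y : CV n}
    (hg : SmoothAt g y) (hg' : SmoothAt g' y) :
    SmoothAt (fun z => stdPair n r (g z) (g' z)) y :=
  SmoothAt.bilin (stdPair n r) hg hg'

/-- Leibniz rule for the sesquilinear pairing. -/
theorem dbar0_stdPair {g g' : CV n → (Fin r → ℂ) ⊗[ℝ] Lam n} {y : CV n}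
    (hg : SmoothAt g y) (hg' : SmoothAt g' y) :
    dbar0 (fun z => stdPair n r (g z) (g' z)) y =
      stdPair n r (dbar0 g y) (g' y) + stdPair n r (parW n _ (g y)) (del0 g' y) := by
  have h1 : ∀ K : CV n →ₗ[ℝ] CV n, Dop K (fun z => stdPair n r (g z) (g' z)) y =
      stdPair n r (Dop K g y) (g' y) + stdPair n r (parW n _ (g y)) (Dop K g' y) := by
    intro K
    simp only [Dop, map_sum, LinearMap.sum_apply, ← Finset.sum_add_distrib, stdPair_par_wedge,
      stdPair_wedge_left, dirDeriv_bilin (stdPair n r) hg hg', map_add]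
  simp only [dbar0, del0, h1, stdPair_csmul_left, stdPair_csmul_right, map_add, map_sub,
    LinearMap.add_apply, map_ofNat, map_div₀, map_one, conj_I]
  module

end Pairing

/-! ### The top degree coefficient -/

section Top

variable {n : ℕ}

/-- The top coefficient as a complex linear map. -/
def topC (n : ℕ) : ℂ ⊗[ℝ] Lam n →ₗ[ℂ] ℂ where
  toFun := topCoeff n
  map_add' u v := by simp only [topCoeff, map_add]
  map_smul' c u := by
    induction u using TensorProduct.induction_on with
    | zero => simp [topCoeff]
    | tmul s a =>
      simp only [topCoeff, TensorProduct.smul_tmul', LinearMap.lTensor_tmul,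
        TensorProduct.rid_tmul, RingHom.id_apply, smul_eq_mul, mul_smul_comm]
    | add u v hu hv =>
      simp only [topCoeff, map_add, smul_add] at hu hv ⊢
      rw [hu, hv]

theorem topC_tmul (s : ℂ) (a : Lam n) :
    topC n (s ⊗ₜ a) = evalForm (realFrame n) a * s := by
  change topCoeff n (s ⊗ₜ[ℝ] a) = _
  simp [topCoeff, TensorProduct.rid_tmul]

/-- Integration by parts against the constant function `1`. -/
theorem integral_fderiv_eq_zero {f : CV n → ℂ} (hf : ContDiff ℝ ∞ f) (hc : HasCompactSupport f)
    (v : CV n) : ∫ y, fderiv ℝ f y v = 0 := by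
  have h1 : Continuous fun y => fderiv ℝ f y v :=
    (hf.continuous_fderiv (by simp)).clm_apply continuous_const
  have h2 : Integrable fun y => fderiv ℝ f y v :=
    h1.integrable_of_hasCompactSupport (hc.fderiv_apply (𝕜 := ℝ) v)
  have := integral_smul_fderiv_eq_neg_fderiv_smul_of_integrable (𝕜 := ℝ) (μ := volume)
    (f := fun _ : CV n => (1 : ℝ)) (g := f) (v := v) (by simp) (by simpa using h2)
    (by simpa using hf.continuous.integrable_of_hasCompactSupport hc)
    (fun x _ => differentiableAt_const _) (fun x _ => hf.differentiable (by simp) x)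
  simpa using this

/-- Stokes' theorem for `∂̄` on `ℂⁿ`. -/
theorem integral_topC_dbar0 {g : CV n → ℂ ⊗[ℝ] Lam n} (hg : ∀ y, SmoothAt g y)
    {K : Set (CV n)} (hK : IsCompact K) (h0 : ∀ y ∉ K, g y = 0) :
    ∫ y, topC n (dbar0 g y) = 0 := by
  have key : ∀ (a : Module.Dual ℝ (CV n)) (v : CV n),
      Integrable (fun y => topC n (wedge (ExteriorAlgebra.ι ℝ a) (dirDeriv g y v))) ∧
      ∫ y, topC n (wedge (ExteriorAlgebra.ι ℝ a) (dirDeriv g y v)) = 0 := by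
    intro a v
    let A : ℂ ⊗[ℝ] Lam n →ₗ[ℝ] ℂ := (topC n ∘ₗ wedge (ExteriorAlgebra.ι ℝ a)).restrictScalars ℝ
    have hA : ∀ y, SmoothAt (fun z => A (g z)) y := fun y => (hg y).linear A
    have hf : ContDiff ℝ ∞ fun z => A (g z) :=
      contDiff_iff_contDiffAt.2 fun y => smoothAt_iff_contDiffAt.1 (hA y)
    have hc : HasCompactSupport fun z => A (g z) :=
      HasCompactSupport.intro hK fun y hy => by rw [h0 y hy, map_zero]
    have e : (fun y => topC n (wedge (ExteriorAlgebra.ι ℝ a) (dirDeriv g y v))) =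
        fun y => fderiv ℝ (fun z => A (g z)) y v := by
      funext y
      rw [← dirDeriv_eq_fderiv (hA y), dirDeriv_linear (hg y)]
      rfl
    rw [e]
    refine ⟨?_, integral_fderiv_eq_zero hf hc v⟩
    exact ((hf.continuous_fderiv (by simp)).clm_apply
      continuous_const).integrable_of_hasCompactSupport (hc.fderiv_apply (𝕜 := ℝ) v)
  have hD : ∀ K : CV n →ₗ[ℝ] CV n, Integrable (fun y => topC n (Dop K g y)) ∧
      ∫ y, topC n (Dop K g y) = 0 := by
    intro K
    simp only [Dop, map_sum]
    refine ⟨integrable_finsetSum _ fun a _ => (key _ _).1, ?_⟩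
    rw [integral_finsetSum _ fun a _ => (key _ _).1]
    exact Finset.sum_eq_zero fun a _ => (key _ _).2
  simp only [dbar0, map_smul, map_add, smul_eq_mul]
  rw [integral_const_mul, integral_add (hD _).1 ((hD _).1.const_mul I), integral_const_mul,
    (hD _).2, (hD _).2]
  simp

end Top

end THodge
end

noncomputable section

namespace THodge

/-! ### Charts and holomorphic coordinate changes -/

section Coordinates

variable {n : ℕ} {X : Type*} [TopologicalSpace X] [ChartedSpace (CV n) X]

theorem ContDiffAt.real_of_complex {F : Type*} [NormedAddCommGroup F] [NormedSpace ℂ F]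
    {f : CV n → F} {y : CV n} (hf : ContDiffAt ℂ ω f y) :
    ContDiffAt ℝ ∞ f y ∧
      ∀ᶠ z in 𝓝 y, ∀ v, fderiv ℝ f z (I • v) = I • fderiv ℝ f z v := by
  refine ⟨(hf.restrict_scalars ℝ).of_le le_top, ?_⟩
  filter_upwards [hf.eventually (by simp)] with z hz v
  have hd : DifferentiableAt ℂ f z := hz.differentiableAt (by simp)
  rw [hd.fderiv_restrictScalars ℝ]
  simp

/-- The coordinate change from the preferred chart at `x₀` to the preferred chart at `x₁`. -/
def trans (n : ℕ) {X : Type*} [TopologicalSpace X] [ChartedSpace (CV n) X] (x₀ x₁ : X)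
    (y : CV n) : CV n :=
  chartAt (CV n) x₁ ((chartAt (CV n) x₀).symm y)

/-- The differential of a coordinate change. -/
def dtrans (n : ℕ) {X : Type*} [TopologicalSpace X] [ChartedSpace (CV n) X] (x₀ x₁ : X)
    (y : CV n) : CV n →ₗ[ℝ] CV n :=
  (fderiv ℝ (trans n x₀ x₁) y : CV n →ₗ[ℝ] CV n)

theorem pullLam_eq (x₀ : X) (y : CV n) :
    pullLam x₀ y = pb (dtrans n x₀ ((chartAt (CV n) x₀).symm y) y) := rfl

theorem symm_trans {x₀ x₁ : X} {y : CV n}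
    (h : (chartAt (CV n) x₀).symm y ∈ (chartAt (CV n) x₁).source) :
    (chartAt (CV n) x₁).symm (trans n x₀ x₁ y) = (chartAt (CV n) x₀).symm y :=
  (chartAt (CV n) x₁).left_inv h

theorem trans_mem_target {x₀ x₁ : X} {y : CV n}
    (h : (chartAt (CV n) x₀).symm y ∈ (chartAt (CV n) x₁).source) :
    trans n x₀ x₁ y ∈ (chartAt (CV n) x₁).target :=
  (chartAt (CV n) x₁).map_source h

theorem isOpen_overlap (x₀ x₁ : X) :
    IsOpen {y | y ∈ (chartAt (CV n) x₀).target ∧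
      (chartAt (CV n) x₀).symm y ∈ (chartAt (CV n) x₁).source} :=
  (chartAt (CV n) x₀).isOpen_inter_preimage_symm (chartAt (CV n) x₁).open_source

variable [IsManifold 𝓘(ℂ, CV n) ω X]

theorem contDiffAt_trans {x₀ x₁ : X} {y : CV n} (hy : y ∈ (chartAt (CV n) x₀).target)
    (h : (chartAt (CV n) x₀).symm y ∈ (chartAt (CV n) x₁).source) :
    ContDiffAt ℂ ω (trans n x₀ x₁) y := by
  have h1 : ContMDiffAt 𝓘(ℂ, CV n) 𝓘(ℂ, CV n) ω (chartAt (CV n) x₀).symm y :=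
    (contMDiffOn_chart_symm (x := x₀)).contMDiffAt ((chartAt (CV n) x₀).open_target.mem_nhds hy)
  have h2 : ContMDiffAt 𝓘(ℂ, CV n) 𝓘(ℂ, CV n) ω (chartAt (CV n) x₁)
      ((chartAt (CV n) x₀).symm y) :=
    (contMDiffOn_chart (x := x₁)).contMDiffAt ((chartAt (CV n) x₁).open_source.mem_nhds h)
  exact (h2.comp y h1).contDiffAt

theorem holAt_trans {x₀ x₁ : X} {y : CV n} (hy : y ∈ (chartAt (CV n) x₀).target)
    (h : (chartAt (CV n) x₀).symm y ∈ (chartAt (CV n) x₁).source) :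
    HolAt (trans n x₀ x₁) y :=
  ⟨(ContDiffAt.real_of_complex (contDiffAt_trans hy h)).1,
    (ContDiffAt.real_of_complex (contDiffAt_trans hy h)).2⟩

theorem dtrans_I {x₀ x₁ : X} {y : CV n} (hy : y ∈ (chartAt (CV n) x₀).target)
    (h : (chartAt (CV n) x₀).symm y ∈ (chartAt (CV n) x₁).source) :
    dtrans n x₀ x₁ y ∘ₗ mulI n = mulI n ∘ₗ dtrans n x₀ x₁ y :=
  LinearMap.ext fun v => (holAt_trans hy h).linear.self_of_nhds v

omit [IsManifold 𝓘(ℂ, CV n) ω X] in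
theorem eventually_overlap {x₀ x₁ : X} {y : CV n} (hy : y ∈ (chartAt (CV n) x₀).target)
    (h : (chartAt (CV n) x₀).symm y ∈ (chartAt (CV n) x₁).source) :
    ∀ᶠ z in 𝓝 y, z ∈ (chartAt (CV n) x₀).target ∧
      (chartAt (CV n) x₀).symm z ∈ (chartAt (CV n) x₁).source :=
  (isOpen_overlap x₀ x₁).mem_nhds ⟨hy, h⟩

theorem dtrans_comp {x₀ x₁ x₂ : X} {y : CV n} (hy : y ∈ (chartAt (CV n) x₀).target)
    (h1 : (chartAt (CV n) x₀).symm y ∈ (chartAt (CV n) x₁).source)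
    (h2 : (chartAt (CV n) x₀).symm y ∈ (chartAt (CV n) x₂).source) :
    dtrans n x₀ x₂ y = dtrans n x₁ x₂ (trans n x₀ x₁ y) ∘ₗ dtrans n x₀ x₁ y := by
  have e : trans n x₀ x₂ =ᶠ[𝓝 y] fun z => trans n x₁ x₂ (trans n x₀ x₁ z) := by
    filter_upwards [eventually_overlap hy h1] with z hz
    rw [trans, trans, symm_trans hz.2]
  have d1 := (holAt_trans hy h1).smooth.differentiableAt (by simp)
  have d2 : DifferentiableAt ℝ (trans n x₁ x₂) (trans n x₀ x₁ y) :=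
    (holAt_trans (trans_mem_target h1) (by rwa [symm_trans h1])).smooth.differentiableAt (by simp)
  have := (d2.hasFDerivAt.comp y d1.hasFDerivAt).fderiv
  rw [dtrans, e.fderiv_eq, dtrans, dtrans]
  exact congrArg (fun T : CV n →L[ℝ] CV n => (T : CV n →ₗ[ℝ] CV n)) this

omit [IsManifold 𝓘(ℂ, CV n) ω X] in
theorem dtrans_self {x₀ : X} {y : CV n} (hy : y ∈ (chartAt (CV n) x₀).target) :
    dtrans n x₀ x₀ y = LinearMap.id := by
  have e : trans n x₀ x₀ =ᶠ[𝓝 y] id := by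
    filter_upwards [(chartAt (CV n) x₀).open_target.mem_nhds hy] with z hz
    exact (chartAt (CV n) x₀).right_inv hz
  rw [dtrans, e.fderiv_eq, fderiv_id]
  rfl

theorem pullLam_trans {x₀ x₁ : X} {y : CV n} (hy : y ∈ (chartAt (CV n) x₀).target)
    (h : (chartAt (CV n) x₀).symm y ∈ (chartAt (CV n) x₁).source) (a : Lam n) :
    pullLam x₀ y a = pb (dtrans n x₀ x₁ y) (pullLam x₁ (trans n x₀ x₁ y) a) := by
  rw [pullLam_eq, pullLam_eq, symm_trans h, pb_comp,
    ← dtrans_comp hy h (mem_chart_source (CV n) _)]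

omit [IsManifold 𝓘(ℂ, CV n) ω X] in
theorem pullLam_chart (x : X) (a : Lam n) :
    pullLam x (chartAt (CV n) x x) a = a := by
  rw [pullLam_eq, (chartAt (CV n) x).left_inv (mem_chart_source (CV n) x),
    dtrans_self (mem_chart_target (CV n) x), pb_id]

theorem pullLam_weil {x₀ : X} {y : CV n} (hy : y ∈ (chartAt (CV n) x₀).target) (a : Lam n) :
    pullLam x₀ y (weilLam n a) = weilLam n (pullLam x₀ y a) := by
  rw [pullLam_eq, weilLam_eq, pb_comp, pb_comp, dtrans_I hy (mem_chart_source (CV n) _)]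

omit [IsManifold 𝓘(ℂ, CV n) ω X] in
theorem localReal_chart (a : X → Lam n) (x : X) : localReal a x (chartAt (CV n) x x) = a x := by
  rw [localReal, pullLam_chart, (chartAt (CV n) x).left_inv (mem_chart_source (CV n) x)]

omit [IsManifold 𝓘(ℂ, CV n) ω X] in
theorem localReal_mul (a b : X → Lam n) (x₀ : X) (y : CV n) :
    localReal (fun x => a x * b x) x₀ y = localReal a x₀ y * localReal b x₀ y := by
  simp only [localReal, map_mul]

omit [IsManifold 𝓘(ℂ, CV n) ω X] in
theorem IsSmoothReal.mul {a b : X → Lam n} (ha : IsSmoothReal a) (hb : IsSmoothReal b) :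
    IsSmoothReal fun x => a x * b x := fun x₀ =>
  (smoothAt_mul (ha x₀) (hb x₀)).congr
    (Filter.Eventually.of_forall fun y => localReal_mul a b x₀ y)

omit [IsManifold 𝓘(ℂ, CV n) ω X] in
theorem isSmoothReal_one : IsSmoothReal fun _ : X => (1 : Lam n) := fun x₀ => by
  have : localReal (fun _ : X => (1 : Lam n)) x₀ = fun _ => 1 := by
    funext y
    rw [localReal, map_one]
  rw [this]
  exact smoothAt_const _ _

end Coordinates

/-! ### Bundle valued forms in charts and frames -/

section BundleCoordinates

variable {n r : ℕ} {X : Type*} [TopologicalSpace X] [ChartedSpace (CV n) X]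
  [IsManifold 𝓘(ℂ, CV n) ω X]
  {E : X → Type*} [∀ x, AddCommGroup (E x)] [∀ x, Module ℂ (E x)]
  [TopologicalSpace (Bundle.TotalSpace (Fin r → ℂ) E)] [∀ x, TopologicalSpace (E x)]
  [FiberBundle (Fin r → ℂ) E] [VectorBundle ℂ (Fin r → ℂ) E]

variable (n r E) in
/-- The coordinates of the points where both the chart and the frame at `x₀` are defined. -/
def dom (x₀ : X) : Set (CV n) :=
  {y | y ∈ (chartAt (CV n) x₀).target ∧
    (chartAt (CV n) x₀).symm y ∈ (trivializationAt (Fin r → ℂ) E x₀).baseSet}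

omit [IsManifold 𝓘(ℂ, CV n) ω X] [∀ x, Module ℂ (E x)] [VectorBundle ℂ (Fin r → ℂ) E]
  [∀ x, AddCommGroup (E x)] in
theorem isOpen_dom (x₀ : X) : IsOpen (dom n r E x₀) :=
  (chartAt (CV n) x₀).isOpen_inter_preimage_symm (trivializationAt (Fin r → ℂ) E x₀).open_baseSet

omit [IsManifold 𝓘(ℂ, CV n) ω X] [∀ x, Module ℂ (E x)] [VectorBundle ℂ (Fin r → ℂ) E]
  [∀ x, AddCommGroup (E x)] in
theorem chart_mem_dom (x₀ : X) : chartAt (CV n) x₀ x₀ ∈ dom n r E x₀ := by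
  refine ⟨mem_chart_target (CV n) x₀, ?_⟩
  rw [(chartAt (CV n) x₀).left_inv (mem_chart_source (CV n) x₀)]
  exact FiberBundle.mem_baseSet_trivializationAt' x₀

variable (r) in
/-- The change of frame from the frame at `x₁` to the frame at `x₀`, over the point `p`. -/
def fch (E : X → Type*) [∀ x, AddCommGroup (E x)] [∀ x, Module ℂ (E x)]
    [TopologicalSpace (Bundle.TotalSpace (Fin r → ℂ) E)] [∀ x, TopologicalSpace (E x)]
    [FiberBundle (Fin r → ℂ) E] [VectorBundle ℂ (Fin r → ℂ) E] (x₀ x₁ p : X) :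
    (Fin r → ℂ) →ₗ[ℂ] (Fin r → ℂ) :=
  (trivializationAt (Fin r → ℂ) E x₀).linearMapAt ℂ p ∘ₗ
    (trivializationAt (Fin r → ℂ) E x₁).symmₗ ℂ p

variable (r) in
/-- The map from the fibre over `p` to its expression in the chart and frame at `x₀`. -/
def repAt (x₀ : X) (y : CV n) (p : X) : E p ⊗[ℝ] Lam n →ₗ[ℂ] (Fin r → ℂ) ⊗[ℝ] Lam n :=
  tm ((trivializationAt (Fin r → ℂ) E x₀).linearMapAt ℂ p) (pullLam x₀ y).toLinearMap

omit [IsManifold 𝓘(ℂ, CV n) ω X] in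
theorem localRep_eq_of_eq {x₀ p : X} {y : CV n} (h : (chartAt (CV n) x₀).symm y = p)
    (u : Forms n E) : localRep r u x₀ y = repAt r x₀ y p (u p) := by
  subst h
  rfl

theorem localRep_trans {x₀ x₁ : X} {y : CV n} (hy : y ∈ (chartAt (CV n) x₀).target)
    (h : (chartAt (CV n) x₀).symm y ∈ (chartAt (CV n) x₁).source)
    (h' : (chartAt (CV n) x₀).symm y ∈ (trivializationAt (Fin r → ℂ) E x₁).baseSet)
    (u : Forms n E) :
    localRep r u x₀ y = tm (fch r E x₀ x₁ ((chartAt (CV n) x₀).symm y)) LinearMap.id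
      (tm LinearMap.id (pb (dtrans n x₀ x₁ y)).toLinearMap
        (localRep r u x₁ (trans n x₀ x₁ y))) := by
  rw [localRep_eq_of_eq rfl, localRep_eq_of_eq (symm_trans h), repAt, repAt, tm_tm, tm_tm]
  congr 2
  · refine LinearMap.ext fun s => ?_
    simp only [LinearMap.comp_apply, fch, LinearMap.id_apply]
    rw [Bundle.Trivialization.symmₗ_linearMapAt _ h']
  · exact LinearMap.ext fun a => pullLam_trans hy h a

end BundleCoordinates

end THodge
end

noncomputable section

namespace THodge

/-! ### Coordinate invariance of `∂̄` and `∂^E` -/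

section Invariance

variable {n r : ℕ} {X : Type*} [TopologicalSpace X] [ChartedSpace (CV n) X]
  [IsManifold 𝓘(ℂ, CV n) ω X]
  {E : X → Type*} [∀ x, AddCommGroup (E x)] [∀ x, Module ℂ (E x)]
  [TopologicalSpace (Bundle.TotalSpace (Fin r → ℂ) E)] [∀ x, TopologicalSpace (E x)]
  [FiberBundle (Fin r → ℂ) E] [VectorBundle ℂ (Fin r → ℂ) E]
  [ContMDiffVectorBundle ω (Fin r → ℂ) E 𝓘(ℂ, CV n)]

/-- The overlap of the domains at `x₀` and `x₁`, in the coordinates at `x₀`. -/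
structure Overlap (r : ℕ) (E : X → Type*) [TopologicalSpace (Bundle.TotalSpace (Fin r → ℂ) E)]
    [∀ x, TopologicalSpace (E x)] [FiberBundle (Fin r → ℂ) E] (x₀ x₁ : X) (y : CV n) : Prop where
  tgt : y ∈ (chartAt (CV n) x₀).target
  base : (chartAt (CV n) x₀).symm y ∈ (trivializationAt (Fin r → ℂ) E x₀).baseSet
  src : (chartAt (CV n) x₀).symm y ∈ (chartAt (CV n) x₁).source
  base' : (chartAt (CV n) x₀).symm y ∈ (trivializationAt (Fin r → ℂ) E x₁).baseSet

omit [IsManifold 𝓘(ℂ, CV n) ω X] [∀ x, AddCommGroup (E x)] [∀ x, Module ℂ (E x)]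
  [VectorBundle ℂ (Fin r → ℂ) E] [ContMDiffVectorBundle ω (Fin r → ℂ) E 𝓘(ℂ, CV n)] in
theorem overlap_self {x₀ : X} {y : CV n} (hy : y ∈ dom n r E x₀) :
    Overlap r E x₀ ((chartAt (CV n) x₀).symm y) y :=
  ⟨hy.1, hy.2, mem_chart_source _ _, FiberBundle.mem_baseSet_trivializationAt' _⟩

omit [IsManifold 𝓘(ℂ, CV n) ω X] [∀ x, AddCommGroup (E x)] [∀ x, Module ℂ (E x)]
  [VectorBundle ℂ (Fin r → ℂ) E] [ContMDiffVectorBundle ω (Fin r → ℂ) E 𝓘(ℂ, CV n)] in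
theorem Overlap.eventually {x₀ x₁ : X} {y : CV n} (h : Overlap r E x₀ x₁ y) :
    ∀ᶠ z in 𝓝 y, Overlap r E x₀ x₁ z := by
  have h1 := (isOpen_dom (r := r) (E := E) x₀).mem_nhds ⟨h.tgt, h.base⟩
  have h2 := (isOpen_overlap x₀ x₁).mem_nhds ⟨h.tgt, h.src⟩
  have h3 := ((chartAt (CV n) x₀).isOpen_inter_preimage_symm
    (trivializationAt (Fin r → ℂ) E x₁).open_baseSet).mem_nhds ⟨h.tgt, h.base'⟩
  filter_upwards [h1, h2, h3] with z a b c
  exact ⟨a.1, a.2, b.2, c.2⟩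

omit [IsManifold 𝓘(ℂ, CV n) ω X] [∀ x, AddCommGroup (E x)] [∀ x, Module ℂ (E x)]
  [VectorBundle ℂ (Fin r → ℂ) E] [ContMDiffVectorBundle ω (Fin r → ℂ) E 𝓘(ℂ, CV n)] in
theorem Overlap.trans_mem_dom {x₀ x₁ : X} {y : CV n} (h : Overlap r E x₀ x₁ y) :
    trans n x₀ x₁ y ∈ dom n r E x₁ :=
  ⟨trans_mem_target h.src, by rw [symm_trans h.src]; exact h.base'⟩

/-- The coordinate changes of a holomorphic bundle are analytic over `ℂ`. The statement is made for
two arbitrary frames `a` and `b` in the chart at `x₀`, so that it yields a change of frame and also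
its inverse. -/
theorem contDiffAt_fch {x₀ : X} {y : CV n} (hy : y ∈ (chartAt (CV n) x₀).target)
    (a b : X) (ha : (chartAt (CV n) x₀).symm y ∈ (trivializationAt (Fin r → ℂ) E a).baseSet)
    (hb : (chartAt (CV n) x₀).symm y ∈ (trivializationAt (Fin r → ℂ) E b).baseSet)
    (s : Fin r → ℂ) :
    ContDiffAt ℂ ω (fun z => fch r E b a ((chartAt (CV n) x₀).symm z) s) y := by
  have h1 : ContMDiffAt 𝓘(ℂ, CV n) 𝓘(ℂ, CV n) ω (chartAt (CV n) x₀).symm y :=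
    (contMDiffOn_chart_symm (x := x₀)).contMDiffAt ((chartAt (CV n) x₀).open_target.mem_nhds hy)
  have h2 := (contMDiffAt_coordChangeL (IB := 𝓘(ℂ, CV n)) (n := ω)
    (e := trivializationAt (Fin r → ℂ) E a)
    (e' := trivializationAt (Fin r → ℂ) E b) ha hb).comp y h1
  have h3 := (h2.contDiffAt).clm_apply (contDiffAt_const (c := s))
  refine h3.congr_of_eventuallyEq ?_
  have hU := ((chartAt (CV n) x₀).isOpen_inter_preimage_symm
    ((trivializationAt (Fin r → ℂ) E a).open_baseSet.inter
      (trivializationAt (Fin r → ℂ) E b).open_baseSet)).mem_nhds ⟨hy, ha, hb⟩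
  filter_upwards [hU] with z hz
  have hz1 := hz.2.1
  have hz2 := hz.2.2
  simp only [fch, LinearMap.comp_apply, Function.comp_apply]
  rw [ContinuousLinearEquiv.coe_coe, Bundle.Trivialization.coordChangeL_apply _ _ hz.2,
    Bundle.Trivialization.coe_linearMapAt_of_mem _ hz2, Bundle.Trivialization.symmₗ_apply _ hz1]

theorem smoothAt_fch {x₀ x₁ : X} {y : CV n} (h : Overlap r E x₀ x₁ y) (s : Fin r → ℂ) :
    SmoothAt (fun z => fch r E x₀ x₁ ((chartAt (CV n) x₀).symm z) s) y :=
  smoothAt_iff_contDiffAt.2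
    (ContDiffAt.real_of_complex (contDiffAt_fch h.tgt x₁ x₀ h.base' h.base s)).1

theorem fch_hol {x₀ x₁ : X} {y : CV n} (h : Overlap r E x₀ x₁ y) (s : Fin r → ℂ) (v : CV n) :
    dirDeriv (fun z => fch r E x₀ x₁ ((chartAt (CV n) x₀).symm z) s) y (I • v) =
      I • dirDeriv (fun z => fch r E x₀ x₁ ((chartAt (CV n) x₀).symm z) s) y v := by
  rw [dirDeriv_eq_fderiv (smoothAt_fch h s), dirDeriv_eq_fderiv (smoothAt_fch h s)]
  exact (ContDiffAt.real_of_complex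
    (contDiffAt_fch h.tgt x₁ x₀ h.base' h.base s)).2.self_of_nhds v

/-- Smoothness of a (not necessarily compactly supported) bundle valued form. -/
def IsSmoothForm (r : ℕ) {E : X → Type*} [∀ x, AddCommGroup (E x)] [∀ x, Module ℂ (E x)]
    [TopologicalSpace (Bundle.TotalSpace (Fin r → ℂ) E)] [∀ x, TopologicalSpace (E x)]
    [FiberBundle (Fin r → ℂ) E] [VectorBundle ℂ (Fin r → ℂ) E] (u : Forms n E) : Prop :=
  ∀ x₀ : X, SmoothAt (localRep r u x₀) (chartAt (CV n) x₀ x₀)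

omit [ContMDiffVectorBundle ω (Fin r → ℂ) E 𝓘(ℂ, CV n)] in
theorem localRep_eventually {x₀ x₁ : X} {y : CV n} (h : Overlap r E x₀ x₁ y) (u : Forms n E) :
    localRep r u x₀ =ᶠ[𝓝 y] fun z =>
      tm (fch r E x₀ x₁ ((chartAt (CV n) x₀).symm z)) LinearMap.id
        (tm LinearMap.id (pb (fderiv ℝ (trans n x₀ x₁) z : CV n →ₗ[ℝ] CV n)).toLinearMap
          (localRep r u x₁ (trans n x₀ x₁ z))) := by
  filter_upwards [h.eventually] with z hz
  exact localRep_trans hz.tgt hz.src hz.base' u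

/-- Smoothness is required by definition only at the centre of each preferred chart. The
transformation rule transports it to all other points of the domain. -/
theorem smoothAt_localRep_of {u : Forms n E} {x₀ x₁ : X} {y : CV n} (h : Overlap r E x₀ x₁ y)
    (hu : SmoothAt (localRep r u x₁) (trans n x₀ x₁ y)) : SmoothAt (localRep r u x₀) y := by
  refine SmoothAt.congr ?_ (localRep_eventually h u)
  exact smoothAt_gauge (smoothAt_fch h) (smoothAt_tm_pb (g := fun z => localRep r u x₁ (trans n x₀ x₁ z))
    (holAt_trans h.tgt h.src).smooth (hu.comp (holAt_trans h.tgt h.src).smooth))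

theorem IsSmoothForm.smoothAt {u : Forms n E} (hu : IsSmoothForm r u) {x₀ : X} {y : CV n}
    (hy : y ∈ dom n r E x₀) : SmoothAt (localRep r u x₀) y :=
  smoothAt_localRep_of (overlap_self hy) (hu _)

omit [IsManifold 𝓘(ℂ, CV n) ω X] [ContMDiffVectorBundle ω (Fin r → ℂ) E 𝓘(ℂ, CV n)] in
theorem repAt_fromLocal {x₀ : X} {y : CV n}
    (w : (Fin r → ℂ) ⊗[ℝ] Lam n) :
    repAt r x₀ y ((chartAt (CV n) x₀).symm y)
      (fromLocal (E := E) r ((chartAt (CV n) x₀).symm y) w) =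
    tm (fch r E x₀ ((chartAt (CV n) x₀).symm y) ((chartAt (CV n) x₀).symm y)) LinearMap.id
      (tm LinearMap.id
        (pb (dtrans n x₀ ((chartAt (CV n) x₀).symm y) y)).toLinearMap w) := by
  rw [repAt, fromLocal, tm_tm, tm_tm]
  rfl

/-- The value of `∂̄ u` at a point is computed in the chart and frame preferred at that point.
Passing to those at `x₀` is a holomorphic pull back followed by a holomorphic gauge transformation,
and `dbar0` commutes with both. -/
theorem localRep_dbar {u : Forms n E} (hu : IsSmoothForm r u) {x₀ : X} {y : CV n}
    (hy : y ∈ dom n r E x₀) : localRep r (dbar r u) x₀ y = dbar0 (localRep r u x₀) y := by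
  have h := overlap_self hy
  have hs := holAt_trans h.tgt h.src
  have hu' : SmoothAt (localRep r u _) (trans n x₀ ((chartAt (CV n) x₀).symm y) y) := hu _
  rw [localRep_eq_of_eq rfl, dbar, repAt_fromLocal, dbar0_congr (localRep_eventually h u),
    dbar0_gauge (smoothAt_fch h) (fch_hol h) (smoothAt_tm_pb hs.smooth (hu'.comp hs.smooth)),
    dbar0_pullback hs hu', flatDbar_eq]
  rfl

theorem IsSmoothForm.dbar {u : Forms n E} (hu : IsSmoothForm r u) :
    IsSmoothForm r (THodge.dbar r u) := fun x₀ => by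
  refine SmoothAt.congr (hu x₀).dbar0 ?_
  filter_upwards [(isOpen_dom (r := r) (E := E) x₀).mem_nhds (chart_mem_dom x₀)] with z hz
  exact localRep_dbar hu hz

/-! #### The Gram matrix -/

variable {h : SesqForm E}

omit [IsManifold 𝓘(ℂ, CV n) ω X] [ContMDiffVectorBundle ω (Fin r → ℂ) E 𝓘(ℂ, CV n)] in
theorem metric_symm (x₀ : X) (y : CV n) (v w : Fin r → ℂ) :
    h ((chartAt (CV n) x₀).symm y)
      ((trivializationAt (Fin r → ℂ) E x₀).symmₗ ℂ ((chartAt (CV n) x₀).symm y) v)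
      ((trivializationAt (Fin r → ℂ) E x₀).symmₗ ℂ ((chartAt (CV n) x₀).symm y) w) =
    ∑ b, Matrix.vecMul v (gram n r h x₀ y) b * (starRingEnd ℂ) (w b) := by
  have he : ∀ v : Fin r → ℂ, v = ∑ a, v a • Pi.single a 1 := fun v => by
    funext j
    simp [Finset.sum_apply, Pi.single_apply]
  conv_lhs => rw [he v, he w]
  simp only [map_sum, map_smul, map_smulₛₗ, LinearMap.sum_apply, LinearMap.smul_apply,
    Matrix.vecMul, dotProduct, gram, Matrix.of_apply, smul_eq_mul, Finset.sum_mul]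
  refine Finset.sum_congr rfl fun b _ => ?_
  rw [Finset.mul_sum]
  refine Finset.sum_congr rfl fun a _ => ?_
  ring

variable (r) in
/-- The change of frame conjugate transposed, as a left multiplication. -/
def conjFch (E : X → Type*) [∀ x, AddCommGroup (E x)] [∀ x, Module ℂ (E x)]
    [TopologicalSpace (Bundle.TotalSpace (Fin r → ℂ) E)] [∀ x, TopologicalSpace (E x)]
    [FiberBundle (Fin r → ℂ) E] [VectorBundle ℂ (Fin r → ℂ) E] (x₀ x₁ p : X) :
    (Fin r → ℂ) →ₗ[ℂ] (Fin r → ℂ) :=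
  Matrix.mulVecLin (Matrix.of fun b d =>
    (starRingEnd ℂ) (fch r E x₁ x₀ p (Pi.single b 1) d))

omit [IsManifold 𝓘(ℂ, CV n) ω X] [ContMDiffVectorBundle ω (Fin r → ℂ) E 𝓘(ℂ, CV n)] in
theorem symmₗ_fch {x₀ x₁ p : X} (h1 : p ∈ (trivializationAt (Fin r → ℂ) E x₁).baseSet)
    (v : Fin r → ℂ) :
    (trivializationAt (Fin r → ℂ) E x₁).symmₗ ℂ p (fch r E x₁ x₀ p v) =
      (trivializationAt (Fin r → ℂ) E x₀).symmₗ ℂ p v :=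
  Bundle.Trivialization.symmₗ_linearMapAt _ h1 _

omit [IsManifold 𝓘(ℂ, CV n) ω X] [ContMDiffVectorBundle ω (Fin r → ℂ) E 𝓘(ℂ, CV n)] in
theorem metric_symm' {x₀ p : X} {y : CV n} (e : (chartAt (CV n) x₀).symm y = p)
    (v w : Fin r → ℂ) :
    h p ((trivializationAt (Fin r → ℂ) E x₀).symmₗ ℂ p v)
      ((trivializationAt (Fin r → ℂ) E x₀).symmₗ ℂ p w) =
    ∑ b, Matrix.vecMul v (gram n r h x₀ y) b * (starRingEnd ℂ) (w b) := by
  subst e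
  exact metric_symm x₀ y v w

omit [IsManifold 𝓘(ℂ, CV n) ω X] [ContMDiffVectorBundle ω (Fin r → ℂ) E 𝓘(ℂ, CV n)] in
theorem vecMul_gram (x₀ : X) (y : CV n) (v : Fin r → ℂ) (b : Fin r) :
    Matrix.vecMul v (gram n r h x₀ y) b = h ((chartAt (CV n) x₀).symm y)
      ((trivializationAt (Fin r → ℂ) E x₀).symmₗ ℂ ((chartAt (CV n) x₀).symm y) v)
      ((trivializationAt (Fin r → ℂ) E x₀).symmₗ ℂ ((chartAt (CV n) x₀).symm y)
        (Pi.single b 1)) := by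
  rw [metric_symm, Finset.sum_eq_single b]
  · simp
  · intro c _ hc
    simp [hc]
  · simp

-- Multiplication by the Gram matrix lowers the index of the coefficient vector. The lowered vector
-- changes by the conjugate transpose of the inverse change of frame, and this is antiholomorphic,
-- as `del0_gauge` requires.
omit [IsManifold 𝓘(ℂ, CV n) ω X] [ContMDiffVectorBundle ω (Fin r → ℂ) E 𝓘(ℂ, CV n)] in
theorem gram_fch {x₀ x₁ : X} {y : CV n} (ho : Overlap r E x₀ x₁ y) (v : Fin r → ℂ) :
    Matrix.vecMulLinear (gram n r h x₀ y) (fch r E x₀ x₁ ((chartAt (CV n) x₀).symm y) v) =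
      conjFch r E x₀ x₁ ((chartAt (CV n) x₀).symm y)
        (Matrix.vecMulLinear (gram n r h x₁ (trans n x₀ x₁ y)) v) := by
  funext b
  rw [Matrix.vecMulLinear_apply, vecMul_gram, symmₗ_fch ho.base, ← symmₗ_fch (x₀ := x₀) ho.base',
    metric_symm' (symm_trans ho.src)]
  simp only [conjFch, Matrix.mulVecLin_apply, Matrix.mulVec, dotProduct, Matrix.of_apply,
    Matrix.vecMulLinear_apply, mul_comm]

theorem contDiffAt_conjFch {x₀ x₁ : X} {y : CV n} (ho : Overlap r E x₀ x₁ y) (s : Fin r → ℂ) :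
    ContDiffAt ℝ ∞ (fun z => conjFch r E x₀ x₁ ((chartAt (CV n) x₀).symm z) s) y ∧
    ∀ v, fderiv ℝ (fun z => conjFch r E x₀ x₁ ((chartAt (CV n) x₀).symm z) s) y (I • v) =
      (-I) • fderiv ℝ (fun z => conjFch r E x₀ x₁ ((chartAt (CV n) x₀).symm z) s) y v := by
  have hb : ∀ b d, ContDiffAt ℝ ∞ (fun z => (starRingEnd ℂ)
      (fch r E x₁ x₀ ((chartAt (CV n) x₀).symm z) (Pi.single b 1) d) * s d) y ∧
      ∀ v, fderiv ℝ (fun z => (starRingEnd ℂ)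
        (fch r E x₁ x₀ ((chartAt (CV n) x₀).symm z) (Pi.single b 1) d) * s d) y (I • v) =
        (-I) • fderiv ℝ (fun z => (starRingEnd ℂ)
        (fch r E x₁ x₀ ((chartAt (CV n) x₀).symm z) (Pi.single b 1) d) * s d) y v := by
    intro b d
    have h1 := ContDiffAt.real_of_complex (contDiffAt_pi.1
      (contDiffAt_fch ho.tgt x₀ x₁ ho.base ho.base' (Pi.single b 1)) d)
    have h2 : ContDiffAt ℝ ∞ (fun z => (starRingEnd ℂ)
        (fch r E x₁ x₀ ((chartAt (CV n) x₀).symm z) (Pi.single b 1) d)) y :=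
      Complex.conjCLE.contDiff.contDiffAt.comp y h1.1
    refine ⟨h2.mul contDiffAt_const, fun v => ?_⟩
    have h3 : HasFDerivAt (fun z => (starRingEnd ℂ)
        (fch r E x₁ x₀ ((chartAt (CV n) x₀).symm z) (Pi.single b 1) d))
        ((Complex.conjCLE : ℂ →L[ℝ] ℂ).comp (fderiv ℝ (fun z =>
        fch r E x₁ x₀ ((chartAt (CV n) x₀).symm z) (Pi.single b 1) d) y)) y :=
      (Complex.conjCLE : ℂ →L[ℝ] ℂ).hasFDerivAt.comp y
        ((h1.1.differentiableAt (by simp)).hasFDerivAt)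
    rw [fderiv_mul_const h3.differentiableAt, h3.fderiv]
    simp only [_root_.smul_apply, ContinuousLinearMap.comp_apply,
      h1.2.self_of_nhds v, ContinuousLinearEquiv.coe_coe, conjCLE_apply, smul_eq_mul, map_mul,
      conj_I]
    ring
  have hexp : ∀ b z, conjFch r E x₀ x₁ ((chartAt (CV n) x₀).symm z) s b =
      ∑ d, (starRingEnd ℂ)
        (fch r E x₁ x₀ ((chartAt (CV n) x₀).symm z) (Pi.single b 1) d) * s d := by
    intro b z
    simp only [conjFch, Matrix.mulVecLin_apply, Matrix.mulVec, dotProduct, Matrix.of_apply]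
  have hc : ∀ b, ContDiffAt ℝ ∞
      (fun z => conjFch r E x₀ x₁ ((chartAt (CV n) x₀).symm z) s b) y := by
    intro b
    simp only [hexp]
    exact ContDiffAt.sum fun d _ => (hb b d).1
  refine ⟨contDiffAt_pi.2 hc, fun v => ?_⟩
  rw [fderiv_pi fun b => (hc b).differentiableAt (by simp)]
  funext b
  simp only [ContinuousLinearMap.coe_pi', Pi.smul_apply, hexp]
  rw [fderiv_fun_sum fun d _ => (hb b d).1.differentiableAt (by simp), _root_.sum_apply,
    _root_.sum_apply, Finset.smul_sum]
  exact Finset.sum_congr rfl fun d _ => (hb b d).2 v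

/-- A Hermitian metric is assumed smooth only at the centres of charts. Near `y` the Gram matrix at
`x₀` is expressed through the one preferred at the point with coordinate `y`, by a smooth change of
chart and frame. -/
theorem contDiffAt_gram (hh : IsHermitianMetric n r h) {x₀ : X} {y : CV n}
    (hy : y ∈ dom n r E x₀) (a b : Fin r) :
    ContDiffAt ℝ ∞ (fun z => gram n r h x₀ z a b) y := by
  have ho := overlap_self hy
  set x₁ := (chartAt (CV n) x₀).symm y
  have hf : ∀ a c, ContDiffAt ℝ ∞
      (fun z => fch r E x₁ x₀ ((chartAt (CV n) x₀).symm z) (Pi.single a 1) c) y := fun a c =>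
    (ContDiffAt.real_of_complex (contDiffAt_pi.1
      (contDiffAt_fch ho.tgt x₀ x₁ ho.base ho.base' (Pi.single a 1)) c)).1
  have hg : ∀ c d, ContDiffAt ℝ ∞ (fun z => gram n r h x₁ (trans n x₀ x₁ z) c d) y := fun c d =>
    ContDiffAt.comp (g := fun z => gram n r h x₁ z c d) y (hh.smooth x₁ c d)
      (holAt_trans ho.tgt ho.src).smooth
  have hsum : ContDiffAt ℝ ∞ (fun z => ∑ d, (∑ c,
      fch r E x₁ x₀ ((chartAt (CV n) x₀).symm z) (Pi.single a 1) c *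
        gram n r h x₁ (trans n x₀ x₁ z) c d) *
      (starRingEnd ℂ) (fch r E x₁ x₀ ((chartAt (CV n) x₀).symm z) (Pi.single b 1) d)) y :=
    ContDiffAt.sum fun d _ => (ContDiffAt.sum fun c _ => (hf a c).mul (hg c d)).mul
      (Complex.conjCLE.contDiff.contDiffAt.comp y (hf b d))
  refine hsum.congr_of_eventuallyEq ?_
  filter_upwards [ho.eventually] with z hz
  rw [gram, Matrix.of_apply, ← symmₗ_fch (x₀ := x₀) hz.base',
    ← symmₗ_fch (x₀ := x₀) (v := Pi.single b 1) hz.base', metric_symm' (symm_trans hz.src)]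
  rfl

omit [IsManifold 𝓘(ℂ, CV n) ω X] [ContMDiffVectorBundle ω (Fin r → ℂ) E 𝓘(ℂ, CV n)] in
theorem isUnit_det_gram (hh : IsHermitianMetric n r h) {x₀ : X} {y : CV n}
    (hy : y ∈ dom n r E x₀) : IsUnit (gram n r h x₀ y).det := by
  rw [isUnit_iff_ne_zero]
  intro h0
  obtain ⟨v, hv, hv0⟩ := Matrix.exists_vecMul_eq_zero_iff.2 h0
  have h1 := metric_symm (h := h) x₀ y v v
  rw [hv0] at h1
  set s := (trivializationAt (Fin r → ℂ) E x₀).symmₗ ℂ ((chartAt (CV n) x₀).symm y) v with hs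
  have hne : s ≠ 0 := by
    intro h2
    apply hv
    have := Bundle.Trivialization.linearMapAt_symmₗ (R := ℂ)
      (trivializationAt (Fin r → ℂ) E x₀) hy.2 v
    rw [← this, ← hs, h2, map_zero]
  have := hh.pos _ s hne
  rw [h1] at this
  simp at this

/-- In each frame `∂^E` is `H⁻¹ ∂ H`. The vector `H u` transforms by a holomorphic pull back and an
antiholomorphic matrix, and `∂` commutes with both. The remaining matrices combine to the change of
frame by `gram_fch`. -/
theorem localRep_del (hh : IsHermitianMetric n r h) {u : Forms n E} (hu : IsSmoothForm r u)
    {x₀ : X} {y : CV n} (hy : y ∈ dom n r E x₀) :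
    localRep r (del r h u) x₀ y = flatDel (gram n r h x₀) (localRep r u x₀) y := by
  have ho := overlap_self hy
  set x₁ := (chartAt (CV n) x₀).symm y with hx₁
  have hs := holAt_trans ho.tgt ho.src
  have hy1 : trans n x₀ x₁ y ∈ dom n r E x₁ := ho.trans_mem_dom
  have hH0 := contDiffAt_gram hh hy
  have hH1 := contDiffAt_gram hh hy1
  have hu1 : SmoothAt (localRep r u x₁) (trans n x₀ x₁ y) := hu.smoothAt hy1
  have hR : SmoothAt (fun z => rmul (gram n r h x₁ z) (localRep r u x₁ z)) (trans n x₀ x₁ y) :=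
    smoothAt_gauge (smoothAt_vecMul hH1) hu1
  have key : (fun z => rmul (gram n r h x₀ z) (localRep r u x₀ z)) =ᶠ[𝓝 y] fun z =>
      tm (conjFch r E x₀ x₁ ((chartAt (CV n) x₀).symm z)) LinearMap.id
        (tm LinearMap.id (pb (fderiv ℝ (trans n x₀ x₁) z : CV n →ₗ[ℝ] CV n)).toLinearMap
          (rmul (gram n r h x₁ (trans n x₀ x₁ z)) (localRep r u x₁ (trans n x₀ x₁ z)))) := by
    filter_upwards [ho.eventually] with z hz
    rw [localRep_trans hz.tgt hz.src hz.base' u]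
    simp only [rmul, tm_tm]
    congr 2
    refine LinearMap.ext fun v => ?_
    exact gram_fch hz v
  rw [localRep_eq_of_eq rfl, del, repAt_fromLocal, flatDel_eq hH0 (isUnit_det_gram hh hy)
    (hu.smoothAt hy), del0_congr key, del0_gauge
      (fun s => smoothAt_iff_contDiffAt.2 (contDiffAt_conjFch ho s).1) ?_
      (smoothAt_tm_pb hs.smooth (hR.comp hs.smooth)), del0_pullback hs hR]
  · have e : chartAt (CV n) x₁ x₁ = trans n x₀ x₁ y := rfl
    rw [e, flatDel_eq hH1 (isUnit_det_gram hh hy1) hu1]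
    simp only [rmul, tm_tm, ← hx₁]
    congr 2
    refine LinearMap.ext fun w => ?_
    have h1 := gram_fch (h := h) ho (Matrix.vecMulLinear (gram n r h x₁ (trans n x₀ x₁ y))⁻¹ w)
    have h2 : ∀ (A : Matrix (Fin r) (Fin r) ℂ), IsUnit A.det → ∀ w : Fin r → ℂ,
        Matrix.vecMulLinear A (Matrix.vecMulLinear A⁻¹ w) = w := by
      intro A hA w
      rw [Matrix.vecMulLinear_apply, Matrix.vecMulLinear_apply, Matrix.vecMul_vecMul,
        Matrix.nonsing_inv_mul _ hA, Matrix.vecMul_one]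
    have h3 : ∀ (A : Matrix (Fin r) (Fin r) ℂ), IsUnit A.det → ∀ w : Fin r → ℂ,
        Matrix.vecMulLinear A⁻¹ (Matrix.vecMulLinear A w) = w := by
      intro A hA w
      rw [Matrix.vecMulLinear_apply, Matrix.vecMulLinear_apply, Matrix.vecMul_vecMul,
        Matrix.mul_nonsing_inv _ hA, Matrix.vecMul_one]
    rw [h2 _ (isUnit_det_gram hh hy1)] at h1
    have h4 := congrArg (Matrix.vecMulLinear (gram n r h x₀ y)⁻¹) h1
    rw [h3 _ (isUnit_det_gram hh hy)] at h4
    simpa using h4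
  · intro s v
    have hc := smoothAt_iff_contDiffAt.2 (contDiffAt_conjFch ho s).1
    rw [dirDeriv_eq_fderiv hc, dirDeriv_eq_fderiv hc]
    exact (contDiffAt_conjFch ho s).2 v

end Invariance

end THodge
end

noncomputable section

namespace THodge

/-! ### The grading of the algebra of forms -/

section Grading

variable {n k l : ℕ}

/-- The space of real forms of degree `k`. -/
abbrev LamDeg (n k : ℕ) : Submodule ℝ (Lam n) := ⋀[ℝ]^k (Module.Dual ℝ (CV n))

theorem lamDeg_induction {p : Lam n → Prop} {a : Lam n} (ha : a ∈ LamDeg n k)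
    (hι : ∀ v : Fin k → Module.Dual ℝ (CV n), p (ExteriorAlgebra.ιMulti ℝ k v)) (h0 : p 0)
    (hadd : ∀ a b, p a → p b → p (a + b)) (hsmul : ∀ (c : ℝ) a, p a → p (c • a)) : p a := by
  rw [LamDeg, ← ExteriorAlgebra.ιMulti_span_fixedDegree] at ha
  induction ha using Submodule.span_induction with
  | mem x hx =>
    obtain ⟨v, rfl⟩ := hx
    exact hι v
  | zero => exact h0
  | add x y _ _ hx hy => exact hadd x y hx hy
  | smul c x _ hx => exact hsmul c x hx

theorem ιMulti_mem (v : Fin k → Module.Dual ℝ (CV n)) :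
    ExteriorAlgebra.ιMulti ℝ k v ∈ LamDeg n k := by
  rw [LamDeg, ← ExteriorAlgebra.ιMulti_span_fixedDegree]
  exact Submodule.subset_span ⟨v, rfl⟩

theorem mul_mem_lamDeg {a b : Lam n} (ha : a ∈ LamDeg n k) (hb : b ∈ LamDeg n l) :
    a * b ∈ LamDeg n (k + l) :=
  SetLike.mul_mem_graded (A := fun i : ℕ => ⋀[ℝ]^i (Module.Dual ℝ (CV n))) ha hb

theorem one_mem_lamDeg : (1 : Lam n) ∈ LamDeg n 0 :=
  SetLike.one_mem_graded (fun i : ℕ => ⋀[ℝ]^i (Module.Dual ℝ (CV n)))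

theorem ι_mem_lamDeg (v : Module.Dual ℝ (CV n)) : ExteriorAlgebra.ι ℝ v ∈ LamDeg n 1 := by
  have : ExteriorAlgebra.ι ℝ v = ExteriorAlgebra.ιMulti ℝ 1 fun _ => v := by
    simp [ExteriorAlgebra.ιMulti_apply]
  rw [this]
  exact ιMulti_mem _

theorem pb_ιMulti {m : ℕ} (A : CV m →ₗ[ℝ] CV n) (v : Fin k → Module.Dual ℝ (CV n)) :
    pb A (ExteriorAlgebra.ιMulti ℝ k v) = ExteriorAlgebra.ιMulti ℝ k fun i => v i ∘ₗ A := by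
  rw [pb, ExteriorAlgebra.map_apply_ιMulti]
  rfl

theorem pb_mem {m : ℕ} (A : CV m →ₗ[ℝ] CV n) {a : Lam n} (ha : a ∈ LamDeg n k) :
    pb A a ∈ LamDeg m k := by
  refine lamDeg_induction ha (p := fun a => pb A a ∈ LamDeg m k) ?_ ?_ ?_ ?_
  · intro v
    rw [pb_ιMulti]
    exact ιMulti_mem _
  · simp
  · intro a b ha hb
    rw [map_add]
    exact Submodule.add_mem _ ha hb
  · intro c a ha
    rw [map_smul]
    exact Submodule.smul_mem _ _ ha

theorem par_eq {a : Lam n} (ha : a ∈ LamDeg n k) : par n a = (-1 : ℝ) ^ k • a := by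
  refine lamDeg_induction ha (p := fun a => par n a = (-1 : ℝ) ^ k • a) ?_ ?_ ?_ ?_
  · intro v
    have h : (fun i => v i ∘ₗ (-(LinearMap.id : CV n →ₗ[ℝ] CV n))) = fun i => (-1 : ℝ) • v i := by
      funext i
      ext
      simp
    rw [par, pb_ιMulti, h, AlternatingMap.map_smul_univ]
    simp
  · simp
  · intro a b ha hb
    rw [map_add, ha, hb, smul_add]
  · intro c a ha
    rw [map_smul, ha, smul_comm]

theorem mul_comm_of_two {a : Lam n} (ha : a ∈ LamDeg n 2) (x : Lam n) : a * x = x * a := by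
  refine lamDeg_induction ha (p := fun a => a * x = x * a) ?_ ?_ ?_ ?_
  · intro v
    simp only [ExteriorAlgebra.ιMulti_apply, List.ofFn_succ, List.ofFn_zero, List.prod_cons,
      List.prod_nil, mul_one]
    rw [mul_assoc, ι_mul_eq _ x, ← mul_assoc, ι_mul_eq _ (par n x), par_par, mul_assoc]
  · simp
  · intro a b ha hb
    rw [add_mul, mul_add, ha, hb]
  · intro c a ha
    rw [smul_mul_assoc, mul_smul_comm, ha]

theorem finrank_dual (n : ℕ) : Module.finrank ℝ (Module.Dual ℝ (CV n)) = 2 * n := by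
  rw [Subspace.dual_finrank_eq]
  simp [finrank_real_of_complex, mul_comm]

theorem finrank_lamDeg (n k : ℕ) : Module.finrank ℝ (LamDeg n k) = (2 * n).choose k := by
  rw [LamDeg, exteriorPower.finrank_eq, finrank_dual]

theorem lamDeg_eq_zero {a : Lam n} (hk : 2 * n < k) (ha : a ∈ LamDeg n k) : a = 0 := by
  have h : Module.finrank ℝ (LamDeg n k) = 0 := by
    rw [finrank_lamDeg, Nat.choose_eq_zero_of_lt hk]
  have := Module.finrank_zero_iff.1 h
  exact congrArg Subtype.val (Subsingleton.elim (⟨a, ha⟩ : LamDeg n k) 0)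

/-- The projection to the component of degree `k`. -/
def proj (n k : ℕ) : Lam n →ₗ[ℝ] Lam n :=
  GradedAlgebra.proj (fun i : ℕ => ⋀[ℝ]^i (Module.Dual ℝ (CV n))) k

theorem proj_mem (k : ℕ) (a : Lam n) : proj n k a ∈ LamDeg n k :=
  SetLike.coe_mem _

theorem proj_of_mem {a : Lam n} (ha : a ∈ LamDeg n k) : proj n k a = a :=
  DirectSum.decompose_of_mem_same _ ha

theorem proj_of_mem_ne {a : Lam n} (ha : a ∈ LamDeg n k) (h : k ≠ l) : proj n l a = 0 :=
  DirectSum.decompose_of_mem_ne _ ha h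

theorem sum_proj (a : Lam n) : ∑ k ∈ Finset.range (2 * n + 1), proj n k a = a := by
  classical
  have h := DirectSum.sum_support_decompose (fun i : ℕ => ⋀[ℝ]^i (Module.Dual ℝ (CV n))) a
  conv_rhs => rw [← h]
  symm
  refine Finset.sum_subset ?_ ?_
  · intro i hi
    rw [Finset.mem_range]
    by_contra hlt
    rw [DFinsupp.mem_support_iff] at hi
    exact hi (Subtype.ext (lamDeg_eq_zero (by omega) (SetLike.coe_mem _)))
  · intro i _ hi
    rw [DFinsupp.notMem_support_iff] at hi
    rw [hi]
    rfl

theorem proj_mul {a : Lam n} (ha : a ∈ LamDeg n l) (k : ℕ) (b : Lam n) :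
    proj n (l + k) (a * b) = a * proj n k b := by
  conv_lhs => rw [← sum_proj b, Finset.mul_sum, map_sum]
  by_cases hk : k ∈ Finset.range (2 * n + 1)
  · rw [Finset.sum_eq_single k]
    · exact proj_of_mem (mul_mem_lamDeg ha (proj_mem k b))
    · intro j _ hj
      exact proj_of_mem_ne (mul_mem_lamDeg ha (proj_mem j b)) (by omega)
    · intro h
      exact absurd hk h
  · have h0 : proj n k b = 0 := lamDeg_eq_zero (by rw [Finset.mem_range] at hk; omega) (proj_mem k b)
    rw [h0, mul_zero]
    refine Finset.sum_eq_zero fun j hj => ?_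
    refine proj_of_mem_ne (mul_mem_lamDeg ha (proj_mem j b)) ?_
    intro h
    have : j = k := by omega
    exact hk (this ▸ hj)

theorem proj_pb {m : ℕ} (A : CV m →ₗ[ℝ] CV n) (k : ℕ) (a : Lam n) :
    proj m k (pb A a) = pb A (proj n k a) := by
  conv_lhs => rw [← sum_proj a, map_sum, map_sum]
  by_cases hk : k ∈ Finset.range (2 * n + 1)
  · rw [Finset.sum_eq_single k]
    · exact proj_of_mem (pb_mem A (proj_mem k a))
    · intro j _ hj
      exact proj_of_mem_ne (pb_mem A (proj_mem j a)) hj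
    · intro h
      exact absurd hk h
  · have h0 : proj n k a = 0 := lamDeg_eq_zero (by rw [Finset.mem_range] at hk; omega) (proj_mem k a)
    rw [h0, map_zero]
    refine Finset.sum_eq_zero fun j hj => ?_
    exact proj_of_mem_ne (pb_mem A (proj_mem j a)) fun h => hk (h ▸ hj)

theorem evalForm_ιMulti (v : Fin k → CV n) (x : Fin k → Module.Dual ℝ (CV n)) :
    evalForm v (ExteriorAlgebra.ιMulti ℝ k x) = (Matrix.of fun a b => x a (v b)).det := by
  rw [evalForm, ExteriorAlgebra.liftAlternating_apply_ιMulti, Pi.single_eq_same]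
  rfl

theorem evalForm_ιMulti_ne (v : Fin k → CV n) (x : Fin l → Module.Dual ℝ (CV n)) (h : l ≠ k) :
    evalForm v (ExteriorAlgebra.ιMulti ℝ l x) = 0 := by
  rw [evalForm, ExteriorAlgebra.liftAlternating_apply_ιMulti, Pi.single_eq_of_ne h]
  rfl

theorem evalForm_of_mem_ne (v : Fin k → CV n) {a : Lam n} (ha : a ∈ LamDeg n l) (h : l ≠ k) :
    evalForm v a = 0 :=
  lamDeg_induction ha (p := fun a => evalForm v a = 0) (fun x => evalForm_ιMulti_ne v x h)
    (map_zero _) (fun a b ha hb => by rw [map_add, ha, hb, add_zero])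
    (fun c a ha => by rw [map_smul, ha, smul_zero])

theorem evalForm_pb {m : ℕ} (A : CV m →ₗ[ℝ] CV n) (v : Fin k → CV m) (a : Lam n) :
    evalForm v (pb A a) = evalForm (fun i => A (v i)) a := by
  have h : evalForm v ∘ₗ (pb A).toLinearMap = evalForm fun i => A (v i) := by
    refine ExteriorAlgebra.lhom_ext fun l => ?_
    ext x
    simp only [LinearMap.compAlternatingMap_apply, LinearMap.comp_apply,
      AlgHom.toLinearMap_apply, pb_ιMulti]
    by_cases hl : l = k
    · subst hl
      rw [evalForm_ιMulti, evalForm_ιMulti]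
      rfl
    · rw [evalForm_ιMulti_ne _ _ hl, evalForm_ιMulti_ne _ _ hl]
  exact congrArg (fun f => f a) h

/-- Only the component of degree `2 n` contributes, and this degree is even. -/
theorem topC_par (η : ℂ ⊗[ℝ] Lam n) : topC n (parW n ℂ η) = topC n η := by
  induction η using TensorProduct.induction_on with
  | zero => simp
  | tmul s a =>
    rw [parW, tm_tmul, topC_tmul, topC_tmul]
    congr 2
    conv_rhs => rw [← sum_proj a]
    rw [AlgHom.toLinearMap_apply]
    conv_lhs => rw [← sum_proj a]
    rw [map_sum, map_sum, map_sum]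
    refine Finset.sum_congr rfl fun k _ => ?_
    by_cases hk : k = n * 2
    · subst hk
      have he : (-1 : ℝ) ^ (n * 2) = 1 := by rw [mul_comm, pow_mul]; simp
      rw [par_eq (proj_mem _ a), he, one_smul]
    · rw [par_eq (proj_mem _ a), map_smul, evalForm_of_mem_ne _ (proj_mem _ a) hk, smul_zero]
  | add u v hu hv => rw [map_add, map_add, map_add, hu, hv]

end Grading

/-! ### The grading of vector valued forms -/

section GradingW

variable {n : ℕ} {W W' : Type*} [AddCommGroup W] [Module ℂ W] [AddCommGroup W'] [Module ℂ W']

/-- The projection of vector valued forms to the component of degree `k`. -/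
def projW (n : ℕ) (W : Type*) [AddCommGroup W] [Module ℂ W] (k : ℕ) :
    W ⊗[ℝ] Lam n →ₗ[ℂ] W ⊗[ℝ] Lam n := tm LinearMap.id (proj n k)

theorem projW_projW (k : ℕ) (u : W ⊗[ℝ] Lam n) :
    projW n W k (projW n W k u) = projW n W k u := by
  rw [projW, tm_tm]
  congr 2
  exact LinearMap.ext fun a => proj_of_mem (proj_mem k a)

theorem projW_projW_ne {k l : ℕ} (h : k ≠ l) (u : W ⊗[ℝ] Lam n) :
    projW n W l (projW n W k u) = 0 := by
  induction u using TensorProduct.induction_on with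
  | zero => simp only [map_zero]
  | tmul s a =>
    rw [projW, projW, tm_tmul, tm_tmul, proj_of_mem_ne (proj_mem k a) h, TensorProduct.tmul_zero]
  | add u v hu hv => simp only [map_add, hu, hv, add_zero]

theorem sum_projW (u : W ⊗[ℝ] Lam n) :
    ∑ k ∈ Finset.range (2 * n + 1), projW n W k u = u := by
  induction u using TensorProduct.induction_on with
  | zero => simp only [map_zero, Finset.sum_const_zero]
  | tmul s a =>
    simp only [projW, tm_tmul, LinearMap.id_apply]
    rw [← TensorProduct.tmul_sum, sum_proj]
  | add u v hu hv => simp only [map_add, Finset.sum_add_distrib, hu, hv]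

theorem mem_range_iff (k : ℕ) (u : W ⊗[ℝ] Lam n) :
    u ∈ LinearMap.range (TensorProduct.AlgebraTensorModule.map (LinearMap.id : W →ₗ[ℂ] W)
      (⋀[ℝ]^k (Module.Dual ℝ (CV n))).subtype) ↔ projW n W k u = u := by
  constructor
  · rintro ⟨w, rfl⟩
    induction w using TensorProduct.induction_on with
    | zero => simp only [map_zero]
    | tmul s a =>
      simp only [TensorProduct.AlgebraTensorModule.map_tmul, projW]
      rw [Submodule.subtype_apply, proj_of_mem a.2]
      rfl
    | add u v hu hv => simp only [map_add, hu, hv]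
  · intro h
    rw [← h]
    clear h
    induction u using TensorProduct.induction_on with
    | zero => simp only [map_zero, Submodule.zero_mem]
    | tmul s a => exact ⟨s ⊗ₜ ⟨proj n k a, proj_mem k a⟩, rfl⟩
    | add u v hu hv =>
      rw [map_add]
      exact Submodule.add_mem _ hu hv

theorem projW_wedge {l : ℕ} {a : Lam n} (ha : a ∈ LamDeg n l) (k : ℕ) (u : W ⊗[ℝ] Lam n) :
    projW n W (l + k) (wedge a u) = wedge a (projW n W k u) := by
  induction u using TensorProduct.induction_on with
  | zero => simp only [map_zero]
  | tmul s b => rw [projW, projW, wedge_tmul, tm_tmul, tm_tmul, wedge_tmul, proj_mul ha]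
  | add u v hu hv => simp only [map_add, hu, hv]

theorem projW_tm_pb {m : ℕ} (f : W →ₗ[ℂ] W') (A : CV m →ₗ[ℝ] CV n) (k : ℕ) (u : W ⊗[ℝ] Lam n) :
    projW m W' k (tm f (pb A).toLinearMap u) = tm f (pb A).toLinearMap (projW n W k u) := by
  induction u using TensorProduct.induction_on with
  | zero => simp only [map_zero]
  | tmul s b =>
    rw [projW, projW, tm_tmul, tm_tmul, tm_tmul, tm_tmul, AlgHom.toLinearMap_apply, proj_pb]
    rfl
  | add u v hu hv => simp only [map_add, hu, hv]

theorem parW_eq {k : ℕ} {u : W ⊗[ℝ] Lam n} (hu : projW n W k u = u) :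
    parW n W u = (-1 : ℂ) ^ k • u := by
  rw [← hu]
  clear hu
  induction u using TensorProduct.induction_on with
  | zero => simp only [map_zero, smul_zero]
  | tmul s b =>
    rw [projW, parW, tm_tmul, tm_tmul, AlgHom.toLinearMap_apply, par_eq (proj_mem k b),
      TensorProduct.smul_tmul', ← TensorProduct.smul_tmul]
    congr 1
    rcases Nat.even_or_odd k with h | h <;> simp [h.neg_one_pow]
  | add u v hu hv => simp only [map_add, hu, hv, smul_add]

theorem eq_zero_of_projW {k : ℕ} (hk : 2 * n < k) {u : W ⊗[ℝ] Lam n} (hu : projW n W k u = u) :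
    u = 0 := by
  rw [← hu]
  clear hu
  induction u using TensorProduct.induction_on with
  | zero => simp only [map_zero]
  | tmul s b =>
    rw [projW, tm_tmul, lamDeg_eq_zero hk (proj_mem k b), TensorProduct.tmul_zero]
  | add u v hu hv => simp only [map_add, hu, hv, add_zero]

end GradingW

end THodge
end

noncomputable section

namespace THodge

/-! ### Flat Leibniz rules -/

section FlatLeibniz

variable {n r : ℕ} {W : Type*} [AddCommGroup W] [Module ℂ W]

theorem mul_comm_of_even {k : ℕ} {a : Lam n} (ha : a ∈ LamDeg n (2 * k)) (x : Lam n) :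
    a * x = x * a := by
  induction x using ExteriorAlgebra.induction with
  | algebraMap c => exact (Algebra.commutes c a).symm
  | ι l => rw [ι_mul_eq, par_eq ha, pow_mul]; simp
  | mul b c hb hc => rw [← mul_assoc, hb, mul_assoc, hc, mul_assoc]
  | add b c hb hc => rw [mul_add, add_mul, hb, hc]

/-- The operator `w ↦ (b₁ - i b₂) ∧ w / 2`. -/
def halfWedge (b₁ b₂ : Lam n) : W ⊗[ℝ] Lam n →ₗ[ℂ] W ⊗[ℝ] Lam n :=
  (1 / 2 : ℂ) • (wedge b₁ - I • wedge b₂)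

theorem halfWedge_apply (b₁ b₂ : Lam n) (w : W ⊗[ℝ] Lam n) :
    halfWedge b₁ b₂ w = (1 / 2 : ℂ) • (wedge b₁ w - I • wedge b₂ w) := rfl

theorem halfWedge_wedge (b₁ b₂ a : Lam n) (ha : ∀ x, a * x = x * a) (w : W ⊗[ℝ] Lam n) :
    halfWedge b₁ b₂ (wedge a w) = wedge a (halfWedge b₁ b₂ w) := by
  simp only [halfWedge_apply, map_smul, map_sub, wedge_wedge, ha]

theorem tm_halfWedge {W' : Type*} [AddCommGroup W'] [Module ℂ W'] (f : W →ₗ[ℂ] W')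
    (b₁ b₂ : Lam n) (w : W ⊗[ℝ] Lam n) :
    tm f LinearMap.id (halfWedge b₁ b₂ w) = halfWedge b₁ b₂ (tm f LinearMap.id w) := by
  simp only [halfWedge_apply, map_smul, map_sub, tm_id_wedge]

/-- Since `a` is scalar, wedging with it commutes with `H` and `H⁻¹`. Hence the connection matrix
does not enter the commutator, which is wedging with `∂a = (da - i D_i a) / 2`, where `D_i` is `DopR
(mulI n)`. -/
theorem flatDel_wedge {H : CV n → Matrix (Fin r) (Fin r) ℂ} {a : CV n → Lam n}
    {g : CV n → (Fin r → ℂ) ⊗[ℝ] Lam n} {y : CV n}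
    (hH : ∀ a b, ContDiffAt ℝ ∞ (fun z => H z a b) y) (hdet : IsUnit (H y).det)
    (ha : SmoothAt a y) (hc : ∀ x, a y * x = x * a y) (hg : SmoothAt g y) :
    flatDel H (fun z => wedge (a z) (g z)) y =
      halfWedge (DopR LinearMap.id a y) (DopR (mulI n) a y) (g y) +
        wedge (a y) (flatDel H g y) := by
  have hR := smoothAt_gauge (smoothAt_vecMul hH) hg
  rw [flatDel_eq hH hdet (smoothAt_wedge ha hg), flatDel_eq hH hdet hg]
  simp only [rmul, tm_id_wedge]
  rw [del0, Dop_wedge ha hR hc, Dop_wedge ha hR hc]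
  have e : (1 / 2 : ℂ) • (wedge (DopR LinearMap.id a y) (rmul (H y) (g y)) +
      wedge (a y) (Dop LinearMap.id (fun z => rmul (H z) (g z)) y) -
      I • (wedge (DopR (mulI n) a y) (rmul (H y) (g y)) +
      wedge (a y) (Dop (mulI n) (fun z => rmul (H z) (g z)) y))) =
      halfWedge (DopR LinearMap.id a y) (DopR (mulI n) a y) (rmul (H y) (g y)) +
      wedge (a y) (del0 (fun z => rmul (H z) (g z)) y) := by
    simp only [halfWedge_apply, del0, map_smul, map_sub]
    module
  rw [e, map_add, tm_id_wedge, tm_halfWedge]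
  have := rmul_rmul (n := n) (H y) (H y)⁻¹ (g y)
  rw [Matrix.mul_nonsing_inv _ hdet, rmul_one] at this
  rw [this]

theorem dbar0_wedge [Module.Finite ℝ W] {a : CV n → Lam n} {g : CV n → W ⊗[ℝ] Lam n} {y : CV n}
    (ha : SmoothAt a y) (hc : ∀ x, a y * x = x * a y) (hg : SmoothAt g y)
    (h1 : DopR LinearMap.id a y = 0) (h2 : DopR (mulI n) a y = 0) :
    dbar0 (fun z => wedge (a z) (g z)) y = wedge (a y) (dbar0 g y) := by
  rw [dbar0, Dop_wedge ha hg hc, Dop_wedge ha hg hc, h1, h2, dbar0]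
  simp only [wedge_zero, zero_add, map_smul, map_add]

theorem flatDel_weil {H : CV n → Matrix (Fin r) (Fin r) ℂ}
    {g : CV n → (Fin r → ℂ) ⊗[ℝ] Lam n} {y : CV n}
    (hH : ∀ a b, ContDiffAt ℝ ∞ (fun z => H z a b) y) (hdet : IsUnit (H y).det)
    (hg : SmoothAt g y) :
    weilW n _ (flatDel H g y) = I • flatDel H (fun z => weilW n _ (g z)) y := by
  have hR := smoothAt_gauge (smoothAt_vecMul hH) hg
  have hw : SmoothAt (fun z => weilW n (Fin r → ℂ) (g z)) y :=
    hg.linear ((weilW n (Fin r → ℂ)).restrictScalars ℝ)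
  have hc : ∀ (A : Matrix (Fin r) (Fin r) ℂ) (u : (Fin r → ℂ) ⊗[ℝ] Lam n),
      weilW n _ (rmul A u) = rmul A (weilW n _ u) := by
    intro A u
    rw [weilW, rmul, tm_tm, tm_tm]
    rfl
  rw [flatDel_eq hH hdet hg, flatDel_eq hH hdet hw, hc, weilW_del0 hR, map_smul]
  simp only [hc]

theorem Dop_linear_anti {K : CV n →ₗ[ℝ] CV n} [Module.Finite ℝ W] {g : CV n → W ⊗[ℝ] Lam n}
    {y : CV n} (hg : SmoothAt g y) (A B : W ⊗[ℝ] Lam n →ₗ[ℂ] W ⊗[ℝ] Lam n)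
    (h : ∀ l u, A (wedge (ExteriorAlgebra.ι ℝ l) u) = wedge (ExteriorAlgebra.ι ℝ l) (B u)) :
    A (Dop K g y) = Dop K (fun z => B (g z)) y := by
  have h1 : ∀ v, dirDeriv (fun z => B (g z)) y v = B (dirDeriv g y v) :=
    fun v => dirDeriv_linear hg (B.restrictScalars ℝ) v
  simp only [Dop, map_sum, h, h1]

/-- Zeroth order operators on forms intertwine `∂^E`. -/
theorem flatDel_linear {H : CV n → Matrix (Fin r) (Fin r) ℂ}
    {g : CV n → (Fin r → ℂ) ⊗[ℝ] Lam n} {y : CV n}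
    (hH : ∀ a b, ContDiffAt ℝ ∞ (fun z => H z a b) y) (hdet : IsUnit (H y).det)
    (hg : SmoothAt g y) (α β : Lam n →ₗ[ℝ] Lam n)
    (h : ∀ l a, α (ExteriorAlgebra.ι ℝ l * a) = ExteriorAlgebra.ι ℝ l * β a) :
    tm LinearMap.id α (flatDel H g y) = flatDel H (fun z => tm LinearMap.id β (g z)) y := by
  have hR := smoothAt_gauge (smoothAt_vecMul hH) hg
  have hw : SmoothAt (fun z => tm (LinearMap.id : (Fin r → ℂ) →ₗ[ℂ] (Fin r → ℂ)) β (g z)) y :=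
    hg.linear ((tm LinearMap.id β).restrictScalars ℝ)
  have hc : ∀ (γ : Lam n →ₗ[ℝ] Lam n) (A : Matrix (Fin r) (Fin r) ℂ)
      (u : (Fin r → ℂ) ⊗[ℝ] Lam n),
      tm LinearMap.id γ (rmul A u) = rmul A (tm LinearMap.id γ u) := by
    intro γ A u
    rw [rmul, tm_tm, tm_tm]
    rfl
  have hl : ∀ (l) (u : (Fin r → ℂ) ⊗[ℝ] Lam n),
      tm LinearMap.id α (wedge (ExteriorAlgebra.ι ℝ l) u) =
        wedge (ExteriorAlgebra.ι ℝ l) (tm LinearMap.id β u) := by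
    intro l u
    induction u using TensorProduct.induction_on with
    | zero => simp only [map_zero]
    | tmul s b => rw [wedge_tmul, tm_tmul, tm_tmul, wedge_tmul, h]
    | add u v hu hv => simp only [map_add, hu, hv]
  rw [flatDel_eq hH hdet hg, flatDel_eq hH hdet hw, hc]
  simp only [← hc β]
  simp only [del0, map_smul, map_sub, Dop_linear_anti hR _ _ hl]

end FlatLeibniz

/-! ### Operators on bundle valued forms on a manifold -/

section FormsOnManifold

variable {n r : ℕ} {X : Type*} [TopologicalSpace X] [ChartedSpace (CV n) X]
  {E : X → Type*} [∀ x, AddCommGroup (E x)] [∀ x, Module ℂ (E x)]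

/-- A fibrewise operator acting only on the form part. -/
def formOp (E : X → Type*) [∀ x, AddCommGroup (E x)] [∀ x, Module ℂ (E x)]
    (A : Lam n →ₗ[ℝ] Lam n) : Forms n E →ₗ[ℂ] Forms n E :=
  LinearMap.pi fun x => tm LinearMap.id A ∘ₗ LinearMap.proj x

theorem formOp_apply (A : Lam n →ₗ[ℝ] Lam n) (u : Forms n E) (x : X) :
    formOp E A u x = tm LinearMap.id A (u x) := rfl

theorem weil_eq : (weil : Forms n E →ₗ[ℂ] Forms n E) = formOp E (weilLam n).toLinearMap := rfl

theorem wedgeForm_apply (a : X → Lam n) (u : Forms n E) (x : X) :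
    wedgeForm a u x = wedge (a x) (u x) := rfl

theorem mem_homogeneous_iff (k : ℕ) (u : Forms n E) :
    u ∈ homogeneous n E k ↔ formOp E (proj n k) u = u := by
  constructor
  · intro h
    funext x
    exact (mem_range_iff k (u x)).1 (h x)
  · intro h x
    exact (mem_range_iff k (u x)).2 (congrFun h x)

variable [TopologicalSpace (Bundle.TotalSpace (Fin r → ℂ) E)] [∀ x, TopologicalSpace (E x)]
  [FiberBundle (Fin r → ℂ) E] [VectorBundle ℂ (Fin r → ℂ) E]

theorem localRep_add (u v : Forms n E) (x₀ : X) (y : CV n) :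
    localRep r (u + v) x₀ y = localRep r u x₀ y + localRep r v x₀ y := by
  simp only [localRep, Pi.add_apply, map_add]

theorem localRep_smul (c : ℂ) (u : Forms n E) (x₀ : X) (y : CV n) :
    localRep r (c • u) x₀ y = c • localRep r u x₀ y := by
  simp only [localRep, Pi.smul_apply, map_smul]

theorem localRep_wedge (a : X → Lam n) (u : Forms n E) (x₀ : X) (y : CV n) :
    localRep r (wedgeForm a u) x₀ y = wedge (localReal a x₀ y) (localRep r u x₀ y) :=
  tm_wedge _ _ _ _

theorem localRep_formOp {A : Lam n →ₗ[ℝ] Lam n} {x₀ : X} {y : CV n}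
    (hA : ∀ a, pullLam x₀ y (A a) = A (pullLam x₀ y a)) (u : Forms n E) :
    localRep r (formOp E A u) x₀ y = tm LinearMap.id A (localRep r u x₀ y) := by
  rw [localRep, localRep, formOp_apply, tm_tm, tm_tm]
  congr 2
  exact LinearMap.ext hA

theorem fromLocal_localRep [IsManifold 𝓘(ℂ, CV n) ω X] (u : Forms n E) (x : X) :
    fromLocal r x (localRep r u x (chartAt (CV n) x x)) = u x := by
  rw [localRep_eq_of_eq ((chartAt (CV n) x).left_inv (mem_chart_source (CV n) x)), repAt,
    fromLocal, tm_tm]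
  have h1 : LinearMap.id ∘ₗ (pullLam x (chartAt (CV n) x x)).toLinearMap =
      (LinearMap.id : Lam n →ₗ[ℝ] Lam n) := LinearMap.ext fun a => pullLam_chart x a
  have h2 : (trivializationAt (Fin r → ℂ) E x).symmₗ ℂ x ∘ₗ
      (trivializationAt (Fin r → ℂ) E x).linearMapAt ℂ x = LinearMap.id :=
    LinearMap.ext fun s => Bundle.Trivialization.symmₗ_linearMapAt _
      (FiberBundle.mem_baseSet_trivializationAt' x) s
  rw [h1, h2, tm_id]

theorem forms_ext [IsManifold 𝓘(ℂ, CV n) ω X] {u v : Forms n E}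
    (h : ∀ x, localRep r u x (chartAt (CV n) x x) = localRep r v x (chartAt (CV n) x x)) :
    u = v := by
  funext x
  rw [← fromLocal_localRep (r := r) u x, h, fromLocal_localRep]

theorem mem_smoothForms {u : Forms n E} : u ∈ smoothForms n r E ↔
    IsSmoothForm r u ∧ ∃ K : Set X, IsCompact K ∧ ∀ x ∉ K, u x = 0 := Iff.rfl

theorem IsSmoothForm.add {u v : Forms n E} (hu : IsSmoothForm r u) (hv : IsSmoothForm r v) :
    IsSmoothForm r (u + v) := fun x₀ =>
  ((hu x₀).add (hv x₀)).congr (Filter.Eventually.of_forall fun y => localRep_add u v x₀ y)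

theorem IsSmoothForm.smul {u : Forms n E} (hu : IsSmoothForm r u) (c : ℂ) :
    IsSmoothForm r (c • u) := fun x₀ =>
  ((hu x₀).csmul c).congr (Filter.Eventually.of_forall fun y => localRep_smul c u x₀ y)

theorem IsSmoothForm.wedge {a : X → Lam n} {u : Forms n E} (ha : IsSmoothReal a)
    (hu : IsSmoothForm r u) : IsSmoothForm r (wedgeForm a u) := fun x₀ =>
  (smoothAt_wedge (ha x₀) (hu x₀)).congr
    (Filter.Eventually.of_forall fun y => localRep_wedge a u x₀ y)

theorem IsSmoothForm.formOp {A : Lam n →ₗ[ℝ] Lam n} {u : Forms n E}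
    (hA : ∀ x₀ : X, ∀ y ∈ (chartAt (CV n) x₀).target, ∀ a,
      pullLam x₀ y (A a) = A (pullLam x₀ y a))
    (hu : IsSmoothForm r u) : IsSmoothForm r (formOp E A u) := fun x₀ => by
  refine ((hu x₀).linear ((tm LinearMap.id A).restrictScalars ℝ)).congr ?_
  filter_upwards [(chartAt (CV n) x₀).open_target.mem_nhds (mem_chart_target (CV n) x₀)] with z hz
  exact localRep_formOp (hA x₀ z hz) u

theorem smoothForms_wedge {a : X → Lam n} {u : Forms n E} (ha : IsSmoothReal a)
    (hu : u ∈ smoothForms n r E) : wedgeForm a u ∈ smoothForms n r E := by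
  obtain ⟨h, K, hK, h0⟩ := mem_smoothForms.1 hu
  exact ⟨h.wedge ha, K, hK, fun x hx => by rw [wedgeForm_apply, h0 x hx, map_zero]⟩

theorem smoothForms_formOp {A : Lam n →ₗ[ℝ] Lam n} {u : Forms n E}
    (hA : ∀ x₀ : X, ∀ y ∈ (chartAt (CV n) x₀).target, ∀ a,
      pullLam x₀ y (A a) = A (pullLam x₀ y a))
    (hu : u ∈ smoothForms n r E) : formOp E A u ∈ smoothForms n r E := by
  obtain ⟨h, K, hK, h0⟩ := mem_smoothForms.1 hu
  exact ⟨h.formOp hA, K, hK, fun x hx => by rw [formOp_apply, h0 x hx, map_zero]⟩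

theorem pullLam_par (x₀ : X) (y : CV n) (a : Lam n) :
    pullLam x₀ y (par n a) = par n (pullLam x₀ y a) := pb_par _ a

theorem pullLam_proj (k : ℕ) (x₀ : X) (y : CV n) (a : Lam n) :
    pullLam x₀ y (proj n k a) = proj n k (pullLam x₀ y a) := (proj_pb _ k a).symm

theorem localRep_eventually_zero [T2Space X] {u : Forms n E} {K : Set X} (hK : IsCompact K)
    (h0 : ∀ x ∉ K, u x = 0) {x : X} (hx : x ∉ K) :
    localRep r u x =ᶠ[𝓝 (chartAt (CV n) x x)] fun _ => 0 := by
  have hU := ((chartAt (CV n) x).isOpen_inter_preimage_symm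
    hK.isClosed.isOpen_compl).mem_nhds (x := chartAt (CV n) x x)
    ⟨mem_chart_target (CV n) x, by
      change (chartAt (CV n) x).symm (chartAt (CV n) x x) ∈ Kᶜ
      rw [(chartAt (CV n) x).left_inv (mem_chart_source (CV n) x)]
      exact hx⟩
  filter_upwards [hU] with z hz
  rw [localRep, h0 _ hz.2, map_zero]

variable [IsManifold 𝓘(ℂ, CV n) ω X] [ContMDiffVectorBundle ω (Fin r → ℂ) E 𝓘(ℂ, CV n)]

theorem dbar_eq_zero [T2Space X] {u : Forms n E} {K : Set X} (hK : IsCompact K)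
    (h0 : ∀ x ∉ K, u x = 0) {x : X} (hx : x ∉ K) : dbar r u x = 0 := by
  rw [dbar, flatDbar_eq, dbar0_congr (localRep_eventually_zero hK h0 hx)]
  simp [dbar0, Dop, dirDeriv_const]

theorem smoothForms_dbar [T2Space X] {u : Forms n E} (hu : u ∈ smoothForms n r E) :
    dbar r u ∈ smoothForms n r E := by
  obtain ⟨h, K, hK, h0⟩ := mem_smoothForms.1 hu
  exact ⟨h.dbar, K, hK, fun x hx => dbar_eq_zero hK h0 hx⟩

theorem smoothAt_flatDel {H : CV n → Matrix (Fin r) (Fin r) ℂ}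
    {g : CV n → (Fin r → ℂ) ⊗[ℝ] Lam n} {y : CV n}
    (hH : ∀ a b, ContDiffAt ℝ ∞ (fun z => H z a b) y)
    (hdet : ∀ᶠ z in 𝓝 y, (∀ a b, ContDiffAt ℝ ∞ (fun z => H z a b) z) ∧ IsUnit (H z).det ∧
      SmoothAt g z)
    (hg : SmoothAt g y) : SmoothAt (fun z => flatDel H g z) y := by
  have hR := smoothAt_gauge (smoothAt_vecMul hH) hg
  have hd : ContDiffAt ℝ ∞ (fun z => (H z).det) y := by
    simp only [Matrix.det_apply]
    exact ContDiffAt.sum fun σ _ => (contDiffAt_prod fun i _ => hH _ _).const_smul _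
  have hinv : ∀ a b, ContDiffAt ℝ ∞ (fun z => (H z)⁻¹ a b) y := by
    intro a b
    -- Cramer's rule: the entries of the inverse are polynomials in the entries of `H` divided by
    -- the determinant.
    have e : (fun z => (H z)⁻¹ a b) = fun z => ((H z).det)⁻¹ * (H z).adjugate a b := by
      funext z
      rw [Matrix.inv_def, Ring.inverse_eq_inv']
      rfl
    rw [e]
    refine (hd.inv hdet.self_of_nhds.2.1.ne_zero).mul ?_
    simp only [Matrix.adjugate_apply, Matrix.det_apply]
    refine ContDiffAt.sum fun σ _ => (contDiffAt_prod fun i _ => ?_).const_smul _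
    simp only [Matrix.updateRow_apply]
    by_cases hi : σ i = b
    · simp only [hi, if_true]
      exact contDiffAt_const
    · simp only [hi, if_false]
      exact hH _ _
  refine (smoothAt_gauge (smoothAt_vecMul hinv) hR.del0).congr ?_
  filter_upwards [hdet] with z hz
  exact flatDel_eq hz.1 hz.2.1 hz.2.2

variable {h : SesqForm E}

theorem IsSmoothForm.del (hh : IsHermitianMetric n r h) {u : Forms n E} (hu : IsSmoothForm r u) :
    IsSmoothForm r (THodge.del r h u) := fun x₀ => by
  have hc := chart_mem_dom (n := n) (r := r) (E := E) x₀
  have hd := (isOpen_dom (r := r) (E := E) x₀).mem_nhds hc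
  refine SmoothAt.congr (smoothAt_flatDel (contDiffAt_gram hh hc) ?_ (hu x₀)) ?_
  · filter_upwards [hd] with z hz
    exact ⟨contDiffAt_gram hh hz, isUnit_det_gram hh hz, hu.smoothAt hz⟩
  · filter_upwards [hd] with z hz
    exact localRep_del hh hu hz

theorem smoothForms_del [T2Space X] (hh : IsHermitianMetric n r h) {u : Forms n E}
    (hu : u ∈ smoothForms n r E) : del r h u ∈ smoothForms n r E := by
  obtain ⟨hs, K, hK, h0⟩ := mem_smoothForms.1 hu
  refine ⟨hs.del hh, K, hK, fun x hx => ?_⟩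
  have hz := localRep_eventually_zero (r := r) hK h0 hx
  have hd := chart_mem_dom (n := n) (r := r) (E := E) x
  have hz' : (fun z => rmul (gram n r h x z) (localRep r u x z)) =ᶠ[𝓝 (chartAt (CV n) x x)]
      fun _ => 0 := by
    filter_upwards [hz] with z hz
    rw [hz, map_zero]
  rw [del, flatDel_eq (contDiffAt_gram hh hd) (isUnit_det_gram hh hd) (hs x), del0_congr hz']
  simp [del0, Dop, dirDeriv_const]

theorem dbar_add {u v : Forms n E} (hu : IsSmoothForm r u) (hv : IsSmoothForm r v) :
    dbar r (u + v) = dbar r u + dbar r v := by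
  refine forms_ext (r := r) fun x => ?_
  have hd := chart_mem_dom (n := n) (r := r) (E := E) x
  rw [localRep_add, localRep_dbar (hu.add hv) hd, localRep_dbar hu hd, localRep_dbar hv hd,
    ← dbar0_add (hu x) (hv x)]
  exact dbar0_congr (Filter.Eventually.of_forall fun y => localRep_add u v x y)

theorem dbar_smul {u : Forms n E} (hu : IsSmoothForm r u) (c : ℂ) :
    dbar r (c • u) = c • dbar r u := by
  refine forms_ext (r := r) fun x => ?_
  have hd := chart_mem_dom (n := n) (r := r) (E := E) x
  rw [localRep_smul, localRep_dbar (hu.smul c) hd, localRep_dbar hu hd, ← dbar0_csmul (hu x)]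
  exact dbar0_congr (Filter.Eventually.of_forall fun y => localRep_smul c u x y)

theorem flatDel_congr {H : CV n → Matrix (Fin r) (Fin r) ℂ}
    {g g' : CV n → (Fin r → ℂ) ⊗[ℝ] Lam n} {y : CV n} (hg : g =ᶠ[𝓝 y] g') :
    flatDel H g y = flatDel H g' y := by
  simp only [flatDel, partialZ, dirDeriv_congr hg, hg.self_of_nhds]

theorem del_add (hh : IsHermitianMetric n r h) {u v : Forms n E} (hu : IsSmoothForm r u)
    (hv : IsSmoothForm r v) : del r h (u + v) = del r h u + del r h v := by
  refine forms_ext (r := r) fun x => ?_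
  have hd := chart_mem_dom (n := n) (r := r) (E := E) x
  have hH := contDiffAt_gram hh hd
  have hdet := isUnit_det_gram hh hd
  rw [localRep_add, localRep_del hh (hu.add hv) hd, localRep_del hh hu hd, localRep_del hh hv hd,
    flatDel_congr (Filter.Eventually.of_forall fun y => localRep_add u v x y),
    flatDel_eq hH hdet ((hu x).add (hv x)), flatDel_eq hH hdet (hu x), flatDel_eq hH hdet (hv x),
    ← map_add, ← del0_add (smoothAt_gauge (smoothAt_vecMul hH) (hu x))
      (smoothAt_gauge (smoothAt_vecMul hH) (hv x))]
  simp only [map_add]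

theorem del_smul (hh : IsHermitianMetric n r h) {u : Forms n E} (hu : IsSmoothForm r u)
    (c : ℂ) : del r h (c • u) = c • del r h u := by
  refine forms_ext (r := r) fun x => ?_
  have hd := chart_mem_dom (n := n) (r := r) (E := E) x
  have hH := contDiffAt_gram hh hd
  have hdet := isUnit_det_gram hh hd
  rw [localRep_smul, localRep_del hh (hu.smul c) hd, localRep_del hh hu hd,
    flatDel_congr (Filter.Eventually.of_forall fun y => localRep_smul c u x y),
    flatDel_eq hH hdet ((hu x).csmul c), flatDel_eq hH hdet (hu x),
    ← map_smul, ← del0_csmul (smoothAt_gauge (smoothAt_vecMul hH) (hu x))]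
  simp only [map_smul]

/-- Real smooth forms of even degree `2 d` which are invariant under the Weil operator. -/
structure IsEvenInv (d : ℕ) (a : X → Lam n) : Prop where
  smooth : IsSmoothReal a
  deg : ∀ x, a x ∈ LamDeg n (2 * d)
  inv : ∀ x, weilLam n (a x) = a x

theorem IsEvenInv.central {d : ℕ} {a : X → Lam n} (ha : IsEvenInv d a) (x : X) (b : Lam n) :
    a x * b = b * a x := mul_comm_of_even (ha.deg x) b

theorem IsEvenInv.localCentral {d : ℕ} {a : X → Lam n} (ha : IsEvenInv d a) (x₀ : X) (y : CV n)
    (b : Lam n) : localReal a x₀ y * b = b * localReal a x₀ y :=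
  mul_comm_of_even (pb_mem _ (ha.deg _)) b

/-- Applying `J` to `da = 0` gives `D_i (J a) = 0`, where `D_i` is the operator with `K = i`, and `J
a = a`. A closed `J`-invariant form is therefore annihilated by both `∂` and `∂̄`. -/
theorem IsEvenInv.DopR_eq_zero {d : ℕ} {a : X → Lam n} (ha : IsEvenInv d a) (hd : IsDClosed a)
    (x : X) : DopR LinearMap.id (localReal a x) (chartAt (CV n) x x) = 0 ∧
      DopR (mulI n) (localReal a x) (chartAt (CV n) x x) = 0 := by
  have h1 : DopR LinearMap.id (localReal a x) (chartAt (CV n) x x) = 0 := by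
    rw [← flatD_eq]
    exact hd x
  refine ⟨h1, ?_⟩
  have h2 := weilLam_DopR (K := LinearMap.id) (ha.smooth x)
  rw [h1, map_zero, LinearMap.id_comp] at h2
  rw [h2]
  simp only [DopR]
  refine Finset.sum_congr rfl fun b _ => ?_
  congr 1
  refine dirDeriv_congr ?_ _
  filter_upwards [(chartAt (CV n) x).open_target.mem_nhds (mem_chart_target (CV n) x)] with z hz
  rw [localReal, ← pullLam_weil hz, ha.inv]

/-- With `a = T` this shows that `∂̄` preserves `V_T`; `del_wedge_closed` does the same for `∂^E`.
-/
theorem dbar_wedge {d : ℕ} {a : X → Lam n} (ha : IsEvenInv d a) (hc : IsDClosed a)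
    {u : Forms n E} (hu : IsSmoothForm r u) :
    dbar r (wedgeForm a u) = wedgeForm a (dbar r u) := by
  refine forms_ext (r := r) fun x => ?_
  have hd := chart_mem_dom (n := n) (r := r) (E := E) x
  rw [localRep_wedge, localRep_dbar (hu.wedge ha.smooth) hd, localRep_dbar hu hd,
    ← dbar0_wedge (ha.smooth x) (ha.localCentral x _) (hu x) (ha.DopR_eq_zero hc x).1
      (ha.DopR_eq_zero hc x).2]
  exact dbar0_congr (Filter.Eventually.of_forall fun y => localRep_wedge a u x y)

/-- The zeroth order operator `[∂, a ∧]`. -/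
def delSymbol (a : X → Lam n) (x : X) : E x ⊗[ℝ] Lam n →ₗ[ℂ] E x ⊗[ℝ] Lam n :=
  halfWedge (DopR LinearMap.id (localReal a x) (chartAt (CV n) x x))
    (DopR (mulI n) (localReal a x) (chartAt (CV n) x x))

theorem del_wedge (hh : IsHermitianMetric n r h) {d : ℕ} {a : X → Lam n} (ha : IsEvenInv d a)
    {u : Forms n E} (hu : IsSmoothForm r u) (x : X) :
    del r h (wedgeForm a u) x = delSymbol a x (u x) + wedge (a x) (del r h u x) := by
  have hd := chart_mem_dom (n := n) (r := r) (E := E) x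
  have hH := contDiffAt_gram hh hd
  have hdet := isUnit_det_gram hh hd
  have h1 : del r h (wedgeForm a u) x = fromLocal r x (flatDel (gram n r h x)
    (localRep r (wedgeForm a u) x) (chartAt (CV n) x x)) := rfl
  rw [h1, flatDel_congr (Filter.Eventually.of_forall fun y => localRep_wedge a u x y),
    flatDel_wedge hH hdet (ha.smooth x) (ha.localCentral x _) (hu x), map_add]
  congr 1
  · rw [fromLocal, tm_halfWedge]
    congr 1
    exact fromLocal_localRep u x
  · rw [fromLocal, tm_id_wedge, localReal_chart]
    rfl

theorem del_wedge_closed (hh : IsHermitianMetric n r h) {d : ℕ} {a : X → Lam n}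
    (ha : IsEvenInv d a) (hc : IsDClosed a) {u : Forms n E} (hu : IsSmoothForm r u) :
    del r h (wedgeForm a u) = wedgeForm a (del r h u) := by
  funext x
  rw [del_wedge hh ha hu, delSymbol, (ha.DopR_eq_zero hc x).1, (ha.DopR_eq_zero hc x).2,
    halfWedge_apply, wedge_zero, smul_zero, sub_zero, smul_zero, zero_add, wedgeForm_apply]

theorem weil_del (hh : IsHermitianMetric n r h) {u : Forms n E} (hu : IsSmoothForm r u) :
    weil (del r h u) = I • del r h (weil u) := by
  refine forms_ext (r := r) fun x => ?_
  have hd := chart_mem_dom (n := n) (r := r) (E := E) x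
  have hA : ∀ x₀ : X, ∀ y ∈ (chartAt (CV n) x₀).target, ∀ a,
      pullLam x₀ y ((weilLam n).toLinearMap a) = (weilLam n).toLinearMap (pullLam x₀ y a) :=
    fun x₀ y hy a => pullLam_weil hy a
  have hw : weilW n (Fin r → ℂ) = tm LinearMap.id (weilLam n).toLinearMap := rfl
  rw [localRep_smul, weil_eq, localRep_formOp (hA x _ hd.1), localRep_del hh hu hd,
    localRep_del hh (hu.formOp hA) hd, ← hw,
    flatDel_weil (contDiffAt_gram hh hd) (isUnit_det_gram hh hd) (hu x)]
  refine congrArg (I • ·) (flatDel_congr ?_)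
  filter_upwards [(chartAt (CV n) x).open_target.mem_nhds (mem_chart_target (CV n) x)] with z hz
  rw [localRep_formOp (hA x z hz) u, hw]

end FormsOnManifold

end THodge
end

noncomputable section

namespace THodge

/-! ### Integration of forms -/

section Determinant

variable {n : ℕ}

/-- The real basis `∂/∂x₁, ∂/∂y₁, …` of `ℂⁿ`. -/
def frBasis (n : ℕ) : Module.Basis (Fin n × Fin 2) ℝ (CV n) :=
  Module.Basis.ofEquivFun
    { toFun := fun v a => cofr a v
      invFun := fun c => ∑ a, c a • fr a
      map_add' := fun v w => by ext a; simp
      map_smul' := fun c v => by ext a; simp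
      left_inv := fun v => sum_cofr_smul_fr v
      right_inv := fun c => by
        ext a
        simp [map_sum, cofr_fr] }

theorem frBasis_repr (v : CV n) (a : Fin n × Fin 2) : (frBasis n).repr v a = cofr a v := rfl

theorem frBasis_apply (a : Fin n × Fin 2) : frBasis n a = fr a := by
  apply (frBasis n).repr.injective
  ext b
  rw [Module.Basis.repr_self, frBasis_repr, cofr_fr, Finsupp.single_apply]
  simp only [eq_comm]

theorem evalForm_realFrame_comp (A : CV n →ₗ[ℝ] CV n) (a : Lam n) :
    evalForm (fun i => A (realFrame n i)) a = LinearMap.det A * evalForm (realFrame n) a := by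
  rw [← sum_proj a, map_sum, map_sum, Finset.mul_sum]
  refine Finset.sum_congr rfl fun k _ => ?_
  by_cases hk : k = n * 2
  · subst hk
    refine lamDeg_induction (proj_mem (n * 2) a) (p := fun a =>
      evalForm (fun i => A (realFrame n i)) a = LinearMap.det A * evalForm (realFrame n) a)
      (fun x => ?_) ?_ ?_ ?_
    · let b := (frBasis n).reindex finProdFinEquiv
      have hb : ∀ i, b i = realFrame n i := fun i => by
        rw [Module.Basis.reindex_apply, frBasis_apply, realFrame_eq]
      rw [evalForm_ιMulti, evalForm_ιMulti, ← LinearMap.det_toMatrix b A]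
      refine Eq.trans (congrArg Matrix.det ?_) ((Matrix.det_mul _ _).trans (mul_comm _ _))
      ext i j
      rw [Matrix.mul_apply]
      simp only [Matrix.of_apply, LinearMap.toMatrix_apply, ← hb]
      conv_lhs => rw [← b.sum_repr (A (b j)), map_sum]
      exact Finset.sum_congr rfl fun l _ => by rw [map_smul, smul_eq_mul, mul_comm]
    · simp
    · intro a b ha hb
      rw [map_add, map_add, ha, hb, mul_add]
    · intro c a ha
      rw [map_smul, map_smul, ha, smul_eq_mul, smul_eq_mul]
      ring
  · rw [evalForm_of_mem_ne _ (proj_mem k a) hk, evalForm_of_mem_ne _ (proj_mem k a) hk, mul_zero]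

theorem topC_tm_pb (A : CV n →ₗ[ℝ] CV n) (η : ℂ ⊗[ℝ] Lam n) :
    topC n (tm LinearMap.id (pb A).toLinearMap η) = (LinearMap.det A : ℝ) * topC n η := by
  induction η using TensorProduct.induction_on with
  | zero => simp only [map_zero, mul_zero]
  | tmul s a =>
    rw [tm_tmul, topC_tmul, topC_tmul, AlgHom.toLinearMap_apply, evalForm_pb,
      evalForm_realFrame_comp, LinearMap.id_apply]
    push_cast
    ring
  | add u v hu hv => rw [map_add, map_add, hu, hv, map_add, mul_add]

/-- A real linear map commuting with `i` is complex linear, and its real determinant is the squared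
modulus of the complex one. -/
theorem det_nonneg_of_comm {A : CV n →ₗ[ℝ] CV n} (hA : A ∘ₗ mulI n = mulI n ∘ₗ A) :
    0 ≤ LinearMap.det A := by
  have hI : ∀ v, A (I • v) = I • A v := fun v => by
    have := LinearMap.congr_fun hA v
    simpa only [LinearMap.comp_apply, mulI_apply] using this
  let B : CV n →ₗ[ℂ] CV n :=
    { toFun := A
      map_add' := A.map_add
      map_smul' := fun c v => by
        conv_lhs => rw [← re_add_im c]
        have h1 : ((c.re : ℂ) + c.im * I) • v = c.re • v + c.im • (I • v) := by
          rw [add_smul, mul_smul, Complex.coe_smul, Complex.coe_smul]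
        rw [h1, map_add, map_smul, map_smul, hI]
        conv_rhs => rw [RingHom.id_apply, ← re_add_im c]
        rw [add_smul, mul_smul, Complex.coe_smul, Complex.coe_smul] }
  have e : A = B.restrictScalars ℝ := rfl
  rw [e, LinearMap.det_restrictScalars, Algebra.norm_complex_apply]
  exact normSq_nonneg _

end Determinant

section Integral

variable {n : ℕ} {X : Type*} [TopologicalSpace X] [ChartedSpace (CV n) X]

/-- The top degree coefficient of a form in the chart at `x₀`. -/
def locTop (η : X → ℂ ⊗[ℝ] Lam n) (x₀ : X) (y : CV n) : ℂ :=
  topC n (tm LinearMap.id (pullLam x₀ y).toLinearMap (η ((chartAt (CV n) x₀).symm y)))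

theorem locTop_add (η η' : X → ℂ ⊗[ℝ] Lam n) (x₀ : X) (y : CV n) :
    locTop (η + η') x₀ y = locTop η x₀ y + locTop η' x₀ y := by
  simp only [locTop, Pi.add_apply, map_add]

theorem locTop_smul (ρ : X → ℝ) (η : X → ℂ ⊗[ℝ] Lam n) (x₀ : X) (y : CV n) :
    locTop (fun x => ρ x • η x) x₀ y = ρ ((chartAt (CV n) x₀).symm y) * locTop η x₀ y := by
  simp only [locTop]
  rw [LinearMap.map_smul_of_tower, LinearMap.map_smul_of_tower, Complex.real_smul]

theorem locTop_eq_zero {η : X → ℂ ⊗[ℝ] Lam n} {x₀ : X} {y : CV n}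
    (h : η ((chartAt (CV n) x₀).symm y) = 0) : locTop η x₀ y = 0 := by
  rw [locTop, h, map_zero, map_zero]

theorem integral_eq_finsum [T2Space X] [SecondCountableTopology X] (η : X → ℂ ⊗[ℝ] Lam n) :
    integral η = ∑ᶠ x : X, ∫ y in (chartAt (CV n) x).target,
      locTop (fun p => chartPartition n X x p • η p) x y := by
  simp only [locTop_smul]
  rfl

section

variable [IsManifold 𝓘(ℂ, CV n) ω X]

theorem locTop_trans {x₀ x₁ : X} {y : CV n} (hy : y ∈ (chartAt (CV n) x₀).target)
    (h : (chartAt (CV n) x₀).symm y ∈ (chartAt (CV n) x₁).source) (η : X → ℂ ⊗[ℝ] Lam n) :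
    locTop η x₀ y = (LinearMap.det (dtrans n x₀ x₁ y) : ℝ) * locTop η x₁ (trans n x₀ x₁ y) := by
  rw [locTop, locTop, ← topC_tm_pb, tm_tm, symm_trans h]
  congr 2
  congr 1
  exact LinearMap.ext fun a => pullLam_trans hy h a

/-- Change of variables. The transformation rule of top forms involves the determinant and the
integral involves its absolute value; they agree because coordinate changes are holomorphic. -/
theorem setIntegral_locTop_overlap (η : X → ℂ ⊗[ℝ] Lam n) (x₀ x₁ : X) :
    ∫ y in {y | y ∈ (chartAt (CV n) x₁).target ∧
      (chartAt (CV n) x₁).symm y ∈ (chartAt (CV n) x₀).source}, locTop η x₁ y =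
    ∫ y in {y | y ∈ (chartAt (CV n) x₀).target ∧
      (chartAt (CV n) x₀).symm y ∈ (chartAt (CV n) x₁).source}, locTop η x₀ y := by
  have himg : {y | y ∈ (chartAt (CV n) x₁).target ∧
      (chartAt (CV n) x₁).symm y ∈ (chartAt (CV n) x₀).source} =
      trans n x₀ x₁ '' {y | y ∈ (chartAt (CV n) x₀).target ∧
      (chartAt (CV n) x₀).symm y ∈ (chartAt (CV n) x₁).source} := by
    ext y
    constructor
    · rintro ⟨h1, h2⟩
      refine ⟨trans n x₁ x₀ y, ⟨trans_mem_target h2, ?_⟩, ?_⟩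
      · rw [symm_trans h2]
        exact (chartAt (CV n) x₁).map_target h1
      · change chartAt (CV n) x₁ ((chartAt (CV n) x₀).symm (trans n x₁ x₀ y)) = y
        rw [symm_trans h2, (chartAt (CV n) x₁).right_inv h1]
    · rintro ⟨z, ⟨h1, h2⟩, rfl⟩
      refine ⟨trans_mem_target h2, ?_⟩
      rw [symm_trans h2]
      exact (chartAt (CV n) x₀).map_target h1
  rw [himg, integral_image_eq_integral_abs_det_fderiv_smul volume (f := trans n x₀ x₁)
    (f' := fun y => fderiv ℝ (trans n x₀ x₁) y) (isOpen_overlap x₀ x₁).measurableSet]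
  · refine setIntegral_congr_fun (isOpen_overlap x₀ x₁).measurableSet fun y hy => ?_
    have h0 : 0 ≤ LinearMap.det (dtrans n x₀ x₁ y) := det_nonneg_of_comm (dtrans_I hy.1 hy.2)
    have e : (fderiv ℝ (trans n x₀ x₁) y).det = LinearMap.det (dtrans n x₀ x₁ y) := rfl
    change |(fderiv ℝ (trans n x₀ x₁) y).det| • locTop η x₁ (trans n x₀ x₁ y) = locTop η x₀ y
    rw [locTop_trans hy.1 hy.2, e, abs_of_nonneg h0]
    exact (Complex.coe_smul _ _).symm
  · intro y hy
    exact ((ContDiffAt.real_of_complex (contDiffAt_trans hy.1 hy.2)).1.differentiableAt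
      (by simp)).hasFDerivAt.hasFDerivWithinAt
  · intro y hy z hz hyz
    have := congrArg (chartAt (CV n) x₁).symm hyz
    rw [symm_trans hy.2, symm_trans hz.2] at this
    exact (chartAt (CV n) x₀).symm.injOn hy.1 hz.1 this

theorem setIntegral_locTop_eq {η : X → ℂ ⊗[ℝ] Lam n} {x₀ x₁ : X}
    (h0 : ∀ p ∉ (chartAt (CV n) x₀).source, η p = 0)
    (h1 : ∀ p ∉ (chartAt (CV n) x₁).source, η p = 0) :
    ∫ y in (chartAt (CV n) x₁).target, locTop η x₁ y =
      ∫ y in (chartAt (CV n) x₀).target, locTop η x₀ y := by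
  have key : ∀ x x' : X, (∀ p ∉ (chartAt (CV n) x').source, η p = 0) →
      ∫ y in (chartAt (CV n) x).target, locTop η x y =
        ∫ y in {y | y ∈ (chartAt (CV n) x).target ∧
          (chartAt (CV n) x).symm y ∈ (chartAt (CV n) x').source}, locTop η x y := by
    intro x x' h
    refine (setIntegral_eq_of_subset_of_forall_diff_eq_zero
      (chartAt (CV n) x).open_target.measurableSet (fun y hy => hy.1) fun y hy => ?_)
    exact locTop_eq_zero (h _ fun hs => hy.2 ⟨hy.1, hs⟩)
  rw [key x₁ x₀ h0, key x₀ x₁ h1, setIntegral_locTop_overlap]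

end

variable [T2Space X]

theorem integrableOn_of_compact {x₀ : X} {f : CV n → ℂ}
    (hf : ContinuousOn f (chartAt (CV n) x₀).target) {K : Set X} (hK : IsCompact K)
    (hKs : K ⊆ (chartAt (CV n) x₀).source)
    (h0 : ∀ y ∈ (chartAt (CV n) x₀).target, (chartAt (CV n) x₀).symm y ∉ K → f y = 0) :
    IntegrableOn f (chartAt (CV n) x₀).target := by
  have hC : IsCompact (chartAt (CV n) x₀ '' K) :=
    hK.image_of_continuousOn ((chartAt (CV n) x₀).continuousOn.mono hKs)
  have hCt : chartAt (CV n) x₀ '' K ⊆ (chartAt (CV n) x₀).target := by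
    rintro _ ⟨p, hp, rfl⟩
    exact (chartAt (CV n) x₀).map_source (hKs hp)
  refine ((hf.mono hCt).integrableOn_compact hC).of_forall_diff_eq_zero
    (chartAt (CV n) x₀).open_target.measurableSet fun y hy => h0 y hy.1 fun hyK => hy.2 ?_
  exact ⟨_, hyK, (chartAt (CV n) x₀).right_inv hy.1⟩

/-- Compactly supported forms with continuous top degree coefficient. -/
structure ContCompact (η : X → ℂ ⊗[ℝ] Lam n) : Prop where
  cont : ∀ x₀ : X, ContinuousOn (locTop η x₀) (chartAt (CV n) x₀).target
  supp : ∃ K : Set X, IsCompact K ∧ ∀ p ∉ K, η p = 0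

theorem ContCompact.add {η η' : X → ℂ ⊗[ℝ] Lam n} (h : ContCompact η) (h' : ContCompact η') :
    ContCompact (η + η') where
  cont x₀ := ((h.cont x₀).add (h'.cont x₀)).congr fun y _ => locTop_add η η' x₀ y
  supp := by
    obtain ⟨K, hK, h0⟩ := h.supp
    obtain ⟨K', hK', h0'⟩ := h'.supp
    refine ⟨K ∪ K', hK.union hK', fun p hp => ?_⟩
    rw [Set.mem_union, not_or] at hp
    rw [Pi.add_apply, h0 p hp.1, h0' p hp.2, add_zero]

variable [SecondCountableTopology X]

theorem finite_chartPartition {K : Set X} (hK : IsCompact K) :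
    {x : X | ∃ p ∈ K, chartPartition n X x p ≠ 0}.Finite := by
  refine ((chartPartition n X).locallyFinite.finite_nonempty_inter_compact hK).subset ?_
  rintro x ⟨p, hp, hx⟩
  exact ⟨p, hx, hp⟩

theorem continuousOn_locTop_smul {η : X → ℂ ⊗[ℝ] Lam n} {x₀ : X} {ρ : X → ℝ} (hρ : Continuous ρ)
    (h : ContinuousOn (locTop η x₀) (chartAt (CV n) x₀).target) :
    ContinuousOn (locTop (fun p => ρ p • η p) x₀) (chartAt (CV n) x₀).target := by
  refine ContinuousOn.congr ?_ fun y _ => locTop_smul ρ η x₀ y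
  exact ((continuous_ofReal.comp hρ).comp_continuousOn
    (chartAt (CV n) x₀).continuousOn_symm).mul h

theorem chartPartition_tsupport (x : X) :
    tsupport (chartPartition n X x) ⊆ (chartAt (CV n) x).source :=
  (exists_chartPartition n X).choose_spec x

theorem ContCompact.integrableOn {η : X → ℂ ⊗[ℝ] Lam n} (h : ContCompact η) (x : X) :
    IntegrableOn (locTop (fun p => chartPartition n X x p • η p) x)
      (chartAt (CV n) x).target := by
  obtain ⟨K, hK, h0⟩ := h.supp
  refine integrableOn_of_compact
    (continuousOn_locTop_smul (chartPartition n X x).continuous (h.cont x))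
    (hK.inter_right (isClosed_tsupport (chartPartition n X x)))
    (Set.inter_subset_right.trans (chartPartition_tsupport x)) fun y _ hy => ?_
  refine locTop_eq_zero ?_
  rw [Set.mem_inter_iff, not_and_or] at hy
  rcases hy with hy | hy
  · simp only [h0 _ hy, smul_zero]
  · simp only [image_eq_zero_of_notMem_tsupport hy, zero_smul]

theorem ContCompact.finite_support {η : X → ℂ ⊗[ℝ] Lam n} (h : ContCompact η) :
    (Function.support fun x => ∫ y in (chartAt (CV n) x).target,
      locTop (fun p => chartPartition n X x p • η p) x y).Finite := by
  obtain ⟨K, hK, h0⟩ := h.supp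
  refine (finite_chartPartition (n := n) hK).subset fun x hx => ?_
  by_contra hn
  refine hx ?_
  have : ∀ y, locTop (fun p => chartPartition n X x p • η p) x y = 0 := by
    refine fun y => locTop_eq_zero ?_
    by_cases hy : (chartAt (CV n) x).symm y ∈ K
    · have : chartPartition n X x ((chartAt (CV n) x).symm y) = 0 := by
        by_contra h1
        exact hn ⟨_, hy, h1⟩
      simp only [this, zero_smul]
    · simp only [h0 _ hy, smul_zero]
  simp only [this, integral_zero]

theorem integral_form_add {η η' : X → ℂ ⊗[ℝ] Lam n} (h : ContCompact η) (h' : ContCompact η') :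
    integral (η + η') = integral η + integral η' := by
  rw [integral_eq_finsum, integral_eq_finsum, integral_eq_finsum,
    ← finsum_add_distrib h.finite_support h'.finite_support]
  refine finsum_congr fun x => ?_
  rw [← integral_add (h.integrableOn x) (h'.integrableOn x)]
  congr 1
  funext y
  rw [← locTop_add]
  congr 1
  funext p
  exact smul_add _ _ _

theorem integral_form_zero : integral (0 : X → ℂ ⊗[ℝ] Lam n) = 0 := by
  rw [integral_eq_finsum]
  refine (finsum_congr fun x => ?_).trans finsum_zero
  have : ∀ y, locTop (fun p => chartPartition n X x p • (0 : X → ℂ ⊗[ℝ] Lam n) p) x y = 0 :=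
    fun y => locTop_eq_zero (smul_zero _)
  simp only [this, integral_zero]

theorem integral_form_congr {η η' : X → ℂ ⊗[ℝ] Lam n}
    (h : ∀ x₀ : X, ∀ y ∈ (chartAt (CV n) x₀).target, locTop η x₀ y = locTop η' x₀ y) :
    integral η = integral η' := by
  rw [integral_eq_finsum, integral_eq_finsum]
  refine finsum_congr fun x => setIntegral_congr_fun
    (chartAt (CV n) x).open_target.measurableSet fun y hy => ?_
  simp only [locTop_smul, h x y hy]

/-- The integral of a form supported in the domain of a chart. -/
theorem integral_eq_setIntegral [IsManifold 𝓘(ℂ, CV n) ω X] {η : X → ℂ ⊗[ℝ] Lam n} {x₀ : X}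
    (h : ContinuousOn (locTop η x₀) (chartAt (CV n) x₀).target) {K : Set X} (hK : IsCompact K)
    (hKs : K ⊆ (chartAt (CV n) x₀).source) (h0 : ∀ p ∉ K, η p = 0) :
    integral η = ∫ y in (chartAt (CV n) x₀).target, locTop η x₀ y := by
  classical
  -- Each piece is supported both in the chart at `x` and in the one at `x₀`, so all integrals can
  -- be taken at `x₀`, where the partition of unity sums to one on `K`.
  have e1 : ∀ x, ∫ y in (chartAt (CV n) x).target,
      locTop (fun p => chartPartition n X x p • η p) x y =
      ∫ y in (chartAt (CV n) x₀).target,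
        locTop (fun p => chartPartition n X x p • η p) x₀ y := by
    intro x
    refine setIntegral_locTop_eq (fun p hp => ?_) fun p hp => ?_
    · rw [h0 p fun hp' => hp (hKs hp'), smul_zero]
    · rw [image_eq_zero_of_notMem_tsupport fun hp' => hp (chartPartition_tsupport x hp'),
        zero_smul]
  rw [integral_eq_finsum]
  simp only [e1]
  have hfin := finite_chartPartition (n := n) hK
  have hz : ∀ x ∉ hfin.toFinset, ∀ p, chartPartition n X x p • η p = 0 := by
    intro x hx p
    by_cases hp : p ∈ K
    · have : chartPartition n X x p = 0 := by
        by_contra h1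
        exact hx (hfin.mem_toFinset.2 ⟨p, hp, h1⟩)
      rw [this, zero_smul]
    · rw [h0 p hp, smul_zero]
  rw [finsum_eq_sum_of_support_subset (s := hfin.toFinset)]
  · rw [← integral_finsetSum]
    · refine setIntegral_congr_fun (chartAt (CV n) x₀).open_target.measurableSet fun y hy => ?_
      simp only [locTop_smul]
      rw [← Finset.sum_mul]
      by_cases hp : (chartAt (CV n) x₀).symm y ∈ K
      · have h1 : ∑ x ∈ hfin.toFinset, chartPartition n X x ((chartAt (CV n) x₀).symm y) = 1 := by
          rw [← (chartPartition n X).sum_eq_one (Set.mem_univ ((chartAt (CV n) x₀).symm y))]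
          refine (finsum_eq_sum_of_support_subset _ fun x hx => ?_).symm
          exact hfin.mem_toFinset.2 ⟨_, hp, hx⟩
        rw [← Complex.ofReal_sum, h1, Complex.ofReal_one, one_mul]
      · rw [locTop_eq_zero (h0 _ hp), mul_zero]
    · intro x _
      refine integrableOn_of_compact (continuousOn_locTop_smul
        (chartPartition n X x).continuous h) hK hKs fun y _ hy => locTop_eq_zero ?_
      simp only [h0 _ hy, smul_zero]
  · intro x hx
    by_contra hn
    refine hx ?_
    have : ∀ y, locTop (fun p => chartPartition n X x p • η p) x₀ y = 0 :=
      fun y => locTop_eq_zero (hz x hn _)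
    simp only [this, integral_zero]

end Integral

end THodge
end

noncomputable section

namespace THodge

/-! ### Splitting off a complex coordinate -/

section Splitting

variable {n : ℕ}

/-- The coefficient of `dx₁ ∧ dy₁ ∧ ⋯ ∧ dxₙ ∧ dyₙ` in a real form. -/
def tau (n : ℕ) : Lam n →ₗ[ℝ] ℝ := evalForm (realFrame n)

/-- The projection `ℂⁿ⁺¹ → ℂⁿ` which forgets the first coordinate. -/
def forget (n : ℕ) : CV (n + 1) →ₗ[ℝ] CV n := LinearMap.funLeft ℝ ℂ Fin.succ

/-- The inclusion `ℂⁿ → ℂⁿ⁺¹` as the hyperplane where the first coordinate vanishes. -/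
def emb (n : ℕ) : CV n →ₗ[ℝ] CV (n + 1) where
  toFun v := Fin.cons 0 v
  map_add' v w := by
    ext j
    refine Fin.cases ?_ (fun i => ?_) j <;> simp
  map_smul' c v := by
    ext j
    refine Fin.cases ?_ (fun i => ?_) j <;> simp

/-- The pull back along the projection `ℂⁿ⁺¹ → ℂⁿ`. -/
abbrev up : Lam n →ₐ[ℝ] Lam (n + 1) := pb (forget n)

/-- The covector `dx` of the first coordinate. -/
abbrev X0 : Lam (n + 1) := ExteriorAlgebra.ι ℝ (dx 0)

/-- The covector `dy` of the first coordinate. -/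
abbrev Y0 : Lam (n + 1) := ExteriorAlgebra.ι ℝ (dy 0)

theorem forget_emb : forget n ∘ₗ emb n = LinearMap.id := by
  ext v
  rfl

theorem pb_emb_up (a : Lam n) : pb (emb n) (up a) = a := by
  rw [pb_comp, forget_emb, pb_id]

theorem par_up (a : Lam n) : par (n + 1) (up a) = up (par n a) := (pb_par _ _).symm

theorem mul_ι (l : Module.Dual ℝ (CV n)) (x : Lam n) :
    x * ExteriorAlgebra.ι ℝ l = ExteriorAlgebra.ι ℝ l * par n x := by
  rw [ι_mul_eq, par_par]

theorem up_mul_X (a : Lam n) : up a * X0 = X0 * up (par n a) := by rw [mul_ι, par_up]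

theorem up_mul_Y (a : Lam n) : up a * Y0 = Y0 * up (par n a) := by rw [mul_ι, par_up]

theorem Y_mul_X : (Y0 : Lam (n + 1)) * X0 = -(X0 * Y0) := by
  rw [mul_ι, par_ι, mul_neg]

/-- The form `a + dx ∧ b + dy ∧ c + dx ∧ dy ∧ e`. -/
def spl (a b c e : Lam n) : Lam (n + 1) := up a + X0 * up b + Y0 * up c + X0 * (Y0 * up e)

theorem spl_mul (a b c e a' b' c' e' : Lam n) :
    spl a b c e * spl a' b' c' e' = spl (a * a') (par n a * b' + b * a')
      (par n a * c' + c * a') (a * e' + par n b * c' - par n c * b' + e * a') := by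
  have h1 : ∀ (a : Lam n) z, up a * (X0 * z) = X0 * (up (par n a) * z) := fun a z => by
    rw [← mul_assoc, up_mul_X, mul_assoc]
  have h2 : ∀ (a : Lam n) z, up a * (Y0 * z) = Y0 * (up (par n a) * z) := fun a z => by
    rw [← mul_assoc, up_mul_Y, mul_assoc]
  have h3 : ∀ z : Lam (n + 1), Y0 * (X0 * z) = -(X0 * (Y0 * z)) := fun z => by
    rw [← mul_assoc, Y_mul_X, neg_mul, mul_assoc]
  have h4 : ∀ z : Lam (n + 1), X0 * (X0 * z) = 0 := fun z => by
    rw [← mul_assoc, ExteriorAlgebra.ι_sq_zero, zero_mul]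
  have h5 : ∀ z : Lam (n + 1), Y0 * (Y0 * z) = 0 := fun z => by
    rw [← mul_assoc, ExteriorAlgebra.ι_sq_zero, zero_mul]
  simp only [spl, mul_add, add_mul, mul_assoc, h1, h2, h3, h4, h5, par_par, map_add, map_sub,
    map_mul, mul_neg, neg_zero, mul_zero, mul_sub]
  abel

theorem covector_split (l : Module.Dual ℝ (CV (n + 1))) :
    ExteriorAlgebra.ι ℝ l = spl (ExteriorAlgebra.ι ℝ (l ∘ₗ emb n))
      (algebraMap ℝ _ (l (ex 0))) (algebraMap ℝ _ (l (ey 0))) 0 := by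
  have h : l = (l ∘ₗ emb n) ∘ₗ forget n + l (ex 0) • dx 0 + l (ey 0) • dy 0 := by
    refine LinearMap.ext fun v => ?_
    have hv : v = emb n (forget n v) + (v 0).re • ex 0 + (v 0).im • ey 0 := by
      ext j
      refine Fin.cases ?_ (fun i => ?_) j
      · simp [emb, ex, ey, re_add_im]
      · simp [emb, ex, ey, forget, LinearMap.funLeft_apply]
    conv_lhs => rw [hv]
    simp only [map_add, map_smul, LinearMap.add_apply, LinearMap.comp_apply,
      LinearMap.smul_apply, dx, dy, LinearMap.proj_apply, reLm_coe, imLm_coe, smul_eq_mul]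
    ring
  conv_lhs => rw [h]
  rw [spl, pb_ι, map_add, map_add, map_smul, map_smul, AlgHom.commutes, AlgHom.commutes,
    ← Algebra.commutes, ← Algebra.commutes, ← Algebra.smul_def, ← Algebra.smul_def, map_zero,
    mul_zero, mul_zero, add_zero]

/-- Forms of this shape include scalars and covectors and are closed under sums and, by `spl_mul`,
under products. -/
theorem exists_spl (u : Lam (n + 1)) : ∃ a b c e, u = spl a b c e := by
  induction u using ExteriorAlgebra.induction with
  | algebraMap s =>
    refine ⟨algebraMap ℝ _ s, 0, 0, 0, ?_⟩
    simp [spl]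
  | ι l => exact ⟨_, _, _, _, covector_split l⟩
  | mul u v hu hv =>
    obtain ⟨a, b, c, e, rfl⟩ := hu
    obtain ⟨a', b', c', e', rfl⟩ := hv
    exact ⟨_, _, _, _, spl_mul _ _ _ _ _ _ _ _⟩
  | add u v hu hv =>
    obtain ⟨a, b, c, e, rfl⟩ := hu
    obtain ⟨a', b', c', e', rfl⟩ := hv
    refine ⟨a + a', b + b', c + c', e + e', ?_⟩
    simp only [spl, map_add, mul_add]
    abel

/-- Expansion of the determinant along its first row: only the first entry survives, because `l`
vanishes on the other vectors. -/
theorem evalForm_cons {k : ℕ} (v : CV n) (w : Fin k → CV n) (l : Module.Dual ℝ (CV n))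
    (hl : ∀ i, l (w i) = 0) (a : Lam n) :
    evalForm (Fin.cons v w : Fin (k + 1) → CV n) (ExteriorAlgebra.ι ℝ l * a) =
      l v * evalForm w a := by
  rw [← sum_proj a, Finset.mul_sum, map_sum, map_sum, Finset.mul_sum]
  refine Finset.sum_congr rfl fun j _ => ?_
  by_cases hj : j = k
  · subst hj
    refine lamDeg_induction (proj_mem j a) (p := fun a =>
      evalForm (Fin.cons v w : Fin (j + 1) → CV n) (ExteriorAlgebra.ι ℝ l * a) =
      l v * evalForm w a) ?_ ?_ ?_ ?_
    · intro x
      have e : ExteriorAlgebra.ι ℝ l * ExteriorAlgebra.ιMulti ℝ j x =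
          ExteriorAlgebra.ιMulti ℝ (j + 1) (Fin.cons l x : Fin (j + 1) → _) := by
        rw [ExteriorAlgebra.ιMulti_succ_apply]
        rfl
      rw [e, evalForm_ιMulti, evalForm_ιMulti, Matrix.det_succ_row_zero, Fin.sum_univ_succ]
      have h0 : ∀ i : Fin j, (Matrix.of fun a b => (Fin.cons l x : Fin (j + 1) → _) a
          ((Fin.cons v w : Fin (j + 1) → CV n) b)) 0 i.succ = 0 := fun i => by
        simp [hl]
      simp only [h0, mul_zero, zero_mul, Finset.sum_const_zero, add_zero]
      simp only [Matrix.of_apply, Fin.cons_zero, Fin.val_zero, pow_zero, one_mul]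
      congr 1
    · simp
    · intro a b ha hb
      rw [mul_add, map_add, map_add, ha, hb, mul_add]
    · intro c a ha
      rw [mul_smul_comm, map_smul, map_smul, ha, smul_eq_mul, smul_eq_mul]
      ring
  · have h1 : ExteriorAlgebra.ι ℝ l * proj n j a ∈ LamDeg n (1 + j) :=
      mul_mem_lamDeg (ι_mem_lamDeg l) (proj_mem j a)
    rw [evalForm_of_mem_ne _ h1 (by omega), evalForm_of_mem_ne _ (proj_mem j a) hj, mul_zero]

theorem evalForm_cast {k k' : ℕ} (h : k' = k) (v : Fin k → CV n) (a : Lam n) :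
    evalForm v a = evalForm (fun i : Fin k' => v (Fin.cast h i)) a := by
  subst h
  rfl

theorem realFrame_succ (i : Fin (n * 2 + 2)) :
    realFrame (n + 1) (Fin.cast (by ring) i) =
      (Fin.cons (ex 0) (Fin.cons (ey 0) fun j => emb n (realFrame n j) :
        Fin (n * 2 + 1) → CV (n + 1)) : Fin (n * 2 + 2) → CV (n + 1)) i := by
  have key : ∀ (i : Fin (n * 2 + 2)) (b : Fin (n + 1) × Fin 2), (i : ℕ) = b.2 + 2 * b.1 →
      realFrame (n + 1) (Fin.cast (by ring) i) = fr b := by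
    intro i b hb
    rw [realFrame_eq]
    congr 1
    rw [Equiv.symm_apply_eq]
    apply Fin.ext
    simp [finProdFinEquiv, hb]
  refine Fin.cases ?_ (fun i => ?_) i
  · rw [key 0 (0, 0) (by simp)]
    simp [fr]
  refine Fin.cases ?_ (fun j => ?_) i
  · rw [key _ (0, 1) (by simp)]
    simp [fr]
  · rw [key _ ((finProdFinEquiv.symm j).1.succ, (finProdFinEquiv.symm j).2)]
    · simp only [Fin.cons_succ]
      rw [realFrame_eq]
      generalize finProdFinEquiv.symm j = b
      obtain ⟨b, s⟩ := b
      ext t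
      by_cases hs : s = 0
      · subst hs
        refine Fin.cases ?_ (fun t => ?_) t <;>
          simp [fr, emb, ex, Pi.single_apply]
      · refine Fin.cases ?_ (fun t => ?_) t <;>
          simp [fr, emb, ey, Pi.single_apply, hs]
    · have h := congrArg Fin.val (finProdFinEquiv.apply_symm_apply j)
      simp only [finProdFinEquiv, Equiv.coe_fn_mk] at h
      simp only [Fin.val_succ]
      have h' : ((finProdFinEquiv.symm j).2 : ℕ) + 2 * (finProdFinEquiv.symm j).1 = j := h
      omega

theorem tau_of_mem_ne {k : ℕ} {a : Lam n} (ha : a ∈ LamDeg n k) (h : k ≠ 2 * n) : tau n a = 0 :=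
  evalForm_of_mem_ne _ ha (by omega)

theorem tau_XY (a : Lam (n + 1)) : tau (n + 1) (X0 * (Y0 * a)) = tau n (pb (emb n) a) := by
  rw [tau, evalForm_cast (show n * 2 + 2 = (n + 1) * 2 by ring), funext realFrame_succ,
    evalForm_cons, evalForm_cons, tau, evalForm_pb]
  · simp [dx, dy, ex, ey]
  · intro i
    simp [dy, emb]
  · intro i
    refine Fin.cases ?_ (fun j => ?_) i
    · simp [dx, ey]
    · simp [dx, emb]

/-- The components other than `dx ∧ dy ∧ e` have degree at most `2 n + 1`, below the top degree `2 n
+ 2`. -/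
theorem tau_spl (a b c e : Lam n) : tau (n + 1) (spl a b c e) = tau n e := by
  have h1 : tau (n + 1) (up a) = 0 := by
    rw [← sum_proj a, map_sum, map_sum]
    refine Finset.sum_eq_zero fun k hk => tau_of_mem_ne (pb_mem _ (proj_mem k a)) ?_
    rw [Finset.mem_range] at hk
    omega
  have h2 : ∀ (l : Module.Dual ℝ (CV (n + 1))) (b : Lam n),
      tau (n + 1) (ExteriorAlgebra.ι ℝ l * up b) = 0 := by
    intro l b
    rw [← sum_proj b, map_sum, Finset.mul_sum, map_sum]
    refine Finset.sum_eq_zero fun k hk => tau_of_mem_ne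
      (mul_mem_lamDeg (ι_mem_lamDeg l) (pb_mem _ (proj_mem k b))) ?_
    rw [Finset.mem_range] at hk
    omega
  rw [spl, map_add, map_add, map_add, h1, h2, h2, tau_XY, pb_emb_up, add_zero, zero_add, zero_add]

theorem tau_zero_nondeg {x : Lam 0} (h : tau 0 x = 0) : x = 0 := by
  have hx : x ∈ LamDeg 0 0 := by
    rw [← sum_proj x]
    simpa using proj_mem 0 x
  have key : x = tau 0 x • (1 : Lam 0) := by
    refine lamDeg_induction hx (p := fun x => x = tau 0 x • (1 : Lam 0)) ?_ ?_ ?_ ?_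
    · intro v
      have : tau 0 (ExteriorAlgebra.ιMulti ℝ 0 v) = 1 := by
        rw [tau]
        refine (evalForm_ιMulti (k := 0) _ v).trans ?_
        simp
      rw [this, one_smul]
      simp [ExteriorAlgebra.ιMulti_apply]
    · simp
    · intro a b ha hb
      rw [map_add, add_smul, ← ha, ← hb]
    · intro c a ha
      rw [map_smul, smul_eq_mul, mul_smul, ← ha]
  rw [key, h, zero_smul]

/-- The wedge pairing is nondegenerate. -/
theorem wedge_nondeg : ∀ {n : ℕ} {x : Lam n}, (∀ v, tau n (x * v) = 0) → x = 0
  | 0, x, h => tau_zero_nondeg (by simpa using h 1)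
  | n + 1, x, h => by
    obtain ⟨a, b, c, e, rfl⟩ := exists_spl x
    have hp : ∀ {b : Lam n}, par n b = 0 → b = 0 := fun {b} hb => by
      rw [← par_par b, hb, map_zero]
    -- Each component is isolated by multiplying with a form whose only component is the
    -- complementary one.
    have ha : a = 0 := wedge_nondeg fun v => by
      simpa [spl_mul, tau_spl] using h (spl 0 0 0 v)
    have hb : b = 0 := hp (wedge_nondeg fun v => by
      simpa [spl_mul, tau_spl] using h (spl 0 0 v 0))
    have hc : c = 0 := hp (wedge_nondeg fun v => by
      simpa [spl_mul, tau_spl] using h (spl 0 v 0 0))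
    have he : e = 0 := wedge_nondeg fun v => by
      simpa [spl_mul, tau_spl] using h (spl v 0 0 0)
    rw [ha, hb, hc, he]
    simp [spl]

/-- Uniqueness of the four components, again by pairing with the complementary one. It allows
equations in dimension `n + 1` to be read as four equations in dimension `n`. -/
theorem spl_eq_zero {a b c e : Lam n} (h : spl a b c e = 0) : a = 0 ∧ b = 0 ∧ c = 0 ∧ e = 0 := by
  have hp : ∀ {b : Lam n}, par n b = 0 → b = 0 := fun {b} hb => by
    rw [← par_par b, hb, map_zero]
  have h' : ∀ x, tau (n + 1) (spl a b c e * x) = 0 := fun x => by rw [h, zero_mul, map_zero]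
  refine ⟨wedge_nondeg fun v => ?_, hp (wedge_nondeg fun v => ?_), hp (wedge_nondeg fun v => ?_),
    wedge_nondeg fun v => ?_⟩
  · simpa [spl_mul, tau_spl] using h' (spl 0 0 0 v)
  · simpa [spl_mul, tau_spl] using h' (spl 0 0 v 0)
  · simpa [spl_mul, tau_spl] using h' (spl 0 v 0 0)
  · simpa [spl_mul, tau_spl] using h' (spl v 0 0 0)

theorem weil_spl (a b c e : Lam n) : weilLam (n + 1) (spl a b c e) =
    spl (weilLam n a) (weilLam n c) (-weilLam n b) (weilLam n e) := by
  have hu : ∀ a : Lam n, weilLam (n + 1) (up a) = up (weilLam n a) := fun a => by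
    rw [weilLam_eq, weilLam_eq, pb_comp, pb_comp]
    rfl
  have hx : weilLam (n + 1) X0 = -Y0 := by
    rw [weilLam_eq, pb_ι, ← map_neg]
    congr 1
    ext v
    simp [dx, dy, mulI_apply]
  have hy : weilLam (n + 1) Y0 = X0 := by
    rw [weilLam_eq, pb_ι]
    congr 1
    ext v
    simp [dx, dy, mulI_apply]
  simp only [spl, map_add, map_mul, hu, hx, hy, map_neg, mul_neg, neg_mul]
  rw [← mul_assoc Y0 X0, Y_mul_X, neg_mul, neg_neg, mul_assoc]
  abel

end Splitting

end THodge
end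

noncomputable section

namespace THodge

/-! ### The Hodge–Riemann relations for the standard form -/

section IntegerGrading

variable {n : ℕ} {k l : ℤ}

/-- Homogeneous forms of integer degree; there are no nonzero forms of negative degree. -/
def LZ (n : ℕ) (k : ℤ) : Submodule ℝ (Lam n) where
  carrier := {u | ∀ j : ℕ, (j : ℤ) ≠ k → proj n j u = 0}
  add_mem' hu hv j hj := by rw [map_add, hu j hj, hv j hj, add_zero]
  zero_mem' j _ := map_zero _
  smul_mem' c u hu j hj := by rw [map_smul, hu j hj, smul_zero]

theorem mem_LZ {k : ℕ} {u : Lam n} : u ∈ LZ n k ↔ u ∈ LamDeg n k := by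
  constructor
  · intro h
    rw [← sum_proj u]
    refine Submodule.sum_mem _ fun j _ => ?_
    by_cases hj : j = k
    · rw [hj]
      exact proj_mem k u
    · rw [h j (by exact_mod_cast hj)]
      exact Submodule.zero_mem _
  · intro h j hj
    exact proj_of_mem_ne h fun e => hj (by rw [e])

theorem LZ_cases {u : Lam n} (hu : u ∈ LZ n k) :
    u = 0 ∨ ∃ j : ℕ, k = j ∧ j ≤ 2 * n ∧ u ∈ LamDeg n j := by
  by_cases h : 0 ≤ k ∧ k ≤ 2 * n
  · refine Or.inr ⟨k.toNat, (Int.toNat_of_nonneg h.1).symm, by omega, ?_⟩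
    rw [← mem_LZ, Int.toNat_of_nonneg h.1]
    exact hu
  · left
    rw [← sum_proj u]
    refine Finset.sum_eq_zero fun j hj => hu j ?_
    rw [Finset.mem_range] at hj
    omega

theorem mul_mem_LZ {a b : Lam n} (ha : a ∈ LZ n k) (hb : b ∈ LZ n l) : a * b ∈ LZ n (k + l) := by
  rcases LZ_cases ha with rfl | ⟨i, rfl, -, ha⟩
  · rw [zero_mul]
    exact Submodule.zero_mem _
  rcases LZ_cases hb with rfl | ⟨j, rfl, -, hb⟩
  · rw [mul_zero]
    exact Submodule.zero_mem _
  rw [← Nat.cast_add, mem_LZ]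
  exact mul_mem_lamDeg ha hb

theorem pb_mem_LZ {m : ℕ} (A : CV m →ₗ[ℝ] CV n) {a : Lam n} (ha : a ∈ LZ n k) :
    pb A a ∈ LZ m k := fun j hj => by rw [proj_pb, ha j hj, map_zero]

theorem weil_mem_LZ {a : Lam n} (ha : a ∈ LZ n k) : weilLam n a ∈ LZ n k := pb_mem_LZ _ ha

/-- The sign `(-1)^k`. -/
def psgn (k : ℤ) : ℝ := if k % 2 = 0 then 1 else -1

/-- The sign `(-1)^{k (k + 1) / 2}`. -/
def ssgn (k : ℤ) : ℝ := if k % 4 = 0 ∨ k % 4 = 3 then 1 else -1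

theorem ssgn_sub_two (k : ℤ) : ssgn (k - 2) = -ssgn k := by
  unfold ssgn
  split_ifs <;> first | omega | norm_num

theorem ssgn_mul_psgn (k : ℤ) : ssgn k * -psgn (k - 1) = ssgn (k - 1) := by
  unfold ssgn psgn
  split_ifs <;> first | omega | norm_num

theorem psgn_mul_self (k : ℤ) : psgn k * psgn k = 1 := by
  unfold psgn
  split_ifs <;> norm_num

theorem ssgn_mul_self (k : ℤ) : ssgn k * ssgn k = 1 := by
  unfold ssgn
  split_ifs <;> norm_num

theorem par_LZ {a : Lam n} (ha : a ∈ LZ n k) : par n a = psgn k • a := by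
  rcases LZ_cases ha with rfl | ⟨i, rfl, -, ha⟩
  · simp
  · rw [par_eq ha]
    congr 1
    unfold psgn
    split_ifs with h
    · exact (Nat.even_iff.2 (by omega)).neg_one_pow
    · exact (Nat.odd_iff.2 (by omega)).neg_one_pow

theorem tau_LZ_ne {a : Lam n} (ha : a ∈ LZ n k) (hk : k ≠ 2 * n) : tau n a = 0 := by
  rcases LZ_cases ha with rfl | ⟨i, rfl, -, ha⟩
  · exact map_zero _
  · exact tau_of_mem_ne ha (by omega)

/-- Poincaré duality for homogeneous forms. -/
theorem wedge_nondeg_LZ {x : Lam n} (hx : x ∈ LZ n k)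
    (h : ∀ v ∈ LZ n (2 * n - k), tau n (x * v) = 0) : x = 0 := by
  refine wedge_nondeg fun v => ?_
  rw [← sum_proj v, Finset.mul_sum, map_sum]
  refine Finset.sum_eq_zero fun j _ => ?_
  have hj : proj n j v ∈ LZ n j := mem_LZ.2 (proj_mem j v)
  by_cases e : (j : ℤ) = 2 * n - k
  · exact h _ (e ▸ hj)
  · exact tau_LZ_ne (mul_mem_LZ hx hj) (by omega)

/-- Injective multiplication operators between forms of complementary degree are surjective. -/
theorem exists_mul_eq {M : ℕ} {Ω : Lam n} (hΩ : Ω ∈ LamDeg n (2 * M)) (hk : k + M = n)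
    (hinj : ∀ u ∈ LZ n k, Ω * u = 0 → u = 0) {y : Lam n} (hy : y ∈ LZ n (k + 2 * M)) :
    ∃ x ∈ LZ n k, Ω * x = y := by
  rcases LZ_cases hy with rfl | ⟨i, hi, h2, hy⟩
  · exact ⟨0, Submodule.zero_mem _, mul_zero _⟩
  obtain ⟨j, rfl⟩ : ∃ j : ℕ, k = j := ⟨k.toNat, by omega⟩
  have hi : i = 2 * M + j := by omega
  subst hi
  let f : LamDeg n j →ₗ[ℝ] LamDeg n (2 * M + j) :=
    (LinearMap.mulLeft ℝ Ω ∘ₗ (LamDeg n j).subtype).codRestrict _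
      fun x => mul_mem_lamDeg hΩ x.2
  have hf : Function.Injective f := by
    rw [injective_iff_map_eq_zero]
    intro x hx
    exact Subtype.ext (hinj x (mem_LZ.2 x.2) (congrArg Subtype.val hx))
  -- The degrees `j` and `2 M + j` add up to `2 n`, so the two spaces have equal dimension.
  have hd : Module.finrank ℝ (LamDeg n j) = Module.finrank ℝ (LamDeg n (2 * M + j)) := by
    rw [finrank_lamDeg, finrank_lamDeg]
    exact (Nat.choose_symm_of_eq_add (by omega))
  obtain ⟨x, hx⟩ := (LinearMap.injective_iff_surjective_of_finrank_eq_finrank hd).1 hf ⟨y, hy⟩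
  exact ⟨x, mem_LZ.2 x.2, congrArg Subtype.val hx⟩

end IntegerGrading

section Standard

variable {n : ℕ}

/-- The standard Kähler form `∑ dx_j ∧ dy_j`. -/
def stdForm (n : ℕ) : Lam n := ∑ j, ExteriorAlgebra.ι ℝ (dx j) * ExteriorAlgebra.ι ℝ (dy j)

theorem stdForm_succ : stdForm (n + 1) = spl (stdForm n) 0 0 1 := by
  have h : up (stdForm n) = ∑ j : Fin n, ExteriorAlgebra.ι ℝ (dx j.succ) *
      ExteriorAlgebra.ι ℝ (dy j.succ) := by
    rw [stdForm, map_sum]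
    refine Finset.sum_congr rfl fun j _ => ?_
    rw [map_mul, pb_ι, pb_ι]
    rfl
  rw [stdForm, Fin.sum_univ_succ, spl, ← h]
  simp [add_comm]

theorem ι_mul_ι_mem (l l' : Module.Dual ℝ (CV n)) :
    ExteriorAlgebra.ι ℝ l * ExteriorAlgebra.ι ℝ l' ∈ LamDeg n 2 :=
  mul_mem_lamDeg (ι_mem_lamDeg l) (ι_mem_lamDeg l')

theorem stdForm_mem : stdForm n ∈ LamDeg n 2 := Submodule.sum_mem _ fun _ _ => ι_mul_ι_mem _ _

theorem pow_mem_lamDeg {a : Lam n} {d : ℕ} (ha : a ∈ LamDeg n d) (N : ℕ) :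
    a ^ N ∈ LamDeg n (d * N) := by
  induction N with
  | zero => simpa using one_mem_lamDeg
  | succ N ih =>
    rw [pow_succ]
    exact mul_mem_lamDeg ih ha

theorem weil_stdForm : weilLam n (stdForm n) = stdForm n := by
  rw [stdForm, map_sum]
  refine Finset.sum_congr rfl fun j _ => ?_
  have hx : dx j ∘ₗ mulI n = -dy j := by
    ext v
    simp [dx, dy, mulI_apply]
  have hy : dy j ∘ₗ mulI n = dx j := by
    ext v
    simp [dx, dy, mulI_apply]
  rw [weilLam_eq, map_mul, pb_ι, pb_ι, hx, hy, map_neg, neg_mul, ι_mul_eq, par_ι, neg_mul, neg_neg]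

/-- The binomial formula stops after two terms because `dx ∧ dy` has square zero. For `N = 0` the
truncated exponent `N - 1` is harmless, its coefficient being zero. -/
theorem stdForm_pow (N : ℕ) : stdForm (n + 1) ^ N =
    spl (stdForm n ^ N) 0 0 ((N : ℝ) • stdForm n ^ (N - 1)) := by
  induction N with
  | zero => simp [spl]
  | succ N ih =>
    rw [pow_succ, ih, stdForm_succ, spl_mul]
    have h : (N : ℝ) • stdForm n ^ (N - 1) * stdForm n = (N : ℝ) • stdForm n ^ N := by
      cases N with
      | zero => simp
      | succ N => rw [smul_mul_assoc, Nat.add_sub_cancel, pow_succ]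
    simp only [map_zero, zero_mul, mul_zero, add_zero, mul_one, sub_zero, h]
    rw [← pow_succ, Nat.add_sub_cancel, add_comm (stdForm n ^ N)]
    push_cast
    rw [add_smul, one_smul]

/-- The components of a homogeneous form are homogeneous. -/
theorem exists_spl_LZ {k : ℤ} {u : Lam (n + 1)} (hu : u ∈ LZ (n + 1) k) :
    ∃ a ∈ LZ n k, ∃ b ∈ LZ n (k - 1), ∃ c ∈ LZ n (k - 1), ∃ e ∈ LZ n (k - 2),
      u = spl a b c e := by
  have hm : ∀ (j : ℕ) (a : Lam n) {k : ℤ}, (j : ℤ) = k → proj n j a ∈ LZ n k := fun j a k h =>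
    h ▸ mem_LZ.2 (proj_mem j a)
  have h0 : ∀ k : ℤ, (0 : Lam n) ∈ LZ n k := fun k => Submodule.zero_mem _
  rcases LZ_cases hu with rfl | ⟨i, rfl, -, hu⟩
  · exact ⟨0, h0 _, 0, h0 _, 0, h0 _, 0, h0 _, by simp [spl]⟩
  obtain ⟨a, b, c, e, rfl⟩ := exists_spl u
  have hX : (X0 : Lam (n + 1)) ∈ LamDeg (n + 1) 1 := ι_mem_lamDeg _
  have hY : (Y0 : Lam (n + 1)) ∈ LamDeg (n + 1) 1 := ι_mem_lamDeg _
  have hXY : (X0 : Lam (n + 1)) * Y0 ∈ LamDeg (n + 1) 2 := ι_mul_ι_mem _ _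
  have e1 : ∀ {l} {x : Lam (n + 1)}, x ∈ LamDeg (n + 1) l → ∀ b j,
      proj (n + 1) (l + j) (x * up b) = x * up (proj n j b) := fun hx b j => by
    rw [proj_mul hx, proj_pb]
  have e0 : ∀ {l} {x : Lam (n + 1)}, x ∈ LamDeg (n + 1) l → ∀ (b : Lam n) j, j < l →
      proj (n + 1) j (x * up b) = 0 := fun {l} {x} hx b j hj => by
    rw [← sum_proj b, map_sum, Finset.mul_sum, map_sum]
    exact Finset.sum_eq_zero fun i _ => proj_of_mem_ne
      (mul_mem_lamDeg hx (pb_mem _ (proj_mem i b))) (by omega)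
  rw [← proj_of_mem hu, spl, map_add, map_add, map_add, ← mul_assoc, proj_pb]
  -- In degrees `0` and `1` some components would have negative degree; they are taken to be zero.
  match i with
  | 0 =>
    refine ⟨proj n 0 a, hm _ _ rfl, 0, h0 _, 0, h0 _, 0, h0 _, ?_⟩
    rw [e0 hX _ _ (by omega), e0 hY _ _ (by omega), e0 hXY _ _ (by omega)]
    simp [spl]
  | 1 =>
    refine ⟨proj n 1 a, hm _ _ rfl, proj n 0 b, hm _ _ (by simp), proj n 0 c, hm _ _ (by simp),
      0, h0 _, ?_⟩
    have q1 : proj (n + 1) 1 (X0 * up b) = X0 * up (proj n 0 b) := e1 hX b 0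
    have q2 : proj (n + 1) 1 (Y0 * up c) = Y0 * up (proj n 0 c) := e1 hY c 0
    rw [q1, q2, e0 hXY _ _ (by omega)]
    simp [spl]
  | j + 2 =>
    refine ⟨proj n (j + 2) a, hm _ _ rfl, proj n (j + 1) b, hm _ _ (by push_cast; ring),
      proj n (j + 1) c, hm _ _ (by push_cast; ring), proj n j e, hm _ _ (by push_cast; ring), ?_⟩
    have q1 := e1 hX b (j + 1)
    have q2 := e1 hY c (j + 1)
    have q3 := e1 hXY e j
    rw [show 1 + (j + 1) = j + 2 by ring] at q1 q2
    rw [add_comm 2 j] at q3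
    rw [q1, q2, q3, spl, mul_assoc]

theorem lam_zero_eq (x : Lam 0) : x = tau 0 x • (1 : Lam 0) := by
  have h1 : tau 0 (1 : Lam 0) = 1 := by
    have e : (1 : Lam 0) = ExteriorAlgebra.ιMulti ℝ 0 ![] := by simp [ExteriorAlgebra.ιMulti_apply]
    rw [e, tau]
    refine (evalForm_ιMulti (k := 0) _ _).trans ?_
    simp
  refine sub_eq_zero.1 (tau_zero_nondeg ?_)
  rw [map_sub, map_smul, h1, smul_eq_mul, mul_one, sub_self]

theorem central_mul_left {w : Lam n} (hw : ∀ x, w * x = x * w) (x y : Lam n) (M : ℕ) :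
    w * x * y * w ^ M = x * y * w ^ (M + 1) := by
  rw [mul_assoc w, hw, mul_assoc _ w, ← pow_succ']

theorem central_mul_right {w : Lam n} (hw : ∀ x, w * x = x * w) (x y : Lam n) (M : ℕ) :
    x * (w * y) * w ^ M = x * y * w ^ (M + 1) := by
  rw [hw y, ← mul_assoc, mul_assoc _ w, ← pow_succ']

/-- The Hodge–Riemann relations for the standard form. -/
theorem hodgeRiemann_std : ∀ (n : ℕ) (k : ℤ) (N : ℕ), k + N = n → ∀ u ∈ LZ n k, u ≠ 0 →
    stdForm n ^ (N + 1) * u = 0 → 0 < ssgn k * tau n (u * weilLam n u * stdForm n ^ N)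
  | 0, k, N, hk, u, hu, h0, _ => by
    rcases LZ_cases hu with rfl | ⟨i, rfl, hi, -⟩
    · exact absurd rfl h0
    obtain rfl : i = 0 := by omega
    obtain rfl : N = 0 := by omega
    have h1 : tau 0 u ≠ 0 := fun h => h0 (tau_zero_nondeg h)
    have hs : ssgn ((0 : ℕ) : ℤ) = 1 := by simp [ssgn]
    have h2 : tau 0 (1 : Lam 0) = 1 := by
      have := congrArg (tau 0) (lam_zero_eq u)
      rw [map_smul, smul_eq_mul] at this
      exact mul_left_cancel₀ h1 (by rw [← this, mul_one])
    rw [hs, one_mul, pow_zero, mul_one, lam_zero_eq u, map_smul, map_one, smul_mul_smul_comm,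
      map_smul, mul_one, h2, smul_eq_mul, mul_one]
    exact mul_self_pos.2 h1
  | n + 1, k, N, hk, u, hu, h0, hp => by
    obtain ⟨a, ha, b, hb, c, hc', e, he, rfl⟩ := exists_spl_LZ hu
    have ih := hodgeRiemann_std n
    have w2 : stdForm n ∈ LamDeg n 2 := stdForm_mem
    have wJ : weilLam n (stdForm n) = stdForm n := weil_stdForm
    have hpow := stdForm_pow (n := n) N
    -- With `w` the standard form in dimension `n`, primitivity splits into `w^(N+1) a = 0`,
    -- `w^(N+1) b = 0`, `w^(N+1) c = 0` and `w^(N+1) e + (N+1) w^N a = 0`. Thus `b` and `c` are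
    -- primitive, while `a` and `e` are coupled.
    rw [stdForm_pow, spl_mul] at hp
    simp only [map_zero, zero_mul, add_zero, sub_zero] at hp
    obtain ⟨pa, pb', pc, pe⟩ := spl_eq_zero hp
    clear hp
    generalize stdForm n = w at *
    have hc : ∀ x, w * x = x * w := fun x => mul_comm_of_two w2 x
    have hcomm : ∀ (M : ℕ) (x : Lam n), x * w ^ M = w ^ M * x := fun M x =>
      ((Commute.pow_left (hc x) M)).symm
    have hpar : ∀ M x, par n (w ^ M) * x = w ^ M * x := by
      intro M x
      rw [par_eq (pow_mem_lamDeg w2 M), pow_mul]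
      simp
    rw [hpar] at pb' pc
    rw [Nat.add_sub_cancel] at pe
    have hJw : ∀ (M : ℕ) x, weilLam n (w ^ M * x) = w ^ M * weilLam n x := fun M x => by
      rw [map_mul, map_pow, wJ]
    -- the hard Lefschetz theorem in degree `k - 2`
    have hinj : ∀ x ∈ LZ n (k - 2), w ^ (N + 1) * x = 0 → x = 0 := by
      intro x hx h
      by_contra hne
      have h1 := ih (k - 2) (N + 1) (by push_cast at hk ⊢; linarith) x hx hne
        (by rw [pow_succ', mul_assoc, h, mul_zero])
      have h2 : x * weilLam n x * w ^ (N + 1) = 0 := by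
        rw [mul_assoc, hcomm, ← hJw, h, map_zero, mul_zero]
      rw [h2, map_zero, mul_zero] at h1
      exact lt_irrefl _ h1
    have hwN : ∀ M, w ^ M ∈ LZ n (2 * M : ℕ) := fun M => mem_LZ.2 (pow_mem_lamDeg w2 M)
    -- Lefschetz decomposition `a = a0 + w a1`. The part `a1` solves `w^(N+1) a1 = w^N a`, which is
    -- possible by hard Lefschetz in degree `k - 2`; then `w^N a0 = 0` and `w^(N+2) a1 = 0`, so both
    -- are primitive in dimension `n`.
    obtain ⟨a1, ha1, h1⟩ := exists_mul_eq (k := k - 2) (M := N + 1)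
      (pow_mem_lamDeg w2 (N + 1)) (by push_cast at hk ⊢; linarith) hinj
      (y := w ^ N * a) (by
        have := mul_mem_LZ (hwN N) ha
        convert this using 1
        push_cast
        ring)
    have ha1' : w * a1 ∈ LZ n k := by
      have := mul_mem_LZ (mem_LZ.2 w2) ha1
      convert this using 1
      push_cast
      ring
    set a0 := a - w * a1 with ha0
    have ha0m : a0 ∈ LZ n k := Submodule.sub_mem _ ha ha1'
    have p0 : w ^ N * a0 = 0 := by
      rw [ha0, mul_sub, ← mul_assoc, ← pow_succ, h1, sub_self]
    have p1 : w ^ (N + 2) * a1 = 0 := by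
      rw [pow_succ', mul_assoc, h1, ← mul_assoc, ← pow_succ', pa]
    -- The fourth equation says `w^(N+1) (e + (N+1) a1) = 0`, so injectivity in degree `k - 2`
    -- determines `e`.
    have he1 : e = -((N : ℝ) + 1) • a1 := by
      refine sub_eq_zero.1 (hinj _ (Submodule.sub_mem _ he (Submodule.smul_mem _ _ ha1)) ?_)
      rw [mul_sub, mul_smul_comm, h1]
      rw [smul_mul_assoc] at pe
      push_cast at pe
      rw [neg_smul, sub_neg_eq_add]
      exact pe
    -- the value of the form
    have hval : tau (n + 1) (spl a b c e * weilLam (n + 1) (spl a b c e) * stdForm (n + 1) ^ N) =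
        N * tau n (a0 * weilLam n a0 * w ^ (N - 1)) -
        (N + 2) * tau n (a1 * weilLam n a1 * w ^ (N + 1)) -
        psgn (k - 1) * tau n (b * weilLam n b * w ^ N) -
        psgn (k - 1) * tau n (c * weilLam n c * w ^ N) := by
      rw [weil_spl, spl_mul, hpow, spl_mul, tau_spl]
      simp only [mul_zero, add_zero, sub_zero]
      have q0 : ∀ x, a0 * x * w ^ N = 0 := fun x => by
        rw [hcomm, ← mul_assoc, p0, zero_mul]
      have q1 : ∀ x, x * weilLam n a0 * w ^ N = 0 := fun x => by
        rw [mul_assoc, hcomm, ← hJw, p0, map_zero, mul_zero]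
      have haa : a = a0 + w * a1 := by rw [ha0, sub_add_cancel]
      have r1 : a * weilLam n a * ((N : ℝ) • w ^ (N - 1)) =
          (N : ℝ) • (a0 * weilLam n a0 * w ^ (N - 1)) +
          (N : ℝ) • (a1 * weilLam n a1 * w ^ (N + 1)) := by
        cases N with
        | zero => simp
        | succ M =>
          rw [mul_smul_comm, ← smul_add]
          congr 1
          rw [Nat.add_sub_cancel, haa, map_add, map_mul, wJ]
          simp only [mul_add, add_mul]
          rw [central_mul_left hc, central_mul_right hc, central_mul_left hc,
            central_mul_right hc, q1, q0, add_zero, zero_add]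
      have r2 : a * weilLam n e * w ^ N =
          -((N : ℝ) + 1) • (a1 * weilLam n a1 * w ^ (N + 1)) := by
        rw [he1, map_smul, mul_smul_comm, smul_mul_assoc]
        congr 1
        rw [haa, add_mul, add_mul, q0, zero_add, central_mul_left hc]
      have r3 : e * weilLam n a * w ^ N =
          -((N : ℝ) + 1) • (a1 * weilLam n a1 * w ^ (N + 1)) := by
        rw [he1, smul_mul_assoc, smul_mul_assoc]
        congr 1
        rw [haa, map_add, mul_add, add_mul, q1, zero_add, map_mul, wJ, central_mul_right hc]
      rw [par_LZ hb, par_LZ hc', map_add, r1, add_mul _ (e * weilLam n a), sub_mul (_ + _),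
        add_mul (a * weilLam n e), r2, r3]
      simp only [map_add, map_sub, map_smul, smul_mul_assoc, mul_neg, neg_mul, map_neg,
        smul_eq_mul]
      ring
    have t0 : 0 ≤ ssgn k * (N * tau n (a0 * weilLam n a0 * w ^ (N - 1))) ∧
        (a0 ≠ 0 → 0 < ssgn k * (N * tau n (a0 * weilLam n a0 * w ^ (N - 1)))) := by
      have hpos : a0 ≠ 0 → 0 < ssgn k * (N * tau n (a0 * weilLam n a0 * w ^ (N - 1))) := by
        intro hne
        cases N with
        | zero => exact absurd (by simpa using p0) hne
        | succ M =>
          have := ih k M (by push_cast at hk; linarith) a0 ha0m hne p0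
          have hM : (0 : ℝ) < (M + 1 : ℕ) := by positivity
          rw [Nat.add_sub_cancel, mul_left_comm]
          exact mul_pos hM this
      refine ⟨?_, hpos⟩
      by_cases hne : a0 = 0
      · simp [hne]
      · exact (hpos hne).le
    have t1 : ∀ (x : Lam n) (j : ℤ) (M : ℕ), j + M = n → x ∈ LZ n j → w ^ (M + 1) * x = 0 →
        0 ≤ ssgn j * tau n (x * weilLam n x * w ^ M) := by
      intro x j M hj hx hx0
      by_cases hne : x = 0
      · simp [hne]
      · exact (ih j M hj x hx hne hx0).le
    have hk1 : k - 1 + N = n := by push_cast at hk; linarith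
    have hk2 : k - 2 + (N + 1 : ℕ) = n := by push_cast at hk ⊢; linarith
    -- The signs for `k`, `k - 1` and `k - 2` are related so that all four terms become nonnegative
    -- multiples of Hodge–Riemann forms of primitive elements in dimension `n`.
    have key : ssgn k * tau (n + 1)
        (spl a b c e * weilLam (n + 1) (spl a b c e) * stdForm (n + 1) ^ N) =
        ssgn k * (N * tau n (a0 * weilLam n a0 * w ^ (N - 1))) +
        (N + 2) * (ssgn (k - 2) * tau n (a1 * weilLam n a1 * w ^ (N + 1))) +
        ssgn (k - 1) * tau n (b * weilLam n b * w ^ N) +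
        ssgn (k - 1) * tau n (c * weilLam n c * w ^ N) := by
      rw [hval, ← ssgn_mul_psgn, ssgn_sub_two]
      ring
    rw [key]
    have u1 := t1 a1 _ _ hk2 ha1 p1
    have u2 := t1 b _ _ hk1 hb pb'
    have u3 := t1 c _ _ hk1 hc' pc
    have u1' : 0 ≤ (N + 2 : ℝ) * (ssgn (k - 2) * tau n (a1 * weilLam n a1 * w ^ (N + 1))) :=
      mul_nonneg (by positivity) u1
    by_cases hb0 : b = 0
    · by_cases hc0 : c = 0
      · by_cases h10 : a1 = 0
        · have h00 : a0 ≠ 0 := by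
            intro h00
            apply h0
            have haa : a = 0 := by
              rw [← sub_add_cancel a (w * a1), ← ha0, h00, h10, mul_zero, add_zero]
            rw [haa, hb0, hc0, he1, h10]
            simp [spl]
          linarith [t0.2 h00]
        · have := mul_pos (show (0 : ℝ) < N + 2 by positivity) (ih _ _ hk2 a1 ha1 h10 p1)
          linarith [t0.1]
      · linarith [t0.1, ih _ _ hk1 c hc' hc0 pc]
    · linarith [t0.1, ih _ _ hk1 b hb hb0 pb']

end Standard

end THodge
end

noncomputable section

namespace THodge

/-! ### The mixed hard Lefschetz theorem -/

section Deformation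

-- A connectedness argument on the unit interval. Let `S` be the set of parameters for which `Q t`
-- is negative somewhere on the orthogonal complement of the range of `c t`. It is closed: a
-- nonpositive unit vector of the complement can be perturbed to a negative one, because `Q t` is
-- nondegenerate on the complement, and nonpositive unit vectors form a compact set. It is open,
-- since a negative vector extends continuously to nearby complements. As `1` is not in `S`, the set
-- is empty, and a nonpositive vector at `0` would put `0` in it.
open Matrix in
theorem pos_of_deform_coord {d p : ℕ} (Q : unitInterval → (Fin d → ℝ) →ₗ[ℝ] (Fin d → ℝ) →ₗ[ℝ] ℝ)
    (c : unitInterval → (Fin p → ℝ) →ₗ[ℝ] (Fin d → ℝ))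
    (hsymm : ∀ t u v, Q t u v = Q t v u) (hQ : ∀ u v, Continuous fun t => Q t u v)
    (hc : ∀ w, Continuous fun t => c t w)
    (hV : ∀ t u, (∀ v, Q t u v = 0) → u = 0)
    (hC : ∀ t w, (∀ w', Q t (c t w) (c t w') = 0) → w = 0)
    (h1 : ∀ u, u ≠ 0 → (∀ w, Q 1 u (c 1 w) = 0) → 0 < Q 1 u u)
    (u : Fin d → ℝ) (hu : u ≠ 0) (hu0 : ∀ w, Q 0 u (c 0 w) = 0) : 0 < Q 0 u u := by
  have hexp : ∀ {q : ℕ} (x : Fin q → ℝ), x = ∑ i, x i • (Pi.single i 1 : Fin q → ℝ) := by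
    intro q x
    funext j
    simp [Finset.sum_apply, Pi.single_apply]
  have hQQ : ∀ {α : Type} [TopologicalSpace α] {τ : α → unitInterval} {f g : α → Fin d → ℝ},
      Continuous τ → Continuous f → Continuous g →
      Continuous fun a => Q (τ a) (f a) (g a) := by
    intro α _ τ f g hτ hf hg
    have e : (fun a => Q (τ a) (f a) (g a)) = fun a => ∑ i, ∑ j, f a i * (g a j *
        Q (τ a) (Pi.single i 1) (Pi.single j 1)) := by
      funext a
      conv_lhs => rw [hexp (f a), hexp (g a)]
      simp only [map_sum, map_smul, LinearMap.sum_apply, LinearMap.smul_apply, smul_eq_mul,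
        Finset.mul_sum]
      rw [Finset.sum_comm]
      exact Finset.sum_congr rfl fun i _ => Finset.sum_congr rfl fun j _ => by ring
    rw [e]
    refine continuous_finsetSum _ fun i _ => continuous_finsetSum _ fun j _ => ?_
    exact ((continuous_apply i).comp hf).mul (((continuous_apply j).comp hg).mul
      ((hQ _ _).comp hτ))
  have hcc : ∀ {α : Type} [TopologicalSpace α] {τ : α → unitInterval} {f : α → Fin p → ℝ},
      Continuous τ → Continuous f → Continuous fun a => c (τ a) (f a) := by
    intro α _ τ f hτ hf
    have e : (fun a => c (τ a) (f a)) = fun a => ∑ i, f a i • c (τ a) (Pi.single i 1) := by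
      funext a
      conv_lhs => rw [hexp (f a)]
      simp only [map_sum, map_smul]
    rw [e]
    exact continuous_finsetSum _ fun i _ => ((continuous_apply i).comp hf).smul ((hc _).comp hτ)
  let S : Set unitInterval := {t | ∃ u, (∀ w, Q t u (c t w) = 0) ∧ Q t u u < 0}
  let S' : Set unitInterval := {t | ∃ u, ‖u‖ = 1 ∧ (∀ w, Q t u (c t w) = 0) ∧ Q t u u ≤ 0}
  have hnorm : ∀ t u, u ≠ 0 → (∀ w, Q t u (c t w) = 0) → Q t u u ≤ 0 → t ∈ S' := by
    intro t u hu hP hle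
    have hu' : ‖u‖ ≠ 0 := norm_ne_zero_iff.2 hu
    refine ⟨‖u‖⁻¹ • u, ?_, fun w => ?_, ?_⟩
    · rw [norm_smul, norm_inv, norm_norm, inv_mul_cancel₀ hu']
    · rw [map_smul, LinearMap.smul_apply, hP, smul_zero]
    · rw [map_smul, map_smul, LinearMap.smul_apply, smul_eq_mul, smul_eq_mul]
      have h2 : 0 ≤ ‖u‖⁻¹ := by positivity
      exact mul_nonpos_of_nonneg_of_nonpos h2 (mul_nonpos_of_nonneg_of_nonpos h2 hle)
  have hSS : S = S' := by
    ext t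
    constructor
    · rintro ⟨u, hP, hlt⟩
      refine hnorm t u ?_ hP hlt.le
      rintro rfl
      simp at hlt
    · rintro ⟨u, hu1, hP, hle⟩
      have hune : u ≠ 0 := fun h => by simp [h] at hu1
      rcases hle.lt_or_eq with hlt | heq
      · exact ⟨u, hP, hlt⟩
      -- a vector of the orthogonal complement which is not orthogonal to `u`
      have hex : ∃ v, (∀ w, Q t v (c t w) = 0) ∧ Q t u v ≠ 0 := by
        by_contra hcon
        push Not at hcon
        refine hune (hV t u fun v => ?_)
        -- Nondegeneracy on the range of `c t` allows any `v` to be projected to the complement. As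
        -- `u` is orthogonal to the range, orthogonality of `u` to the complement then gives
        -- orthogonality to everything.
        let G : (Fin p → ℝ) →ₗ[ℝ] Module.Dual ℝ (Fin p → ℝ) := (Q t).compl₁₂ (c t) (c t)
        have hG : Function.Surjective G := by
          refine (LinearMap.injective_iff_surjective_of_finrank_eq_finrank
            (Subspace.dual_finrank_eq (K := ℝ)).symm).1 ?_
          rw [injective_iff_map_eq_zero]
          intro w hw
          exact hC t w fun w' => LinearMap.congr_fun hw w'
        obtain ⟨w, hw⟩ := hG (Q t v ∘ₗ c t)
        have hv := hcon (v - c t w) fun w' => by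
          have := LinearMap.congr_fun hw w'
          rw [map_sub, LinearMap.sub_apply, sub_eq_zero]
          exact this.symm
        rw [map_sub, hP, sub_zero] at hv
        exact hv
      obtain ⟨v, hvP, hv⟩ := hex
      -- perturb `u` in the direction of `v`
      have hquad : ∀ ε : ℝ, Q t (u + ε • v) (u + ε • v) =
          ε * (2 * Q t u v + ε * Q t v v) := by
        intro ε
        simp only [map_add, map_smul, LinearMap.add_apply, LinearMap.smul_apply, smul_eq_mul, heq,
          hsymm t v u]
        ring
      have hP' : ∀ ε : ℝ, ∀ w, Q t (u + ε • v) (c t w) = 0 := fun ε w => by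
        rw [map_add, map_smul, LinearMap.add_apply, LinearMap.smul_apply, hP, hvP, smul_zero,
          add_zero]
      -- The step has sign opposite to `Q t u v`, and its size keeps the quadratic term from
      -- dominating the linear one.
      refine ⟨u + (-(Q t u v) / (1 + |Q t v v|)) • v, hP' _, ?_⟩
      rw [hquad]
      set x := Q t u v
      set y := Q t v v
      have hy : 0 < 1 + |y| := by positivity
      have e : -x / (1 + |y|) * (2 * x + -x / (1 + |y|) * y) =
          -(x ^ 2 * (2 * (1 + |y|) - y)) / (1 + |y|) ^ 2 := by
        field_simp
        ring
      rw [e]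
      have hx2 : 0 < x ^ 2 := by positivity
      have h3 : 0 < 2 * (1 + |y|) - y := by linarith [le_abs_self y, abs_nonneg y]
      exact div_neg_of_neg_of_pos (neg_neg_of_pos (mul_pos hx2 h3)) (by positivity)
  have hclosed : IsClosed S' := by
    have hK : IsCompact {q : unitInterval × (Fin d → ℝ) |
        ‖q.2‖ = 1 ∧ (∀ w, Q q.1 q.2 (c q.1 w) = 0) ∧ Q q.1 q.2 q.2 ≤ 0} := by
      refine ((isCompact_univ (X := unitInterval)).prod
        (isCompact_sphere (0 : Fin d → ℝ) 1)).of_isClosed_subset ?_ ?_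
      · refine (isClosed_eq continuous_snd.norm continuous_const).inter (IsClosed.inter ?_ ?_)
        · have e : {q : unitInterval × (Fin d → ℝ) | ∀ w, Q q.1 q.2 (c q.1 w) = 0} =
              ⋂ w, {q : unitInterval × (Fin d → ℝ) | Q q.1 q.2 (c q.1 w) = 0} :=
            Set.ext fun q => ⟨fun h => Set.mem_iInter.2 h, fun h w => Set.mem_iInter.1 h w⟩
          change IsClosed {q : unitInterval × (Fin d → ℝ) | ∀ w, Q q.1 q.2 (c q.1 w) = 0}
          rw [e]
          refine isClosed_iInter fun w => isClosed_eq ?_ continuous_const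
          exact hQQ continuous_fst continuous_snd ((hc w).comp continuous_fst)
        · exact isClosed_le (hQQ continuous_fst continuous_snd continuous_snd) continuous_const
      · rintro ⟨t, u⟩ ⟨h, -⟩
        exact ⟨trivial, by simpa using h⟩
    have e : S' = Prod.fst '' {q : unitInterval × (Fin d → ℝ) |
        ‖q.2‖ = 1 ∧ (∀ w, Q q.1 q.2 (c q.1 w) = 0) ∧ Q q.1 q.2 q.2 ≤ 0} := by
      ext t
      constructor
      · rintro ⟨u, h⟩
        exact ⟨(t, u), h, rfl⟩
      · rintro ⟨⟨t', u⟩, h, rfl⟩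
        exact ⟨u, h⟩
    rw [e]
    exact (hK.image continuous_fst).isClosed
  have hopen : IsOpen S := by
    rw [isOpen_iff_mem_nhds]
    rintro t₀ ⟨u₀, hP, hlt⟩
    let M : unitInterval → Matrix (Fin p) (Fin p) ℝ := fun t =>
      Matrix.of fun i j => Q t (c t (Pi.single i 1)) (c t (Pi.single j 1))
    let R : unitInterval → Fin p → ℝ := fun t i => Q t (c t (Pi.single i 1)) u₀
    have hM : Continuous M := continuous_matrix fun i j => hQQ continuous_id (hc _) (hc _)
    have hR : Continuous R := continuous_pi fun i => hQQ continuous_id (hc _) continuous_const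
    -- The orthogonal projection of `u₀` to the complement at `t`, multiplied by the Gram
    -- determinant. Cramer's rule removes the division, so it is continuous in `t`; at `t₀` it is a
    -- nonzero multiple of `u₀`.
    let U : unitInterval → Fin d → ℝ := fun t =>
      (M t).det • u₀ - c t ((M t).adjugate *ᵥ R t)
    have hU : Continuous U := (hM.matrix_det.smul continuous_const).sub
      (hcc continuous_id (hM.matrix_adjugate.matrix_mulVec hR))
    have hMc : ∀ t i x, Q t (c t (Pi.single i 1)) (c t x) = (M t *ᵥ x) i := by
      intro t i x
      conv_lhs => rw [hexp x]
      rw [map_sum, map_sum, Matrix.mulVec, dotProduct]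
      refine Finset.sum_congr rfl fun j _ => ?_
      rw [map_smul, map_smul, smul_eq_mul, mul_comm]
      rfl
    have hUP : ∀ t w, Q t (U t) (c t w) = 0 := by
      intro t w
      have hbas : ∀ i, Q t (c t (Pi.single i 1)) (U t) = 0 := by
        intro i
        simp only [U]
        rw [map_sub, map_smul, hMc, Matrix.mulVec_mulVec, Matrix.mul_adjugate, Matrix.smul_mulVec,
          Matrix.one_mulVec, Pi.smul_apply, sub_self]
      have hz : (Q t (U t)) ∘ₗ c t = 0 := by
        refine LinearMap.pi_ext fun i x => ?_
        have hx : (Pi.single i x : Fin p → ℝ) = x • Pi.single i 1 := by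
          funext j
          simp [Pi.single_apply]
        rw [hx, map_smul, LinearMap.comp_apply, hsymm, hbas, smul_zero, map_smul,
          LinearMap.zero_apply, smul_zero]
      exact LinearMap.congr_fun hz w
    have hR0 : R t₀ = 0 := by
      funext i
      change Q t₀ (c t₀ (Pi.single i 1)) u₀ = 0
      rw [hsymm, hP]
    have hU0 : U t₀ = (M t₀).det • u₀ := by
      simp only [U, hR0, Matrix.mulVec_zero, map_zero, sub_zero]
    have hdet : (M t₀).det ≠ 0 := by
      intro h0
      obtain ⟨x, hx, hx0⟩ := Matrix.exists_mulVec_eq_zero_iff.2 h0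
      refine hx (hC t₀ x fun w' => ?_)
      have hz : (Q t₀ (c t₀ x)) ∘ₗ c t₀ = 0 := by
        refine LinearMap.pi_ext fun i y => ?_
        have hy : (Pi.single i y : Fin p → ℝ) = y • Pi.single i 1 := by
          funext j
          simp [Pi.single_apply]
        rw [hy, map_smul, LinearMap.comp_apply, hsymm, hMc, hx0, Pi.zero_apply, smul_zero, map_smul,
          LinearMap.zero_apply, smul_zero]
      exact LinearMap.congr_fun hz w'
    have hneg : Q t₀ (U t₀) (U t₀) < 0 := by
      rw [hU0, map_smul, map_smul, LinearMap.smul_apply, smul_eq_mul, smul_eq_mul, ← mul_assoc]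
      exact mul_neg_of_pos_of_neg (mul_self_pos.2 hdet) hlt
    have hcont : Continuous fun t => Q t (U t) (U t) := hQQ continuous_id hU hU
    filter_upwards [hcont.continuousAt.eventually_lt continuousAt_const hneg] with t ht
    exact ⟨U t, hUP t, ht⟩
  have hclopen : IsClopen S := ⟨hSS ▸ hclosed, hopen⟩
  have hS1 : (1 : unitInterval) ∉ S := by
    rintro ⟨u, hP, hlt⟩
    have hune : u ≠ 0 := by
      rintro rfl
      simp at hlt
    exact absurd hlt (h1 u hune hP).le.not_gt
  have hSe : S = ∅ := by
    rcases isClopen_iff.1 hclopen with h | h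
    · exact h
    · exact absurd (h ▸ Set.mem_univ _) hS1
  by_contra hle
  have := hnorm 0 u hu hu0 (not_lt.1 hle)
  rw [← hSS, hSe] at this
  exact this

/-- Positivity on orthogonal complements is preserved along a path of nondegenerate forms. -/
theorem pos_of_deform {V C : Type*} [AddCommGroup V] [Module ℝ V] [Module.Finite ℝ V]
    [AddCommGroup C] [Module ℝ C] [Module.Finite ℝ C]
    (Q : unitInterval → V →ₗ[ℝ] V →ₗ[ℝ] ℝ) (c : unitInterval → C →ₗ[ℝ] V)
    (hsymm : ∀ t u v, Q t u v = Q t v u) (hQ : ∀ u v, Continuous fun t => Q t u v)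
    (hc : ∀ w (φ : Module.Dual ℝ V), Continuous fun t => φ (c t w))
    (hV : ∀ t u, (∀ v, Q t u v = 0) → u = 0)
    (hC : ∀ t w, (∀ w', Q t (c t w) (c t w') = 0) → w = 0)
    (h1 : ∀ u, u ≠ 0 → (∀ w, Q 1 u (c 1 w) = 0) → 0 < Q 1 u u)
    (u : V) (hu : u ≠ 0) (hu0 : ∀ w, Q 0 u (c 0 w) = 0) : 0 < Q 0 u u := by
  let eV := (Module.finBasis ℝ V).equivFun
  let eC := (Module.finBasis ℝ C).equivFun
  have key := pos_of_deform_coord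
    (fun t => (Q t).compl₁₂ eV.symm.toLinearMap eV.symm.toLinearMap)
    (fun t => eV.toLinearMap ∘ₗ c t ∘ₗ eC.symm.toLinearMap)
    (fun t u v => hsymm _ _ _) (fun u v => hQ _ _)
    (fun w => continuous_pi fun i => hc _ ((Module.finBasis ℝ V).coord i))
    (fun t u h => by
      have := hV t (eV.symm u) fun v => by simpa using h (eV v)
      simpa using this)
    (fun t w h => by
      have := hC t (eC.symm w) fun w' => by simpa using h (eC w')
      simpa using this)
    (fun u hu h => by
      have := h1 (eV.symm u) (by simpa using hu) fun w => by simpa using h (eC w)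
      simpa using this)
    (eV u) (by simpa using hu) (fun w => by simpa using hu0 (eC.symm w))
  simpa using key

end Deformation

end THodge
end

noncomputable section

namespace THodge

/-! ### Linear coordinates in which a positive form is standard -/

section Diagonalization

variable {n : ℕ}

/-- The inner product enters as a bare core, and the space is abstract, so that it does not compete
with the norm which `ℂⁿ` already carries. -/
theorem exists_orthonormal_basis {V : Type*} [AddCommGroup V] [Module ℂ V]
    [FiniteDimensional ℂ V] (core : InnerProductSpace.Core ℂ V) (hn : Module.finrank ℂ V = n) :
    ∃ e : Module.Basis (Fin n) ℂ V, ∀ i j, core.inner (e i) (e j) = if i = j then 1 else 0 := by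
  letI : NormedAddCommGroup V := core.toNormedAddCommGroup
  letI : InnerProductSpace ℂ V := InnerProductSpace.ofCore core.toCore
  subst hn
  refine ⟨(stdOrthonormalBasis ℂ V).toBasis, fun i j => ?_⟩
  rw [OrthonormalBasis.coe_toBasis]
  exact orthonormal_iff_ite.1 (stdOrthonormalBasis ℂ V).orthonormal i j

theorem exists_bilin {a : Lam n} (ha : a ∈ LamDeg n 2) :
    ∃ B : CV n →ₗ[ℝ] CV n →ₗ[ℝ] ℝ, (∀ v w, evalForm ![v, w] a = B v w) ∧ ∀ v, B v v = 0 := by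
  refine lamDeg_induction ha (p := fun a => ∃ B : CV n →ₗ[ℝ] CV n →ₗ[ℝ] ℝ,
    (∀ v w, evalForm ![v, w] a = B v w) ∧ ∀ v, B v v = 0) ?_ ?_ ?_ ?_
  · intro x
    refine ⟨(x 0).smulRight (x 1) - (x 1).smulRight (x 0), fun v w => ?_, fun v => ?_⟩
    · rw [evalForm_ιMulti, Matrix.det_fin_two]
      simp
      ring
    · simp
      ring
  · exact ⟨0, by simp, by simp⟩
  · rintro a b ⟨B, h1, h2⟩ ⟨B', h1', h2'⟩
    exact ⟨B + B', fun v w => by simp [h1, h1'], fun v => by simp [h2, h2']⟩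
  · rintro c a ⟨B, h1, h2⟩
    exact ⟨c • B, fun v w => by simp [h1], fun v => by simp [h2]⟩

theorem ιMulti_two (x : Fin 2 → Module.Dual ℝ (CV n)) : ExteriorAlgebra.ιMulti ℝ 2 x =
    ExteriorAlgebra.ι ℝ (x 0) * ExteriorAlgebra.ι ℝ (x 1) := by
  rw [ExteriorAlgebra.ιMulti_succ_apply, ExteriorAlgebra.ιMulti_succ_apply,
    ExteriorAlgebra.ιMulti_zero_apply, mul_one]
  rfl

/-- The sum runs over ordered pairs, so every basis two-form is counted twice. -/
theorem two_form_expand {a : Lam n} (ha : a ∈ LamDeg n 2) :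
    (2 : ℝ) • a = ∑ i, ∑ j, evalForm ![fr i, fr j] a •
      (ExteriorAlgebra.ι ℝ (cofr i) * ExteriorAlgebra.ι ℝ (cofr j)) := by
  refine lamDeg_induction ha (p := fun a => (2 : ℝ) • a = ∑ i, ∑ j, evalForm ![fr i, fr j] a •
      (ExteriorAlgebra.ι ℝ (cofr i) * ExteriorAlgebra.ι ℝ (cofr j))) ?_ ?_ ?_ ?_
  · intro x
    have hx : ∀ l l' : Module.Dual ℝ (CV n),
        ∑ i, ∑ j, (l (fr i) * l' (fr j)) •
          (ExteriorAlgebra.ι ℝ (cofr i) * ExteriorAlgebra.ι ℝ (cofr j)) =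
        ExteriorAlgebra.ι ℝ l * ExteriorAlgebra.ι ℝ l' := by
      intro l l'
      conv_rhs => rw [← sum_apply_fr_smul_cofr l, ← sum_apply_fr_smul_cofr l', map_sum, map_sum,
        Finset.sum_mul_sum]
      refine Finset.sum_congr rfl fun i _ => Finset.sum_congr rfl fun j _ => ?_
      rw [map_smul, map_smul, smul_mul_smul_comm]
    have he : ∀ i j : Fin n × Fin 2, evalForm ![fr i, fr j] (ExteriorAlgebra.ιMulti ℝ 2 x) =
        x 0 (fr i) * x 1 (fr j) - x 1 (fr i) * x 0 (fr j) := by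
      intro i j
      rw [evalForm_ιMulti, Matrix.det_fin_two]
      simp
      ring
    simp only [he, sub_smul, Finset.sum_sub_distrib, hx]
    rw [ιMulti_two, ι_mul_eq (x 1), par_ι, neg_mul, sub_neg_eq_add, two_smul]
  · simp
  · intro a b ha hb
    simp only [smul_add, ha, hb, map_add, add_smul, Finset.sum_add_distrib]
  · intro c a ha
    rw [smul_comm, ha]
    simp only [Finset.smul_sum, map_smul, smul_smul, smul_eq_mul]

theorem evalForm_weil (a : Lam n) (v w : CV n) :
    evalForm ![v, w] (weilLam n a) = evalForm ![I • v, I • w] a := by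
  rw [weilLam_eq, evalForm_pb]
  congr 1

/-- A positive `(1,1)`-form is the standard form in suitable complex linear coordinates. -/
theorem exists_linear_std {b : Lam n} (hb : IsPositive11 b) :
    ∃ A B : CV n →ₗ[ℝ] CV n, A ∘ₗ mulI n = mulI n ∘ₗ A ∧ A ∘ₗ B = LinearMap.id ∧
      B ∘ₗ A = LinearMap.id ∧ pb A b = stdForm n := by
  obtain ⟨h2, hJ, hpos⟩ := hb
  obtain ⟨G, hG, hG0⟩ := exists_bilin h2
  have hGn : ∀ v w, G v w = -G w v := by
    intro v w
    have := hG0 (v + w)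
    simp only [map_add, LinearMap.add_apply, hG0] at this
    linarith
  have hGI : ∀ v w, G (I • v) (I • w) = G v w := fun v w => by
    rw [← hG, ← evalForm_weil, hJ, hG]
  have hII : ∀ v : CV n, I • I • v = -v := fun v => by
    rw [smul_smul, I_mul_I, neg_one_smul]
  have hG1 : ∀ v w, G (I • v) w = -G v (I • w) := fun v w => by
    rw [← hGI v (I • w), hII, map_neg, neg_neg]
  have hG2 : ∀ v w, G v (I • w) = G w (I • v) := fun v w => by
    rw [hGn, hG1, neg_neg]
  have hpos' : ∀ v, v ≠ 0 → 0 < G v (I • v) := fun v hv => by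
    rw [← hG]
    exact hpos v hv
  -- The Hermitian inner product whose imaginary part is the alternating form `G` of `b`, with real
  -- part `G v (i w)`. In an orthonormal basis `b` is the standard form.
  let core : InnerProductSpace.Core ℂ (CV n) :=
    { inner := fun v w => ⟨G v (I • w), G v w⟩
      conj_inner_symm := fun v w => by
        apply Complex.ext
        · exact hG2 w v
        · exact (hGn v w).symm
      re_inner_nonneg := fun v => by
        by_cases hv : v = 0
        · simp [hv]
        · exact (hpos' v hv).le
      add_left := fun u v w => by
        apply Complex.ext <;> simp
      smul_left := fun v w c => by
        have e : ∀ v : CV n, c • v = c.re • v + c.im • (I • v) := fun v => by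
          conv_lhs => rw [← re_add_im c, add_smul, mul_smul, Complex.coe_smul, Complex.coe_smul]
        rw [e v]
        apply Complex.ext
        · simp [hG1, hII]
        · simp [hG1]
      definite := fun v hv => by
        by_contra hne
        have := congrArg Complex.re hv
        exact (hpos' v hne).ne' this }
  obtain ⟨e, he⟩ := exists_orthonormal_basis core (n := n) (by simp)
  have heG : ∀ i j, G (e i) (I • e j) = if i = j then 1 else 0 := fun i j => by
    have := congrArg Complex.re (he i j)
    rw [apply_ite Complex.re] at this
    exact this
  have heG' : ∀ i j, G (e i) (e j) = 0 := fun i j => by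
    have := congrArg Complex.im (he i j)
    rw [apply_ite Complex.im, one_im, zero_im, ite_self] at this
    exact this
  let A := e.equivFun.symm.toLinearMap.restrictScalars ℝ
  let B := e.equivFun.toLinearMap.restrictScalars ℝ
  have hA : ∀ (c : ℂ) v, A (c • v) = c • A v := fun c v => e.equivFun.symm.map_smul c v
  have hAx : ∀ j, A (ex j) = e j := fun j => by
    have : e.equivFun.symm (Pi.single j 1) = e j := by
      rw [LinearEquiv.symm_apply_eq]
      funext i
      rw [Module.Basis.equivFun_self, Pi.single_apply]
      simp only [eq_comm]
    exact this
  have hey : ∀ j : Fin n, ey j = I • (ex j : CV n) := fun j => by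
    rw [ey, ex, ← Pi.single_smul, smul_eq_mul, mul_one]
  refine ⟨A, B, ?_, ?_, ?_, ?_⟩
  · refine LinearMap.ext fun v => ?_
    simp only [LinearMap.comp_apply, mulI_apply, hA]
  · exact LinearMap.ext fun v => e.equivFun.symm_apply_apply v
  · exact LinearMap.ext fun v => e.equivFun.apply_symm_apply v
  · have key : (2 : ℝ) • pb A b = (2 : ℝ) • stdForm n := by
      have hv : ∀ v w, evalForm ![v, w] (pb A b) = G (A v) (A w) := fun v w => by
        rw [evalForm_pb, ← hG]
        congr 1
      rw [two_form_expand (pb_mem A h2)]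
      simp only [hv, sum_fr]
      have hx : ∀ j, fr ((j, 0) : Fin n × Fin 2) = ex j := fun j => rfl
      have hy : ∀ j, fr ((j, 1) : Fin n × Fin 2) = I • (ex j : CV n) := fun j => hey j
      simp only [hx, hy, hA, hAx, hGI, heG', hG1, heG,
        cofr, if_true, zero_smul, zero_add, add_zero, neg_smul]
      simp only [ite_smul, one_smul, zero_smul, Finset.sum_ite_eq, Finset.mem_univ, if_true,
        Fin.isValue, one_ne_zero, if_false, Finset.sum_neg_distrib, stdForm, Finset.smul_sum]
      refine Finset.sum_congr rfl fun j _ => ?_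
      rw [ι_mul_eq (dy j), par_ι, neg_mul, neg_neg, two_smul]
    exact smul_right_injective _ (two_ne_zero (α := ℝ)) key

theorem IsPositive11.pb {m : ℕ} {b : Lam n} (hb : IsPositive11 b) {A : CV m →ₗ[ℝ] CV n}
    (hA : A ∘ₗ mulI m = mulI n ∘ₗ A) (hinj : Function.Injective A) :
    IsPositive11 (THodge.pb A b) := by
  obtain ⟨h2, hJ, hpos⟩ := hb
  refine ⟨pb_mem A h2, ?_, fun v hv => ?_⟩
  · rw [weilLam_eq, pb_comp, hA, ← pb_comp, ← weilLam_eq, hJ]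
  · rw [evalForm_pb]
    have e : (fun i => A ((![v, I • v] : Fin 2 → CV m) i)) = ![A v, I • A v] := by
      funext i
      have h := LinearMap.congr_fun hA v
      simp only [LinearMap.comp_apply, mulI_apply] at h
      fin_cases i
      · rfl
      · exact h
    rw [e]
    exact hpos _ fun h => hv (hinj (by rw [h, map_zero]))

theorem IsPositive11.combine {b b' : Lam n} (hb : IsPositive11 b) (hb' : IsPositive11 b') {s t : ℝ}
    (hs : 0 ≤ s) (ht : 0 ≤ t) (hst : 0 < s + t) : IsPositive11 (s • b + t • b') := by
  refine ⟨Submodule.add_mem _ (Submodule.smul_mem _ _ hb.1) (Submodule.smul_mem _ _ hb'.1), ?_,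
    fun v hv => ?_⟩
  · rw [map_add, map_smul, map_smul, hb.2.1, hb'.2.1]
  · rw [map_add, map_smul, map_smul, smul_eq_mul, smul_eq_mul]
    have h1 := hb.2.2 v hv
    have h2 := hb'.2.2 v hv
    rcases hs.eq_or_lt with rfl | hs
    · rw [zero_add] at hst
      rw [zero_mul, zero_add]
      positivity
    · positivity

theorem isPositive11_stdForm : IsPositive11 (stdForm n) := by
  refine ⟨stdForm_mem, weil_stdForm, fun v hv => ?_⟩
  have h1 : ∀ j : Fin n, evalForm ![v, I • v]
      (ExteriorAlgebra.ι ℝ (dx j) * ExteriorAlgebra.ι ℝ (dy j)) = normSq (v j) := by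
    intro j
    have e : ExteriorAlgebra.ι ℝ (dx j) * ExteriorAlgebra.ι ℝ (dy j) =
        ExteriorAlgebra.ιMulti ℝ 2 ![dx j, dy j] := (ιMulti_two ![dx j, dy j]).symm
    rw [e, evalForm_ιMulti, Matrix.det_fin_two]
    simp [dx, dy, normSq_apply]
  rw [stdForm, map_sum]
  simp only [h1]
  obtain ⟨j, hj⟩ := Function.ne_iff.1 hv
  exact Finset.sum_pos' (fun i _ => normSq_nonneg _)
    ⟨j, Finset.mem_univ j, normSq_pos.2 (by simpa using hj)⟩

end Diagonalization

/-! ### From Hodge–Riemann in dimension n to hard Lefschetz in dimension n + 1 -/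

section Mixed

variable {n : ℕ}

theorem tau_pb (A : CV n →ₗ[ℝ] CV n) (a : Lam n) : tau n (pb A a) = LinearMap.det A * tau n a := by
  rw [tau, evalForm_pb, evalForm_realFrame_comp]

theorem det_eq_one_of_comm {A : CV n →ₗ[ℝ] CV n} (hA : A ∘ₗ mulI n = mulI n ∘ₗ A)
    (hd : LinearMap.det A * LinearMap.det A = 1) : LinearMap.det A = 1 := by
  have := det_nonneg_of_comm hA
  nlinarith

/-- The map `i` is complex linear with square `-1` on a real space of even dimension, so its real
determinant is nonnegative of square one. -/
theorem tau_weil (a : Lam n) : tau n (weilLam n a) = tau n a := by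
  have hd : LinearMap.det (mulI n) * LinearMap.det (mulI n) = 1 := by
    have e : mulI n ∘ₗ mulI n = (-1 : ℝ) • LinearMap.id := by
      refine LinearMap.ext fun v => ?_
      rw [LinearMap.comp_apply, mulI_apply, mulI_apply, smul_smul, I_mul_I, LinearMap.smul_apply,
        neg_one_smul, neg_one_smul, LinearMap.id_apply]
    rw [← LinearMap.det_comp, e, LinearMap.det_smul, LinearMap.det_id, mul_one,
      finrank_real_of_complex, pow_mul]
    simp
  rw [weilLam_eq, tau_pb, det_eq_one_of_comm rfl hd, one_mul]

/-- The inclusion of the hyperplane where the coordinate `j` vanishes. -/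
def hyper (j : Fin (n + 1)) : CV n →ₗ[ℝ] CV (n + 1) :=
  LinearMap.funLeft ℝ ℂ (Equiv.swap 0 j) ∘ₗ emb n

theorem hyper_injective (j : Fin (n + 1)) : Function.Injective (hyper (n := n) j) := by
  have h1 := LinearMap.funLeft_injective_of_surjective ℝ ℂ _ (Equiv.swap 0 j).surjective
  exact fun v w h => Fin.cons_right_injective (α := fun _ : Fin (n + 1) => ℂ) 0 (h1 h)

theorem hyper_mulI (j : Fin (n + 1)) : hyper (n := n) j ∘ₗ mulI n = mulI (n + 1) ∘ₗ hyper j := by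
  have h : emb n ∘ₗ mulI n = mulI (n + 1) ∘ₗ emb n := by
    refine LinearMap.ext fun v => ?_
    rw [LinearMap.comp_apply, LinearMap.comp_apply, mulI_apply, mulI_apply]
    funext i
    refine Fin.cases ?_ (fun i => ?_) i <;> simp [emb]
  rw [hyper, LinearMap.comp_assoc, h]
  rfl

/-- Exchanging the coordinates `0` and `j` has real determinant one, which reduces to `j = 0`. The
formula turns multiplication by the standard form into a sum of restrictions to hyperplanes. -/
theorem tau_hyper (j : Fin (n + 1)) (a : Lam (n + 1)) :
    tau (n + 1) (ExteriorAlgebra.ι ℝ (dx j) * (ExteriorAlgebra.ι ℝ (dy j) * a)) =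
      tau n (pb (hyper j) a) := by
  let σ : CV (n + 1) →ₗ[ℝ] CV (n + 1) := LinearMap.funLeft ℝ ℂ (Equiv.swap 0 j)
  have hσ : σ ∘ₗ σ = LinearMap.id := by
    refine LinearMap.ext fun v => funext fun i => ?_
    simp [σ, LinearMap.funLeft_apply]
  have hd : LinearMap.det σ = 1 := by
    refine det_eq_one_of_comm rfl ?_
    rw [← LinearMap.det_comp, hσ, LinearMap.det_id]
  have h1 : ExteriorAlgebra.ι ℝ (dx j) * (ExteriorAlgebra.ι ℝ (dy j) * a) =
      pb σ (X0 * (Y0 * pb σ a)) := by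
    rw [map_mul, map_mul, pb_comp, hσ, pb_id, pb_ι, pb_ι]
    congr 2
  rw [h1, tau_pb, hd, one_mul, tau_XY, pb_comp]
  rfl

theorem graded_comm {i j : ℕ} {x y : Lam n} (hx : x ∈ LamDeg n i) (hy : y ∈ LamDeg n j) :
    x * y = ((-1 : ℝ) ^ (i * j)) • (y * x) := by
  refine lamDeg_induction hx (p := fun x => x * y = ((-1 : ℝ) ^ (i * j)) • (y * x)) ?_ ?_ ?_ ?_
  · clear hx
    induction i with
    | zero =>
      intro v
      simp [ExteriorAlgebra.ιMulti_apply]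
    | succ i ih =>
      intro v
      rw [ExteriorAlgebra.ιMulti_succ_apply, mul_assoc, ih, mul_smul_comm, ← mul_assoc, ι_mul_eq,
        par_eq hy, smul_mul_assoc, smul_mul_assoc, smul_smul, mul_assoc, ← pow_add]
      congr 2
      ring
  · simp
  · intro a b ha hb
    rw [add_mul, mul_add, ha, hb, smul_add]
  · intro c a ha
    rw [smul_mul_assoc, mul_smul_comm, ha, smul_comm]

theorem psgn_natCast (k : ℕ) : psgn k = (-1 : ℝ) ^ k := by
  unfold psgn
  split_ifs with h
  · exact (Nat.even_iff.2 (by omega)).neg_one_pow.symm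
  · exact (Nat.odd_iff.2 (by omega)).neg_one_pow.symm

/-- Applying `J` to the top form replaces `u ∧ J v` by `J u ∧ J² v`, and `J²` is the parity.
Together with the exchange of factors the sign is `(-1)^(k + k²) = 1`. -/
theorem tau_mul_weil_symm {k : ℤ} {u v Ω : Lam n} (hu : u ∈ LZ n k) (hv : v ∈ LZ n k)
    (hΩ : weilLam n Ω = Ω) :
    tau n (u * weilLam n v * Ω) = tau n (v * weilLam n u * Ω) := by
  have h1 : tau n (u * weilLam n v * Ω) = tau n (weilLam n u * par n v * Ω) := by
    rw [← tau_weil, map_mul (weilLam n), map_mul (weilLam n), weilLam_weilLam, hΩ]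
  rw [h1, par_LZ hv]
  rcases LZ_cases hu with rfl | ⟨i, rfl, -, hu⟩
  · simp
  have hJu : weilLam n u ∈ LamDeg n i := pb_mem _ hu
  rw [mul_smul_comm, graded_comm hJu (mem_LZ.1 hv), smul_smul,
    psgn_natCast]
  have e : (-1 : ℝ) ^ i * (-1) ^ (i * i) = 1 := by
    rw [← pow_add]
    refine Even.neg_one_pow ?_
    rw [show i + i * i = i * (i + 1) by ring]
    exact Nat.even_mul_succ_self i
  rw [e, one_smul]

/-- The Hodge–Riemann relations for products of positive forms in dimension `n`. -/
def MixedHR (n : ℕ) : Prop := ∀ (k : ℤ) (b₀ : Lam n) (l : List (Lam n)), k + l.length = n →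
  IsPositive11 b₀ → (∀ b ∈ l, IsPositive11 b) → ∀ u ∈ LZ n k, u ≠ 0 → b₀ * l.prod * u = 0 →
    0 < ssgn k * tau n (u * weilLam n u * l.prod)

/-- The hard Lefschetz theorem for products of positive forms in dimension `n`. -/
def MixedHL (n : ℕ) : Prop := ∀ (k : ℤ) (l : List (Lam n)), k + l.length = n →
  (∀ b ∈ l, IsPositive11 b) → ∀ u ∈ LZ n k, l.prod * u = 0 → u = 0

theorem weil_prod {l : List (Lam n)} (hl : ∀ b ∈ l, IsPositive11 b) :
    weilLam n l.prod = l.prod := by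
  rw [map_list_prod]
  congr 1
  conv_rhs => rw [← List.map_id l]
  exact List.map_congr_left fun b hb => (hl b hb).2.1

theorem prod_mem_lamDeg {l : List (Lam n)} (hl : ∀ b ∈ l, IsPositive11 b) :
    l.prod ∈ LamDeg n (2 * l.length) := by
  induction l with
  | nil => exact one_mem_lamDeg
  | cons b l ih =>
    rw [List.prod_cons, List.length_cons, show 2 * (l.length + 1) = 2 + 2 * l.length by ring]
    exact mul_mem_lamDeg (hl b (by simp)).1 (ih fun c hc => hl c (by simp [hc]))

theorem mixedHL_zero : MixedHL 0 := by
  intro k l hk _ u hu h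
  rcases LZ_cases hu with rfl | ⟨i, rfl, -, -⟩
  · rfl
  · have : l = [] := List.eq_nil_of_length_eq_zero (by push_cast at hk; omega)
    subst this
    simpa using h

/-- Choose coordinates in which the first form of the list is standard, `∑ dx_j ∧ dy_j`. An element
killed by the product restricts on each coordinate hyperplane to a primitive element for the
remaining forms. The Hodge–Riemann values of these restrictions are nonnegative and add up to zero,
so all restrictions vanish. Then the standard form itself kills the element, which contradicts
`hodgeRiemann_std` unless the element is zero. -/
theorem mixedHL_succ (h : MixedHR n) : MixedHL (n + 1) := by
  intro k l hk hl u hu h0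
  cases l with
  | nil => simpa using h0
  | cons b l =>
  obtain ⟨A, B, hA, hAB, hBA, hstd⟩ := exists_linear_std (hl b (by simp))
  have hAinj : Function.Injective A := fun v w hvw => by
    rw [← LinearMap.id_apply (R := ℝ) v, ← hBA, LinearMap.comp_apply, hvw, ← LinearMap.comp_apply,
      hBA, LinearMap.id_apply]
  set v := pb A u with hv
  have hvu : pb B v = u := by rw [hv, pb_comp, hAB, pb_id]
  set l' := l.map (pb A) with hl'
  have hl'pos : ∀ c ∈ l', IsPositive11 c := by
    intro c hc
    obtain ⟨d, hd, rfl⟩ := List.mem_map.1 hc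
    exact (hl d (by simp [hd])).pb hA hAinj
  have hvm : v ∈ LZ (n + 1) k := pb_mem_LZ A hu
  have hprod : pb A l.prod = l'.prod := map_list_prod _ _
  have hcen : ∀ x, l'.prod * x = x * l'.prod :=
    fun x => mul_comm_of_even (prod_mem_lamDeg hl'pos) x
  have h0' : stdForm (n + 1) * l'.prod * v = 0 := by
    have := congrArg (pb A) h0
    rwa [List.prod_cons, map_mul, map_mul, hstd, map_zero, hprod] at this
  -- restriction to the coordinate hyperplanes
  have hpos : ∀ j : Fin (n + 1), 0 ≤ ssgn k * tau n (pb (hyper j) (v * weilLam (n + 1) v *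
      l'.prod)) ∧ (pb (hyper j) v ≠ 0 → 0 < ssgn k * tau n (pb (hyper j)
        (v * weilLam (n + 1) v * l'.prod))) := by
    intro j
    have hJ : pb (hyper j) (weilLam (n + 1) v) = weilLam n (pb (hyper j) v) := by
      rw [weilLam_eq, weilLam_eq, pb_comp (mulI (n + 1)), pb_comp (hyper j), hyper_mulI]
    have hp := h k (pb (hyper j) (stdForm (n + 1))) (l'.map (pb (hyper j)))
      (by simp only [List.length_map, hl', List.length_cons] at hk ⊢; push_cast at hk; linarith)
      (isPositive11_stdForm.pb (hyper_mulI j) (hyper_injective j))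
      (fun c hc => by
        obtain ⟨d, hd, rfl⟩ := List.mem_map.1 hc
        exact (hl'pos d hd).pb (hyper_mulI j) (hyper_injective j))
      (pb (hyper j) v) (pb_mem_LZ _ hvm)
    rw [← map_list_prod, ← map_mul, ← map_mul, h0', map_zero] at hp
    rw [map_mul (pb (hyper j)), map_mul (pb (hyper j)), hJ]
    have hp' : pb (hyper j) v ≠ 0 → _ := fun hne => hp hne rfl
    refine ⟨?_, hp'⟩
    by_cases hne : pb (hyper j) v = 0
    · simp [hne]
    · exact (hp' hne).le
  -- By `tau_hyper` the sum is the top coefficient of the standard form times `v ∧ J v` times the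
  -- remaining product, and this contains the factor assumed to vanish.
  have hsum : ∑ j : Fin (n + 1), ssgn k * tau n (pb (hyper j) (v * weilLam (n + 1) v *
      l'.prod)) = 0 := by
    rw [← Finset.mul_sum]
    simp only [← tau_hyper, ← mul_assoc]
    rw [← map_sum]
    simp only [mul_assoc]
    simp only [← mul_assoc (ExteriorAlgebra.ι ℝ (dx _)) (ExteriorAlgebra.ι ℝ (dy _))]
    rw [← Finset.sum_mul]
    have e : stdForm (n + 1) * (v * (weilLam (n + 1) v * l'.prod)) =
        (stdForm (n + 1) * l'.prod * v) * weilLam (n + 1) v := by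
      rw [← hcen (weilLam (n + 1) v), ← mul_assoc v, ← hcen v]
      simp only [mul_assoc]
    change ssgn k * tau (n + 1) (stdForm (n + 1) * (v * (weilLam (n + 1) v * l'.prod))) = 0
    rw [e, h0', zero_mul, map_zero, mul_zero]
  have hz : ∀ j : Fin (n + 1), pb (hyper j) v = 0 := by
    intro j
    by_contra hne
    have := (Finset.sum_eq_zero_iff_of_nonneg fun j _ => (hpos j).1).1 hsum j (Finset.mem_univ j)
    exact ((hpos j).2 hne).ne' this
  have hstdv : stdForm (n + 1) * v = 0 := by
    rw [stdForm, Finset.sum_mul]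
    refine Finset.sum_eq_zero fun j _ => wedge_nondeg fun x => ?_
    rw [mul_assoc, mul_assoc, tau_hyper, map_mul, hz, zero_mul, map_zero]
  -- The element is primitive for the standard form. Its Hodge–Riemann value contains a positive
  -- power of that form and is therefore zero.
  have hv0 : v = 0 := by
    by_contra hne
    have := hodgeRiemann_std (n + 1) k (l.length + 1)
      (by simp only [List.length_cons] at hk; exact hk) v hvm hne
      (by rw [pow_succ, mul_assoc, hstdv, mul_zero])
    have e : v * weilLam (n + 1) v * stdForm (n + 1) ^ (l.length + 1) = 0 := by
      rw [pow_succ', ← mul_assoc, ← mul_comm_of_two stdForm_mem, ← mul_assoc, hstdv, zero_mul,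
        zero_mul]
    rw [e, map_zero, mul_zero] at this
    exact lt_irrefl _ this
  rw [← hvu, hv0, map_zero]

end Mixed

end THodge
end

noncomputable section

namespace THodge

/-! ### From hard Lefschetz to Hodge–Riemann by deformation -/

section Mixed

variable {n : ℕ}

/-- Poincaré duality, where the test form may be written as `J v` because `J` is bijective in each
degree. It converts orthogonality for the Hodge–Riemann form into an equation between forms. -/
theorem weil_mem_nondeg {M : ℕ} {j k : ℤ} {Ω u : Lam n} (hΩ : Ω ∈ LamDeg n (2 * M))
    (hu : u ∈ LZ n k) (hjk : j + k + 2 * M = 2 * n)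
    (h : ∀ v ∈ LZ n j, tau n (u * weilLam n v * Ω) = 0) : Ω * u = 0 := by
  have hΩu : Ω * u ∈ LZ n (2 * M + k) := mul_mem_LZ (by exact_mod_cast mem_LZ.2 hΩ) hu
  refine wedge_nondeg_LZ hΩu fun v hv => ?_
  rw [show 2 * (n : ℤ) - (2 * M + k) = j by linarith] at hv
  have e : v = weilLam n (psgn j • weilLam n v) := by
    rw [map_smul, weilLam_weilLam, par_LZ hv, smul_smul, psgn_mul_self, one_smul]
  rw [mul_assoc, mul_comm_of_even hΩ, e]
  exact h _ (Submodule.smul_mem _ _ (weil_mem_LZ hv))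

/-- The segment from a positive form to the standard one. -/
def segm (t : unitInterval) (b : Lam n) : Lam n := (1 - (t : ℝ)) • b + (t : ℝ) • stdForm n

theorem isPositive11_segm (t : unitInterval) {b : Lam n} (hb : IsPositive11 b) :
    IsPositive11 (segm t b) :=
  hb.combine isPositive11_stdForm (sub_nonneg.2 t.2.2) t.2.1 (by linarith)

theorem continuous_segm_prod (l : List (Lam n)) (φ : Lam n →ₗ[ℝ] ℝ) :
    Continuous fun t : unitInterval => φ (l.map (segm t)).prod := by
  induction l generalizing φ with
  | nil => simpa using continuous_const
  | cons b l ih =>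
    have e : (fun t : unitInterval => φ ((b :: l).map (segm t)).prod) = fun t : unitInterval =>
        (1 - (t : ℝ)) * (φ ∘ₗ LinearMap.mulLeft ℝ b) (l.map (segm t)).prod +
          (t : ℝ) * (φ ∘ₗ LinearMap.mulLeft ℝ (stdForm n)) (l.map (segm t)).prod := by
      funext t
      simp [segm, add_mul]
    rw [e]
    have := ih (φ ∘ₗ LinearMap.mulLeft ℝ b)
    have := ih (φ ∘ₗ LinearMap.mulLeft ℝ (stdForm n))
    fun_prop

/-- Deform all forms linearly to the standard one. On `k`-forms take the Hodge–Riemann form `Q t`,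
and let `c t` be multiplication by the deformed `b₀` from degree `k - 2`. Primitive elements are
exactly the orthogonal complement of the range of `c t`. Hard Lefschetz along the path supplies the
two nondegeneracy hypotheses of `pos_of_deform`. -/
theorem mixedHR_of_mixedHL (h : MixedHL n) : MixedHR n := by
  intro k b₀ l hk hb₀ hl u hu hne h0
  let Ω : unitInterval → Lam n := fun t => (l.map (segm t)).prod
  have hpos : ∀ t, ∀ b ∈ l.map (segm t), IsPositive11 b := by
    intro t b hb
    obtain ⟨d, hd, rfl⟩ := List.mem_map.1 hb
    exact isPositive11_segm t (hl d hd)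
  have hΩ : ∀ t, Ω t ∈ LamDeg n (2 * l.length) := fun t => by
    simpa using prod_mem_lamDeg (hpos t)
  have hJΩ : ∀ t, weilLam n (Ω t) = Ω t := fun t => weil_prod (hpos t)
  have hbmem : ∀ t, segm t b₀ ∈ LZ n 2 := fun t =>
    mem_LZ.2 (isPositive11_segm t hb₀).1
  have hJb : ∀ t, weilLam n (segm t b₀) = segm t b₀ := fun t => (isPositive11_segm t hb₀).2.1
  have hbc : ∀ t x, segm t b₀ * x = x * segm t b₀ := fun t x =>
    mul_comm_of_two (isPositive11_segm t hb₀).1 x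
  let Q : unitInterval → LZ n k →ₗ[ℝ] LZ n k →ₗ[ℝ] ℝ := fun t =>
    LinearMap.mk₂ ℝ (fun u v => ssgn k * tau n ((u : Lam n) * weilLam n (v : Lam n) * Ω t))
      (by intros; simp [add_mul, mul_add]) (by intros; simp; ring)
      (by intros; simp [add_mul, mul_add]) (by intros; simp; ring)
  let c : unitInterval → LZ n (k - 2) →ₗ[ℝ] LZ n k := fun t =>
    LinearMap.codRestrict _ ((LinearMap.mulLeft ℝ (segm t b₀)).domRestrict (LZ n (k - 2)))
      fun w => by
        have := mul_mem_LZ (hbmem t) w.2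
        rwa [show 2 + (k - 2) = k by ring] at this
  have hs : ssgn k ≠ 0 := by
    intro e
    have := ssgn_mul_self k
    rw [e, zero_mul] at this
    exact zero_ne_one this
  have hQc : ∀ t (u : LZ n k) w, Q t u (c t w) =
      ssgn k * tau n ((u : Lam n) * weilLam n (w : Lam n) * (segm t b₀ * Ω t)) := by
    intro t u w
    change ssgn k * tau n ((u : Lam n) * weilLam n (segm t b₀ * w) * Ω t) = _
    rw [map_mul (weilLam n), hJb, hbc]
    simp only [mul_assoc]
  have hdeg1 : ∀ t, segm t b₀ * Ω t ∈ LamDeg n (2 * (l.length + 1)) := fun t => by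
    rw [mul_add, mul_one, add_comm]
    exact mul_mem_lamDeg (isPositive11_segm t hb₀).1 (hΩ t)
  have key := pos_of_deform Q c
    (fun t u v => by
      change ssgn k * tau n ((u : Lam n) * weilLam n (v : Lam n) * Ω t) =
        ssgn k * tau n ((v : Lam n) * weilLam n (u : Lam n) * Ω t)
      rw [tau_mul_weil_symm u.2 v.2 (hJΩ t)])
    (fun u v => continuous_const.mul
      (continuous_segm_prod l (tau n ∘ₗ LinearMap.mulLeft ℝ ((u : Lam n) * weilLam n (v : Lam n)))))
    (fun w φ => by
      have m1 : b₀ * w ∈ LZ n k := by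
        have := mul_mem_LZ (mem_LZ.2 hb₀.1) w.2
        rwa [show ((2 : ℕ) : ℤ) + (k - 2) = k by push_cast; ring] at this
      have m2 : stdForm n * w ∈ LZ n k := by
        have := mul_mem_LZ (mem_LZ.2 stdForm_mem) w.2
        rwa [show ((2 : ℕ) : ℤ) + (k - 2) = k by push_cast; ring] at this
      have e : (fun t => φ (c t w)) = fun t : unitInterval =>
          (1 - (t : ℝ)) * φ (⟨b₀ * w, m1⟩ : LZ n k) +
          (t : ℝ) * φ (⟨stdForm n * w, m2⟩ : LZ n k) := by
        funext t
        rw [← smul_eq_mul (1 - (t : ℝ)), ← smul_eq_mul (t : ℝ), ← map_smul φ, ← map_smul φ,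
          ← map_add φ]
        congr 1
        apply Subtype.ext
        change segm t b₀ * (w : Lam n) = (1 - (t : ℝ)) • (b₀ * w) + (t : ℝ) • (stdForm n * w)
        rw [segm, add_mul, smul_mul_assoc, smul_mul_assoc]
      rw [e]
      fun_prop)
    (fun t u hu => by
      refine Subtype.ext (h k (l.map (segm t)) (by simpa using hk) (hpos t) u u.2 ?_)
      refine weil_mem_nondeg (j := k) (hΩ t) u.2 (by linarith) fun v hv => ?_
      exact (mul_eq_zero.1 (hu ⟨v, hv⟩)).resolve_left hs)
    -- On the range of multiplication by `b₀` the form is the one on degree `k - 2` with `b₀`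
    -- inserted twice, so hard Lefschetz is applied to the list lengthened by two copies of it.
    (fun t w hw => by
      refine Subtype.ext (h (k - 2) (segm t b₀ :: segm t b₀ :: l.map (segm t))
        (by simp; linarith) ?_ w w.2 ?_)
      · intro b hb
        rcases List.mem_cons.1 hb with rfl | hb
        · exact isPositive11_segm t hb₀
        rcases List.mem_cons.1 hb with rfl | hb
        · exact isPositive11_segm t hb₀
        exact hpos t b hb
      · rw [List.prod_cons, List.prod_cons]
        refine weil_mem_nondeg (M := l.length + 2) (j := k - 2) ?_ w.2
          (by push_cast; linarith) fun v hv => ?_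
        · rw [show 2 * (l.length + 2) = 2 + 2 * (l.length + 1) by ring]
          exact mul_mem_lamDeg (isPositive11_segm t hb₀).1 (hdeg1 t)
        · have := hw ⟨v, hv⟩
          rw [hQc] at this
          have := (mul_eq_zero.1 this).resolve_left hs
          rw [← this]
          congr 1
          change _ = segm t b₀ * (w : Lam n) * _ * _
          rw [← mul_assoc, ← hbc, mul_assoc (segm t b₀), mul_assoc (segm t b₀), mul_assoc (segm t b₀)])
    -- At `t = 1` every form is standard, and orthogonality to the range says that `u` is primitive
    -- in the classical sense.
    (fun u hne hw => by
      have h1 : ∀ b, segm (1 : unitInterval) b = stdForm n := fun b => by simp [segm]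
      have hΩ1 : Ω 1 = stdForm n ^ l.length := by
        simp only [Ω]
        rw [List.prod_eq_pow_card _ (stdForm n), List.length_map]
        intro x hx
        obtain ⟨d, -, rfl⟩ := List.mem_map.1 hx
        exact h1 d
      change 0 < ssgn k * tau n ((u : Lam n) * weilLam n (u : Lam n) * Ω 1)
      rw [hΩ1]
      refine hodgeRiemann_std n k l.length hk u u.2 (fun e => hne (Subtype.ext e)) ?_
      have := weil_mem_nondeg (j := k - 2) (hdeg1 1) u.2 (by push_cast; linarith) fun v hv => by
        have := hw ⟨v, hv⟩
        rw [hQc] at this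
        exact (mul_eq_zero.1 this).resolve_left hs
      rwa [h1, hΩ1, ← pow_succ'] at this)
    ⟨u, hu⟩ (fun e => hne (congrArg Subtype.val e)) (fun w => by
      have h1 : ∀ b : Lam n, segm (0 : unitInterval) b = b := fun b => by simp [segm]
      have hΩ0 : Ω 0 = l.prod := by
        simp only [Ω]
        congr 1
        conv_rhs => rw [← List.map_id l]
        exact List.map_congr_left fun b _ => h1 b
      rw [hQc, h1, hΩ0]
      have e : u * weilLam n (w : Lam n) * (b₀ * l.prod) = b₀ * l.prod * u * weilLam n w := by
        have h2 : b₀ * l.prod ∈ LamDeg n (2 * (l.length + 1)) := by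
          have := hdeg1 0
          rwa [h1, hΩ0] at this
        rw [← mul_comm_of_even h2]
        simp only [mul_assoc]
      change _ * tau n (u * weilLam n (w : Lam n) * (b₀ * l.prod)) = 0
      rw [e, h0, zero_mul, map_zero, mul_zero])
  have hΩ0 : Ω 0 = l.prod := by
    simp only [Ω]
    congr 1
    conv_rhs => rw [← List.map_id l]
    exact List.map_congr_left fun b _ => by simp [segm]
  rw [← hΩ0]
  exact key

/-- Hard Lefschetz in dimension `n` yields Hodge–Riemann in dimension `n`, which yields hard
Lefschetz in dimension `n + 1`. Only hard Lefschetz is needed in the sequel. -/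
theorem mixedHL : ∀ n, MixedHL n
  | 0 => mixedHL_zero
  | n + 1 => mixedHL_succ (mixedHR_of_mixedHL (mixedHL n))

end Mixed

end THodge
end

noncomputable section

namespace THodge

/-! ### Bump functions and decomposition of forms -/

section Bump

variable {n r : ℕ} {X : Type*} [TopologicalSpace X] [ChartedSpace (CV n) X]

variable (n) in
/-- Smooth real functions. -/
def IsSmoothFn (f : X → ℝ) : Prop :=
  ∀ x₀ : X, ContDiffAt ℝ ∞ (fun y => f ((chartAt (CV n) x₀).symm y)) (chartAt (CV n) x₀ x₀)

theorem IsSmoothFn.continuous {f : X → ℝ} (hf : IsSmoothFn n f) : Continuous f := by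
  refine continuous_iff_continuousAt.2 fun x => ?_
  have h1 := ContinuousAt.comp (x := x) (hf x).continuousAt
    ((chartAt (CV n) x).continuousAt (mem_chart_source (CV n) x))
  refine h1.congr ?_
  filter_upwards [(chartAt (CV n) x).open_source.mem_nhds (mem_chart_source (CV n) x)] with z hz
  exact congrArg f ((chartAt (CV n) x).left_inv hz)

theorem IsSmoothFn.sum {ι : Type*} {s : Finset ι} {f : ι → X → ℝ}
    (hf : ∀ i ∈ s, IsSmoothFn n (f i)) : IsSmoothFn n fun x => ∑ i ∈ s, f i x :=
  fun x₀ => ContDiffAt.sum fun i hi => hf i hi x₀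

theorem chart_symm_notMem_eventually [T2Space X] {K : Set X} (hK : IsCompact K) {x : X}
    (hx : x ∉ K) : ∀ᶠ y in 𝓝 (chartAt (CV n) x x), (chartAt (CV n) x).symm y ∉ K := by
  have hU := ((chartAt (CV n) x).isOpen_inter_preimage_symm
    hK.isClosed.isOpen_compl).mem_nhds (x := chartAt (CV n) x x)
    ⟨mem_chart_target (CV n) x, by
      change (chartAt (CV n) x).symm (chartAt (CV n) x x) ∈ Kᶜ
      rwa [(chartAt (CV n) x).left_inv (mem_chart_source (CV n) x)]⟩
  filter_upwards [hU] with z hz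
  exact hz.2

/-- A bump function on `ℂⁿ` carried over by the chart and extended by zero. Smoothness outside the
chart domain uses that the compact support is closed in a Hausdorff space. -/
theorem exists_bump [T2Space X] [IsManifold 𝓘(ℂ, CV n) ω X] {U : Set X} (hU : IsOpen U) {p : X}
    (hp : p ∈ U) : ∃ f : X → ℝ, IsSmoothFn n f ∧ (∀ x, 0 ≤ f x) ∧ 0 < f p ∧
      ∃ K, IsCompact K ∧ K ⊆ (chartAt (CV n) p).source ∩ U ∧ ∀ x ∉ K, f x = 0 := by
  classical
  have hW := ((chartAt (CV n) p).isOpen_inter_preimage_symm hU).mem_nhds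
    (x := chartAt (CV n) p p) ⟨mem_chart_target (CV n) p, by
      change (chartAt (CV n) p).symm (chartAt (CV n) p p) ∈ U
      rwa [(chartAt (CV n) p).left_inv (mem_chart_source (CV n) p)]⟩
  obtain ⟨ε, hε, hball⟩ := Metric.nhds_basis_closedBall.mem_iff.1 hW
  let b : ContDiffBump (chartAt (CV n) p p) := ⟨ε / 2, ε, by positivity, by linarith⟩
  let f : X → ℝ := fun x => if x ∈ (chartAt (CV n) p).source then b (chartAt (CV n) p x) else 0
  let K := (chartAt (CV n) p).symm '' Metric.closedBall (chartAt (CV n) p p) ε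
  have hK : IsCompact K := (isCompact_closedBall _ _).image_of_continuousOn
    ((chartAt (CV n) p).continuousOn_symm.mono fun y hy => (hball hy).1)
  have hf0 : ∀ x ∉ K, f x = 0 := by
    intro x hx
    simp only [f]
    split_ifs with hs
    · refine b.zero_of_le_dist (not_lt.1 fun hlt => hx ?_)
      exact ⟨_, Metric.ball_subset_closedBall (Metric.mem_ball.2 hlt),
        (chartAt (CV n) p).left_inv hs⟩
    · rfl
  refine ⟨f, fun x₀ => ?_, fun x => ?_, ?_, K, hK, ?_, hf0⟩
  · by_cases hs : x₀ ∈ (chartAt (CV n) p).source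
    · have ht := mem_chart_target (CV n) x₀
      have hs' : (chartAt (CV n) x₀).symm (chartAt (CV n) x₀ x₀) ∈ (chartAt (CV n) p).source := by
        rwa [(chartAt (CV n) x₀).left_inv (mem_chart_source (CV n) x₀)]
      refine ContDiffAt.congr_of_eventuallyEq
        ((b.contDiff (n := ⊤)).contDiffAt.comp _ (holAt_trans ht hs').smooth) ?_
      filter_upwards [eventually_overlap ht hs'] with z hz
      simp only [f, if_pos hz.2]
      rfl
    · have hx : x₀ ∉ K := by
        rintro ⟨y, hy, rfl⟩
        exact hs ((chartAt (CV n) p).map_target (hball hy).1)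
      refine ContDiffAt.congr_of_eventuallyEq (contDiffAt_const (c := 0)) ?_
      filter_upwards [chart_symm_notMem_eventually hK hx] with z hz
      exact hf0 _ hz
  · simp only [f]
    split_ifs
    · exact b.nonneg
    · exact le_rfl
  · simp only [f, if_pos (mem_chart_source (CV n) p)]
    exact b.pos_of_mem_ball (Metric.mem_ball_self hε)
  · rintro _ ⟨y, hy, rfl⟩
    exact ⟨(chartAt (CV n) p).map_target (hball hy).1, (hball hy).2⟩

variable {E : X → Type*} [∀ x, AddCommGroup (E x)] [∀ x, Module ℂ (E x)]
  [TopologicalSpace (Bundle.TotalSpace (Fin r → ℂ) E)] [∀ x, TopologicalSpace (E x)]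
  [FiberBundle (Fin r → ℂ) E] [VectorBundle ℂ (Fin r → ℂ) E]

theorem localRep_fsmul (f : X → ℝ) (u : Forms n E) (x₀ : X) (y : CV n) :
    localRep r (fun x => f x • u x) x₀ y = f ((chartAt (CV n) x₀).symm y) • localRep r u x₀ y :=
  LinearMap.map_smul_of_tower _ _ _

theorem IsSmoothForm.fsmul {f : X → ℝ} {u : Forms n E} (hf : IsSmoothFn n f)
    (hu : IsSmoothForm r u) : IsSmoothForm r fun x => f x • u x := fun x₀ =>
  (SmoothAt.smul (hf x₀) (hu x₀)).congr
    (Filter.Eventually.of_forall fun y => localRep_fsmul f u x₀ y)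

variable (n r E) in
/-- The domain of definition of the chart and of the frame at `x₀`. -/
def Dom (x₀ : X) : Set X :=
  (chartAt (CV n) x₀).source ∩ (trivializationAt (Fin r → ℂ) E x₀).baseSet

/-- Finitely many bump functions cover the compact support of `a`, and their sum `F` is positive
there. Dividing `a` by `F` is harmless because `a` vanishes off that support, so multiplying the
quotient by the individual bumps decomposes `a`. -/
theorem exists_local_decomp [T2Space X] [IsManifold 𝓘(ℂ, CV n) ω X] {a : Forms n E}
    (ha : a ∈ smoothForms n r E) :
    ∃ (s : Finset X) (b : X → Forms n E), a = ∑ i ∈ s, b i ∧ ∀ i ∈ s, IsSmoothForm r (b i) ∧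
      ∃ K, IsCompact K ∧ K ⊆ Dom n r E i ∧ ∀ x ∉ K, b i x = 0 := by
  obtain ⟨hs, K, hK, h0⟩ := mem_smoothForms.1 ha
  choose f hf hf0 hfp C hC hCs hfC using fun p : X => exists_bump (n := n)
    (trivializationAt (Fin r → ℂ) E p).open_baseSet (FiberBundle.mem_baseSet_trivializationAt' p)
  obtain ⟨t, -, ht⟩ := hK.elim_nhds_subcover (fun p => {x | 0 < f p x})
    fun p _ => (isOpen_lt continuous_const (hf p).continuous).mem_nhds (hfp p)
  let F : X → ℝ := fun x => ∑ p ∈ t, f p x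
  have hF : IsSmoothFn n F := IsSmoothFn.sum fun p _ => hf p
  have hFK : ∀ x ∈ K, F x ≠ 0 := by
    intro x hx
    obtain ⟨p, hp⟩ := Set.mem_iUnion.1 (ht hx)
    obtain ⟨hpt, hp⟩ := Set.mem_iUnion.1 hp
    exact (Finset.sum_pos' (fun q _ => hf0 q x) ⟨p, hpt, hp⟩).ne'
  let a' : Forms n E := fun x => (F x)⁻¹ • a x
  have ha' : IsSmoothForm r a' := by
    intro x₀
    by_cases hx : x₀ ∈ K
    · have hne : F ((chartAt (CV n) x₀).symm (chartAt (CV n) x₀ x₀)) ≠ 0 := by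
        rw [(chartAt (CV n) x₀).left_inv (mem_chart_source (CV n) x₀)]
        exact hFK x₀ hx
      exact (SmoothAt.smul ((hF x₀).inv hne) (hs x₀)).congr
        (Filter.Eventually.of_forall fun y => localRep_fsmul (fun x => (F x)⁻¹) a x₀ y)
    · exact (smoothAt_const 0 _).congr (localRep_eventually_zero (r := r) hK
        (fun x hx => by simp only [a', h0 x hx, smul_zero]) hx)
  refine ⟨t, fun p x => f p x • a' x, ?_, fun p _ => ⟨ha'.fsmul (hf p), C p, hC p, hCs p,
    fun x hx => by simp only [hfC p x hx, zero_smul]⟩⟩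
  funext x
  rw [Finset.sum_apply, ← Finset.sum_smul]
  by_cases hx : x ∈ K
  · exact (smul_inv_smul₀ (hFK x hx) (a x)).symm
  · simp only [a', h0 x hx, smul_zero]

end Bump

/-! ### The Hermitian pairing of forms -/

section Pairing

variable {n r : ℕ} {X : Type*} [TopologicalSpace X] [ChartedSpace (CV n) X]
  {E : X → Type*} [∀ x, AddCommGroup (E x)] [∀ x, Module ℂ (E x)] {h : SesqForm E}

theorem hermPair_tmul (x : X) (s t : E x) (a b : Lam n) :
    hermPair h x (s ⊗ₜ a) (t ⊗ₜ b) = h x s t ⊗ₜ[ℝ] (a * b) := rfl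

theorem hermPair_wedge_left (x : X) (c : Lam n) (u v : E x ⊗[ℝ] Lam n) :
    hermPair h x (wedge c u) v = wedge c (hermPair h x u v) := by
  refine tensor_induction₂ (p := fun u v => hermPair h x (wedge c u) v =
    wedge c (hermPair h x u v)) ?_ ?_ ?_ ?_ ?_ u v
  · intro s a t b
    rw [wedge_tmul, hermPair_tmul, hermPair_tmul, wedge_tmul, mul_assoc]
  · intro v
    simp only [map_zero, LinearMap.zero_apply]
  · intro u
    simp only [map_zero]
  · intro u u' v hu hu'
    simp only [map_add, LinearMap.add_apply, hu, hu']
  · intro u v v' hv hv'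
    simp only [map_add, hv, hv']

theorem hermPair_wedge_right (x : X) {c : Lam n} (hc : ∀ b, c * b = b * c)
    (u v : E x ⊗[ℝ] Lam n) : hermPair h x u (wedge c v) = wedge c (hermPair h x u v) := by
  refine tensor_induction₂ (p := fun u v => hermPair h x u (wedge c v) =
    wedge c (hermPair h x u v)) ?_ ?_ ?_ ?_ ?_ u v
  · intro s a t b
    rw [wedge_tmul, hermPair_tmul, hermPair_tmul, wedge_tmul, ← mul_assoc, ← mul_assoc, hc]
  · intro v
    simp only [map_zero, LinearMap.zero_apply]
  · intro u
    simp only [map_zero]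
  · intro u u' v hu hu'
    simp only [map_add, LinearMap.add_apply, hu, hu']
  · intro u v v' hv hv'
    simp only [map_add, hv, hv']

theorem hermPair_parW (x : X) (u v : E x ⊗[ℝ] Lam n) :
    hermPair h x (parW n _ u) (parW n _ v) = parW n ℂ (hermPair h x u v) := by
  refine tensor_induction₂ (p := fun u v => hermPair h x (parW n _ u) (parW n _ v) =
    parW n ℂ (hermPair h x u v)) ?_ ?_ ?_ ?_ ?_ u v
  · intro s a t b
    simp only [parW, tm_tmul, hermPair_tmul, AlgHom.toLinearMap_apply, map_mul, LinearMap.id_apply]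
  · intro v
    simp only [map_zero, LinearMap.zero_apply]
  · intro u
    simp only [map_zero]
  · intro u u' v hu hu'
    simp only [map_add, LinearMap.add_apply, hu, hu']
  · intro u v v' hv hv'
    simp only [map_add, hv, hv']

variable [TopologicalSpace (Bundle.TotalSpace (Fin r → ℂ) E)] [∀ x, TopologicalSpace (E x)]
  [FiberBundle (Fin r → ℂ) E] [VectorBundle ℂ (Fin r → ℂ) E]

variable (n r h) in
/-- The pairing of two forms, in the chart and frame at `x₀`. -/
def locPair (x₀ : X) (u v : Forms n E) (y : CV n) : ℂ ⊗[ℝ] Lam n :=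
  stdPair n r (localRep r u x₀ y) (rmul (gram n r h x₀ y) (localRep r v x₀ y))

/-- Hermitian symmetry allows the Gram matrix to act on the second argument, before conjugation. In
this form the factor `H⁻¹` of `∂^E = H⁻¹ ∂ H` cancels in the Leibniz rule. -/
theorem pull_hermPair (hh : IsHermitianMetric n r h) {x₀ : X} {y : CV n}
    (hy : y ∈ dom n r E x₀) (u v : Forms n E) :
    tm LinearMap.id (pullLam x₀ y).toLinearMap
      (hermPair h ((chartAt (CV n) x₀).symm y) (u _) (v _)) = locPair n r h x₀ u v y := by
  have key : ∀ u v : E ((chartAt (CV n) x₀).symm y) ⊗[ℝ] Lam n,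
      tm LinearMap.id (pullLam x₀ y).toLinearMap
        (hermPair h ((chartAt (CV n) x₀).symm y) u v) =
      stdPair n r (repAt r x₀ y _ u) (rmul (gram n r h x₀ y) (repAt r x₀ y _ v)) := by
    intro u v
    refine tensor_induction₂ (p := fun u v => tm LinearMap.id (pullLam x₀ y).toLinearMap
        (hermPair h ((chartAt (CV n) x₀).symm y) u v) =
      stdPair n r (repAt r x₀ y _ u) (rmul (gram n r h x₀ y) (repAt r x₀ y _ v))) ?_ ?_ ?_ ?_ ?_ u v
    · intro s a t b
      rw [hermPair_tmul, repAt, tm_tmul, tm_tmul, tm_tmul, rmul, tm_tmul, stdPair_tmul,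
        AlgHom.toLinearMap_apply, map_mul]
      congr 1
      have hs : ∀ s, (trivializationAt (Fin r → ℂ) E x₀).symmₗ ℂ ((chartAt (CV n) x₀).symm y)
          ((trivializationAt (Fin r → ℂ) E x₀).linearMapAt ℂ ((chartAt (CV n) x₀).symm y) s) = s :=
        fun s => Bundle.Trivialization.symmₗ_linearMapAt _ hy.2 _
      rw [LinearMap.id_apply, hh.symm]
      conv_lhs => rw [← hs s, ← hs t, metric_symm, map_sum]
      refine Finset.sum_congr rfl fun i _ => ?_
      rw [map_mul, conj_conj, mul_comm]
      rfl
    · intro v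
      simp only [map_zero, LinearMap.zero_apply]
    · intro u
      simp only [map_zero]
    · intro u u' v hu hu'
      simp only [map_add, LinearMap.add_apply, hu, hu']
    · intro u v v' hv hv'
      simp only [map_add, hv, hv']
  exact key _ _

/-- The pairing of two forms. -/
def pairForm (h : SesqForm E) (u v : Forms n E) (x : X) : ℂ ⊗[ℝ] Lam n := hermPair h x (u x) (v x)

theorem locTop_pairForm (hh : IsHermitianMetric n r h) {x₀ : X} {y : CV n}
    (hy : y ∈ dom n r E x₀) (u v : Forms n E) :
    locTop (pairForm h u v) x₀ y = topC n (locPair n r h x₀ u v y) := by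
  rw [← pull_hermPair hh hy]
  rfl

end Pairing

end THodge
end

noncomputable section

namespace THodge

/-! ### Stokes' theorem -/

section Stokes

variable {n r : ℕ} {X : Type*} [TopologicalSpace X] [ChartedSpace (CV n) X]
  [IsManifold 𝓘(ℂ, CV n) ω X]
  {E : X → Type*} [∀ x, AddCommGroup (E x)] [∀ x, Module ℂ (E x)]
  [TopologicalSpace (Bundle.TotalSpace (Fin r → ℂ) E)] [∀ x, TopologicalSpace (E x)]
  [FiberBundle (Fin r → ℂ) E] [VectorBundle ℂ (Fin r → ℂ) E]
  [ContMDiffVectorBundle ω (Fin r → ℂ) E 𝓘(ℂ, CV n)] {h : SesqForm E}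

theorem continuousAt_topC {g : CV n → ℂ ⊗[ℝ] Lam n} {y : CV n} (hg : SmoothAt g y) :
    ContinuousAt (fun z => topC n (g z)) y :=
  (smoothAt_iff_contDiffAt.1 (hg.linear ((topC n).restrictScalars ℝ))).continuousAt

theorem smoothAt_locPair (hh : IsHermitianMetric n r h) {u v : Forms n E}
    (hu : IsSmoothForm r u) (hv : IsSmoothForm r v) {x₀ : X} {y : CV n}
    (hy : y ∈ dom n r E x₀) : SmoothAt (locPair n r h x₀ u v) y :=
  smoothAt_stdPair (hu.smoothAt hy)
    (smoothAt_gauge (smoothAt_vecMul (contDiffAt_gram hh hy)) (hv.smoothAt hy))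

theorem continuousAt_locTop_pairForm (hh : IsHermitianMetric n r h) {u v : Forms n E}
    (hu : IsSmoothForm r u) (hv : IsSmoothForm r v) {x₀ : X} {y : CV n}
    (hy : y ∈ dom n r E x₀) : ContinuousAt (locTop (pairForm h u v) x₀) y := by
  refine (continuousAt_topC (smoothAt_locPair hh hu hv hy)).congr ?_
  filter_upwards [(isOpen_dom (r := r) (E := E) x₀).mem_nhds hy] with z hz
  exact (locTop_pairForm hh hz u v).symm

/-- Continuity is needed on the whole chart target, including points where the frame at `x₀` is not
defined. Near such a point the coefficient is compared with the one in the chart and frame preferred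
there. -/
theorem contCompact_pairForm (hh : IsHermitianMetric n r h) {u v : Forms n E}
    (hu : u ∈ smoothForms n r E) (hv : IsSmoothForm r v) : ContCompact (pairForm h u v) where
  cont x₀ y hy := by
    have hp : (chartAt (CV n) x₀).symm y ∈
        (chartAt (CV n) ((chartAt (CV n) x₀).symm y)).source := mem_chart_source _ _
    set p := (chartAt (CV n) x₀).symm y
    have ht := (holAt_trans hy hp).smooth
    have h1 : ContinuousAt (fun z => LinearMap.det (dtrans n x₀ p z)) y :=
      ContinuousLinearMap.continuous_det.continuousAt.comp
        ((ht.fderiv_right (m := ∞) (by simp)).continuousAt)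
    have h2 : ContinuousAt (locTop (pairForm h u v) p) (trans n x₀ p y) :=
      continuousAt_locTop_pairForm hh hu.1 hv (chart_mem_dom p)
    have h3 : ContinuousAt (fun z => ((LinearMap.det (dtrans n x₀ p z) : ℝ) : ℂ) *
        locTop (pairForm h u v) p (trans n x₀ p z)) y :=
      (continuous_ofReal.continuousAt.comp h1).mul
        (ContinuousAt.comp (f := trans n x₀ p) h2 ht.continuousAt)
    refine ContinuousAt.continuousWithinAt (h3.congr ?_)
    filter_upwards [eventually_overlap hy hp] with z hz
    exact (locTop_trans hz.1 hz.2 _).symm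
  supp := by
    obtain ⟨-, K, hK, h0⟩ := hu
    exact ⟨K, hK, fun p hp => by rw [pairForm, h0 p hp, map_zero, LinearMap.zero_apply]⟩

/-- The parity operator on forms. -/
def parF (E : X → Type*) [∀ x, AddCommGroup (E x)] [∀ x, Module ℂ (E x)] :
    Forms n E →ₗ[ℂ] Forms n E := formOp E (par n).toLinearMap

omit [IsManifold 𝓘(ℂ, CV n) ω X] [ContMDiffVectorBundle ω (Fin r → ℂ) E 𝓘(ℂ, CV n)] in
theorem smoothForms_parF {u : Forms n E} (hu : u ∈ smoothForms n r E) :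
    parF E u ∈ smoothForms n r E :=
  smoothForms_formOp (fun x₀ y _ a => pullLam_par x₀ y a) hu

omit [IsManifold 𝓘(ℂ, CV n) ω X] [ContMDiffVectorBundle ω (Fin r → ℂ) E 𝓘(ℂ, CV n)] in
theorem localRep_parF (u : Forms n E) (x₀ : X) (y : CV n) :
    localRep r (parF E u) x₀ y = parW n _ (localRep r u x₀ y) :=
  localRep_formOp (fun a => pullLam_par x₀ y a) u

/-- Compatibility of the Chern connection with the metric. Conjugating the second argument exchanges
`∂̄` and `∂`, and the parity is the sign from moving the derivative past the first factor. -/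
theorem dbar0_locPair (hh : IsHermitianMetric n r h) {a b : Forms n E}
    (ha : IsSmoothForm r a) (hb : IsSmoothForm r b) {x₀ : X} {y : CV n}
    (hy : y ∈ dom n r E x₀) : dbar0 (locPair n r h x₀ a b) y =
      locPair n r h x₀ (dbar r a) b y + locPair n r h x₀ (parF E a) (del r h b) y := by
  have hH := contDiffAt_gram hh hy
  have hdet := isUnit_det_gram hh hy
  have h1 : dbar0 (locPair n r h x₀ a b) y = _ := dbar0_stdPair (ha.smoothAt hy)
    (smoothAt_gauge (smoothAt_vecMul hH) (hb.smoothAt hy))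
  rw [h1, locPair, locPair, localRep_dbar ha hy, localRep_parF, localRep_del hh hb hy,
    flatDel_eq hH hdet (hb.smoothAt hy), rmul_rmul, Matrix.nonsing_inv_mul _ hdet, rmul_one]

variable [T2Space X] [SecondCountableTopology X]

/-- When `a` is supported in the domain of one chart and frame, the local expression of the pairing
extends by zero to a smooth form with compact support on `ℂⁿ`. The integrand is `∂̄` of it. -/
theorem stokes_local (hh : IsHermitianMetric n r h) {a b : Forms n E}
    (ha : IsSmoothForm r a) (hb : IsSmoothForm r b) {x₀ : X} {K : Set X} (hK : IsCompact K)
    (hKs : K ⊆ Dom n r E x₀) (h0 : ∀ x ∉ K, a x = 0) :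
    integral (pairForm h (dbar r a) b) + integral (pairForm h (parF E a) (del r h b)) = 0 := by
  classical
  have haV : a ∈ smoothForms n r E := ⟨ha, K, hK, h0⟩
  have hc1 := contCompact_pairForm hh (smoothForms_dbar haV) hb
  have hc2 := contCompact_pairForm hh (smoothForms_parF haV) (hb.del hh)
  rw [← integral_form_add hc1 hc2]
  set η := pairForm h (dbar r a) b + pairForm h (parF E a) (del r h b) with hη
  have hη0 : ∀ p ∉ K, η p = 0 := by
    intro p hp
    have e1 : dbar r a p = 0 := dbar_eq_zero hK h0 hp
    have e2 : parF E a p = 0 := by rw [parF, formOp_apply, h0 p hp, map_zero]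
    rw [hη, Pi.add_apply, pairForm, pairForm, e1, e2]
    simp only [map_zero, LinearMap.zero_apply, add_zero]
  rw [integral_eq_setIntegral ((hc1.add hc2).cont x₀) hK (fun x hx => (hKs hx).1) hη0]
  let G : CV n → ℂ ⊗[ℝ] Lam n := fun y =>
    if y ∈ dom n r E x₀ then locPair n r h x₀ a b y else 0
  let C := chartAt (CV n) x₀ '' K
  have hC : IsCompact C := hK.image_of_continuousOn
    ((chartAt (CV n) x₀).continuousOn.mono fun x hx => (hKs hx).1)
  have hG0 : ∀ y ∉ C, G y = 0 := by
    intro y hy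
    simp only [G]
    split_ifs with hd
    · have : a ((chartAt (CV n) x₀).symm y) = 0 := h0 _ fun hk =>
        hy ⟨_, hk, (chartAt (CV n) x₀).right_inv hd.1⟩
      have : localRep r a x₀ y = 0 := by rw [localRep, this, map_zero]
      rw [locPair, this, map_zero, LinearMap.zero_apply]
    · rfl
  have hGd : ∀ y ∈ dom n r E x₀, G =ᶠ[𝓝 y] locPair n r h x₀ a b := by
    intro y hy
    filter_upwards [(isOpen_dom (r := r) (E := E) x₀).mem_nhds hy] with z hz
    exact if_pos hz
  have hGC : ∀ y ∉ C, G =ᶠ[𝓝 y] fun _ => 0 := by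
    intro y hy
    filter_upwards [hC.isClosed.isOpen_compl.mem_nhds hy] with z hz
    exact hG0 z hz
  have hCd : ∀ y ∈ C, y ∈ dom n r E x₀ := by
    rintro _ ⟨x, hx, rfl⟩
    refine ⟨(chartAt (CV n) x₀).map_source (hKs hx).1, ?_⟩
    rw [(chartAt (CV n) x₀).left_inv (hKs hx).1]
    exact (hKs hx).2
  have hGs : ∀ y, SmoothAt G y := by
    intro y
    by_cases hy : y ∈ C
    · exact (smoothAt_locPair hh ha hb (hCd y hy)).congr (hGd y (hCd y hy))
    · exact (smoothAt_const 0 y).congr (hGC y hy)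
  have hdz : ∀ y ∉ C, dbar0 G y = 0 := by
    intro y hy
    rw [dbar0_congr (hGC y hy)]
    simp [dbar0, Dop, dirDeriv_const]
  have hout : ∀ y ∉ (chartAt (CV n) x₀).target, topC n (dbar0 G y) = 0 := by
    intro y hy
    rw [hdz y fun hyC => hy (hCd y hyC).1, map_zero]
  rw [← integral_topC_dbar0 hGs hC hG0, ← setIntegral_eq_integral_of_forall_compl_eq_zero hout]
  · refine setIntegral_congr_fun (chartAt (CV n) x₀).open_target.measurableSet fun y hy => ?_
    by_cases hyC : y ∈ C
    · have hd := hCd y hyC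
      rw [locTop_add, locTop_pairForm hh hd, locTop_pairForm hh hd, ← map_add,
        ← dbar0_locPair hh ha hb hd, dbar0_congr (hGd y hd)]
    · change locTop η x₀ y = topC n (dbar0 G y)
      rw [hdz y hyC, map_zero]
      exact locTop_eq_zero (hη0 _ fun hk => hyC ⟨_, hk, (chartAt (CV n) x₀).right_inv hy⟩)

/-- Both sides are additive in `a`, so the decomposition into locally supported forms suffices. The
form `b` needs no compact support. -/
theorem stokes (hh : IsHermitianMetric n r h) {a b : Forms n E}
    (ha : a ∈ smoothForms n r E) (hb : IsSmoothForm r b) :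
    integral (pairForm h (dbar r a) b) = -integral (pairForm h (parF E a) (del r h b)) := by
  rw [← add_eq_zero_iff_eq_neg]
  obtain ⟨s, c, rfl, hc⟩ := exists_local_decomp ha
  refine (Finset.sum_induction c (fun a => a ∈ smoothForms n r E ∧
    integral (pairForm h (dbar r a) b) + integral (pairForm h (parF E a) (del r h b)) = 0)
    ?_ ?_ ?_).2
  · rintro a a' ⟨ha, hi⟩ ⟨ha', hi'⟩
    refine ⟨Submodule.add_mem _ ha ha', ?_⟩
    have e1 : pairForm h (dbar r (a + a')) b =
        pairForm h (dbar r a) b + pairForm h (dbar r a') b := by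
      funext x
      simp only [dbar_add ha.1 ha'.1, pairForm, Pi.add_apply, map_add, LinearMap.add_apply]
    have e2 : pairForm h (parF E (a + a')) (del r h b) =
        pairForm h (parF E a) (del r h b) + pairForm h (parF E a') (del r h b) := by
      funext x
      simp only [pairForm, Pi.add_apply, map_add, LinearMap.add_apply]
    rw [e1, e2, integral_form_add (contCompact_pairForm hh (smoothForms_dbar ha) hb)
      (contCompact_pairForm hh (smoothForms_dbar ha') hb),
      integral_form_add (contCompact_pairForm hh (smoothForms_parF ha) (hb.del hh))
      (contCompact_pairForm hh (smoothForms_parF ha') (hb.del hh)), add_add_add_comm, hi, hi',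
      add_zero]
  · refine ⟨Submodule.zero_mem _, ?_⟩
    have e1 : pairForm h (dbar r (0 : Forms n E)) b = 0 := by
      funext x
      rw [pairForm, dbar_eq_zero (u := (0 : Forms n E)) isCompact_empty (fun _ _ => rfl)
        (Set.notMem_empty x), map_zero, LinearMap.zero_apply]
      rfl
    have e2 : pairForm h (parF E (0 : Forms n E)) (del r h b) = 0 := by
      funext x
      simp only [pairForm, map_zero, Pi.zero_apply, LinearMap.zero_apply]
    rw [e1, e2, integral_form_zero, add_zero]
  · intro i hi
    obtain ⟨hs, K, hK, hKs, h0⟩ := hc i hi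
    exact ⟨⟨hs, K, hK, h0⟩, stokes_local hh hs hb hK hKs h0⟩

omit [IsManifold 𝓘(ℂ, CV n) ω X] [TopologicalSpace (Bundle.TotalSpace (Fin r → ℂ) E)]
  [∀ x, TopologicalSpace (E x)] [FiberBundle (Fin r → ℂ) E] [VectorBundle ℂ (Fin r → ℂ) E]
  [ContMDiffVectorBundle ω (Fin r → ℂ) E 𝓘(ℂ, CV n)] in
theorem integral_pairForm_parF (a b : Forms n E) :
    integral (pairForm h (parF E a) (parF E b)) = integral (pairForm h a b) := by
  refine integral_form_congr fun x₀ y _ => ?_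
  have e : pairForm h (parF E a) (parF E b) ((chartAt (CV n) x₀).symm y) =
    parW n ℂ (pairForm h a b ((chartAt (CV n) x₀).symm y)) := hermPair_parW _ _ _
  rw [locTop, e, locTop, ← topC_par (tm LinearMap.id (pullLam x₀ y).toLinearMap
    (pairForm h a b ((chartAt (CV n) x₀).symm y))), parW, tm_tm, tm_tm]
  congr 2
  congr 1
  exact LinearMap.ext fun a => pullLam_par x₀ y a

end Stokes

/-! ### Nondegeneracy of the integral pairing -/

section Nondegenerate

variable {n r : ℕ}

/-- In finite dimension a pairing nondegenerate on the left is perfect. -/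
theorem wedge_nondeg_right {x : Lam n} (hx : ∀ v, tau n (v * x) = 0) : x = 0 := by
  let B : Lam n →ₗ[ℝ] Module.Dual ℝ (Lam n) := (LinearMap.mul ℝ (Lam n)).compr₂ (tau n)
  have hB : Function.Injective B := by
    rw [← LinearMap.ker_eq_bot, LinearMap.ker_eq_bot']
    exact fun y hy => wedge_nondeg fun v => LinearMap.congr_fun hy v
  have hs : Function.Surjective B :=
    (LinearMap.injective_iff_surjective_of_finrank_eq_finrank
      Subspace.dual_finrank_eq.symm).1 hB
  have hf : Function.Injective B.flip := LinearMap.flip_injective_iff₁.2 hs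
  refine hf ?_
  rw [map_zero]
  exact LinearMap.ext hx

/-- Expand `w` in a real basis of the forms with coefficients in `ℂʳ`, and test against `e_i ⊗ a`.
The real and imaginary parts of each coefficient are detected separately by the real wedge pairing.
-/
theorem exists_topC_stdPair_ne {w : (Fin r → ℂ) ⊗[ℝ] Lam n} (hw : w ≠ 0) :
    ∃ a, topC n (stdPair n r a w) ≠ 0 := by
  classical
  by_contra! hz
  refine hw ?_
  let b := Module.finBasis ℝ (Lam n)
  obtain ⟨c, rfl⟩ := (TensorProduct.equivFinsuppOfBasisRight (M := Fin r → ℂ) b).symm.surjective w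
  have hexp : (TensorProduct.equivFinsuppOfBasisRight (M := Fin r → ℂ) b).symm c =
      ∑ j, c j ⊗ₜ[ℝ] b j := by
    have := LinearMap.congr_fun (TensorProduct.equivFinsuppOfBasisRight_symm (M := Fin r → ℂ) b) c
    refine Eq.trans this ?_
    rw [Finsupp.lsum_apply, Finsupp.sum_fintype _ _ fun i => map_zero _]
    rfl
  rw [hexp] at hz ⊢
  have key : ∀ (i : Fin r) (a : Lam n), ∑ j, (tau n (a * b j) : ℂ) * (starRingEnd ℂ) (c j i) = 0 := by
    intro i a
    rw [← hz ((Pi.single i 1 : Fin r → ℂ) ⊗ₜ a), map_sum, map_sum]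
    refine Finset.sum_congr rfl fun j _ => ?_
    rw [stdPair_tmul, topC_tmul]
    simp [Pi.single_apply, tau]
  have hre : ∀ i, ∑ j, (c j i).re • b j = 0 := fun i => wedge_nondeg_right fun a => by
    have := congrArg re (key i a)
    rw [Finset.mul_sum, map_sum, ← Complex.zero_re, ← this, Complex.re_sum]
    exact Finset.sum_congr rfl fun j _ => by simp [mul_comm]
  have him : ∀ i, ∑ j, (c j i).im • b j = 0 := fun i => wedge_nondeg_right fun a => by
    have := congrArg (fun z => -im z) (key i a)
    rw [Finset.mul_sum, map_sum, ← neg_zero, ← Complex.zero_im]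
    rw [← this, Complex.im_sum, ← Finset.sum_neg_distrib]
    exact Finset.sum_congr rfl fun j _ => by simp [mul_comm]
  have hc : ∀ j, c j = 0 := by
    intro j
    funext i
    have h1 := Fintype.linearIndependent_iff.1 b.linearIndependent _ (hre i) j
    have h2 := Fintype.linearIndependent_iff.1 b.linearIndependent _ (him i) j
    exact Complex.ext h1 h2
  exact Finset.sum_eq_zero fun j _ => by rw [hc, TensorProduct.zero_tmul]

end Nondegenerate

end THodge
end

noncomputable section

namespace THodge

/-! ### Test forms supported near a point -/

section Localized

variable {n r : ℕ} {X : Type*} [TopologicalSpace X] [ChartedSpace (CV n) X]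
  [IsManifold 𝓘(ℂ, CV n) ω X]
  {E : X → Type*} [∀ x, AddCommGroup (E x)] [∀ x, Module ℂ (E x)]
  [TopologicalSpace (Bundle.TotalSpace (Fin r → ℂ) E)] [∀ x, TopologicalSpace (E x)]
  [FiberBundle (Fin r → ℂ) E] [VectorBundle ℂ (Fin r → ℂ) E]

theorem IsSmoothFn.contDiffAt {f : X → ℝ} (hf : IsSmoothFn n f) {x₀ : X} {y : CV n}
    (hy : y ∈ (chartAt (CV n) x₀).target) :
    ContDiffAt ℝ ∞ (fun z => f ((chartAt (CV n) x₀).symm z)) y := by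
  have hp : (chartAt (CV n) x₀).symm y ∈
    (chartAt (CV n) ((chartAt (CV n) x₀).symm y)).source := mem_chart_source _ _
  refine ContDiffAt.congr_of_eventuallyEq (ContDiffAt.comp (f := trans n x₀ _) y (hf _)
    (holAt_trans hy hp).smooth) ?_
  filter_upwards [eventually_overlap hy hp] with z hz
  exact congrArg f (symm_trans hz.2).symm

variable (E) in
/-- The form which is `f` times the constant `a` in the chart and frame at `x₀`. -/
def localForm (x₀ : X) (f : X → ℝ) (a : (Fin r → ℂ) ⊗[ℝ] Lam n) : Forms n E := fun p =>
  f p • tm ((trivializationAt (Fin r → ℂ) E x₀).symmₗ ℂ p)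
    (pb (dtrans n p x₀ (chartAt (CV n) p p))).toLinearMap a

theorem localRep_localForm {x₀ : X} {f : X → ℝ} {a : (Fin r → ℂ) ⊗[ℝ] Lam n} {y : CV n}
    (hy : y ∈ dom n r E x₀) :
    localRep r (localForm E x₀ f a) x₀ y = f ((chartAt (CV n) x₀).symm y) • a := by
  have hp : (chartAt (CV n) x₀).symm y ∈
    (chartAt (CV n) ((chartAt (CV n) x₀).symm y)).source := mem_chart_source _ _
  have hs : (chartAt (CV n) x₀).symm y ∈ (chartAt (CV n) x₀).source :=
    (chartAt (CV n) x₀).map_target hy.1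
  have hd : dtrans n ((chartAt (CV n) x₀).symm y) x₀
      (chartAt (CV n) ((chartAt (CV n) x₀).symm y) ((chartAt (CV n) x₀).symm y)) ∘ₗ
      dtrans n x₀ ((chartAt (CV n) x₀).symm y) y = LinearMap.id := by
    rw [← dtrans_self hy.1]
    exact (dtrans_comp hy.1 hp hs).symm
  rw [localRep, localForm, LinearMap.map_smul_of_tower, tm_tm]
  congr 1
  have h1 : (trivializationAt (Fin r → ℂ) E x₀).linearMapAt ℂ ((chartAt (CV n) x₀).symm y) ∘ₗ
      (trivializationAt (Fin r → ℂ) E x₀).symmₗ ℂ ((chartAt (CV n) x₀).symm y) = LinearMap.id :=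
    LinearMap.ext fun v => Bundle.Trivialization.linearMapAt_symmₗ _ hy.2 v
  have h2 : (pullLam x₀ y).toLinearMap ∘ₗ (pb (dtrans n ((chartAt (CV n) x₀).symm y) x₀
      (chartAt (CV n) ((chartAt (CV n) x₀).symm y) ((chartAt (CV n) x₀).symm y)))).toLinearMap =
      LinearMap.id := LinearMap.ext fun b => by
    rw [LinearMap.comp_apply, AlgHom.toLinearMap_apply, AlgHom.toLinearMap_apply, pullLam_eq,
      pb_comp, hd, pb_id, LinearMap.id_apply]
  rw [h1, h2, tm_id]

variable [ContMDiffVectorBundle ω (Fin r → ℂ) E 𝓘(ℂ, CV n)] [T2Space X]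

theorem localForm_mem {x₀ : X} {f : X → ℝ} (hf : IsSmoothFn n f) {K : Set X} (hK : IsCompact K)
    (hKs : K ⊆ Dom n r E x₀) (h0 : ∀ x ∉ K, f x = 0) (a : (Fin r → ℂ) ⊗[ℝ] Lam n) :
    localForm E x₀ f a ∈ smoothForms n r E := by
  have hz : ∀ x ∉ K, localForm E x₀ f a x = 0 := fun x hx => by
    rw [localForm, h0 x hx, zero_smul]
  refine ⟨fun x₁ => ?_, K, hK, hz⟩
  by_cases hx : x₁ ∈ K
  · have e := (chartAt (CV n) x₁).left_inv (mem_chart_source (CV n) x₁)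
    have ho : Overlap r E x₁ x₀ (chartAt (CV n) x₁ x₁) :=
      ⟨mem_chart_target (CV n) x₁, by rw [e]; exact FiberBundle.mem_baseSet_trivializationAt' x₁,
        by rw [e]; exact (hKs hx).1, by rw [e]; exact (hKs hx).2⟩
    refine smoothAt_localRep_of ho ((SmoothAt.smul (hf.contDiffAt ho.trans_mem_dom.1)
      (smoothAt_const a _)).congr ?_)
    filter_upwards [(isOpen_dom (r := r) (E := E) x₀).mem_nhds ho.trans_mem_dom] with z hz
    exact localRep_localForm hz
  · exact (smoothAt_const 0 _).congr (localRep_eventually_zero (r := r) hK hz hx)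

variable [SecondCountableTopology X] {h : SesqForm E}

/-- Nondegeneracy of the integral pairing. -/
theorem eq_zero_of_integral_pairForm (hh : IsHermitianMetric n r h) {w : Forms n E}
    (hw : IsSmoothForm r w)
    (hz : ∀ a ∈ smoothForms n r E, integral (pairForm h a w) = 0) : w = 0 := by
  refine forms_ext (r := r) fun x => ?_
  have e0 : localRep r (0 : Forms n E) x (chartAt (CV n) x x) = 0 := by
    rw [localRep, Pi.zero_apply, map_zero]
  rw [e0]
  by_contra hne
  have hd := chart_mem_dom (n := n) (r := r) (E := E) x
  let W : CV n → (Fin r → ℂ) ⊗[ℝ] Lam n := fun y => rmul (gram n r h x y) (localRep r w x y)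
  have hW : ∀ y ∈ dom n r E x, SmoothAt W y := fun y hy =>
    smoothAt_gauge (smoothAt_vecMul (contDiffAt_gram hh hy)) (hw.smoothAt hy)
  have hW0 : W (chartAt (CV n) x x) ≠ 0 := by
    intro h0
    refine hne ?_
    have := congrArg (rmul (gram n r h x (chartAt (CV n) x x))⁻¹) h0
    simp only [W] at this
    rwa [rmul_rmul, Matrix.mul_nonsing_inv _ (isUnit_det_gram hh hd), rmul_one, map_zero] at this
  obtain ⟨a₁, ha₁⟩ := exists_topC_stdPair_ne hW0
  set c := topC n (stdPair n r a₁ (W (chartAt (CV n) x x))) with hc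
  -- The normalization makes the pairing function `φ` equal to one at the centre, so its real part
  -- is positive nearby. A bump supported there makes the integral have positive real part.
  let a₀ := c⁻¹ • a₁
  let φ : CV n → ℂ := fun y => topC n (stdPair n r a₀ (W y))
  have hφ1 : φ (chartAt (CV n) x x) = 1 := by
    simp only [φ, a₀]
    rw [stdPair_csmul_left, map_smul, ← hc, smul_eq_mul, inv_mul_cancel₀ ha₁]
  have hφc : ∀ y ∈ dom n r E x, ContinuousAt φ y := fun y hy =>
    continuousAt_topC (smoothAt_stdPair (smoothAt_const a₀ y) (hW y hy))
  have hVo : IsOpen (dom n r E x ∩ φ ⁻¹' {z | 0 < z.re}) :=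
    ContinuousOn.isOpen_inter_preimage (fun y hy => (hφc y hy).continuousWithinAt) (isOpen_dom x)
      (isOpen_lt continuous_const Complex.continuous_re)
  set V := dom n r E x ∩ φ ⁻¹' {z | 0 < z.re} with hV
  have hUo := (chartAt (CV n) x).isOpen_inter_preimage hVo
  obtain ⟨f, hf, hf0, hfx, K, hK, hKs, hfK⟩ := exists_bump (n := n) hUo (p := x)
    ⟨mem_chart_source (CV n) x, hd, by
      change 0 < (φ (chartAt (CV n) x x)).re
      rw [hφ1]
      exact one_pos⟩
  have hKV : ∀ p ∈ K, p ∈ (chartAt (CV n) x).source ∧ chartAt (CV n) x p ∈ V :=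
    fun p hp => ⟨(hKs hp).1, (hKs hp).2.2⟩
  have hKD : K ⊆ Dom n r E x := fun p hp => by
    refine ⟨(hKV p hp).1, ?_⟩
    have := (hKV p hp).2.1.2
    rwa [(chartAt (CV n) x).left_inv (hKV p hp).1] at this
  have hmem := localForm_mem hf hK hKD hfK a₀
  have hcc := contCompact_pairForm hh hmem hw
  have hint := hz _ hmem
  have hη0 : ∀ p ∉ K, pairForm h (localForm E x f a₀) w p = 0 := fun p hp => by
    rw [pairForm, localForm, hfK p hp, zero_smul, map_zero, LinearMap.zero_apply]
  rw [integral_eq_setIntegral (hcc.cont x) hK (fun p hp => (hKD hp).1) hη0] at hint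
  have hval : ∀ y ∈ (chartAt (CV n) x).target, (y ∈ V →
      locTop (pairForm h (localForm E x f a₀) w) x y =
        (f ((chartAt (CV n) x).symm y) : ℂ) * φ y) ∧
      (y ∉ V → locTop (pairForm h (localForm E x f a₀) w) x y = 0) := by
    intro y hy
    refine ⟨fun hyV => ?_, fun hyV => locTop_eq_zero (hη0 _ fun hk => hyV ?_)⟩
    · rw [locTop_pairForm hh hyV.1, locPair, localRep_localForm hyV.1, map_smul,
        LinearMap.smul_apply, LinearMap.map_smul_of_tower, Complex.real_smul]
    · have := (hKV _ hk).2
      rwa [(chartAt (CV n) x).right_inv hy] at this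
  have hI := integrableOn_of_compact (hcc.cont x) hK (fun p hp => (hKD hp).1)
    fun y _ hy => locTop_eq_zero (hη0 _ hy)
  have hpos : 0 < ∫ y in (chartAt (CV n) x).target,
      RCLike.re (locTop (pairForm h (localForm E x f a₀) w) x y) := by
    rw [setIntegral_pos_iff_support_of_nonneg_ae _ (Integrable.re hI)]
    · refine Measure.measure_pos_of_mem_nhds volume (x := chartAt (CV n) x x) ?_
      have h1 : ∀ᶠ y in 𝓝 (chartAt (CV n) x x), 0 < f ((chartAt (CV n) x).symm y) := by
        refine (hf x).continuousAt.eventually (lt_mem_nhds ?_)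
        change 0 < f ((chartAt (CV n) x).symm (chartAt (CV n) x x))
        rw [(chartAt (CV n) x).left_inv (mem_chart_source (CV n) x)]
        exact hfx
      have h2 : V ∈ 𝓝 (chartAt (CV n) x x) := hVo.mem_nhds ⟨hd, by
        change 0 < (φ (chartAt (CV n) x x)).re
        rw [hφ1]
        exact one_pos⟩
      filter_upwards [h1, h2] with y hy1 hy2
      refine ⟨?_, hy2.1.1⟩
      rw [Function.mem_support, (hval y hy2.1.1).1 hy2]
      change ((f ((chartAt (CV n) x).symm y) : ℂ) * φ y).re ≠ 0
      rw [Complex.re_ofReal_mul]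
      exact (mul_pos hy1 hy2.2).ne'
    · refine (ae_restrict_iff' (chartAt (CV n) x).open_target.measurableSet).2
        (Filter.Eventually.of_forall fun y hy => ?_)
      change (0 : ℝ) ≤ (locTop (pairForm h (localForm E x f a₀) w) x y).re
      by_cases hyV : y ∈ V
      · rw [(hval y hy).1 hyV, Complex.re_ofReal_mul]
        exact mul_nonneg (hf0 _) (le_of_lt hyV.2)
      · rw [(hval y hy).2 hyV, Complex.zero_re]
  rw [integral_re hI, hint] at hpos
  simp at hpos

end Localized

end THodge
end

noncomputable section

namespace THodge

/-! ### Lefschetz modules -/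

section Lefschetz

variable {M : Type*} [AddCommGroup M] [Module ℂ M]

/-- A module graded by weights in `[-m, m]`, with an operator `L` of degree two satisfying the
hard Lefschetz property. -/
structure IsLefschetz (m : ℕ) (π : ℤ → Module.End ℂ M) (L : Module.End ℂ M) : Prop where
  proj_self : ∀ k u, π k (π k u) = π k u
  proj_ne : ∀ k l u, k ≠ l → π l (π k u) = 0
  sum : ∀ u, ∑ k ∈ Finset.Icc (-m : ℤ) m, π k u = u
  shift : ∀ k u, π (k + 2) (L u) = L (π k u)
  inj : ∀ N : ℕ, ∀ u, π (-N) u = u → (L ^ N) u = 0 → u = 0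
  surj : ∀ N : ℕ, ∀ v, π N v = v → ∃ u, π (-N) u = u ∧ (L ^ N) u = v

/-- The divided power `L^q / q!`, which is zero for negative `q`. -/
def divPow (L : Module.End ℂ M) (q : ℤ) : Module.End ℂ M :=
  if q < 0 then 0 else ((q.toNat.factorial : ℂ)⁻¹) • L ^ q.toNat

theorem divPow_natCast (L : Module.End ℂ M) (j : ℕ) :
    divPow L j = ((j.factorial : ℂ)⁻¹) • L ^ j := by
  rw [divPow, if_neg (by omega), Int.toNat_natCast]

theorem divPow_neg {L : Module.End ℂ M} {q : ℤ} (hq : q < 0) : divPow L q = 0 := if_pos hq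

/-- The convention that negative divided powers vanish keeps the formula valid for all integers: at
`q = -1` the coefficient `q + 1` is zero. No case distinctions are then needed in the main
computation. -/
theorem L_mul_divPow (L : Module.End ℂ M) (q : ℤ) :
    L * divPow L q = ((q : ℂ) + 1) • divPow L (q + 1) := by
  rcases lt_or_ge q 0 with hq | hq
  · rw [divPow_neg hq, mul_zero]
    rcases eq_or_ne q (-1) with rfl | h
    · simp
    · rw [divPow_neg (by omega), smul_zero]
  · lift q to ℕ using hq
    rw [← Nat.cast_succ, divPow_natCast, divPow_natCast, mul_smul_comm, ← pow_succ', smul_smul,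
      Nat.factorial_succ]
    congr 1
    have h1 : ((q : ℂ) + 1) ≠ 0 := Nat.cast_add_one_ne_zero q
    have h2 : (q.factorial : ℂ) ≠ 0 := Nat.cast_ne_zero.2 q.factorial_ne_zero
    push_cast
    field_simp

theorem divPow_mul_L (L : Module.End ℂ M) (q : ℤ) :
    divPow L q * L = ((q : ℂ) + 1) • divPow L (q + 1) := by
  rw [← L_mul_divPow, divPow]
  split_ifs
  · rw [zero_mul, mul_zero]
  · rw [smul_mul_assoc, mul_smul_comm, ← pow_succ, ← pow_succ']

theorem L_divPow (L : Module.End ℂ M) (q : ℤ) (u : M) :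
    L (divPow L q u) = ((q : ℂ) + 1) • divPow L (q + 1) u :=
  LinearMap.congr_fun (L_mul_divPow L q) u

theorem divPow_L (L : Module.End ℂ M) (q : ℤ) (u : M) :
    divPow L q (L u) = ((q : ℂ) + 1) • divPow L (q + 1) u :=
  LinearMap.congr_fun (divPow_mul_L L q) u

theorem divPow_comm {L C : Module.End ℂ M} (hC : ∀ u, C (L u) = L (C u)) (q : ℤ) (u : M) :
    C (divPow L q u) = divPow L q (C u) := by
  have h : Commute C L := LinearMap.ext hC
  rw [divPow]
  split_ifs
  · simp
  · rw [LinearMap.smul_apply, map_smul, LinearMap.smul_apply]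
    exact congrArg _ (LinearMap.congr_fun (h.pow_right q.toNat) u)

/-- As `C = [D, L]` commutes with `L`, commuting `D` past `L^q` produces `q L^(q-1) C`. The divided
power absorbs the factor `q`. -/
theorem divPow_derivation {L D C : Module.End ℂ M} (hD : ∀ u, D (L u) = L (D u) + C u)
    (hC : ∀ u, C (L u) = L (C u)) (q : ℤ) (u : M) :
    D (divPow L q u) = divPow L q (D u) + divPow L (q - 1) (C u) := by
  rcases lt_or_ge q 0 with hq | hq
  · rw [divPow_neg hq, divPow_neg (by omega)]
    simp
  · lift q to ℕ using hq
    induction q with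
    | zero =>
      rw [divPow_neg (q := ((0 : ℕ) : ℤ) - 1) (by simp), divPow_natCast]
      simp
    | succ q ih =>
      have hne : ((q : ℂ) + 1) ≠ 0 := Nat.cast_add_one_ne_zero q
      have e : ∀ v, divPow L ((q + 1 : ℕ) : ℤ) v = ((q : ℂ) + 1)⁻¹ • L (divPow L q v) := by
        intro v
        rw [L_divPow, Int.cast_natCast, smul_smul, inv_mul_cancel₀ hne, one_smul, Nat.cast_succ]
      have e' : L (divPow L ((q : ℤ) - 1) (C u)) = (q : ℂ) • divPow L q (C u) := by
        rw [L_divPow, sub_add_cancel]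
        push_cast
        rw [sub_add_cancel]
      rw [e, map_smul, hD, ih, divPow_comm hC, map_add, e', e, Nat.cast_succ, add_sub_cancel_right,
        add_assoc]
      have : divPow L q (C u) = ((q : ℂ) + 1)⁻¹ • (((q : ℂ) + 1) • divPow L q (C u)) := by
        rw [smul_smul, inv_mul_cancel₀ hne, one_smul]
      conv_rhs => rw [this]
      rw [← smul_add]
      congr 2
      rw [add_smul, one_smul]

namespace IsLefschetz

variable {m : ℕ} {π : ℤ → Module.End ℂ M} {L : Module.End ℂ M} (hL : IsLefschetz m π L)

include hL

theorem proj_eq_zero {k : ℤ} (hk : k < -m ∨ m < k) (u : M) : π k u = 0 := by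
  rw [← hL.sum u, map_sum]
  refine Finset.sum_eq_zero fun l hl => hL.proj_ne l k u ?_
  rw [Finset.mem_Icc] at hl
  omega

theorem mem_unique {k l : ℤ} {u : M} (hu : π k u = u) (h : k ≠ l) : π l u = 0 := by
  rw [← hu]
  exact hL.proj_ne k l u h

theorem pow_shift {k : ℤ} {u : M} (hu : π k u = u) (j : ℕ) :
    π (k + 2 * j) ((L ^ j) u) = (L ^ j) u := by
  induction j with
  | zero => simpa using hu
  | succ j ih =>
    rw [pow_succ', Module.End.mul_apply, Nat.cast_succ, mul_add, mul_one, ← add_assoc, hL.shift, ih]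

/-- No finiteness is assumed on `M`. An injective linear map over a field still has a linear left
inverse, and its values are taken in the subspace of weight `-N`. -/
theorem exists_leftInverse (N : ℕ) : ∃ G : Module.End ℂ M,
    (∀ u, π (-N) u = u → G ((L ^ N) u) = u) ∧ ∀ v, π (-N) (G v) = G v := by
  let A : Submodule ℂ M := LinearMap.range (π (-N))
  have hA : ∀ u : M, u ∈ A ↔ π (-N) u = u := by
    intro u
    refine ⟨?_, fun h => ⟨u, h⟩⟩
    rintro ⟨v, rfl⟩
    exact hL.proj_self _ v
  obtain ⟨g, hg⟩ := LinearMap.exists_leftInverse_of_injective ((L ^ N).domRestrict A) (by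
    rw [LinearMap.ker_eq_bot']
    intro u hu
    exact Subtype.ext (hL.inj N u ((hA u).1 u.2) hu))
  refine ⟨A.subtype ∘ₗ g, fun u hu => ?_, fun v => (hA _).1 (g v).2⟩
  exact congrArg Subtype.val (LinearMap.congr_fun hg ⟨u, (hA u).2 hu⟩)

omit hL in
/-- Primitive elements of weight `-N`. -/
def _root_.THodge.prim (π : ℤ → Module.End ℂ M) (L : Module.End ℂ M) (N : ℤ) : Submodule ℂ M :=
  if N < 0 then ⊥ else LinearMap.eqLocus (π (-N)) LinearMap.id ⊓ LinearMap.ker (L ^ (N.toNat + 1))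

omit hL in
theorem mem_prim {N : ℕ} {u : M} :
    u ∈ prim π L N ↔ π (-N) u = u ∧ (L ^ (N + 1)) u = 0 := by
  rw [prim, if_neg (by omega), Int.toNat_natCast]
  rfl

omit hL in
theorem prim_cases {N : ℤ} {u : M} (hu : u ∈ prim π L N) :
    u = 0 ∨ ∃ N' : ℕ, N = N' ∧ u ∈ prim π L N' := by
  rcases lt_or_ge N 0 with h | h
  · rw [prim, if_pos h] at hu
    exact Or.inl ((Submodule.mem_bot ℂ).1 hu)
  · lift N to ℕ using h
    exact Or.inr ⟨N, rfl, hu⟩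

omit hL in
theorem divPow_prim {N q : ℤ} {u : M} (hu : u ∈ prim π L N) (hq : N < q) : divPow L q u = 0 := by
  rcases prim_cases hu with rfl | ⟨N', rfl, hu⟩
  · exact map_zero _
  · obtain ⟨j, rfl⟩ : ∃ j : ℕ, q = ((j + (N' + 1) : ℕ) : ℤ) :=
      ⟨(q - N' - 1).toNat, by push_cast; omega⟩
    rw [divPow_natCast, LinearMap.smul_apply, pow_add, Module.End.mul_apply, (mem_prim.1 hu).2,
      map_zero, smul_zero]

/-- The element `L^(N+1) v` has weight `N + 2`, so surjectivity there gives `w` with `L^(N+2) w =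
L^(N+1) v`. Subtracting `L w` from `v` then leaves a primitive element. -/
theorem exists_prim_add {N : ℕ} {v : M} (hv : π (-N) v = v) :
    ∃ w, π (-(N + 2 : ℕ)) w = w ∧ (L ^ (N + 2)) w = (L ^ (N + 1)) v ∧ v - L w ∈ prim π L N := by
  have h1 : π ((N + 2 : ℕ) : ℤ) ((L ^ (N + 1)) v) = (L ^ (N + 1)) v := by
    have := hL.pow_shift hv (N + 1)
    rwa [show -(N : ℤ) + 2 * (N + 1 : ℕ) = (N + 2 : ℕ) by push_cast; ring] at this
  obtain ⟨w, hw, hLw⟩ := hL.surj _ _ h1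
  refine ⟨w, hw, hLw, mem_prim.2 ⟨?_, ?_⟩⟩
  · have h2 : π (-(N : ℤ)) (L w) = L w := by
      have := hL.shift (-(N + 2 : ℕ)) w
      rwa [hw, show -((N + 2 : ℕ) : ℤ) + 2 = -N by push_cast; ring] at this
    rw [map_sub, hv, h2]
  · rw [map_sub, ← Module.End.mul_apply, ← pow_succ, hLw, sub_self]

omit hL in
/-- The subspace generated by the primitive elements. -/
def _root_.THodge.primSpan (π : ℤ → Module.End ℂ M) (L : Module.End ℂ M) : Submodule ℂ M :=
  Submodule.span ℂ {v | ∃ N j : ℕ, ∃ u ∈ prim π L N, divPow L j u = v}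

omit hL in
theorem L_mem_primSpan {v : M} (hv : v ∈ primSpan π L) : L v ∈ primSpan π L := by
  have : primSpan π L ≤ (primSpan π L).comap L := by
    refine Submodule.span_le.2 ?_
    rintro _ ⟨N, j, u, hu, rfl⟩
    rw [SetLike.mem_coe, Submodule.mem_comap, L_divPow]
    exact Submodule.smul_mem _ _ (Submodule.subset_span ⟨N, j + 1, u, hu, rfl⟩)
  exact this hv

/-- Descent in the weight: by `exists_prim_add`, `v` is primitive up to `L w` with `w` of weight
`-(N+2)`, and weights below `-m` vanish. The number `t` bounds the remaining steps. -/
theorem mem_primSpan_of_neg (t : ℕ) : ∀ N : ℕ, m < N + t → ∀ v, π (-N) v = v →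
    v ∈ primSpan π L := by
  induction t with
  | zero =>
    intro N hN v hv
    rw [← hv, hL.proj_eq_zero (by omega)]
    exact Submodule.zero_mem _
  | succ t ih =>
    intro N hN v hv
    obtain ⟨w, hw, -, hp⟩ := hL.exists_prim_add hv
    rw [← sub_add_cancel v (L w)]
    refine Submodule.add_mem _ ?_ (L_mem_primSpan (ih (N + 2) (by omega) w hw))
    refine Submodule.subset_span ⟨N, 0, _, hp, ?_⟩
    rw [divPow_natCast]
    simp

theorem primSpan_eq_top : primSpan π L = ⊤ := by
  refine Submodule.eq_top_iff'.2 fun v => ?_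
  rw [← hL.sum v]
  refine Submodule.sum_mem _ fun k _ => ?_
  have hk := hL.proj_self k v
  generalize π k v = w at hk
  rcases Int.eq_nat_or_neg k with ⟨N, rfl | rfl⟩
  · obtain ⟨u, hu, rfl⟩ := hL.surj N w hk
    have h1 := hL.mem_primSpan_of_neg (m + 1) N (by omega) u hu
    clear hk
    generalize N = j
    induction j with
    | zero => simpa using h1
    | succ j ih =>
      rw [pow_succ', Module.End.mul_apply]
      exact L_mem_primSpan ih
  · exact hL.mem_primSpan_of_neg (m + 1) N (by omega) w hk

/-- Linear maps are determined on divided powers of primitive elements. Existence of the primitive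
decomposition, uniqueness of the star operator and the main identity are all checked this way. -/
theorem hom_ext {M' : Type*} [AddCommGroup M'] [Module ℂ M'] {f g : M →ₗ[ℂ] M'}
    (h : ∀ N j : ℕ, j ≤ N → ∀ u ∈ prim π L N, f (divPow L j u) = g (divPow L j u)) : f = g := by
  refine LinearMap.ext_on (s := {v | ∃ N j : ℕ, ∃ u ∈ prim π L N, divPow L j u = v})
    hL.primSpan_eq_top ?_
  rintro _ ⟨N, j, u, hu, rfl⟩
  by_cases hj : j ≤ N
  · exact h N j hj u hu
  · rw [divPow_prim hu (by omega), map_zero, map_zero]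

theorem proj_divPow {N : ℕ} {u : M} (hu : u ∈ prim π L N) (j : ℕ) :
    π (-N + 2 * j) (divPow L j u) = divPow L j u := by
  rw [divPow_natCast, LinearMap.smul_apply, map_smul, hL.pow_shift (mem_prim.1 hu).1]

/-- The operators which extract the primitive components. -/
theorem exists_component (N j : ℕ) (hj : j ≤ N) : ∃ p : Module.End ℂ M,
    (∀ v, p v ∈ prim π L N) ∧ (∀ u ∈ prim π L N, p (divPow L j u) = u) ∧
    (∀ N' i : ℕ, ∀ u ∈ prim π L N', (N', i) ≠ (N, j) → p (divPow L i u) = 0) ∧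
    (∀ v, p (π (-N + 2 * j) v) = p v) ∧
    ∀ v, (L ^ (N - j)) v = 0 → π (-N + 2 * j) v = v → p v = 0 := by
  obtain ⟨G, hG, hGm⟩ := hL.exists_leftInverse N
  obtain ⟨G', hG', hGm'⟩ := hL.exists_leftInverse (N + 2)
  -- Projection from weight `-N` to its primitive part along the image of `L`: the `w` of
  -- `exists_prim_add` is recovered linearly from `L^(N+1) v`.
  let X : Module.End ℂ M := LinearMap.id - L * G' * L ^ (N + 1)
  have hXprim : ∀ v, π (-N) v = v → X v ∈ prim π L N := by
    intro v hv
    obtain ⟨w, hw, hLw, hp⟩ := hL.exists_prim_add hv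
    have : X v = v - L w := by
      change v - L (G' ((L ^ (N + 1)) v)) = v - L w
      rw [← hLw, hG' w hw]
    rwa [this]
  have hXu : ∀ u ∈ prim π L N, X u = u := by
    intro u hu
    change u - L (G' ((L ^ (N + 1)) u)) = u
    rw [(mem_prim.1 hu).2, map_zero, map_zero, sub_zero]
  have hXL : ∀ u, π (-(N + 2 : ℕ)) u = u → X (L u) = 0 := by
    intro u hu
    change L u - L (G' ((L ^ (N + 1)) (L u))) = 0
    rw [← Module.End.mul_apply (L ^ (N + 1)), ← pow_succ, hG' u hu, sub_self]
  let p : Module.End ℂ M := (j.factorial : ℂ) • (X * G * L ^ (N - j) * π (-N + 2 * j))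
  have hpa : ∀ v, p v = (j.factorial : ℂ) • X (G ((L ^ (N - j)) (π (-N + 2 * j) v))) :=
    fun v => rfl
  have hf : ∀ i : ℕ, (i.factorial : ℂ) ≠ 0 := fun i => Nat.cast_ne_zero.2 i.factorial_ne_zero
  refine ⟨p, fun v => ?_, fun u hu => ?_, fun N' i u hu hne => ?_, fun v => ?_, fun v hv hv' => ?_⟩
  · rw [hpa]
    exact Submodule.smul_mem _ _ (hXprim _ (hGm _))
  · rw [hpa, hL.proj_divPow hu, divPow_natCast, LinearMap.smul_apply, map_smul, map_smul, map_smul,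
      smul_smul, mul_inv_cancel₀ (hf j), one_smul, ← Module.End.mul_apply (L ^ (N - j)), ← pow_add,
      Nat.sub_add_cancel hj, hG u (mem_prim.1 hu).1, hXu u hu]
  · rw [hpa]
    by_cases hw : (-N' + 2 * i : ℤ) = -N + 2 * j
    · rw [← hw, hL.proj_divPow hu, divPow_natCast, LinearMap.smul_apply, map_smul, map_smul,
        map_smul, ← Module.End.mul_apply (L ^ (N - j)), ← pow_add]
      -- Two strings meeting in the same weight. For `i < j` the string of `u` is shorter and the
      -- power of `L` kills it. For `i > j` the inverse `G` leads back to an element of the image of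
      -- `L`, which `X` kills.
      rcases lt_trichotomy i j with hij | rfl | hij
      · obtain ⟨t, ht⟩ : ∃ t, N - j + i = t + (N' + 1) := ⟨N - j + i - (N' + 1), by omega⟩
        rw [ht, pow_add, Module.End.mul_apply, (mem_prim.1 hu).2]
        simp only [map_zero, smul_zero]
      · exact absurd (by rw [show N' = N by omega]) hne
      · obtain ⟨t, rfl⟩ : ∃ t, i = j + t + 1 := ⟨i - j - 1, by omega⟩
        have hN' : N' = N + 2 + 2 * t := by omega
        have hu1 : π (-N) ((L ^ (t + 1)) u) = (L ^ (t + 1)) u := by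
          have := hL.pow_shift (mem_prim.1 hu).1 (t + 1)
          rwa [show -(N' : ℤ) + 2 * (t + 1 : ℕ) = -N by push_cast; omega] at this
        have hu2 : π (-(N + 2 : ℕ)) ((L ^ t) u) = (L ^ t) u := by
          have := hL.pow_shift (mem_prim.1 hu).1 t
          rwa [show -(N' : ℤ) + 2 * (t : ℕ) = -(N + 2 : ℕ) by push_cast; omega] at this
        rw [show N - j + (j + t + 1) = N + (t + 1) by omega, pow_add, Module.End.mul_apply,
          hG _ hu1, pow_succ', Module.End.mul_apply, hXL _ hu2]
        simp only [smul_zero]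
    · rw [← hL.proj_divPow hu, hL.proj_ne _ _ _ hw]
      simp only [map_zero, smul_zero]
  · rw [hpa, hpa, hL.proj_self]
  · rw [hpa, hv', hv]
    simp only [map_zero, smul_zero]

/-- The Lefschetz star operator of a Lefschetz module, for given signs. -/
theorem exists_star (ε : ℤ → ℂ) : ∃ s : Module.End ℂ M, ∀ (N q : ℤ), ∀ u ∈ prim π L N,
    s (divPow L q u) = ε N • divPow L (N - q) u := by
  classical
  choose p hp1 hp2 hp3 hp4 hp5 using
    fun i : {i : ℕ × ℕ // i.2 ≤ i.1} => hL.exists_component i.1.1 i.1.2 i.2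
  let I : Finset {i : ℕ × ℕ // i.2 ≤ i.1} :=
    (Finset.range (m + 1) ×ˢ Finset.range (m + 1)).subtype fun i => i.2 ≤ i.1
  let s : Module.End ℂ M := ∑ i ∈ I, ε i.1.1 • (divPow L ((i.1.1 : ℤ) - i.1.2) * p i)
  have key : ∀ N j : ℕ, j ≤ N → ∀ u ∈ prim π L N,
      s (divPow L j u) = ε N • divPow L ((N : ℤ) - j) u := by
    intro N j hj u hu
    by_cases hN : N ≤ m
    · rw [LinearMap.sum_apply, Finset.sum_eq_single ⟨(N, j), hj⟩]
      · rw [LinearMap.smul_apply, Module.End.mul_apply, hp2 ⟨(N, j), hj⟩ u hu]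
      · intro i _ hi
        rw [LinearMap.smul_apply, Module.End.mul_apply, hp3 i N j u hu, map_zero, smul_zero]
        exact fun h => hi (Subtype.ext h.symm)
      · intro h
        refine absurd ?_ h
        simp only [I, Finset.mem_subtype, Finset.mem_product, Finset.mem_range]
        omega
    · have : u = 0 := by
        rw [← (mem_prim.1 hu).1]
        exact hL.proj_eq_zero (by omega) u
      rw [this]
      simp only [map_zero, smul_zero]
  refine ⟨s, fun N q u hu => ?_⟩
  rcases prim_cases hu with rfl | ⟨N, rfl, hu⟩
  · simp only [map_zero, smul_zero]
  rcases lt_or_ge q 0 with hq | hq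
  · rw [divPow_neg hq, divPow_prim hu (by omega), LinearMap.zero_apply, map_zero, smul_zero]
  · lift q to ℕ using hq
    by_cases hj : q ≤ N
    · exact key N q hj u hu
    · rw [divPow_prim hu (by omega), divPow_neg (by omega), LinearMap.zero_apply, map_zero,
        smul_zero]

/-- The primitive decomposition of an element killed by a power of `L`. -/
theorem exists_decomp {w : ℤ} {v : M} (hv : π w v = v) {b q : ℕ} (hb : (L ^ b) v = 0)
    (hq : (b : ℤ) ≤ -w + q) :
    ∃ c : ℕ → M, (∀ i : ℕ, c i ∈ prim π L (-w + 2 * i)) ∧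
      v = ∑ i ∈ Finset.range q, (L ^ i) (c i) := by
  classical
  choose! p hp1 hp2 hp3 hp4 hp5 using hL.exists_component
  -- The components recombine to the identity, since this holds on divided powers of primitive
  -- elements.
  have hid : ∑ j ∈ Finset.range (m + 1), ∑ N ∈ Finset.range (m + 1),
      (if j ≤ N then divPow L j * p N j else 0) = (LinearMap.id : Module.End ℂ M) := by
    refine hL.hom_ext fun N j hj u hu => ?_
    by_cases hN : N ≤ m
    · rw [LinearMap.sum_apply, Finset.sum_eq_single j, LinearMap.sum_apply,
        Finset.sum_eq_single N, if_pos hj, Module.End.mul_apply, hp2 N j hj u hu,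
        LinearMap.id_apply]
      · intro N' _ hne
        split_ifs with h
        · rw [Module.End.mul_apply, hp3 N' j h N j u hu fun e => hne (Prod.mk.inj e).1.symm,
            map_zero]
        · rfl
      · intro h
        exact absurd (Finset.mem_range.2 (by omega)) h
      · intro i _ hne
        rw [LinearMap.sum_apply]
        refine Finset.sum_eq_zero fun N' _ => ?_
        split_ifs with h
        · rw [Module.End.mul_apply, hp3 N' i h N j u hu fun e => hne (Prod.mk.inj e).2.symm,
            map_zero]
        · rfl
      · intro h
        exact absurd (Finset.mem_range.2 (by omega)) h
    · have : u = 0 := by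
        rw [← (mem_prim.1 hu).1]
        exact hL.proj_eq_zero (by omega) u
      rw [this]
      simp only [map_zero]
  have hpw : ∀ N j : ℕ, j ≤ N → (-N + 2 * j : ℤ) ≠ w → p N j v = 0 := by
    intro N j hj h
    rw [← hp4 N j hj, hL.mem_unique hv h.symm, map_zero]
  let c : ℕ → M := fun j => ∑ N ∈ Finset.range (m + 1),
    if j ≤ N then ((j.factorial : ℂ)⁻¹) • p N j v else 0
  -- In weight `w` the index `j` belongs to the string with `N = -w + 2 j`, so `N - j = -w + j` is
  -- at least `b`, and `L^(N-j)` kills `v`.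
  have hcq : ∀ j, q ≤ j → c j = 0 := by
    intro j hj
    refine Finset.sum_eq_zero fun N _ => ?_
    split_ifs with h
    · by_cases hw : (-N + 2 * j : ℤ) = w
      · obtain ⟨t, ht⟩ : ∃ t, N - j = t + b := ⟨N - j - b, by omega⟩
        rw [hp5 N j h v (by rw [ht, pow_add, Module.End.mul_apply, hb, map_zero])
          (by rw [hw, hv]), smul_zero]
      · rw [hpw N j h hw, smul_zero]
    · rfl
  have hcm : ∀ j, m + 1 ≤ j → c j = 0 := by
    intro j hj
    refine Finset.sum_eq_zero fun N hN => if_neg ?_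
    rw [Finset.mem_range] at hN
    omega
  refine ⟨c, fun i => Submodule.sum_mem _ fun N _ => ?_, ?_⟩
  · split_ifs with h
    · by_cases hw : (-N + 2 * i : ℤ) = w
      · rw [show -w + 2 * i = N by omega]
        exact Submodule.smul_mem _ _ (hp1 N i h v)
      · rw [hpw N i h hw, smul_zero]
        exact Submodule.zero_mem _
    · exact Submodule.zero_mem _
  · have h1 : v = ∑ j ∈ Finset.range (m + 1), (L ^ j) (c j) := by
      conv_lhs => rw [← LinearMap.id_apply (R := ℂ) v, ← hid]
      rw [LinearMap.sum_apply]
      refine Finset.sum_congr rfl fun j _ => ?_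
      rw [LinearMap.sum_apply, map_sum]
      refine Finset.sum_congr rfl fun N _ => ?_
      split_ifs
      · rw [Module.End.mul_apply, divPow_natCast, LinearMap.smul_apply, map_smul]
      · rw [LinearMap.zero_apply, map_zero]
    rw [h1]
    rcases le_total (m + 1) q with h | h
    · refine Finset.sum_subset (Finset.range_subset_range.2 h) fun j _ hj => ?_
      rw [Finset.mem_range, not_lt] at hj
      rw [hcm j hj, map_zero]
    · refine (Finset.sum_subset (Finset.range_subset_range.2 h) fun j _ hj => ?_).symm
      rw [Finset.mem_range, not_lt] at hj
      rw [hcq j hj, map_zero]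

end IsLefschetz

end Lefschetz

end THodge
end

noncomputable section

namespace THodge

/-! ### The star operator and the commutator identity in a Lefschetz module -/

section LefschetzStar

variable {M : Type*} [AddCommGroup M] [Module ℂ M]

/-- The star operator with signs `ε` of a Lefschetz module. -/
def IsStar (π : ℤ → Module.End ℂ M) (L : Module.End ℂ M) (ε : ℤ → ℂ) (s : Module.End ℂ M) : Prop :=
  ∀ N q : ℤ, ∀ u ∈ prim π L N, s (divPow L q u) = ε N • divPow L (N - q) u

namespace IsLefschetz

variable {m : ℕ} {π : ℤ → Module.End ℂ M} {L : Module.End ℂ M} (hL : IsLefschetz m π L)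
  {ε : ℤ → ℂ} {s : Module.End ℂ M} (hs : IsStar π L ε s) (hε : ∀ N, ε N * ε N = 1)

include hL hs in
theorem star_unique {s' : Module.End ℂ M} (h : ∀ N j : ℕ, j ≤ N → ∀ u ∈ prim π L N,
    s' (divPow L j u) = ε N • divPow L (N - j : ℕ) u) : s' = s :=
  hL.hom_ext fun N j hj u hu => by rw [h N j hj u hu, hs _ _ u hu, Nat.cast_sub hj]

include hL hs hε in
theorem star_mul_star : s * s = 1 :=
  hL.hom_ext fun N j hj u hu => by
    rw [Module.End.mul_apply, hs _ _ u hu, map_smul, hs _ _ u hu, smul_smul, hε, one_smul,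
      sub_sub_cancel]
    rfl

-- The `sl₂` formula for `Λ`. The star reflects `L^q u / q!` to `L^(N-q) u / (N-q)!`; one
-- application of `L` and reflecting back lowers `q` by one, and the two equal signs cancel.
include hs hε in
theorem lambda_divPow {N : ℤ} (q : ℤ) {u : M} (hu : u ∈ prim π L N) :
    (s * L * s) (divPow L q u) = ((N : ℂ) - q + 1) • divPow L (q - 1) u := by
  rw [Module.End.mul_apply, Module.End.mul_apply, hs _ _ u hu, map_smul, L_divPow, map_smul,
    map_smul, hs _ _ u hu, smul_smul, smul_smul, show N - (N - q + 1) = q - 1 by ring]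
  push_cast
  rw [mul_right_comm, hε, one_mul]

include hL in
theorem proj_commutator {D C : Module.End ℂ M} (hD : ∀ k u, π (k + 1) (D u) = D (π k u))
    (hC : ∀ u, D (L u) = L (D u) + C u) (k : ℤ) (u : M) : π (k + 3) (C u) = C (π k u) := by
  have e : ∀ u, C u = D (L u) - L (D u) := fun u => by rw [hC, add_sub_cancel_left]
  have h1 : π (k + 3) (D (L u)) = D (L (π k u)) := by
    rw [show k + 3 = k + 2 + 1 by ring, hD, hL.shift]
  have h2 : π (k + 3) (L (D u)) = L (D (π k u)) := by
    rw [show k + 3 = k + 1 + 2 by ring, hL.shift, hD]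
  rw [e, e, map_sub, h1, h2]

variable {D C : Module.End ℂ M} (hD : ∀ k u, π (k + 1) (D u) = D (π k u))
  (hDC : ∀ u, D (L u) = L (D u) + C u) (hC : ∀ u, C (L u) = L (C u))

include hL hD hDC hC in
/-- The primitive components of `C u` and `D u` for primitive `u`. -/
theorem exists_components {N : ℕ} {u : M} (hu : u ∈ prim π L N) :
    ∃ c₀ ∈ prim π L (N - 3), ∃ c₁ ∈ prim π L (N - 1), ∃ c₂ ∈ prim π L (N + 1),
      ∃ c₃ ∈ prim π L (N + 3), ∃ d₀ ∈ prim π L (N - 1), ∃ d₁ ∈ prim π L (N + 1),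
      C u = c₀ + L c₁ + L (L c₂) + L (L (L c₃)) ∧
      D u = d₀ + L d₁ - ((N : ℂ) + 1) • L (L c₃) := by
  have hu' := mem_prim.1 hu
  have hwC : π (-N + 3) (C u) = C u := by rw [hL.proj_commutator hD hDC, hu'.1]
  have hwD : π (-N + 1) (D u) = D u := by rw [hD, hu'.1]
  have hpow : ∀ b, (L ^ b) (C u) = C ((L ^ b) u) := by
    intro b
    exact (LinearMap.congr_fun (((show Commute C L from LinearMap.ext hC).pow_right b)) u).symm
  have hCz : (L ^ (N + 1)) (C u) = 0 := by rw [hpow, hu'.2, map_zero]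
  -- The weight of `C u` is `-N + 3` and `L^(N+1)` kills it, so at most four primitive components
  -- occur. For `D u`, of weight `-N + 1` and killed by `L^(N+2)`, the bound is three.
  obtain ⟨c, hc, hCu⟩ := hL.exists_decomp hwC hCz (q := 4) (by push_cast; omega)
  -- Apply `D` to the relation `L^(N+1) u = 0`.
  have hder : divPow L ((N : ℤ) + 1) (D u) + divPow L N (C u) = 0 := by
    have := divPow_derivation hDC hC ((N : ℤ) + 1) u
    rwa [divPow_prim hu (by omega), map_zero, add_sub_cancel_right, eq_comm] at this
  have hDz : (L ^ (N + 2)) (D u) = 0 := by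
    have h1 := congrArg L hder
    have h2 : divPow L ((N : ℤ) + 1) (C u) = 0 := by
      rw [← Nat.cast_succ, divPow_natCast, LinearMap.smul_apply, hCz, smul_zero]
    rw [map_add, L_divPow, L_divPow, h2, smul_zero, add_zero, map_zero, add_assoc,
      show (N : ℤ) + (1 + 1) = (N + 2 : ℕ) by push_cast; ring, divPow_natCast,
      LinearMap.smul_apply, smul_smul] at h1
    refine (smul_eq_zero.1 h1).resolve_left (mul_ne_zero ?_ ?_)
    · push_cast
      exact_mod_cast Nat.succ_ne_zero (N + 1)
    · exact inv_ne_zero (Nat.cast_ne_zero.2 (Nat.factorial_ne_zero _))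
  obtain ⟨d, hd, hDu⟩ := hL.exists_decomp hwD hDz (q := 3) (by push_cast; omega)
  simp only [Finset.sum_range_succ, Finset.sum_range_zero, zero_add, pow_zero, pow_succ,
    one_mul, Module.End.mul_apply, Module.End.one_apply] at hCu hDu
  have hc0 : c 0 ∈ prim π L (N - 3) := by convert hc 0 using 2; push_cast; ring
  have hc1 : c 1 ∈ prim π L (N - 1) := by convert hc 1 using 2; push_cast; ring
  have hc2 : c 2 ∈ prim π L (N + 1) := by convert hc 2 using 2; push_cast; ring
  have hc3 : c 3 ∈ prim π L (N + 3) := by convert hc 3 using 2; push_cast; ring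
  have hd0 : d 0 ∈ prim π L (N - 1) := by convert hd 0 using 2; push_cast; ring
  have hd1 : d 1 ∈ prim π L (N + 1) := by convert hd 1 using 2; push_cast; ring
  have hd2 : d 2 ∈ prim π L (N + 3) := by convert hd 2 using 2; push_cast; ring
  -- Inserting both decompositions into the relation just found, only the components of primitive
  -- weight `-(N+3)` survive. They appear under `L^(N+3)`, which is injective there.
  have hd2c : d 2 = -(((N : ℂ) + 1) • c 3) := by
    rw [← add_eq_zero_iff_eq_neg]
    have hmem : d 2 + ((N : ℂ) + 1) • c 3 ∈ prim π L ((N + 3 : ℕ) : ℤ) :=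
      Submodule.add_mem _ hd2 (Submodule.smul_mem _ _ hc3)
    refine hL.inj (N + 3) _ (mem_prim.1 hmem).1 ?_
    have h1 := hder
    rw [hCu, hDu] at h1
    simp only [map_add, divPow_L, smul_smul] at h1
    rw [divPow_prim hd0 (by omega), divPow_prim hd1 (by omega), divPow_prim hc0 (by omega),
      divPow_prim hc1 (by omega), divPow_prim hc2 (by omega)] at h1
    simp only [smul_zero, zero_add] at h1
    rw [show (N : ℤ) + 1 + 1 + 1 = (N + 3 : ℕ) by push_cast; ring,
      divPow_natCast, LinearMap.smul_apply, LinearMap.smul_apply, smul_smul, smul_smul] at h1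
    have hne : ((N : ℂ) + 2) * ((N : ℂ) + 3) * (((N + 3).factorial : ℂ))⁻¹ ≠ 0 := by
      refine mul_ne_zero (mul_ne_zero ?_ ?_)
        (inv_ne_zero (Nat.cast_ne_zero.2 (Nat.factorial_ne_zero _)))
      · exact_mod_cast Nat.succ_ne_zero (N + 1)
      · exact_mod_cast Nat.succ_ne_zero (N + 2)
    refine (smul_eq_zero.1 (?_ : (((N : ℂ) + 2) * ((N : ℂ) + 3) * (((N + 3).factorial : ℂ))⁻¹) •
      (L ^ (N + 3)) (d 2 + ((N : ℂ) + 1) • c 3) = 0)).resolve_left hne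
    rw [← h1, map_add, map_smul]
    push_cast
    module
  refine ⟨c 0, hc0, c 1, hc1, c 2, hc2, c 3, hc3, d 0, hd0, d 1, hd1, hCu, ?_⟩
  rw [hDu, hd2c]
  simp only [map_neg, map_smul]
  module

-- By `hom_ext` it is enough to evaluate on `L^j u / j!` with `u` primitive. Both sides become
-- combinations of divided powers of `L` on the six elements `c₀, c₁, c₂, c₃, d₀, d₁`, with
-- coefficients polynomial in `N` and `j`, and these agree. The operator `P` multiplies weight `k`
-- by `δ k`. The hypothesis on `ε N * ε (N - 1) * δ (-N)` makes the signs collected by `s D s P`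
-- uniform.
include hL hs hε hD hDC hC in
theorem commutator_star {P : Module.End ℂ M} {δ : ℤ → ℂ} (hP : ∀ k u, π k u = u → P u = δ k • u)
    (hδ : ∀ k, δ (k + 2) = δ k) (hεδ : ∀ N, ε N * ε (N - 1) * δ (-N) = -1)
    (hε2 : ∀ N, ε (N + 2) = -ε N) :
    L * (s * D * s * P) - s * D * s * P * L = D + (s * L * s * C - C * (s * L * s)) := by
  have hδj : ∀ (k : ℤ) (j : ℕ), δ (k + 2 * j) = δ k := by
    intro k j
    induction j with
    | zero => simp
    | succ j ih => rw [Nat.cast_succ, mul_add, mul_one, ← add_assoc, hδ, ih]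
  refine hL.hom_ext fun N j hj u hu => ?_
  obtain ⟨c₀, hc0, c₁, hc1, c₂, hc2, c₃, hc3, d₀, hd0, d₁, hd1, hCu, hDu⟩ :=
    hL.exists_components hD hDC hC hu
  have hCE : ∀ q : ℤ, C (divPow L q u) = divPow L q c₀ + ((q : ℂ) + 1) • divPow L (q + 1) c₁ +
      (((q : ℂ) + 1) * (q + 2)) • divPow L (q + 2) c₂ +
      (((q : ℂ) + 1) * (q + 2) * (q + 3)) • divPow L (q + 3) c₃ := by
    intro q
    rw [divPow_comm hC, hCu]
    simp only [map_add, divPow_L, smul_smul]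
    rw [show q + 1 + 1 = q + 2 by ring, show q + 2 + 1 = q + 3 by ring]
    push_cast
    module
  have hDE : ∀ q : ℤ, D (divPow L q u) = divPow L (q - 1) c₀ + divPow L q d₀ +
      (q : ℂ) • divPow L q c₁ + ((q : ℂ) + 1) • divPow L (q + 1) d₁ +
      ((q : ℂ) * (q + 1)) • divPow L (q + 1) c₂ +
      (((q : ℂ) + 1) * (q + 2) * (q - N - 1)) • divPow L (q + 2) c₃ := by
    intro q
    rw [divPow_derivation hDC hC, ← divPow_comm hC, hCE, hDu]
    simp only [map_add, map_sub, map_smul, divPow_L, smul_smul]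
    rw [show q - 1 + 1 = q by ring, show q - 1 + 2 = q + 1 by ring, show q - 1 + 3 = q + 2 by ring,
      show q + 1 + 1 = q + 2 by ring]
    push_cast
    module
  -- The six primitive elements have weights `-(N ± 1)` and `-(N ± 3)`, so all signs reduce to `ε (N
  -- - 1)`.
  have e1 : ε ((N : ℤ) + 1) = -ε (N - 1) := by
    rw [show (N : ℤ) + 1 = N - 1 + 2 by ring, hε2]
  have e3 : ε ((N : ℤ) + 3) = ε (N - 1) := by
    rw [show (N : ℤ) + 3 = N + 1 + 2 by ring, hε2, e1, neg_neg]
  have e0 : ε ((N : ℤ) - 3) = -ε (N - 1) := by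
    rw [show (N : ℤ) - 1 = N - 3 + 2 by ring, hε2, neg_neg]
  -- The star replaces `q` by `N - q`, then `D` is expanded, and the second star reflects each of
  -- the six strings about its own centre.
  have hQ : ∀ q : ℕ, (s * D * s * P) (divPow L q u) = divPow L ((q : ℤ) - 2) c₀ -
      divPow L ((q : ℤ) - 1) d₀ - ((N : ℂ) - q) • divPow L ((q : ℤ) - 1) c₁ +
      ((N : ℂ) - q + 1) • divPow L q d₁ + (((N : ℂ) - q) * (N - q + 1)) • divPow L q c₂ +
      (((N : ℂ) - q + 1) * (N - q + 2) * (q + 1)) • divPow L ((q : ℤ) + 1) c₃ := by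
    intro q
    rw [Module.End.mul_apply, Module.End.mul_apply, Module.End.mul_apply,
      hP _ _ (hL.proj_divPow hu q), hδj, map_smul, hs _ _ u hu, map_smul, map_smul,
      map_smul, map_smul, hDE]
    simp only [map_add, map_smul]
    rw [hs _ _ _ hc0, hs _ _ _ hc1, hs _ _ _ hc2, hs _ _ _ hc3, hs _ _ _ hd0, hs _ _ _ hd1,
      e0, e1, e3, show (N : ℤ) - 3 - (N - q - 1) = q - 2 by ring,
      show (N : ℤ) - 1 - (N - q) = q - 1 by ring, show (N : ℤ) + 1 - (N - q + 1) = q by ring,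
      show (N : ℤ) + 3 - (N - q + 2) = q + 1 by ring]
    have h := hεδ N
    push_cast
    linear_combination (norm := module) h • (-(divPow L ((q : ℤ) - 2) c₀) +
      divPow L ((q : ℤ) - 1) d₀ + ((N : ℂ) - q) • divPow L ((q : ℤ) - 1) c₁ -
      ((N : ℂ) - q + 1) • divPow L q d₁ - (((N : ℂ) - q) * (N - q + 1)) • divPow L q c₂ -
      (((N : ℂ) - q + 1) * (N - q + 2) * (q + 1)) • divPow L ((q : ℤ) + 1) c₃)
  have hQ' := hQ (j + 1)
  push_cast at hQ'
  rw [LinearMap.sub_apply, Module.End.mul_apply, hQ, Module.End.mul_apply (s * D * s * P) L,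
    L_divPow, map_smul, hQ', LinearMap.add_apply, LinearMap.sub_apply,
    Module.End.mul_apply (s * L * s) C, Module.End.mul_apply C (s * L * s), hCE, hDE,
    lambda_divPow hs hε _ hu, map_smul, hCE]
  simp only [map_add, map_sub, map_smul, L_divPow]
  rw [lambda_divPow hs hε _ hc0, lambda_divPow hs hε _ hc1, lambda_divPow hs hε _ hc2,
    lambda_divPow hs hε _ hc3]
  push_cast
  rw [show (j : ℤ) - 2 + 1 = j - 1 by ring, show (j : ℤ) - 1 + 1 = j by ring,
    show (j : ℤ) + 1 + 1 = j + 2 by ring, show (j : ℤ) + 1 - 2 = j - 1 by ring,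
    show (j : ℤ) + 1 - 1 = j by ring, show (j : ℤ) + 2 - 1 = j + 1 by ring,
    show (j : ℤ) + 3 - 1 = j + 2 by ring, show (j : ℤ) - 1 + 2 = j + 1 by ring,
    show (j : ℤ) - 1 + 3 = j + 2 by ring]
  module

end IsLefschetz

end LefschetzStar

end THodge
end

noncomputable section

namespace THodge

/-! ### Hard Lefschetz for smooth forms -/

section SmoothSolve

variable {n : ℕ} {W : Type*} [AddCommGroup W] [Module ℝ W] [Module.Finite ℝ W]

/-- Solutions of linear equations depend smoothly on parameters. -/
theorem smoothAt_of_family {A : CV n → W →ₗ[ℝ] W} {c : CV n}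
    (hA : ∀ w, SmoothAt (fun z => A z w) c) (hc : A c = LinearMap.id) {s : CV n → W} {t : W}
    (hs : ∀ᶠ z in 𝓝 c, A z (s z) = t) : SmoothAt s c := by
  classical
  let b := Module.finBasis ℝ W
  let N : CV n → Matrix _ _ ℝ := fun z => LinearMap.toMatrix b b (A z)
  have hN : ∀ i j, ContDiffAt ℝ ∞ (fun z => N z i j) c := by
    intro i j
    have := (hA (b j)).repr i
    simpa only [N, LinearMap.toMatrix_apply] using this
  have hprod : ∀ {ι : Type} (S : Finset ι) (f : ι → CV n → ℝ),
      (∀ i ∈ S, ContDiffAt ℝ ∞ (f i) c) → ContDiffAt ℝ ∞ (fun z => ∏ i ∈ S, f i z) c :=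
    fun S f hf => contDiffAt_prod hf
  have hd : ContDiffAt ℝ ∞ (fun z => (N z).det) c := by
    simp only [Matrix.det_apply]
    exact ContDiffAt.sum fun σ _ => (hprod _ _ fun i _ => hN _ _).const_smul _
  have hadj : ∀ i j, ContDiffAt ℝ ∞ (fun z => (N z).adjugate i j) c := by
    intro i j
    simp only [Matrix.adjugate_apply, Matrix.det_apply]
    refine ContDiffAt.sum fun σ _ => (hprod _ _ fun k _ => ?_).const_smul _
    simp only [Matrix.updateRow_apply]
    by_cases hi : σ k = j
    · simp only [hi, if_true]
      exact contDiffAt_const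
    · simp only [hi, if_false]
      exact hN _ _
  have hdc : (N c).det = 1 := by
    simp only [N, hc, LinearMap.toMatrix_id, Matrix.det_one]
  have hne : ∀ᶠ z in 𝓝 c, (N z).det ≠ 0 :=
    hd.continuousAt.eventually_ne (by rw [hdc]; exact one_ne_zero)
  have e : s =ᶠ[𝓝 c] fun z => ∑ i, (((N z).det)⁻¹ *
      ((N z).adjugate.mulVec (b.repr t)) i) • b i := by
    filter_upwards [hs, hne] with z hz h0
    have h1 : (N z).mulVec (b.repr (s z)) = b.repr t := by
      rw [← hz]
      exact LinearMap.toMatrix_mulVec_repr b b (A z) (s z)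
    conv_lhs => rw [← b.sum_repr (s z)]
    refine Finset.sum_congr rfl fun i _ => ?_
    rw [← h1, Matrix.mulVec_mulVec, Matrix.adjugate_mul, Matrix.smul_mulVec, Matrix.one_mulVec,
      Pi.smul_apply, smul_eq_mul, inv_mul_cancel_left₀ h0]
  refine SmoothAt.congr (SmoothAt.sum fun i _ => SmoothAt.smul ?_ (smoothAt_const _ _)) e
  refine (hd.inv (by rw [hdc]; exact one_ne_zero)).mul ?_
  simp only [Matrix.mulVec, dotProduct]
  exact ContDiffAt.sum fun j _ => (hadj i j).mul contDiffAt_const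

end SmoothSolve

/-! ### Inverting multiplication by a form, smoothly in the form -/

section Solve

variable {n k M : ℕ}

/-- A form of degree `2 M` by which multiplication is injective on forms of degree `k`. -/
structure IsInjForm (k M : ℕ) (Ω : Lam n) : Prop where
  deg : Ω ∈ LamDeg n (2 * M)
  inj : ∀ u ∈ LamDeg n k, Ω * u = 0 → u = 0

theorem IsInjForm.eq_of_mul {Ω : Lam n} (hΩ : IsInjForm k M Ω) {x y : Lam n}
    (hx : x ∈ LamDeg n k) (hy : y ∈ LamDeg n k) (h : Ω * x = Ω * y) : x = y := by
  rw [← sub_eq_zero] at h ⊢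
  exact hΩ.inj _ (Submodule.sub_mem _ hx hy) (by rw [mul_sub, h])

theorem IsInjForm.pb {Ω : Lam n} (hΩ : IsInjForm k M Ω) {A B : CV n →ₗ[ℝ] CV n}
    (hAB : A ∘ₗ B = LinearMap.id) (hBA : B ∘ₗ A = LinearMap.id) :
    IsInjForm k M (THodge.pb A Ω) where
  deg := pb_mem A hΩ.deg
  inj u hu h0 := by
    have h1 : Ω * THodge.pb B u = 0 := by
      have := congrArg (THodge.pb B) h0
      rwa [map_mul, pb_comp, hAB, pb_id, map_zero] at this
    have h2 := congrArg (THodge.pb A) (hΩ.inj _ (pb_mem B hu) h1)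
    rwa [pb_comp, hBA, pb_id, map_zero] at h2

theorem exists_solve {Ω : Lam n} (hk : k + M = n) (hΩ : IsInjForm k M Ω) :
    ∃ S : Lam n →ₗ[ℝ] Lam n, ∀ v, S v ∈ LamDeg n k ∧ Ω * S v = proj n (2 * M + k) v := by
  let f : LamDeg n k →ₗ[ℝ] LamDeg n (2 * M + k) :=
    (LinearMap.mulLeft ℝ Ω ∘ₗ (LamDeg n k).subtype).codRestrict _
      fun x => mul_mem_lamDeg hΩ.deg x.2
  have hf : Function.Surjective f := by
    intro y
    obtain ⟨x, hx, e⟩ := exists_mul_eq (k := k) hΩ.deg (by omega)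
      (fun u hu h => hΩ.inj u (mem_LZ.1 hu) h) (y := y) (by
        rw [show (k : ℤ) + 2 * M = (2 * M + k : ℕ) by push_cast; ring, mem_LZ]
        exact y.2)
    exact ⟨⟨x, mem_LZ.1 hx⟩, Subtype.ext e⟩
  obtain ⟨g, hg⟩ := f.exists_rightInverse_of_surjective (LinearMap.range_eq_top.2 hf)
  refine ⟨(LamDeg n k).subtype ∘ₗ g ∘ₗ (proj n (2 * M + k)).codRestrict _
    (proj_mem (2 * M + k)), fun v => ⟨(g _).2, ?_⟩⟩
  exact congrArg Subtype.val (LinearMap.congr_fun hg ⟨_, proj_mem (2 * M + k) v⟩)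

open Classical in
/-- The inverse of the multiplication by `Ω`, from forms of degree `2 M + k` to forms of degree
`k`. -/
def solve (k M : ℕ) (Ω : Lam n) : Lam n →ₗ[ℝ] Lam n :=
  if h : ∃ S : Lam n →ₗ[ℝ] Lam n, ∀ v, S v ∈ LamDeg n k ∧ Ω * S v = proj n (2 * M + k) v
  then h.choose else 0

variable {Ω : Lam n} (hk : k + M = n) (hΩ : IsInjForm k M Ω)
include hk hΩ

theorem solve_spec (v : Lam n) :
    solve k M Ω v ∈ LamDeg n k ∧ Ω * solve k M Ω v = proj n (2 * M + k) v := by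
  have h := exists_solve hk hΩ
  rw [solve, dif_pos h]
  exact h.choose_spec v

theorem solve_eq {x v : Lam n} (hx : x ∈ LamDeg n k) (h : Ω * x = proj n (2 * M + k) v) :
    solve k M Ω v = x :=
  hΩ.eq_of_mul (solve_spec hk hΩ v).1 hx ((solve_spec hk hΩ v).2.trans h.symm)

/-- The solution is unique, hence natural under invertible pull backs. This lets the fibrewise
solution be computed in any chart. -/
theorem pb_solve {A B : CV n →ₗ[ℝ] CV n} (hAB : A ∘ₗ B = LinearMap.id)
    (hBA : B ∘ₗ A = LinearMap.id) (v : Lam n) :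
    solve k M (pb A Ω) (pb A v) = pb A (solve k M Ω v) :=
  solve_eq hk (hΩ.pb hAB hBA) (pb_mem A (solve_spec hk hΩ v).1) (by
    rw [← map_mul, (solve_spec hk hΩ v).2, proj_pb])

omit hΩ in
theorem smoothAt_solve {b : CV n → Lam n} {c : CV n} (hb : SmoothAt b c)
    (hΩ : ∀ᶠ z in 𝓝 c, IsInjForm k M (b z)) (v : Lam n) :
    SmoothAt (fun z => solve k M (b z) v) c := by
  -- Compose multiplication by `b z` with the inverse at the fixed point `c`, and let the map be the
  -- identity off degree `k`. The result is the identity at `z = c`, and it sends the moving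
  -- solution to the fixed vector `solve k M (b c) v`.
  let A : CV n → Lam n →ₗ[ℝ] Lam n := fun z =>
    solve k M (b c) ∘ₗ LinearMap.mulLeft ℝ (b z) ∘ₗ proj n k + (LinearMap.id - proj n k)
  have hA : ∀ w, SmoothAt (fun z => A z w) c := by
    intro w
    refine SmoothAt.add (SmoothAt.linear ?_ (solve k M (b c))) (smoothAt_const _ c)
    exact smoothAt_mul hb (smoothAt_const _ c)
  have hc := hΩ.self_of_nhds
  refine smoothAt_of_family (t := solve k M (b c) v) hA ?_ ?_
  · refine LinearMap.ext fun w => ?_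
    have : solve k M (b c) (b c * proj n k w) = proj n k w :=
      solve_eq hk hc (proj_mem k w)
        (proj_of_mem (mul_mem_lamDeg hc.deg (proj_mem k w))).symm
    simp only [A, LinearMap.add_apply, LinearMap.sub_apply, LinearMap.comp_apply,
      LinearMap.mulLeft_apply, LinearMap.id_apply, this, add_sub_cancel]
  · filter_upwards [hΩ] with z hz
    have h1 := solve_spec hk hz v
    simp only [A, LinearMap.add_apply, LinearMap.sub_apply, LinearMap.comp_apply,
      LinearMap.mulLeft_apply, LinearMap.id_apply, proj_of_mem h1.1, sub_self, add_zero, h1.2]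
    refine solve_eq hk hc (solve_spec hk hc v).1 ?_
    rw [(solve_spec hk hc v).2, proj_of_mem (proj_mem _ v)]

end Solve

/-! ### Solving on the manifold -/

section Global

variable {n r : ℕ} {X : Type*} [TopologicalSpace X] [ChartedSpace (CV n) X]
  [IsManifold 𝓘(ℂ, CV n) ω X]
  {E : X → Type*} [∀ x, AddCommGroup (E x)] [∀ x, Module ℂ (E x)] {k M : ℕ}

theorem dtrans_inverse {x₀ x₁ : X} {y : CV n} (hy : y ∈ (chartAt (CV n) x₀).target)
    (h : (chartAt (CV n) x₀).symm y ∈ (chartAt (CV n) x₁).source) :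
    ∃ B, dtrans n x₀ x₁ y ∘ₗ B = LinearMap.id ∧ B ∘ₗ dtrans n x₀ x₁ y = LinearMap.id := by
  have h1 := dtrans_comp (x₂ := x₀) hy h ((chartAt (CV n) x₀).map_target hy)
  rw [dtrans_self hy] at h1
  exact ⟨_, (LinearMap.comp_eq_id_comm ℝ _).1 h1.symm, h1.symm⟩

theorem exists_pullLam_inverse {x₀ : X} {y : CV n} (hy : y ∈ (chartAt (CV n) x₀).target) :
    ∃ A B : CV n →ₗ[ℝ] CV n, pullLam x₀ y = pb A ∧ A ∘ₗ B = LinearMap.id ∧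
      B ∘ₗ A = LinearMap.id := by
  obtain ⟨B, h1, h2⟩ := dtrans_inverse hy (mem_chart_source (CV n) ((chartAt (CV n) x₀).symm y))
  exact ⟨_, B, pullLam_eq x₀ y, h1, h2⟩

theorem isInjForm_localReal {b : X → Lam n} (hb : ∀ x, IsInjForm k M (b x)) {x₀ : X} {y : CV n}
    (hy : y ∈ (chartAt (CV n) x₀).target) : IsInjForm k M (localReal b x₀ y) := by
  obtain ⟨A, B, e, h1, h2⟩ := exists_pullLam_inverse hy
  rw [localReal, e]
  exact (hb _).pb h1 h2

/-- The fibrewise solution `u` of `b ∧ u = v`. -/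
def solveForm (k M : ℕ) (b : X → Lam n) (v : Forms n E) : Forms n E := fun x =>
  tm LinearMap.id (solve k M (b x)) (v x)

omit [IsManifold 𝓘(ℂ, CV n) ω X] in
theorem tm_solve {W : Type*} [AddCommGroup W] [Module ℂ W] (hk : k + M = n) {Ω : Lam n}
    (hΩ : IsInjForm k M Ω) (w : W ⊗[ℝ] Lam n) :
    wedge Ω (tm LinearMap.id (solve k M Ω) w) = projW n W (2 * M + k) w ∧
      projW n W k (tm LinearMap.id (solve k M Ω) w) = tm LinearMap.id (solve k M Ω) w := by
  induction w using TensorProduct.induction_on with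
  | zero => simp only [map_zero, and_self]
  | tmul s a =>
    rw [tm_tmul, wedge_tmul, projW, projW, tm_tmul, tm_tmul, (solve_spec hk hΩ a).2,
      proj_of_mem (solve_spec hk hΩ a).1]
    exact ⟨rfl, rfl⟩
  | add u v hu hv => simp only [map_add, hu.1, hu.2, hv.1, hv.2, and_self]

omit [IsManifold 𝓘(ℂ, CV n) ω X] in
theorem wedge_injective {W : Type*} [AddCommGroup W] [Module ℂ W] (hk : k + M = n) {Ω : Lam n}
    (hΩ : IsInjForm k M Ω) {w : W ⊗[ℝ] Lam n} (hw : projW n W k w = w) (h0 : wedge Ω w = 0) :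
    w = 0 := by
  have e : ∀ w : W ⊗[ℝ] Lam n, tm LinearMap.id (solve k M Ω) (wedge Ω (projW n W k w)) =
      projW n W k w := by
    intro w
    induction w using TensorProduct.induction_on with
    | zero => simp only [map_zero]
    | tmul s a =>
      rw [projW, tm_tmul, wedge_tmul, tm_tmul, solve_eq hk hΩ (proj_mem k a)
        (proj_of_mem (mul_mem_lamDeg hΩ.deg (proj_mem k a))).symm]
      rfl
    | add u v hu hv => simp only [map_add, hu, hv]
  rw [← hw, ← e, hw, h0, map_zero]

omit [IsManifold 𝓘(ℂ, CV n) ω X] in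
theorem wedgeForm_injective (hk : k + M = n) {b : X → Lam n} (hb : ∀ x, IsInjForm k M (b x))
    {u : Forms n E} (hu : u ∈ homogeneous n E k) (h0 : wedgeForm b u = 0) : u = 0 := by
  rw [mem_homogeneous_iff] at hu
  funext x
  exact wedge_injective hk (hb x) (congrFun hu x) (congrFun h0 x)

variable [TopologicalSpace (Bundle.TotalSpace (Fin r → ℂ) E)] [∀ x, TopologicalSpace (E x)]
  [FiberBundle (Fin r → ℂ) E] [VectorBundle ℂ (Fin r → ℂ) E]

theorem localRep_solveForm (hk : k + M = n) {b : X → Lam n} (hb : ∀ x, IsInjForm k M (b x))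
    (v : Forms n E) {x₀ : X} {y : CV n} (hy : y ∈ (chartAt (CV n) x₀).target) :
    localRep r (solveForm k M b v) x₀ y =
      tm LinearMap.id (solve k M (localReal b x₀ y)) (localRep r v x₀ y) := by
  obtain ⟨A, B, e, h1, h2⟩ := exists_pullLam_inverse hy
  rw [localRep, localRep, solveForm, tm_tm, tm_tm, localReal, e]
  congr 2
  exact LinearMap.ext fun a => (pb_solve hk (hb _) h1 h2 a).symm

/-- The fibrewise solution is smooth by `smoothAt_solve` and vanishes wherever `v` does, so it keeps
compact support. -/
theorem exists_wedgeForm_eq (hk : k + M = n) {b : X → Lam n} (hs : IsSmoothReal b)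
    (hb : ∀ x, IsInjForm k M (b x)) {v : Forms n E} (hv : v ∈ smoothForms n r E)
    (hvd : v ∈ homogeneous n E (2 * M + k)) :
    ∃ u ∈ smoothForms n r E ⊓ homogeneous n E k, wedgeForm b u = v := by
  obtain ⟨h, K, hK, h0⟩ := mem_smoothForms.1 hv
  rw [mem_homogeneous_iff] at hvd
  refine ⟨solveForm k M b v, ⟨⟨fun x₀ => ?_, K, hK, fun x hx => ?_⟩, ?_⟩, ?_⟩
  · have ht : ∀ᶠ y in 𝓝 (chartAt (CV n) x₀ x₀), y ∈ (chartAt (CV n) x₀).target :=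
      (chartAt (CV n) x₀).open_target.mem_nhds (mem_chart_target (CV n) x₀)
    have hi : ∀ᶠ y in 𝓝 (chartAt (CV n) x₀ x₀), IsInjForm k M (localReal b x₀ y) := by
      filter_upwards [ht] with y hy
      exact isInjForm_localReal hb hy
    have h1 : ∀ w : (Fin r → ℂ) ⊗[ℝ] Lam n, SmoothAt (fun y =>
        tm LinearMap.id (solve k M (localReal b x₀ y)) w) (chartAt (CV n) x₀ x₀) := by
      intro w
      induction w using TensorProduct.induction_on with
      | zero =>
        simp only [map_zero]
        exact smoothAt_const _ _
      | tmul s a =>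
        simp only [tm_tmul, LinearMap.id_apply]
        exact (smoothAt_solve hk (hs x₀) hi a).linear (TensorProduct.mk ℝ _ _ s)
      | add u v hu hv =>
        simp only [map_add]
        exact hu.add hv
    refine (SmoothAt.family (Φ := fun y =>
      (tm LinearMap.id (solve k M (localReal b x₀ y))).restrictScalars ℝ) h1 (h x₀)).congr ?_
    filter_upwards [ht] with y hy
    exact localRep_solveForm hk hb v hy
  · rw [solveForm, h0 x hx, map_zero]
  · rw [SetLike.mem_coe, mem_homogeneous_iff]
    funext x
    exact (tm_solve hk (hb x) (v x)).2
  · funext x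
    rw [wedgeForm_apply, solveForm, (tm_solve hk (hb x) (v x)).1]
    exact congrFun hvd x

end Global

end THodge
end

noncomputable section

namespace THodge

/-! ### The Lefschetz module of forms divisible by `T` -/

section Pointwise

variable {n : ℕ}

theorem proj_mul_of_lt {l d : ℕ} {a : Lam n} (ha : a ∈ LamDeg n l) (hd : d < l) (b : Lam n) :
    proj n d (a * b) = 0 := by
  rw [← sum_proj b, Finset.mul_sum, map_sum]
  exact Finset.sum_eq_zero fun j _ =>
    proj_of_mem_ne (mul_mem_lamDeg ha (proj_mem j b)) (by omega)

theorem projW_wedge_of_lt {W : Type*} [AddCommGroup W] [Module ℂ W] {l d : ℕ} {a : Lam n}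
    (ha : a ∈ LamDeg n l) (hd : d < l) (u : W ⊗[ℝ] Lam n) : projW n W d (wedge a u) = 0 := by
  induction u using TensorProduct.induction_on with
  | zero => simp only [map_zero]
  | tmul s b => rw [projW, wedge_tmul, tm_tmul, proj_mul_of_lt ha hd, TensorProduct.tmul_zero]
  | add u v hu hv => simp only [map_add, hu, hv, add_zero]

end Pointwise

section Data

variable {n m : ℕ} {X : Type*} [TopologicalSpace X] [ChartedSpace (CV n) X]

variable (m) in
/-- The forms `ω` and `T` satisfy the pointwise hypotheses of the mixed hard Lefschetz theorem. -/
structure IsLefschetzPair (om T : X → Lam n) : Prop where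
  le : m ≤ n
  om_even : IsEvenInv 1 om
  T_even : IsEvenInv (n - m) T
  inj : ∀ k N : ℕ, k + N = m → ∀ x, IsInjForm k (N + (n - m)) (om x ^ N * T x)

theorem IsHermitianForm.isEvenInv {a : X → Lam n} (ha : IsHermitianForm a) : IsEvenInv 1 a :=
  ⟨ha.1, fun x => (ha.2 x).1, fun x => (ha.2 x).2.1⟩

theorem IsSmoothReal.pow {a : X → Lam n} (ha : IsSmoothReal a) (N : ℕ) :
    IsSmoothReal fun x => a x ^ N := by
  induction N with
  | zero => simpa only [pow_zero] using isSmoothReal_one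
  | succ N ih => simpa only [pow_succ] using ih.mul ha

theorem isSmoothReal_wedgeProd {s : ℕ} {α : Fin s → X → Lam n} (hα : ∀ j, IsSmoothReal (α j)) :
    IsSmoothReal (wedgeProd α) := by
  induction s with
  | zero => exact isSmoothReal_one
  | succ s ih =>
    have e : wedgeProd α = fun x => α 0 x * wedgeProd (fun j : Fin s => α j.succ) x := by
      funext x
      simp only [wedgeProd, List.ofFn_succ, List.prod_cons]
    rw [e]
    exact (hα 0).mul (ih fun j => hα j.succ)

/-- The form `ω^N ∧ T` is a product of `N + (n - m)` positive forms. For `k + N = m` this is the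
number `n - k` required by `mixedHL` in degree `k`. -/
theorem isLefschetzPair (hm : m ≤ n) {om : X → Lam n} (hom : IsHermitianForm om)
    {α : Fin (n - m) → X → Lam n} (hα : ∀ j, IsHermitianForm (α j)) :
    IsLefschetzPair m om (wedgeProd α) where
  le := hm
  om_even := hom.isEvenInv
  T_even := by
    have hp : ∀ x, ∀ b ∈ List.ofFn fun j => α j x, IsPositive11 b := by
      intro x b hb
      obtain ⟨j, rfl⟩ := (List.mem_ofFn' _ _).1 hb
      exact (hα j).2 x
    refine ⟨isSmoothReal_wedgeProd fun j => (hα j).1, fun x => ?_, fun x => weil_prod (hp x)⟩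
    have := prod_mem_lamDeg (hp x)
    rwa [List.length_ofFn] at this
  inj k N hk x := by
    let l : List (Lam n) := List.replicate N (om x) ++ List.ofFn fun j => α j x
    have hl : ∀ b ∈ l, IsPositive11 b := by
      intro b hb
      rcases List.mem_append.1 hb with hb | hb
      · rw [List.eq_of_mem_replicate hb]
        exact hom.2 x
      · obtain ⟨j, rfl⟩ := (List.mem_ofFn' _ _).1 hb
        exact (hα j).2 x
    have hlen : l.length = N + (n - m) := by simp [l]
    have hprod : l.prod = om x ^ N * wedgeProd α x := by
      rw [List.prod_append, List.prod_replicate]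
      rfl
    rw [← hlen, ← hprod]
    exact ⟨prod_mem_lamDeg hl, fun u hu h0 =>
      mixedHL n k l (by rw [hlen]; push_cast; omega) hl u (mem_LZ.2 hu) h0⟩

end Data

section Module

variable {n m r : ℕ} {X : Type*} [TopologicalSpace X] [ChartedSpace (CV n) X]
  {E : X → Type*} [∀ x, AddCommGroup (E x)] [∀ x, Module ℂ (E x)]
  [TopologicalSpace (Bundle.TotalSpace (Fin r → ℂ) E)] [∀ x, TopologicalSpace (E x)]
  [FiberBundle (Fin r → ℂ) E] [VectorBundle ℂ (Fin r → ℂ) E] {om T : X → Lam n}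

/-- The choice in `restrictVT` is meaningful once `P` maps `V_T` to itself linearly. Linearity is
asked only on `V_T`, because `∂̄` and `∂^E` need not be additive on forms that are not smooth. -/
theorem restrictVT_apply {P : Forms n E → Forms n E} (hmem : ∀ u ∈ VT r E T, P u ∈ VT r E T)
    (hadd : ∀ u ∈ VT r E T, ∀ v ∈ VT r E T, P (u + v) = P u + P v)
    (hsmul : ∀ (c : ℂ), ∀ u ∈ VT r E T, P (c • u) = c • P u) (u : VT r E T) :
    (restrictVT r T P u : Forms n E) = P u := by
  let A : Module.End ℂ (VT r E T) :=
    { toFun := fun u => ⟨P u, hmem u u.2⟩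
      map_add' := fun u v => Subtype.ext (hadd u u.2 v v.2)
      map_smul' := fun c u => Subtype.ext (hsmul c u u.2) }
  exact Classical.epsilon_spec (p := fun A : Module.End ℂ (VT r E T) =>
    ∀ u : VT r E T, (A u : Forms n E) = P u) ⟨A, fun _ => rfl⟩ u

variable (hp : IsLefschetzPair m om T)
include hp

theorem wedgeForm_comm (u : Forms n E) :
    wedgeForm om (wedgeForm T u) = wedgeForm T (wedgeForm om u) := by
  funext x
  rw [wedgeForm_apply, wedgeForm_apply, wedgeForm_apply, wedgeForm_apply, wedge_wedge, wedge_wedge,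
    mul_comm_of_even (hp.om_even.deg x)]

theorem coe_opL (u : VT r E T) : (opL r E om T u : Forms n E) = wedgeForm om u := by
  refine restrictVT_apply (fun u hu => ?_) (fun u _ v _ => map_add _ u v)
    (fun c u _ => map_smul _ c u) u
  obtain ⟨a, ha, rfl⟩ := hu
  exact ⟨_, smoothForms_wedge hp.om_even.smooth ha, (wedgeForm_comm hp a).symm⟩

theorem coe_opL_pow (N : ℕ) (u : VT r E T) (x : X) :
    ((opL r E om T ^ N) u : Forms n E) x = wedge (om x ^ N) ((u : Forms n E) x) := by
  induction N with
  | zero => rw [pow_zero, pow_zero, wedge_one]; rfl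
  | succ N ih =>
    rw [pow_succ', Module.End.mul_apply, coe_opL hp, wedgeForm_apply, ih, wedge_wedge, pow_succ']

omit hp in
/-- The projection to the component of degree `d` relative to `T`. -/
def degForm (n : ℕ) {X : Type*} (E : X → Type*) [∀ x, AddCommGroup (E x)] [∀ x, Module ℂ (E x)]
    (m : ℕ) (d : ℤ) : Forms n E →ₗ[ℂ] Forms n E :=
  if d < 0 then 0 else formOp E (proj n (2 * (n - m) + d.toNat))

omit hp in
theorem degForm_natCast (d : ℕ) (u : Forms n E) (x : X) :
    degForm n E m d u x = projW n (E x) (2 * (n - m) + d) (u x) := by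
  rw [degForm, if_neg (by omega), Int.toNat_natCast]
  rfl

omit hp in
theorem degForm_neg {d : ℤ} (hd : d < 0) : degForm n E m d = 0 := if_pos hd

theorem degForm_wedge (d : ℕ) (a : Forms n E) :
    degForm n E m d (wedgeForm T a) = wedgeForm T (formOp E (proj n d) a) := by
  funext x
  rw [degForm_natCast, wedgeForm_apply, projW_wedge (hp.T_even.deg x)]
  rfl

theorem degForm_mem (d : ℤ) {u : Forms n E} (hu : u ∈ VT r E T) :
    degForm n E m d u ∈ VT r E T := by
  rcases lt_or_ge d 0 with h | h
  · rw [degForm_neg h]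
    exact Submodule.zero_mem _
  · lift d to ℕ using h
    obtain ⟨a, ha, rfl⟩ := hu
    rw [degForm_wedge hp]
    exact ⟨_, smoothForms_formOp (fun x₀ y _ a => pullLam_proj d x₀ y a) ha, rfl⟩

/-- The projection of `V_T` to the component of weight `w`, that is, of degree `w + m`. -/
def weightProj (r : ℕ) (E : X → Type*) [∀ x, AddCommGroup (E x)] [∀ x, Module ℂ (E x)]
    [TopologicalSpace (Bundle.TotalSpace (Fin r → ℂ) E)] [∀ x, TopologicalSpace (E x)]
    [FiberBundle (Fin r → ℂ) E] [VectorBundle ℂ (Fin r → ℂ) E] (w : ℤ) :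
    Module.End ℂ (VT r E T) :=
  (degForm n E m (w + m)).restrict fun _ hu => degForm_mem hp (w + m) hu

theorem coe_weightProj (w : ℤ) (u : VT r E T) :
    (weightProj hp r E w u : Forms n E) = degForm n E m (w + m) u := rfl

theorem mem_VTdeg_iff (k : ℕ) (u : VT r E T) :
    (u : Forms n E) ∈ VTdeg r E T k ↔ weightProj hp r E (k - m) u = u := by
  rw [← Subtype.coe_inj, coe_weightProj, sub_add_cancel]
  constructor
  · rintro ⟨a, ha, e⟩
    rw [← e, degForm_wedge hp, (mem_homogeneous_iff k a).1 ha.2]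
  · intro h
    obtain ⟨a, ha, e⟩ := u.2
    rw [← e, degForm_wedge hp] at h
    refine ⟨formOp E (proj n k) a,
      ⟨smoothForms_formOp (fun x₀ y _ a => pullLam_proj k x₀ y a) ha, ?_⟩, h.trans e⟩
    rw [SetLike.mem_coe, mem_homogeneous_iff]
    funext x
    exact projW_projW k (a x)

omit hp in
theorem degForm_self (d : ℤ) (u : Forms n E) :
    degForm n E m d (degForm n E m d u) = degForm n E m d u := by
  rcases lt_or_ge d 0 with h | h
  · rw [degForm_neg h]
    rfl
  · lift d to ℕ using h
    funext x
    rw [degForm_natCast, degForm_natCast, projW_projW]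

omit hp in
theorem degForm_ne {d e : ℤ} (hde : d ≠ e) (u : Forms n E) :
    degForm n E m e (degForm n E m d u) = 0 := by
  rcases lt_or_ge d 0 with h | h
  · rw [degForm_neg h]
    exact map_zero _
  rcases lt_or_ge e 0 with h' | h'
  · rw [degForm_neg h']
    rfl
  lift d to ℕ using h
  lift e to ℕ using h'
  funext x
  rw [degForm_natCast, degForm_natCast, projW_projW_ne (by omega)]
  rfl

/-- Relative degree `d` means absolute degree `2 (n - m) + d`, which exceeds `2 n` when `d > 2 m`.
-/
theorem degForm_eq_zero {d : ℤ} (hd : d < 0 ∨ 2 * m < d) (u : Forms n E) :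
    degForm n E m d u = 0 := by
  rcases hd with h | h
  · rw [degForm_neg h]
    rfl
  · lift d to ℕ using by omega
    have := hp.le
    funext x
    rw [degForm_natCast]
    exact eq_zero_of_projW (by omega) (projW_projW _ _)

theorem sum_weightProj (u : VT r E T) :
    ∑ w ∈ Finset.Icc (-m : ℤ) m, weightProj hp r E w u = u := by
  obtain ⟨a, ha, e⟩ := u.2
  refine Subtype.ext ?_
  have hle := hp.le
  have h1 : ((∑ w ∈ Finset.Icc (-m : ℤ) m, weightProj hp r E w u : VT r E T) : Forms n E) =
      ∑ d ∈ Finset.range (2 * m + 1), degForm n E m d u := by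
    rw [Submodule.coe_sum]
    refine Finset.sum_nbij' (fun w => (w + m).toNat) (fun d => (d : ℤ) - m) ?_ ?_ ?_ ?_ ?_
    · intro w hw
      rw [Finset.mem_Icc] at hw
      rw [Finset.mem_range]
      omega
    · intro d hd
      rw [Finset.mem_range] at hd
      rw [Finset.mem_Icc]
      omega
    · intro w hw
      rw [Finset.mem_Icc] at hw
      omega
    · intro d _
      omega
    · intro w hw
      rw [Finset.mem_Icc] at hw
      rw [coe_weightProj, Int.toNat_of_nonneg (by omega)]
  have h2 : ∑ d ∈ Finset.range (2 * m + 1), degForm n E m d (u : Forms n E) =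
      ∑ d ∈ Finset.range (2 * n + 1), degForm n E m d u := by
    refine Finset.sum_subset (fun d hd => ?_) fun d _ hd => degForm_eq_zero hp (Or.inr ?_) _
    · rw [Finset.mem_range] at hd ⊢
      omega
    · rw [Finset.mem_range] at hd
      omega
  rw [h1, h2, ← e]
  simp only [degForm_wedge hp]
  rw [← map_sum]
  congr 1
  funext x
  rw [Finset.sum_apply]
  exact sum_projW (a x)

theorem weightProj_shift (w : ℤ) (u : VT r E T) :
    weightProj hp r E (w + 2) (opL r E om T u) = opL r E om T (weightProj hp r E w u) := by
  refine Subtype.ext ?_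
  rw [coe_weightProj, coe_opL hp, coe_opL hp, coe_weightProj, add_right_comm]
  rcases lt_or_ge (w + m) 0 with h | h
  · rw [degForm_neg h, LinearMap.zero_apply, map_zero]
    rcases lt_or_ge (w + m + 2) 0 with h' | h'
    · rw [degForm_neg h', LinearMap.zero_apply]
    · lift w + m + 2 to ℕ using h' with d hd
      obtain ⟨a, ha, e⟩ := u.2
      funext x
      rw [degForm_natCast, ← e, wedgeForm_apply, wedgeForm_apply, wedge_wedge]
      exact projW_wedge_of_lt (mul_mem_lamDeg (hp.om_even.deg x) (hp.T_even.deg x)) (by omega) _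
  · lift w + m to ℕ using h with d
    funext x
    rw [show (d : ℤ) + 2 = (d + 2 : ℕ) by push_cast; rfl, degForm_natCast, wedgeForm_apply,
      wedgeForm_apply, degForm_natCast, show 2 * (n - m) + (d + 2) = 2 * 1 + (2 * (n - m) + d) by
        ring, projW_wedge (hp.om_even.deg x)]

variable [IsManifold 𝓘(ℂ, CV n) ω X]

/-- Weight `-N` consists of the forms `T ∧ a` with `a` of degree `k = m - N`, and `L^N` sends `T ∧
a` to `ω^N ∧ T ∧ a`. Both Lefschetz properties thus come from multiplication by `ω^N ∧ T` being
bijective from degree `k` to the complementary degree. -/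
theorem isLefschetz_VT : IsLefschetz m (weightProj hp r E) (opL r E om T) where
  proj_self w u := Subtype.ext (degForm_self _ _)
  proj_ne v w u h := Subtype.ext (degForm_ne (by omega) _)
  sum := sum_weightProj hp
  shift := weightProj_shift hp
  inj N u hu h0 := by
    have hle := hp.le
    refine Subtype.ext ?_
    have hu' := congrArg Subtype.val hu
    rw [coe_weightProj] at hu'
    -- Weights beyond `m` in absolute value are zero; otherwise `k = m - N` is an honest degree.
    rcases Nat.lt_or_ge m N with h | h
    · rw [← hu']
      exact degForm_eq_zero hp (Or.inl (by omega)) _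
    · obtain ⟨a, ha, e⟩ := u.2
      obtain ⟨k, rfl⟩ := Nat.exists_eq_add_of_le' h
      rw [show -(N : ℤ) + (k + N : ℕ) = k by push_cast; ring, ← e, degForm_wedge hp] at hu'
      have hk : formOp E (proj n k) a = 0 := by
        refine wedgeForm_injective (k := k) (M := N + (n - (k + N))) (by omega)
          (hp.inj k N rfl) ?_ ?_
        · rw [mem_homogeneous_iff]
          funext x
          exact projW_projW k (a x)
        · funext x
          have := congrFun (congrArg Subtype.val h0) x
          rw [coe_opL_pow hp, ← e, ← hu', wedgeForm_apply, wedge_wedge] at this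
          exact this
      rw [← e, ← hu', hk, map_zero]
      rfl
  surj N v hv := by
    have hle := hp.le
    have hv' := congrArg Subtype.val hv
    rw [coe_weightProj] at hv'
    rcases Nat.lt_or_ge m N with h | h
    · refine ⟨0, map_zero _, ?_⟩
      rw [map_zero, eq_comm]
      refine Subtype.ext ?_
      rw [← hv']
      exact degForm_eq_zero hp (Or.inr (by omega)) _
    · obtain ⟨a, ha, e⟩ := v.2
      obtain ⟨k, rfl⟩ := Nat.exists_eq_add_of_le' h
      -- The target `v` is itself a smooth form of absolute degree `2 (N + n - m) + k`. Solving `ω^N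
      -- ∧ T ∧ u = v` gives the preimage `T ∧ u`.
      obtain ⟨u, ⟨hu, hud⟩, hw⟩ := exists_wedgeForm_eq (r := r) (k := k) (M := N + (n - (k + N)))
        (by omega) (b := fun x => om x ^ N * T x) ((hp.om_even.smooth.pow N).mul hp.T_even.smooth)
        (hp.inj k N rfl) (v := (v : Forms n E)) (by
          rw [← e]
          exact smoothForms_wedge hp.T_even.smooth ha) (by
          rw [mem_homogeneous_iff]
          funext x
          have := congrFun hv' x
          rw [show (N : ℤ) + (k + N : ℕ) = (2 * N + k : ℕ) by push_cast; ring,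
            degForm_natCast, show 2 * (n - (k + N)) + (2 * N + k) =
              2 * (N + (n - (k + N))) + k by ring] at this
          exact this)
      refine ⟨⟨wedgeForm T u, u, hu, rfl⟩, Subtype.ext ?_, Subtype.ext ?_⟩
      · rw [coe_weightProj, show -(N : ℤ) + (k + N : ℕ) = k by push_cast; ring]
        change degForm n E (k + N) k (wedgeForm T u) = wedgeForm T u
        rw [degForm_wedge hp, (mem_homogeneous_iff k u).1 hud]
      · funext x
        rw [coe_opL_pow hp, ← hw]
        exact wedge_wedge _ _ _

end Module

end THodge
end

noncomputable section

namespace THodge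

/-! ### The operators of `V_T` -/

section Signs

/-- The signs of the Lefschetz star operator, in terms of the weight. -/
def starSign (m : ℕ) (N : ℤ) : ℂ := (ssgn (m - N) : ℝ)

/-- The parity of the degree, in terms of the weight. -/
def paritySign (m : ℕ) (w : ℤ) : ℂ := (psgn (w + m) : ℝ)

theorem starSign_mul_self (m : ℕ) (N : ℤ) : starSign m N * starSign m N = 1 := by
  rw [starSign, ← ofReal_mul, ssgn_mul_self, ofReal_one]

theorem starSign_add_two (m : ℕ) (N : ℤ) : starSign m (N + 2) = -starSign m N := by
  rw [starSign, starSign, ← sub_sub, ssgn_sub_two, ofReal_neg]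

theorem paritySign_add_two (m : ℕ) (w : ℤ) : paritySign m (w + 2) = paritySign m w := by
  rw [paritySign, paritySign, psgn, psgn]
  congr 1
  split_ifs <;> first | rfl | omega

theorem starSign_mul_paritySign (m : ℕ) (N : ℤ) :
    starSign m N * starSign m (N - 1) * paritySign m (-N) = -1 := by
  have h1 := ssgn_mul_psgn (m - (N - 1))
  have h2 := ssgn_mul_self (m - N)
  rw [show (m : ℤ) - (N - 1) - 1 = m - N by ring] at h1
  rw [starSign, starSign, paritySign, ← ofReal_mul, ← ofReal_mul, neg_add_eq_sub]
  have : ssgn (m - N) * ssgn (m - (N - 1)) * psgn (m - N) = -1 := by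
    linear_combination -ssgn (m - N) * h1 - h2
  rw [this]
  norm_num

theorem ssgn_natCast (k : ℕ) : ((ssgn k : ℝ) : ℂ) = (-1) ^ (k * (k + 1) / 2) := by
  induction k using Nat.strong_induction_on with
  | _ k ih =>
    match k with
    | 0 => norm_num [ssgn]
    | 1 => norm_num [ssgn]
    | k + 2 =>
      have e : (k + 2) * (k + 2 + 1) / 2 = k * (k + 1) / 2 + 2 * k + 3 := by
        rw [show (k + 2) * (k + 2 + 1) = k * (k + 1) + (2 * k + 3) * 2 by ring,
          Nat.add_mul_div_right _ _ (by norm_num)]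
        ring
      have h := ssgn_sub_two ((k + 2 : ℕ) : ℤ)
      rw [show ((k + 2 : ℕ) : ℤ) - 2 = k by push_cast; ring] at h
      rw [e, pow_add, pow_add, pow_mul, ← ih k (by omega), h]
      norm_num

end Signs

section Operators

variable {n m r : ℕ} {X : Type*} [TopologicalSpace X] [ChartedSpace (CV n) X]
  {E : X → Type*} [∀ x, AddCommGroup (E x)] [∀ x, Module ℂ (E x)]
  [TopologicalSpace (Bundle.TotalSpace (Fin r → ℂ) E)] [∀ x, TopologicalSpace (E x)]
  [FiberBundle (Fin r → ℂ) E] [VectorBundle ℂ (Fin r → ℂ) E] {om T : X → Lam n}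
  [IsManifold 𝓘(ℂ, CV n) ω X]

-- Translation between degree and weight: `k = m - N`, so the exponent `m - k + 1` of primitivity is
-- `N + 1` and the sign `(-1)^(k(k+1)/2)` is `starSign m N`. Weights with `N > m` carry no elements.
set_option maxHeartbeats 800000 in
theorem isLefschetzStar_iff (hp : IsLefschetzPair m om T) {S : Module.End ℂ (VT r E T)} :
    IsLefschetzStar r E m om T S ↔ ∀ N j : ℕ, j ≤ N →
      ∀ u ∈ prim (weightProj hp r E) (opL r E om T) N, S (divPow (opL r E om T) j u) =
        starSign m N • divPow (opL r E om T) (N - j : ℕ) u := by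
  have hL := isLefschetz_VT (r := r) (E := E) hp
  simp only [divPow_natCast, LinearMap.smul_apply]
  constructor
  · intro h N j hj u hu
    have hu' := IsLefschetz.mem_prim.1 hu
    rcases Nat.lt_or_ge m N with hN | hN
    · have : u = 0 := by
        rw [← hu'.1]
        exact hL.proj_eq_zero (Or.inl (by omega)) u
      rw [this]
      simp only [map_zero, smul_zero]
    · obtain ⟨k, rfl⟩ := Nat.exists_eq_add_of_le' hN
      have e1 : k + N - k = N := by omega
      have := h k (by omega) u ((mem_VTdeg_iff hp k u).2 (by
        rw [show (k : ℤ) - (k + N : ℕ) = -N by push_cast; ring]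
        exact hu'.1)) (by
        rw [e1]
        exact hu'.2) j (by omega)
      rw [this, e1, starSign, show ((k + N : ℕ) : ℤ) - N = k by push_cast; ring, ssgn_natCast,
        smul_smul]
  · intro h k hk u hu h0 j hj
    have hw := (mem_VTdeg_iff hp k u).1 hu
    have := h (m - k) j hj u (IsLefschetz.mem_prim.2 ⟨by
      rw [Nat.cast_sub hk, neg_sub]
      exact hw, h0⟩)
    rw [starSign, Nat.cast_sub hk, sub_sub_cancel, ssgn_natCast, smul_smul] at this
    exact this

theorem exists_isLefschetzStar (hp : IsLefschetzPair m om T) :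
    ∃ s, IsStar (weightProj hp r E) (opL r E om T) (starSign m) s ∧
      IsLefschetzStar r E m om T s ∧ ∀ s', IsLefschetzStar r E m om T s' → s' = s := by
  have hL := isLefschetz_VT (r := r) (E := E) hp
  obtain ⟨s, hs⟩ := hL.exists_star (starSign m)
  refine ⟨s, hs, (isLefschetzStar_iff hp).2 fun N j hj u hu => ?_, fun s' hs' =>
    hL.star_unique hs ((isLefschetzStar_iff hp).1 hs')⟩
  rw [hs _ _ u hu, Nat.cast_sub hj]

theorem isStar_opStar (hp : IsLefschetzPair m om T) :
    IsStar (weightProj hp r E) (opL r E om T) (starSign m) (opStar r E m om T) := by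
  obtain ⟨s, h1, h2, h3⟩ := exists_isLefschetzStar (r := r) (E := E) hp
  have : opStar r E m om T = s := h3 _ (Classical.epsilon_spec ⟨s, h2⟩)
  rw [this]
  exact h1

theorem opStar_mul_opStar (hp : IsLefschetzPair m om T) :
    opStar r E m om T * opStar r E m om T = 1 :=
  (isLefschetz_VT hp).star_mul_star (isStar_opStar hp) (starSign_mul_self m)

theorem opLambda_eq (hp : IsLefschetzPair m om T) :
    opLambda r E m om T = opStar r E m om T * opL r E om T * opStar r E m om T := by
  have h := opStar_mul_opStar (r := r) (E := E) hp
  rw [opLambda, Ring.inverse_unit (⟨_, _, h, h⟩ : (Module.End ℂ (VT r E T))ˣ)]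
  rfl

theorem isSmoothForm_of_mem_VT (hp : IsLefschetzPair m om T) {u : Forms n E}
    (hu : u ∈ VT r E T) : IsSmoothForm r u := by
  obtain ⟨a, ha, rfl⟩ := hu
  exact (mem_smoothForms.1 ha).1.wedge hp.T_even.smooth

/-! #### The Weil operator and the parity -/

theorem weil_wedgeForm {a : X → Lam n} (ha : ∀ x, weilLam n (a x) = a x) (u : Forms n E) :
    weil (wedgeForm a u) = wedgeForm a (weil u) := by
  funext x
  have := tm_wedge (LinearMap.id : E x →ₗ[ℂ] E x) (weilLam n) (a x) (u x)
  rw [ha] at this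
  exact this

theorem smoothForms_weil {u : Forms n E} (hu : u ∈ smoothForms n r E) :
    weil u ∈ smoothForms n r E :=
  smoothForms_formOp (fun _ _ hy a => pullLam_weil hy a) hu

theorem coe_opJ (hp : IsLefschetzPair m om T) (u : VT r E T) :
    (opJ r E T u : Forms n E) = weil (u : Forms n E) := by
  refine restrictVT_apply (fun u hu => ?_) (fun u _ v _ => map_add _ u v)
    (fun c u _ => map_smul _ c u) u
  obtain ⟨a, ha, rfl⟩ := hu
  exact ⟨_, smoothForms_weil ha, (weil_wedgeForm hp.T_even.inv a).symm⟩

theorem weil_weil (u : Forms n E) : weil (weil u) = parF E u := by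
  funext x
  change tm LinearMap.id (weilLam n).toLinearMap (tm LinearMap.id (weilLam n).toLinearMap (u x)) =
    tm LinearMap.id (par n).toLinearMap (u x)
  rw [tm_tm]
  congr 2
  exact LinearMap.ext weilLam_weilLam

theorem parF_parF (u : Forms n E) : parF E (parF E u) = u := by
  funext x
  change tm LinearMap.id (par n).toLinearMap (tm LinearMap.id (par n).toLinearMap (u x)) = u x
  rw [tm_tm]
  have : (par n).toLinearMap ∘ₗ (par n).toLinearMap = LinearMap.id := LinearMap.ext par_par
  rw [this]
  exact tm_id _

variable (r E T) in
/-- The parity operator of `V_T`. -/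
def opPar : Module.End ℂ (VT r E T) := opJ r E T * opJ r E T

theorem coe_opPar (hp : IsLefschetzPair m om T) (u : VT r E T) :
    (opPar r E T u : Forms n E) = parF E (u : Forms n E) := by
  rw [opPar, Module.End.mul_apply, coe_opJ hp, coe_opJ hp, weil_weil]

theorem opPar_mul_opPar (hp : IsLefschetzPair m om T) : opPar r E T * opPar r E T = 1 :=
  LinearMap.ext fun u => Subtype.ext (by
    rw [Module.End.mul_apply, coe_opPar hp, coe_opPar hp, parF_parF]
    rfl)

theorem opPar_eq (hp : IsLefschetzPair m om T) (w : ℤ) (u : VT r E T)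
    (hu : weightProj hp r E w u = u) : opPar r E T u = paritySign m w • u := by
  refine Subtype.ext ?_
  have hu' := congrArg Subtype.val hu
  rw [coe_weightProj] at hu'
  rw [coe_opPar hp, paritySign]
  rcases lt_or_ge (w + m) 0 with h | h
  · rw [degForm_neg h] at hu'
    have hz : (u : Forms n E) = 0 := hu'.symm
    rw [Submodule.coe_smul, hz, map_zero, smul_zero]
  · generalize w + m = d at h hu' ⊢
    lift d to ℕ using h
    funext x
    have hx := congrFun hu' x
    rw [degForm_natCast] at hx
    have := parW_eq hx
    rw [pow_add, pow_mul, neg_one_sq, one_pow, one_mul] at this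
    rw [psgn_natCast]
    push_cast
    exact this

theorem opJ_opL (hp : IsLefschetzPair m om T) (u : VT r E T) :
    opJ r E T (opL r E om T u) = opL r E om T (opJ r E T u) :=
  Subtype.ext (by
    rw [coe_opJ hp, coe_opL hp, coe_opL hp, coe_opJ hp, weil_wedgeForm hp.om_even.inv])

theorem weightProj_opJ (hp : IsLefschetzPair m om T) (w : ℤ) (u : VT r E T) :
    weightProj hp r E w (opJ r E T u) = opJ r E T (weightProj hp r E w u) := by
  refine Subtype.ext ?_
  rw [coe_weightProj, coe_opJ hp, coe_opJ hp, coe_weightProj]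
  rcases lt_or_ge (w + m) 0 with h | h
  · rw [degForm_neg h]
    exact (map_zero _).symm
  · lift w + m to ℕ using h with d
    funext x
    rw [degForm_natCast]
    refine (projW_tm_pb LinearMap.id (mulI n) _ _).trans ?_
    change _ = tm LinearMap.id (pb (mulI n)).toLinearMap (degForm n E m d u x)
    rw [degForm_natCast]
    rfl

/-- The Weil operator commutes with `L` and preserves weights, so it maps primitive elements to
primitive elements of the same weight, on which the star acts with the same sign. -/
theorem opJ_opStar (hp : IsLefschetzPair m om T) :
    opJ r E T * opStar r E m om T = opStar r E m om T * opJ r E T := by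
  have hL := isLefschetz_VT (r := r) (E := E) hp
  have hs := isStar_opStar (r := r) (E := E) hp
  refine hL.hom_ext fun N j hj u hu => ?_
  have hJu : opJ r E T u ∈ prim (weightProj hp r E) (opL r E om T) N := by
    have hu' := IsLefschetz.mem_prim.1 hu
    refine IsLefschetz.mem_prim.2 ⟨by rw [weightProj_opJ, hu'.1], ?_⟩
    have hc : Commute (opJ r E T) (opL r E om T) := LinearMap.ext (opJ_opL hp)
    rw [← Module.End.mul_apply, ← (hc.pow_right (N + 1)).eq, Module.End.mul_apply, hu'.2, map_zero]
  rw [Module.End.mul_apply, Module.End.mul_apply, hs _ _ u hu, divPow_comm (opJ_opL hp),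
    hs _ _ _ hJu, map_smul, divPow_comm (opJ_opL hp)]

variable [ContMDiffVectorBundle ω (Fin r → ℂ) E 𝓘(ℂ, CV n)] [T2Space X] {h : SesqForm E}

/-! #### The Chern connection -/

theorem coe_opDbar (hp : IsLefschetzPair m om T) (hT : IsDClosed T) (u : VT r E T) :
    (opDbar r E T u : Forms n E) = dbar r (u : Forms n E) := by
  refine restrictVT_apply (fun u hu => ?_)
    (fun u hu v hv => dbar_add (isSmoothForm_of_mem_VT hp hu) (isSmoothForm_of_mem_VT hp hv))
    (fun c u hu => dbar_smul (isSmoothForm_of_mem_VT hp hu) c) u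
  obtain ⟨a, ha, rfl⟩ := hu
  exact ⟨_, smoothForms_dbar ha, (dbar_wedge hp.T_even hT (mem_smoothForms.1 ha).1).symm⟩

theorem coe_opDel (hh : IsHermitianMetric n r h) (hp : IsLefschetzPair m om T) (hT : IsDClosed T)
    (u : VT r E T) : (opDel r h T u : Forms n E) = del r h (u : Forms n E) := by
  refine restrictVT_apply (fun u hu => ?_)
    (fun u hu v hv => del_add hh (isSmoothForm_of_mem_VT hp hu) (isSmoothForm_of_mem_VT hp hv))
    (fun c u hu => del_smul hh (isSmoothForm_of_mem_VT hp hu) c) u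
  obtain ⟨a, ha, rfl⟩ := hu
  exact ⟨_, smoothForms_del hh ha, (del_wedge_closed hh hp.T_even hT (mem_smoothForms.1 ha).1).symm⟩

omit [T2Space X] in
/-- Operators on the form part intertwine `∂^E`. -/
theorem formOp_del (hh : IsHermitianMetric n r h) {u : Forms n E} (hu : IsSmoothForm r u)
    {A B : Lam n →ₗ[ℝ] Lam n}
    (h1 : ∀ l a, A (ExteriorAlgebra.ι ℝ l * a) = ExteriorAlgebra.ι ℝ l * B a)
    (hA : ∀ (x₀ : X) (y) (a), pullLam x₀ y (A a) = A (pullLam x₀ y a))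
    (hB : ∀ (x₀ : X) (y) (a), pullLam x₀ y (B a) = B (pullLam x₀ y a)) :
    formOp E A (del r h u) = del r h (formOp E B u) := by
  refine forms_ext (r := r) fun x => ?_
  have hd := chart_mem_dom (n := n) (r := r) (E := E) x
  rw [localRep_formOp (hA x _), localRep_del hh hu hd,
    localRep_del hh (hu.formOp fun x₀ y _ => hB x₀ y) hd,
    flatDel_linear (contDiffAt_gram hh hd) (isUnit_det_gram hh hd) (hu x) _ B h1]
  exact flatDel_congr (Filter.Eventually.of_forall fun y => (localRep_formOp (hB x y) u).symm)

/-- Every term of `∂^E` wedges a covector onto a zeroth order or differentiated coefficient, so the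
degree rises by exactly one. -/
theorem weightProj_opDel (hh : IsHermitianMetric n r h) (hp : IsLefschetzPair m om T)
    (hT : IsDClosed T) (w : ℤ) (u : VT r E T) :
    weightProj hp r E (w + 1) (opDel r h T u) = opDel r h T (weightProj hp r E w u) := by
  refine Subtype.ext ?_
  rw [coe_weightProj, coe_opDel hh hp hT, coe_opDel hh hp hT, coe_weightProj, add_right_comm]
  have hproj : ∀ k l (a : Lam n), proj n (k + 1) (ExteriorAlgebra.ι ℝ l * a) =
      ExteriorAlgebra.ι ℝ l * proj n k a := fun k l a => by
    rw [add_comm k 1]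
    exact proj_mul (ι_mem_lamDeg l) k a
  obtain ⟨a, ha, e⟩ := u.2
  have hd0 : del r h (0 : Forms n E) = 0 := by
    have := del_smul hh (mem_smoothForms.1 ha).1 0
    rwa [zero_smul, zero_smul] at this
  rcases lt_trichotomy (w + m) (-1) with hw | hw | hw
  · rw [degForm_neg (by omega), degForm_neg (by omega), LinearMap.zero_apply, LinearMap.zero_apply,
      hd0]
  -- The boundary case `w + m = -1`: the component of degree zero of `∂^E a` must vanish, because
  -- each term contains a covector.
  · have h0 := formOp_del (A := proj n 0) (B := 0) hh (mem_smoothForms.1 ha).1 (fun l b => by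
      rw [proj_mul_of_lt (ι_mem_lamDeg l) one_pos, LinearMap.zero_apply, mul_zero])
      (fun x₀ y => pullLam_proj 0 x₀ y) fun x₀ y b => map_zero _
    have hz : formOp E 0 a = 0 := by
      funext x
      rw [formOp_apply]
      induction a x using TensorProduct.induction_on with
      | zero => exact map_zero _
      | tmul s b => exact TensorProduct.tmul_zero _ _
      | add u v hu hv => rw [map_add, hu, hv]; exact add_zero _
    rw [hz, hd0] at h0
    rw [hw, degForm_neg (d := -1) (by norm_num), LinearMap.zero_apply, hd0, ← e,
      del_wedge_closed hh hp.T_even hT (mem_smoothForms.1 ha).1,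
      show (-1 + 1 : ℤ) = (0 : ℕ) by rfl, degForm_wedge hp, h0, map_zero]
  · generalize w + m = d at hw ⊢
    lift d to ℕ using by omega
    have := formOp_del hh (isSmoothForm_of_mem_VT hp u.2) (hproj (2 * (n - m) + d))
      (pullLam_proj _) (pullLam_proj _)
    rw [← Nat.cast_succ, degForm, degForm, if_neg (by omega), if_neg (by omega), Int.toNat_natCast,
      Int.toNat_natCast]
    exact this

theorem opJ_opDel (hh : IsHermitianMetric n r h) (hp : IsLefschetzPair m om T)
    (hT : IsDClosed T) : opJ r E T * opDel r h T = I • (opDel r h T * opJ r E T) :=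
  LinearMap.ext fun u => Subtype.ext (by
    rw [Module.End.mul_apply, coe_opJ hp, coe_opDel hh hp hT,
      weil_del hh (isSmoothForm_of_mem_VT hp u.2), LinearMap.smul_apply, Submodule.coe_smul,
      Module.End.mul_apply, coe_opDel hh hp hT, coe_opJ hp])

/-- The commutator `[∂^E, L]` is the zeroth order operator of wedging with `∂ω`, and the two-form
`ω` commutes with every form. -/
theorem opDel_commutator (hh : IsHermitianMetric n r h) (hp : IsLefschetzPair m om T)
    (hT : IsDClosed T) (u : VT r E T) :
    (opDel r h T * opL r E om T - opL r E om T * opDel r h T) (opL r E om T u) =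
      opL r E om T ((opDel r h T * opL r E om T - opL r E om T * opDel r h T) u) := by
  have key : ∀ (v : VT r E T) x, ((opDel r h T * opL r E om T - opL r E om T * opDel r h T) v :
      Forms n E) x = delSymbol om x ((v : Forms n E) x) := by
    intro v x
    rw [LinearMap.sub_apply, Submodule.coe_sub, Pi.sub_apply, Module.End.mul_apply,
      Module.End.mul_apply, coe_opDel hh hp hT, coe_opL hp, coe_opL hp, coe_opDel hh hp hT,
      del_wedge hh hp.om_even (isSmoothForm_of_mem_VT hp v.2), wedgeForm_apply, add_sub_cancel_right]
  refine Subtype.ext (funext fun x => ?_)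
  rw [key, coe_opL hp, coe_opL hp, wedgeForm_apply, wedgeForm_apply, key, delSymbol,
    halfWedge_wedge _ _ _ (hp.om_even.central x)]

end Operators

end THodge
end

noncomputable section

namespace THodge

/-! ### The adjoint of `∂̄` -/

section Algebra

variable {M : Type*} [AddCommGroup M] [Module ℂ M]

/-- With `s` the star, Stokes' theorem asks for an operator `B` satisfying `s J B = -P ∂^E s J`,
where `P = J²`. Since `s² = 1`, `J s = s J` and `J ∂^E = i ∂^E J`, the operator `-i s ∂^E s P` is a
solution. -/
theorem mul_conj_smul {s J D : Module.End ℂ M} (hss : s * s = 1) (hJs : J * s = s * J)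
    (hJD : J * D = I • (D * J)) :
    s * J * ((-I) • (s * D * s * (J * J))) = -(J * J * D * (s * J)) := by
  have h1 : s * J * (s * D * s * (J * J)) = I • (D * J * s * J * J) := by
    calc s * J * (s * D * s * (J * J)) = s * (J * s) * D * s * J * J := by noncomm_ring
      _ = s * s * (J * D) * s * J * J := by rw [hJs]; noncomm_ring
      _ = I • (D * J * s * J * J) := by
        rw [hss, one_mul, hJD]
        simp only [smul_mul_assoc]
  have h2 : J * J * D * (s * J) = -(D * J * s * J * J) := by
    calc J * J * D * (s * J) = J * (J * D) * s * J := by noncomm_ring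
      _ = I • (J * D * J * s * J) := by
        conv_lhs => rw [hJD]
        simp only [mul_smul_comm, smul_mul_assoc, mul_assoc]
      _ = (I * I) • (D * J * (J * s) * J) := by
        rw [hJD, mul_smul]
        simp only [smul_mul_assoc, mul_assoc]
      _ = -(D * J * s * J * J) := by
        rw [I_mul_I, neg_one_smul, hJs]
        simp only [mul_assoc]
  rw [h2, neg_neg, mul_smul_comm, h1, smul_smul, neg_mul, I_mul_I, neg_neg, one_smul]

theorem mul_conj_eq_one {s J : Module.End ℂ M} (hss : s * s = 1) (hJ : J * J * (J * J) = 1) :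
    J * J * (J * s) * (s * J) = 1 := by
  calc J * J * (J * s) * (s * J) = J * J * J * (s * s) * J := by noncomm_ring
    _ = J * J * (J * J) := by rw [hss, mul_one, mul_assoc]
    _ = 1 := hJ

theorem lie_smul_eq {Q L R : Module.End ℂ M} (h : L * Q - Q * L = R) : ⁅(-I) • Q, L⁆ = I • R := by
  rw [Ring.lie_def, smul_mul_assoc, mul_smul_comm, ← h, neg_smul, neg_smul, smul_sub]
  abel

end Algebra

section Adjoint

variable {n m r : ℕ} {X : Type*} [TopologicalSpace X] [ChartedSpace (CV n) X]
  {E : X → Type*} [∀ x, AddCommGroup (E x)] [∀ x, Module ℂ (E x)]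
  [TopologicalSpace (Bundle.TotalSpace (Fin r → ℂ) E)] [∀ x, TopologicalSpace (E x)]
  [FiberBundle (Fin r → ℂ) E] [VectorBundle ℂ (Fin r → ℂ) E] {om T : X → Lam n}
  [IsManifold 𝓘(ℂ, CV n) ω X] [ContMDiffVectorBundle ω (Fin r → ℂ) E 𝓘(ℂ, CV n)]
  [T2Space X] [SecondCountableTopology X] {h : SesqForm E}

theorem integral_pairForm_add (hh : IsHermitianMetric n r h) {a v w : Forms n E}
    (ha : a ∈ smoothForms n r E) (hv : IsSmoothForm r v) (hw : IsSmoothForm r w) :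
    integral (pairForm h a (v + w)) = integral (pairForm h a v) + integral (pairForm h a w) := by
  rw [← integral_form_add (contCompact_pairForm hh ha hv) (contCompact_pairForm hh ha hw)]
  congr 1
  funext x
  exact map_add _ _ _

theorem integral_pairForm_neg (hh : IsHermitianMetric n r h) {a v : Forms n E}
    (ha : a ∈ smoothForms n r E) (hv : IsSmoothForm r v) :
    integral (pairForm h a (-v)) = -integral (pairForm h a v) := by
  have hv' : IsSmoothForm r (-v) := by
    rw [← neg_one_smul ℂ v]
    exact hv.smul (-1)
  rw [eq_neg_iff_add_eq_zero, ← integral_pairForm_add hh ha hv' hv, neg_add_cancel]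
  rw [← integral_form_zero (n := n) (X := X)]
  congr 1
  funext x
  exact map_zero _

/-- If `* v = T ∧ b`, then `{a, T ∧ b} = {T ∧ a, b}` because `T` is real and central. The integrand
therefore depends on `a` only through `T ∧ a`. -/
theorem innerVT_eq (hp : IsLefschetzPair m om T) (u v : VT r E T) {a : Forms n E}
    (ha : wedgeForm T a = u) : innerVT r m h om T u v =
      integral (pairForm h a ((opStar r E m om T * opJ r E T) v : VT r E T)) := by
  obtain ⟨b, -, hb⟩ := ((opStar r E m om T * opJ r E T) v).2
  have hc := (Submodule.mem_map.1 u.2).choose_spec.2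
  rw [innerVT]
  congr 1
  funext x
  rw [pairForm, ← hb, wedgeForm_apply, hermPair_wedge_right x (hp.T_even.central x),
    hermPair_wedge_right x (hp.T_even.central x), ← hermPair_wedge_left, ← hermPair_wedge_left]
  have h1 := congrFun (hc.trans ha.symm) x
  rw [wedgeForm_apply, wedgeForm_apply] at h1
  rw [h1]

variable (r) in
/-- The formula `∂̄* = -i *ₛ ∂ *ₛ P` for the adjoint, where `P` is the parity. -/
def dbarAdjoint (m : ℕ) (h : SesqForm E) (om T : X → Lam n) : Module.End ℂ (VT r E T) :=
  (-I) • (opStar r E m om T * opDel r h T * opStar r E m om T * opPar r E T)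

omit [SecondCountableTopology X] in
theorem star_mul_dbarAdjoint (hh : IsHermitianMetric n r h) (hp : IsLefschetzPair m om T)
    (hT : IsDClosed T) : opStar r E m om T * opJ r E T * dbarAdjoint r m h om T =
      -(opPar r E T * opDel r h T * (opStar r E m om T * opJ r E T)) := by
  rw [dbarAdjoint, opPar]
  exact mul_conj_smul (M := VT r E T) (opStar_mul_opStar hp) (opJ_opStar hp) (opJ_opDel hh hp hT)

/-- With `u = T ∧ a`, the form `∂̄u` is `T ∧ ∂̄a`. Stokes moves `∂̄` to `-∂^E` on `* v` with a
parity on `a`; parity does not change the integral of a pairing, so it can be moved to the second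
argument, where `star_mul_dbarAdjoint` identifies the result. -/
theorem isAdjointVT_dbarAdjoint (hh : IsHermitianMetric n r h) (hp : IsLefschetzPair m om T)
    (hT : IsDClosed T) : IsAdjointVT r m h om T (opDbar r E T) (dbarAdjoint r m h om T) := by
  intro u v
  obtain ⟨a, ha, e⟩ := u.2
  have has := (mem_smoothForms.1 ha).1
  have e' : wedgeForm T (dbar r a) = (opDbar r E T u : VT r E T) := by
    rw [coe_opDbar hp hT, ← e, dbar_wedge hp.T_even hT has]
  have hD := star_mul_dbarAdjoint hh hp hT
  rw [innerVT_eq hp _ _ e', innerVT_eq hp _ _ e, ← Module.End.mul_apply _ (dbarAdjoint r m h om T),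
    hD, LinearMap.neg_apply, Module.End.mul_apply _ (opStar r E m om T * opJ r E T),
    Module.End.mul_apply (opPar r E T)]
  generalize (opStar r E m om T * opJ r E T) v = w
  rw [stokes hh ha (isSmoothForm_of_mem_VT hp w.2), Submodule.coe_neg,
    integral_pairForm_neg hh ha (isSmoothForm_of_mem_VT hp (opPar r E T (opDel r h T w)).2),
    coe_opPar hp, coe_opDel hh hp hT, ← integral_pairForm_parF (parF E a), parF_parF]

/-- The difference of two adjoints has image under `*ₛ J` orthogonal to all test forms, hence zero,
and `*ₛ J` is invertible. -/
theorem eq_dbarAdjoint (hh : IsHermitianMetric n r h) (hp : IsLefschetzPair m om T)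
    (hT : IsDClosed T) {B : Module.End ℂ (VT r E T)}
    (hB : IsAdjointVT r m h om T (opDbar r E T) B) : B = dbarAdjoint r m h om T := by
  refine LinearMap.ext fun v => ?_
  set B' := dbarAdjoint r m h om T with hB'
  let s := opStar r E m om T
  let J := opJ r E T
  have h0 : (s * J) (B v - B' v) = 0 := by
    refine Subtype.ext (eq_zero_of_integral_pairForm hh (isSmoothForm_of_mem_VT hp (Subtype.prop _))
      fun a ha => ?_)
    let u : VT r E T := ⟨wedgeForm T a, a, ha, rfl⟩
    have h1 := (hB u v).symm.trans (isAdjointVT_dbarAdjoint hh hp hT u v)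
    rw [innerVT_eq hp u _ rfl, innerVT_eq hp u _ rfl] at h1
    rw [map_sub, sub_eq_add_neg, Submodule.coe_add, Submodule.coe_neg,
      integral_pairForm_add hh ha (isSmoothForm_of_mem_VT hp (Subtype.prop _)) (by
        rw [← Submodule.coe_neg]
        exact isSmoothForm_of_mem_VT hp (Subtype.prop _)),
      integral_pairForm_neg hh ha (isSmoothForm_of_mem_VT hp (Subtype.prop _)), h1, add_neg_cancel]
  have hinv : J * J * (J * s) * (s * J) = 1 :=
    mul_conj_eq_one (opStar_mul_opStar hp) (opPar_mul_opPar hp)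
  have h2 := congrArg (J * J * (J * s)) h0
  rw [map_zero, ← Module.End.mul_apply, hinv] at h2
  exact sub_eq_zero.1 h2

theorem opDbarStar_eq (hh : IsHermitianMetric n r h) (hp : IsLefschetzPair m om T)
    (hT : IsDClosed T) : opDbarStar r m h om T = dbarAdjoint r m h om T :=
  eq_dbarAdjoint hh hp hT (Classical.epsilon_spec ⟨_, isAdjointVT_dbarAdjoint hh hp hT⟩)

/-- The Kähler type identity on `V_T`. -/
theorem lie_opDbarStar_opL (hh : IsHermitianMetric n r h) (hp : IsLefschetzPair m om T)
    (hT : IsDClosed T) : ⁅opDbarStar r m h om T, opL r E om T⁆ =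
      I • (opDel r h T + ⁅opLambda r E m om T, ⁅opDel r h T, opL r E om T⁆⁆) := by
  -- The abstract identity with `D = ∂^E`, `C = [∂^E, L]` and `P` the parity. Multiplication by `-i`
  -- then turns `*ₛ ∂^E *ₛ P` into the adjoint.
  have key := (isLefschetz_VT (r := r) (E := E) hp).commutator_star (isStar_opStar hp)
    (starSign_mul_self m) (weightProj_opDel hh hp hT)
    (C := opDel r h T * opL r E om T - opL r E om T * opDel r h T)
    (fun u => (add_sub_cancel (opL r E om T (opDel r h T u)) (opDel r h T (opL r E om T u))).symm)
    (opDel_commutator hh hp hT) (opPar_eq hp) (paritySign_add_two m) (starSign_mul_paritySign m)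
    (starSign_add_two m)
  rw [opDbarStar_eq hh hp hT, opLambda_eq hp]
  exact lie_smul_eq key

end Adjoint

end THodge
end
theorem theorem4p6 {n m r : ℕ} (hm : m ≤ n)
    {X : Type*} [TopologicalSpace X] [T2Space X] [SecondCountableTopology X]
    [ChartedSpace (THodge.CV n) X] [IsManifold 𝓘(ℂ, THodge.CV n) ω X]
    (E : X → Type*) [∀ x, AddCommGroup (E x)] [∀ x, Module ℂ (E x)]
    [TopologicalSpace (Bundle.TotalSpace (Fin r → ℂ) E)] [∀ x, TopologicalSpace (E x)]
    [FiberBundle (Fin r → ℂ) E] [VectorBundle ℂ (Fin r → ℂ) E]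
    [ContMDiffVectorBundle ω (Fin r → ℂ) E 𝓘(ℂ, THodge.CV n)]
    (h : THodge.SesqForm E) (hh : THodge.IsHermitianMetric n r h)
    (om : X → THodge.Lam n) (hom : THodge.IsHermitianForm om)
    (α : Fin (n - m) → X → THodge.Lam n) (hα : ∀ j, THodge.IsHermitianForm (α j))
    (T : X → THodge.Lam n) (hT : T = THodge.wedgeProd α) (hTd : THodge.IsDClosed T) :
    -- the operators `L`, `J`, `∂̄`, `∂^E` preserve `V_T`
    (∀ u : THodge.VT r E T,
      (THodge.opL r E om T u : THodge.Forms n E) = THodge.wedgeForm om u ∧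
      (THodge.opJ r E T u : THodge.Forms n E) = THodge.weil (u : THodge.Forms n E) ∧
      (THodge.opDbar r E T u : THodge.Forms n E) = THodge.dbar r u ∧
      (THodge.opDel r h T u : THodge.Forms n E) = THodge.del r h u) ∧
    -- the Lefschetz star operator and the adjoint of `∂̄` are well defined
    (∃! S, THodge.IsLefschetzStar r E m om T S) ∧
    IsUnit (THodge.opStar r E m om T) ∧
    (∃! B, THodge.IsAdjointVT r m h om T (THodge.opDbar r E T) B) ∧
    -- the identity on `V_T`
    ⁅THodge.opDbarStar r m h om T, THodge.opL r E om T⁆ =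
      Complex.I • (THodge.opDel r h T +
        ⁅THodge.opLambda r E m om T, ⁅THodge.opDel r h T, THodge.opL r E om T⁆⁆) := by
  subst hT
  have hp := THodge.isLefschetzPair hm hom hα
  obtain ⟨S, -, hS, huniq⟩ := THodge.exists_isLefschetzStar (r := r) (E := E) hp
  have hs := THodge.opStar_mul_opStar (r := r) (E := E) hp
  exact ⟨fun u => ⟨THodge.coe_opL hp u, THodge.coe_opJ hp u, THodge.coe_opDbar hp hTd u,
      THodge.coe_opDel hh hp hTd u⟩,
    ⟨S, hS, huniq⟩, ⟨⟨_, _, hs, hs⟩, rfl⟩,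
    ⟨_, THodge.isAdjointVT_dbarAdjoint hh hp hTd, fun _ hB => THodge.eq_dbarAdjoint hh hp hTd hB⟩,
    THodge.lie_opDbarStar_opL hh hp hTd⟩
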